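/- **Model.** A financial network $\mathcal F$ has a finite set $V$ of $n$ banks and a finite set $E$ of $m$ directed edges without loops and multi-edges. An edge $e=(u,w)$ is a claim of liability $\ell_e\ge 0$ of creditor $w$ against debtor $u$. Each bank $w$ has external assets $a^{(x)}_w\ge 0$ and default rates $\alpha_w,\beta_w\in[0,1]$. Let $E^+(w)$, $E^-(w)$ be the outgoing and incoming edges of $w$, and $L^\pm(w)=\sum_{e\in E^\pm(w)}\ell_e$. Each edge $e\in E^+(w)$ has a piecewise-linear payment function $p_e$ given by $k_e\ge1$ interval borders $0=x_{e,0}<x_{e,1}<\dots<x_{e,k_e}=L^+(w)$ and non-negative slopes on the intervals $[x_{e,i},x_{e,i+1})$ (with $x_{e,k_e+1}=\infty$), and for all $a,\varepsilon>0$ it satisfies $0\le p_e(a)\le\ell_e$, $p_e(a)\le p_e(a+\varepsilon)$ and $\sum_{e\in E^+(w)}p_e(a)=\min\{a,L^+(w)\}$. Let $k=\sum_e k_e$, let $m_e(a)$ be the slope of $p_e$ on the interval containing $a$, and let $\delta_e(a)$ be the distance from $a$ to the next larger border of $p_e$. On $\mathcal A=\prod_w[0,L^-(w)+a^{(x)}_w]$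 let $\mathrm{in}_w(\mathbf a)=\sum_{(u,w)\in E^-(w)}p_{(u,w)}(a_u)$ and $$\Phi(\mathbf a)_w=\begin{cases}a^{(x)}_w+\mathrm{in}_w(\mathbf a)&\text{if } a^{(x)}_w+\mathrm{in}_w(\mathbf a)\ge L^+(w),\\ \alpha_w a^{(x)}_w+\beta_w\,\mathrm{in}_w(\mathbf a)&\text{otherwise.}\end{cases}$$ A clearing state is a fixed point of $\Phi$ in $\mathcal A$; the minimal clearing state is the coordinatewise least one. **Adjusted network.** Let $D$ be the set of banks with $\alpha_u<1$ or $\beta_u<1$. For each $u\in D$ reduce the external assets of $u$ to $\alpha_u a^{(x)}_u$; add auxiliary banks $u_s,u_t$ without external assets; re-route every edge $(v,u)$ to $(v,u_s)$; add edges $(u_s,u_t)$ and $(u_s,u)$ with liabilities $(1-\beta_u)L^+(u)$ and $\beta_uL^+(u)$, which $u_s$ pays proportionally. The adjusted network has no default costs. Below, $a^{(x)}$ denotes its current vector of external assets. **Algorithm 1** maintains vectors $\mathbf b^{(x)}$, $\mathbf b$, $a^{(x)}$ and the set of remaining edges of the adjusted network, starting with $\mathbf b^{(x)}=\mathbf b=\mathbf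 0$ and all edges. An edge $(u,w)$ is active if it remains and $m_{(u,w)}(b_u)>0$. * *Settling:* a bank $u\in D$ is solvent if its original external assets plus $b_{u_s}$ are at least $L^+(u)$. For every solvent $u\in D$ and every remaining edge $e=(u,w)$ out of $u$ in the adjusted network, add $p_e(b_u)$ to $b^{(x)}_w$, add $\ell_e$ to $a^{(x)}_w$, and remove $e$. Settling is executed once before the main loop and at the end of each of its iterations. * *Main loop:* while some bank $v$ has $b^{(x)}_v<a^{(x)}_v$, choose such a $v$. 1. *Flooding.* While there is a strongly connected component $C$ of the active graph that has at least two banks, has no active edge leaving it and is reachable from $v$, choose such a $C$, choose $\mathbf d$ maximizing $\sum_{w\in C}d_w$ subject to $d_w=\sum m_{(u,w)}(b_u)d_u$ (sum over active edges $(u,w)$ with $u\in C$), $d_w\le\delta_e(b_w)$ for active edges $e$ out of $w$, and $d_w\ge0$, for all $w\in C$; set $\mathbf b\gets\mathbf b+\mathbf d$ on $C$. 2. *Increase.* Choose $(\delta,\mathbf d)$ maximizing $\delta$ subject to $d_v=\delta+\sum m_{(u,v)}(b_u)d_u$; $d_w=\sum m_{(u,w)}(b_u)d_u$ for $w\ne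 v$ reachable from $v$ (sums over active edges into $v$, respectively $w$); $d_w=0$ for $w$ not reachable from $v$; $d_w\le\delta_e(b_w)$ for all active edges $e$ out of $w$; $\delta\le a^{(x)}_v-b^{(x)}_v$; $\mathbf d\ge\mathbf 0$. Set $b^{(x)}_v\gets b^{(x)}_v+\delta$, $\mathbf b\gets\mathbf b+\mathbf d$; then settle. * *Output:* for each bank $w$ of $\mathcal F$: $b_w$ if $w\notin D$ or $w\in D$ is not solvent; the original external assets of $w$ plus $b_{w_s}$ if $w\in D$ is solvent. **Corollary.** 1. For every network $\mathcal F$ with default costs and all choices made in the algorithm, Algorithm 1 never gets stuck, terminates after $O(k+n+m)$ elementary steps (choices of $v$, floodings, increases), and outputs the minimal clearing state of $\mathcal F$. 2. On a random-access machine with exact real arithmetic at unit cost there is a program that, for every such network with $n\ge1$, carries out an execution of Algorithm 1 and outputs the minimal clearing state in time $O((k+n+m)(n^3+m))$. 3. This holds although $\Phi$ need not be continuous from below: there is a network with default costs and a coordinatewise non-decreasing sequence $\mathbf a^i\to\mathbf a$ in $\mathcal A$ for which $\Phi(\mathbf a^i)\not\to\Phi(\mathbf a)$. The constants hidden in $O(\cdot)$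 are absolute. -/

import Mathlib

namespace Clearing

universe u v

/-! ### Financial networks -/

/-- The data of a financial network with banks `V` and claims `E`.  The claim `e` has debtor `src e`,
creditor `tgt e` and liability `liab e`; the bank `w` has external assets `ext w` and default rates
`alpha w`, `beta w`; `pay e` is the payment function of `e`.  The interval borders of `pay e` are
`border e 0 < … < border e (numBorders e)`; `slope e i` is its slope on
`[border e i, border e (i+1))` for `i < numBorders e`, and on `[border e i, ∞)` for
`i = numBorders e`.  The laws are collected in `Network.WellFormed`. -/
structure Network (V : Type u) (E : Type v) where
  src : E → V
  tgt : E → V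
  liab : E → ℝ
  ext : V → ℝ
  alpha : V → ℝ
  beta : V → ℝ
  pay : E → ℝ → ℝ
  numBorders : E → ℕ
  border : E → ℕ → ℝ
  slope : E → ℕ → ℝ

namespace Network

variable {V : Type u} {E : Type v} [Fintype V] [Fintype E]

open Classical in
/-- `E⁺(w)` -/
noncomputable def outEdges (F : Network V E) (w : V) : Finset E :=
  Finset.univ.filter (fun e => F.src e = w)

open Classical in
/-- `E⁻(w)` -/
noncomputable def inEdges (F : Network V E) (w : V) : Finset E :=
  Finset.univ.filter (fun e => F.tgt e = w)

/-- total outgoing liabilities `L⁺(w)` -/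
noncomputable def outLiab (F : Network V E) (w : V) : ℝ := ∑ e ∈ F.outEdges w, F.liab e

/-- total incoming liabilities `L⁻(w)` -/
noncomputable def inLiab (F : Network V E) (w : V) : ℝ := ∑ e ∈ F.inEdges w, F.liab e

/-- The standing assumptions on a network with monotone, piecewise-linear payments and default
costs. -/
structure WellFormed (F : Network V E) : Prop where
  no_loops : ∀ e, F.src e ≠ F.tgt e
  no_multi : ∀ e e', F.src e = F.src e' → F.tgt e = F.tgt e' → e = e'
  liab_nonneg : ∀ e, 0 ≤ F.liab e
  ext_nonneg : ∀ w, 0 ≤ F.ext w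
  alpha_mem : ∀ w, F.alpha w ∈ Set.Icc (0 : ℝ) 1
  beta_mem : ∀ w, F.beta w ∈ Set.Icc (0 : ℝ) 1
  one_le_numBorders : ∀ e, 1 ≤ F.numBorders e
  border_zero : ∀ e, F.border e 0 = 0
  border_lt : ∀ e i, i < F.numBorders e → F.border e i < F.border e (i + 1)
  border_last : ∀ e, F.border e (F.numBorders e) = F.outLiab (F.src e)
  slope_nonneg : ∀ e i, i ≤ F.numBorders e → 0 ≤ F.slope e i
  pay_piece : ∀ e i a, i < F.numBorders e → F.border e i ≤ a → a < F.border e (i + 1) →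
    F.pay e a = F.slope e i * (a - F.border e i) + F.pay e (F.border e i)
  pay_last : ∀ e a, F.border e (F.numBorders e) ≤ a →
    F.pay e a = F.slope e (F.numBorders e) * (a - F.border e (F.numBorders e))
      + F.pay e (F.border e (F.numBorders e))
  pay_mem : ∀ e a, 0 < a → F.pay e a ∈ Set.Icc 0 (F.liab e)
  pay_mono : ∀ e a ε, 0 < a → 0 < ε → F.pay e a ≤ F.pay e (a + ε)
  no_fraud : ∀ w a, 0 < a → ∑ e ∈ F.outEdges w, F.pay e a = min a (F.outLiab w)

/-- `k`, the total number of interval borders -/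
def totalBorders (F : Network V E) : ℕ := ∑ e, F.numBorders e

/-! ### Clearing states -/

/-- the payments that reach `w` -/
noncomputable def incoming (F : Network V E) (a : V → ℝ) (w : V) : ℝ :=
  ∑ e ∈ F.inEdges w, F.pay e (a (F.src e))

/-- the space of asset vectors, `∏ [0, L⁻(w) + ext w]` -/
def assetSpace (F : Network V E) : Set (V → ℝ) :=
  {a | ∀ w, 0 ≤ a w ∧ a w ≤ F.inLiab w + F.ext w}

open Classical in
/-- the fixed-point map `Φ` of the asset axioms with default costs -/
noncomputable def assetMap (F : Network V E) (a : V → ℝ) (w : V) : ℝ :=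
  if F.outLiab w ≤ F.ext w + F.incoming a w then F.ext w + F.incoming a w
  else F.alpha w * F.ext w + F.beta w * F.incoming a w

def IsClearing (F : Network V E) (a : V → ℝ) : Prop :=
  a ∈ F.assetSpace ∧ F.assetMap a = a

/-- `a` is the minimal clearing state: the coordinatewise least one. -/
def IsMinimalClearing (F : Network V E) (a : V → ℝ) : Prop :=
  IsLeast {a' | F.IsClearing a'} a

/-- Continuity from below of `Φ` on the space of asset vectors. -/
def ContinuousFromBelow (F : Network V E) : Prop :=
  ∀ (a : ℕ → V → ℝ) (l : V → ℝ), Monotone a → (∀ i, a i ∈ F.assetSpace) → l ∈ F.assetSpace →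
    Filter.Tendsto a Filter.atTop (nhds l) →
    Filter.Tendsto (fun i => F.assetMap (a i)) Filter.atTop (nhds (F.assetMap l))

/-! ### Slopes and distances to the next border -/

open Classical in
/-- index of the interval of `e` that contains `a ≥ 0` -/
noncomputable def interval (F : Network V E) (e : E) (a : ℝ) : ℕ :=
  ((Finset.Icc 1 (F.numBorders e)).filter (fun i => F.border e i ≤ a)).card

/-- `m_e(a)` -/
noncomputable def slopeAt (F : Network V E) (e : E) (a : ℝ) : ℝ := F.slope e (F.interval e a)

open Classical in
/-- `δ_e(a)`, the distance to the next border; it is `⊤` when there is no border above `a`. -/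
noncomputable def toBorder (F : Network V E) (e : E) (a : ℝ) : WithTop ℝ :=
  ((Finset.range (F.numBorders e + 1)).filter (fun i => a < F.border e i)).inf
    (fun i => ((F.border e i - a : ℝ) : WithTop ℝ))

/-! ### Active graph and the two linear programs

Here `live` is the set of edges that have not been removed from the network. -/

open Classical in
/-- the active edges for the assets `b` -/
noncomputable def activeEdges (F : Network V E) (live : Finset E) (b : V → ℝ) : Finset E :=
  live.filter (fun e => 0 < F.slopeAt e (b (F.src e)))

def Adj (F : Network V E) (live : Finset E) (b : V → ℝ) (w w' : V) : Prop :=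
  ∃ e ∈ F.activeEdges live b, F.src e = w ∧ F.tgt e = w'

/-- reachability in the active graph -/
def Reach (F : Network V E) (live : Finset E) (b : V → ℝ) : V → V → Prop :=
  Relation.ReflTransGen (F.Adj live b)

/-- `C` is a strongly connected component of the active graph. -/
def IsSCC (F : Network V E) (live : Finset E) (b : V → ℝ) (C : Set V) : Prop :=
  ∃ c, C = {w | F.Reach live b c w ∧ F.Reach live b w c}

/-- `C` is a non-singleton sink component of the active graph that is reachable from `w`. -/
def Floods (F : Network V E) (live : Finset E) (b : V → ℝ) (w : V) (C : Set V) : Prop :=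
  F.IsSCC live b C ∧ C.Nontrivial ∧ (∀ c ∈ C, ∀ c', F.Adj live b c c' → c' ∈ C) ∧
    ∃ c ∈ C, F.Reach live b w c

open Classical in
/-- the feasible points of the Flood-LP of `C`, extended by `0` outside `C` -/
def FloodFeasible (F : Network V E) (live : Finset E) (b : V → ℝ) (C : Set V) (d : V → ℝ) : Prop :=
  (∀ w, w ∉ C → d w = 0) ∧
  (∀ w ∈ C, d w =
    ∑ e ∈ (F.activeEdges live b).filter (fun e => F.tgt e = w ∧ F.src e ∈ C),
      F.slopeAt e (b (F.src e)) * d (F.src e)) ∧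
  (∀ w ∈ C, ∀ e ∈ F.activeEdges live b, F.src e = w →
    ((d w : ℝ) : WithTop ℝ) ≤ F.toBorder e (b w)) ∧
  (∀ w ∈ C, 0 ≤ d w)

/-- `d` is an optimal solution of the Flood-LP: it maximizes `∑ w ∈ C, d w`. -/
def FloodOptimal (F : Network V E) (live : Finset E) (b : V → ℝ) (C : Set V) (d : V → ℝ) : Prop :=
  F.FloodFeasible live b C d ∧
    ∀ d', F.FloodFeasible live b C d' → ∑ w, d' w ≤ ∑ w, d w

open Classical in
/-- the feasible points of the Increase-LP of the bank `w₀`, where `r` is the amount by which the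
external assets of `w₀` may still grow -/
def IncFeasible (F : Network V E) (live : Finset E) (b : V → ℝ) (w₀ : V) (r : ℝ)
    (δ : ℝ) (d : V → ℝ) : Prop :=
  (∀ w, F.Reach live b w₀ w → d w = (if w = w₀ then δ else 0) +
    ∑ e ∈ (F.activeEdges live b).filter (fun e => F.tgt e = w),
      F.slopeAt e (b (F.src e)) * d (F.src e)) ∧
  (∀ w, ¬ F.Reach live b w₀ w → d w = 0) ∧
  (∀ w, ∀ e ∈ F.activeEdges live b, F.src e = w →
    ((d w : ℝ) : WithTop ℝ) ≤ F.toBorder e (b w)) ∧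
  δ ≤ r ∧
  (∀ w, 0 ≤ d w)

/-- `(δ, d)` is an optimal solution of the Increase-LP: it maximizes `δ`. -/
def IncOptimal (F : Network V E) (live : Finset E) (b : V → ℝ) (w₀ : V) (r : ℝ)
    (δ : ℝ) (d : V → ℝ) : Prop :=
  F.IncFeasible live b w₀ r δ d ∧
    ∀ δ' d', F.IncFeasible live b w₀ r δ' d' → δ' ≤ δ

/-! ### The adjusted network with auxiliary banks -/

/-- `D`, the banks with default costs -/
def DefBank (F : Network V E) : Type u := {w : V // F.alpha w < 1 ∨ F.beta w < 1}

noncomputable instance (F : Network V E) : Fintype F.DefBank :=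
  @Fintype.ofFinite _ (inferInstanceAs (Finite {w : V // F.alpha w < 1 ∨ F.beta w < 1}))

/-- Banks of the adjusted network: the banks of `F`, then the collecting banks `u_s` and the sink
banks `u_t` for `u ∈ D`. -/
abbrev AdjBank (F : Network V E) : Type u := V ⊕ F.DefBank ⊕ F.DefBank

/-- Edges of the adjusted network: those of `F` (some of them re-routed), then `(u_s, u_t)` and
`(u_s, u)` for `u ∈ D`. -/
abbrev AdjEdge (F : Network V E) : Type (max u v) := E ⊕ F.DefBank ⊕ F.DefBank

/-- The proportional payment function towards a claim of liability `l` of a debtor with total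
liabilities `L`. -/
noncomputable def proportional (L l a : ℝ) : ℝ := min 1 (a / L) * l

open Classical in
/-- The adjustment: a bank `u ∈ D` gets the external assets `alpha u * ext u`, the edges into `u`
are re-routed to `u_s`, and `u_s` pays proportionally on the edges `(u_s, u_t)` and `(u_s, u)` of
liabilities `(1 - beta u) * L⁺(u)` and `beta u * L⁺(u)`.  The result has no default costs. -/
noncomputable def adjust (F : Network V E) : Network F.AdjBank F.AdjEdge where
  src := fun e => match e with
    | .inl e => .inl (F.src e)
    | .inr (.inl u) => .inr (.inl u)
    | .inr (.inr u) => .inr (.inl u)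
  tgt := fun e => match e with
    | .inl e =>
        if h : F.alpha (F.tgt e) < 1 ∨ F.beta (F.tgt e) < 1 then .inr (.inl ⟨F.tgt e, h⟩)
        else .inl (F.tgt e)
    | .inr (.inl u) => .inr (.inr u)
    | .inr (.inr u) => .inl u.1
  liab := fun e => match e with
    | .inl e => F.liab e
    | .inr (.inl u) => (1 - F.beta u.1) * F.outLiab u.1
    | .inr (.inr u) => F.beta u.1 * F.outLiab u.1
  ext := fun w => match w with
    | .inl w => if F.alpha w < 1 ∨ F.beta w < 1 then F.alpha w * F.ext w else F.ext w
    | .inr _ => 0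
  alpha := fun _ => 1
  beta := fun _ => 1
  pay := fun e => match e with
    | .inl e => F.pay e
    | .inr (.inl u) => proportional (F.outLiab u.1) ((1 - F.beta u.1) * F.outLiab u.1)
    | .inr (.inr u) => proportional (F.outLiab u.1) (F.beta u.1 * F.outLiab u.1)
  numBorders := fun e => match e with
    | .inl e => F.numBorders e
    | .inr _ => 1
  border := fun e i => match e with
    | .inl e => F.border e i
    | .inr (.inl u) => if i = 0 then 0 else F.outLiab u.1
    | .inr (.inr u) => if i = 0 then 0 else F.outLiab u.1
  slope := fun e i => match e with
    | .inl e => F.slope e i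
    | .inr (.inl u) => if i = 0 then 1 - F.beta u.1 else 0
    | .inr (.inr u) => if i = 0 then F.beta u.1 else 0

/-! ### The algorithm -/

/-- The variables of the algorithm: the edges that have not been removed, the vectors `a^(x)`,
`b^(x)` and `b` of the adjusted network, and the bank `cur` of the current iteration of the main
loop (`none` at the head of the main loop). -/
structure State (F : Network V E) where
  live : Finset F.AdjEdge
  ax : F.AdjBank → ℝ
  bx : F.AdjBank → ℝ
  b : F.AdjBank → ℝ
  cur : Option F.AdjBank

/-- Solvency test for `u ∈ D` with respect to the unadjusted network; the bank `u_s` collects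
everything that is currently paid to `u`. -/
def Solvent (F : Network V E) (b : F.AdjBank → ℝ) (u : F.DefBank) : Prop :=
  F.outLiab u.1 ≤ F.ext u.1 + b (.inr (.inl u))

open Classical in
/-- the remaining out-edges of the solvent banks of `D` -/
noncomputable def settled (F : Network V E) (s : State F) : Finset F.AdjEdge :=
  s.live.filter (fun e => ∃ u : F.DefBank, F.adjust.src e = .inl u.1 ∧ F.Solvent s.b u)

open Classical in
/-- The adjustment for all banks of `D` that became solvent: their out-edges are removed, the current
payments on them are added to `b^(x)` and their liabilities are added to `a^(x)` of the creditor. -/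
noncomputable def settle (F : Network V E) (s : State F) : State F where
  live := s.live \ F.settled s
  ax := fun w => s.ax w +
    ∑ e ∈ (F.settled s).filter (fun e => F.adjust.tgt e = w), F.adjust.liab e
  bx := fun w => s.bx w +
    ∑ e ∈ (F.settled s).filter (fun e => F.adjust.tgt e = w),
      F.adjust.pay e (s.b (F.adjust.src e))
  b := s.b
  cur := s.cur

/-- The state before the main loop.  Banks of `D` that are solvent by their own external assets are
settled at once. -/
noncomputable def init (F : Network V E) : State F :=
  F.settle { live := Finset.univ, ax := F.adjust.ext, bx := 0, b := 0, cur := none }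

open Classical in
/-- The elementary steps of the algorithm: an iteration of the main loop selects a bank, floods
components as long as there are any, and then raises the external assets of the selected bank and
settles the banks of `D` that became solvent.  The selection of banks, components and optimal
solutions is arbitrary. -/
inductive Step (F : Network V E) : State F → State F → Prop
  | select (s : State F) (w : F.AdjBank) (hcur : s.cur = none) (hw : s.bx w < s.ax w) :
      Step F s { s with cur := some w }
  | flood (s : State F) (w : F.AdjBank) (C : Set F.AdjBank) (d : F.AdjBank → ℝ)
      (hcur : s.cur = some w) (hC : F.adjust.Floods s.live s.b w C)
      (hd : F.adjust.FloodOptimal s.live s.b C d) :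
      Step F s { s with b := s.b + d }
  | increase (s : State F) (w : F.AdjBank) (δ : ℝ) (d : F.AdjBank → ℝ)
      (hcur : s.cur = some w) (hC : ∀ C, ¬ F.adjust.Floods s.live s.b w C)
      (hd : F.adjust.IncOptimal s.live s.b w (s.ax w - s.bx w) δ d) :
      Step F s (F.settle
        { s with bx := Function.update s.bx w (s.bx w + δ), b := s.b + d, cur := none })

/-- the main loop ends -/
def Final {F : Network V E} (s : State F) : Prop :=
  s.cur = none ∧ ¬ ∃ w, s.bx w < s.ax w

/-- `s 0, …, s N` are the first `N + 1` states of an execution of the algorithm on `F`. -/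
def IsRun (F : Network V E) (N : ℕ) (s : ℕ → State F) : Prop :=
  s 0 = F.init ∧ ∀ i < N, F.Step (s i) (s (i + 1))

open Classical in
/-- The assets of the banks of `F` that are read off from the vector `b` of the adjusted network: a
solvent bank of `D` has no reduction, and the assets of every other bank are those in `b`. -/
noncomputable def result (F : Network V E) (s : State F) (w : V) : ℝ :=
  if h : F.alpha w < 1 ∨ F.beta w < 1 then
    if F.Solvent s.b ⟨w, h⟩ then F.ext w + s.b (.inr (.inl ⟨w, h⟩)) else s.b (.inl w)
  else s.b (.inl w)

end Network

/-! ### A real random-access machine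

A memory of natural-number cells and a memory of real cells.  A cell is addressed by the number of an
array, which is fixed in the program, and by two indices.  Arithmetic on reals is exact.  Expressions
are part of the (fixed) program and hence of constant size, so that every step stands for a constant
number of unit-cost operations. -/

structure Store where
  nat : ℕ → ℕ → ℕ → ℕ
  real : ℕ → ℕ → ℕ → ℝ

inductive NExp : Type
  | const (c : ℕ)
  | cell (arr : ℕ) (i j : NExp)
  | add (x y : NExp)
  | sub (x y : NExp)

/-- Subtraction is truncated at `0`. -/
def NExp.eval (σ : Store) : NExp → ℕ
  | .const c => c
  | .cell arr i j => σ.nat arr (i.eval σ) (j.eval σ)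
  | .add x y => x.eval σ + y.eval σ
  | .sub x y => x.eval σ - y.eval σ

inductive RExp : Type
  | const (c : ℕ)
  | cell (arr : ℕ) (i j : NExp)
  | add (x y : RExp)
  | sub (x y : RExp)
  | mul (x y : RExp)
  | div (x y : RExp)

noncomputable def RExp.eval (σ : Store) : RExp → ℝ
  | .const c => (c : ℝ)
  | .cell arr i j => σ.real arr (i.eval σ) (j.eval σ)
  | .add x y => x.eval σ + y.eval σ
  | .sub x y => x.eval σ - y.eval σ
  | .mul x y => x.eval σ * y.eval σ
  | .div x y => x.eval σ / y.eval σ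

inductive Test : Type
  | natLt (x y : NExp)
  | realLt (x y : RExp)
  | not (t : Test)
  | and (t t' : Test)

def Test.Holds (σ : Store) : Test → Prop
  | .natLt x y => x.eval σ < y.eval σ
  | .realLt x y => x.eval σ < y.eval σ
  | .not t => ¬ t.Holds σ
  | .and t t' => t.Holds σ ∧ t'.Holds σ

inductive Program : Type
  | setNat (arr : ℕ) (i j : NExp) (val : NExp)
  | setReal (arr : ℕ) (i j : NExp) (val : RExp)
  | seq (p q : Program)
  | ite (t : Test) (p q : Program)
  | while (t : Test) (p : Program)

def Store.writeNat (σ : Store) (arr i j val : ℕ) : Store where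
  nat := fun arr' i' j' => if arr' = arr ∧ i' = i ∧ j' = j then val else σ.nat arr' i' j'
  real := σ.real

def Store.writeReal (σ : Store) (arr i j : ℕ) (val : ℝ) : Store where
  nat := σ.nat
  real := fun arr' i' j' => if arr' = arr ∧ i' = i ∧ j' = j then val else σ.real arr' i' j'

/-- A configuration: what remains to be executed, and the memory. -/
abbrev Config : Type := List Program × Store

open Classical in
/-- One step of the machine. -/
noncomputable def step : Config → Config
  | ([], σ) => ([], σ)
  | (.setNat arr i j val :: K, σ) => (K, σ.writeNat arr (i.eval σ) (j.eval σ) (val.eval σ))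
  | (.setReal arr i j val :: K, σ) => (K, σ.writeReal arr (i.eval σ) (j.eval σ) (val.eval σ))
  | (.seq p q :: K, σ) => (p :: q :: K, σ)
  | (.ite t p q :: K, σ) => if t.Holds σ then (p :: K, σ) else (q :: K, σ)
  | (.while t p :: K, σ) => if t.Holds σ then (p :: .while t p :: K, σ) else (K, σ)

/-- the configuration after `t` steps of `P` on the input memory `σ` -/
noncomputable def runFor (P : Program) (σ : Store) (t : ℕ) : Config := step^[t] ([P], σ)

/-- `P` halts on `σ` after at most `t` steps. -/
def HaltsWithin (P : Program) (σ : Store) (t : ℕ) : Prop := (runFor P σ t).1 = []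

/-- The input memory: the numbers of banks and edges, the end points and numbers of borders of the
edges; the external assets and default rates of the banks; the liabilities, borders and slopes of the
edges.  Everything else is `0`. -/
noncomputable def input {n m : ℕ} (F : Network (Fin n) (Fin m)) : Store where
  nat := fun arr i j =>
    if arr = 0 ∧ i = 0 ∧ j = 0 then n
    else if arr = 0 ∧ i = 0 ∧ j = 1 then m
    else if h : j < m then
      if arr = 1 ∧ i = 0 then (F.src ⟨j, h⟩ : ℕ)
      else if arr = 1 ∧ i = 1 then (F.tgt ⟨j, h⟩ : ℕ)
      else if arr = 1 ∧ i = 2 then F.numBorders ⟨j, h⟩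
      else 0
    else 0
  real := fun arr i j =>
    if arr = 0 then
      if h : j < n then
        if i = 0 then F.ext ⟨j, h⟩
        else if i = 1 then F.alpha ⟨j, h⟩
        else if i = 2 then F.beta ⟨j, h⟩
        else 0
      else 0
    else if arr = 1 then
      if h : j < m then (if i = 0 then F.liab ⟨j, h⟩ else 0) else 0
    else if h : i < m then
      if arr = 2 ∧ j ≤ F.numBorders ⟨i, h⟩ then F.border ⟨i, h⟩ j
      else if arr = 3 ∧ j ≤ F.numBorders ⟨i, h⟩ then F.slope ⟨i, h⟩ j
      else 0
    else 0

/-- the indices of the cells that belong to a bank of the adjusted network -/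
def bankIndex {n m : ℕ} {F : Network (Fin n) (Fin m)} : F.AdjBank → ℕ × ℕ
  | .inl w => (0, w)
  | .inr (.inl u) => (1, u.1)
  | .inr (.inr u) => (2, u.1)

/-- the indices of the cells that belong to an edge of the adjusted network -/
def edgeIndex {n m : ℕ} {F : Network (Fin n) (Fin m)} : F.AdjEdge → ℕ × ℕ
  | .inl e => (0, e)
  | .inr (.inl u) => (1, u.1)
  | .inr (.inr u) => (2, u.1)

/-- The memory `σ` holds the state `s` of the algorithm: `b`, `b^(x)`, `a^(x)` in the real arrays
`10`, `11`, `12`, and the indicator of the remaining edges in the natural-number array `10`. -/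
def StoreHolds {n m : ℕ} {F : Network (Fin n) (Fin m)} (s : Network.State F) (σ : Store) : Prop :=
  (∀ w : F.AdjBank,
    σ.real 10 (bankIndex w).1 (bankIndex w).2 = s.b w ∧
    σ.real 11 (bankIndex w).1 (bankIndex w).2 = s.bx w ∧
    σ.real 12 (bankIndex w).1 (bankIndex w).2 = s.ax w) ∧
  (∀ e : F.AdjEdge, σ.nat 10 (edgeIndex e).1 (edgeIndex e).2 ≠ 0 ↔ e ∈ s.live)

/-- the output of the machine: row `0` of the real array `13` -/
def output {n : ℕ} (σ : Store) (w : Fin n) : ℝ := σ.real 13 0 w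

/-- On the input `F`, the program `P` carries out a complete execution `s 0, …, s N` of the
algorithm, passing through its states in order, and halts after at most `T` steps with the returned
vector as output. -/
def Executes {n m : ℕ} (P : Program) (F : Network (Fin n) (Fin m)) (T : ℕ) : Prop :=
  ∃ (N : ℕ) (s : ℕ → Network.State F) (τ : ℕ → ℕ),
    F.IsRun N s ∧ Network.Final (s N) ∧ Monotone τ ∧ τ N ≤ T ∧
    (∀ i ≤ N, StoreHolds (s i) (runFor P (input F) (τ i)).2) ∧
    HaltsWithin P (input F) T ∧
    output (runFor P (input F) T).2 = F.result (s N)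

end Clearing

/-! ### Payment functions of `F` and the laws of its adjusted network. -/

namespace Clearing
namespace Network
universe u v
set_option linter.unusedSectionVars false
variable {V : Type u} {E : Type v} [Fintype E]

/-! ### Intervals and borders -/

/-! Correctness rests on a single comparison from below. A clearing state `a` of `F` induces the
vector `lift F a` in the adjusted network, in which every bank of `D` is still reduced. The
algorithm keeps `b ≤ lift F a` for all clearing states `a`, together with the exact balance equation
`b = bx + payments on the remaining edges`; this is `Core`. With `ax` in place of `bx`, the vector
`lift F a` is a supersolution of the same equations (`lift_super`). The point is settling: a bank
that is solvent at `b` is solvent in `a`, because `b ≤ lift F a`, and hence pays in full in `a`. Its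
edges may therefore be replaced by external assets without losing the comparison, although the
fixed-point map jumps there.

Both linear programs are governed by the matrix `flow` of slopes on active edges. It is
non-negative, with column sums at most `1`, and equal to `1` at every bank with an active out-edge.
A matrix `K ≥ 0` is `Transient` if `z ≥ 0` and `z ≤ K z` force `z = 0`; then `d = q + K d` has
exactly one solution, which is non-negative for `q ≥ 0`. If no component can be flooded, the part
reachable from `v` is transient (`transient_reach`). If `C` can be flooded, it becomes transient
when one row is deleted (`transient_component`). In both cases the feasible points are multiples of
one vector, and the optimum is given by a ratio test (`incOptimal_of_scale`,
`floodOptimal_of_scale`).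

Let `A` be a supersolution above `b`, `d` a feasible direction, and `z = d - min (A - b) d` the
overshoot. Since payments grow at least linearly up to the next border, `z ≤ K z`. For an increase,
transience gives `z = 0` (`increase_le`). For a flooding, the column sums only give `z = K z`; but
some bank of `C` has a strict surplus in `A`, fed from the gap `bx v < ax v`, so `z` vanishes there.
Deleting its row leaves a transient matrix, and again `z = 0` (`flood_le`).

A flooding passes a border; an increase passes a border or closes the gap of its bank; settling
creates at most one new gap per removed edge. Hence `remaining` decreases in every step and is
linear in `k + n + m`. In a final state `bx = ax`, so `result` is a fixed point, and `b ≤ lift F a`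
makes it the least one.

For the running time, one step needs a transitive closure and a linear system on `3 n` cells, both
cubic. The elimination needs no exchange of pivots, since it preserves transience and transience
keeps `1 - K k k` positive (`Transient.eliminate`, `Transient.diag_lt_one`). Each edge has a pointer
to its current interval and the payment at the left end of that interval. Pointers only advance, so
their total cost is amortized over all borders; everything else in a step is linear in `n + m`.

Discontinuity occurs where a bank that loses everything in default becomes solvent only in the
limit. -/

theorem border_mono_of_step {F : Network V E} {e : E}
    (hb : ∀ i, i < F.numBorders e → F.border e i ≤ F.border e (i + 1)) {i j : ℕ} (hij : i ≤ j)
    (hj : j ≤ F.numBorders e) : F.border e i ≤ F.border e j := by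
  induction j, hij using Nat.le_induction with
  | base => exact le_rfl
  | succ k hk ih => exact (ih (by omega)).trans (hb k (by omega))

/-- The borders are only assumed to be weakly increasing: in the adjusted network the auxiliary
edges of a bank without liabilities have both borders equal to `0`. -/
theorem interval_eq_of {F : Network V E} {e : E} {a : ℝ} {j : ℕ}
    (hb : ∀ i, i < F.numBorders e → F.border e i ≤ F.border e (i + 1))
    (hj : j ≤ F.numBorders e) (hja : F.border e j ≤ a)
    (hlt : j < F.numBorders e → a < F.border e (j + 1)) : F.interval e a = j := by
  classical
  have : (Finset.Icc 1 (F.numBorders e)).filter (fun i => F.border e i ≤ a) = Finset.Icc 1 j := by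
    ext i
    simp only [Finset.mem_filter, Finset.mem_Icc]
    constructor
    · rintro ⟨⟨h1, h2⟩, h3⟩
      refine ⟨h1, ?_⟩
      by_contra hc
      have := hlt (by omega)
      have := border_mono_of_step hb (show j + 1 ≤ i by omega) h2
      linarith
    · rintro ⟨h1, h2⟩
      exact ⟨⟨h1, by omega⟩, (border_mono_of_step hb h2 hj).trans hja⟩
  unfold interval
  rw [← Nat.card_Icc 1 j |>.trans (by omega : j + 1 - 1 = j)]
  convert congrArg Finset.card this

theorem interval_spec {F : Network V E} {e : E} {a : ℝ}
    (h0 : F.border e 0 = 0)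
    (hb : ∀ i, i < F.numBorders e → F.border e i ≤ F.border e (i + 1)) (ha : 0 ≤ a) :
    F.interval e a ≤ F.numBorders e ∧ F.border e (F.interval e a) ≤ a ∧
      (F.interval e a < F.numBorders e → a < F.border e (F.interval e a + 1)) := by
  classical
  set j := Nat.findGreatest (fun i => F.border e i ≤ a) (F.numBorders e) with hj
  have h1 : j ≤ F.numBorders e := Nat.findGreatest_le _
  have h2 : F.border e j ≤ a :=
    Nat.findGreatest_spec (P := fun i => F.border e i ≤ a) (Nat.zero_le _) (by rw [h0]; exact ha)
  have h3 : j < F.numBorders e → a < F.border e (j + 1) := fun h =>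
    not_le.1 (Nat.findGreatest_is_greatest (P := fun i => F.border e i ≤ a)
      (Nat.lt_succ_self j) h)
  rw [interval_eq_of hb h1 h2 h3]
  exact ⟨h1, h2, h3⟩

theorem interval_le_numBorders (F : Network V E) (e : E) (a : ℝ) :
    F.interval e a ≤ F.numBorders e := by
  unfold interval
  exact (Finset.card_filter_le _ _).trans (by simp)

theorem interval_mono (F : Network V E) (e : E) {a a' : ℝ} (h : a ≤ a') :
    F.interval e a ≤ F.interval e a' := by
  unfold interval
  apply Finset.card_le_card
  intro i
  simp only [Finset.mem_filter]
  exact fun ⟨h1, h2⟩ => ⟨h1, h2.trans h⟩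

/-- The source of progress: a step whose length is the distance to a border makes that border count
as passed. -/
theorem interval_lt_of_toBorder_eq {F : Network V E} {e : E} {a d : ℝ} (h0 : F.border e 0 = 0)
    (ha : 0 ≤ a) (hd : (d : WithTop ℝ) = F.toBorder e a) :
    F.interval e a < F.interval e (a + d) := by
  classical
  unfold toBorder at hd
  set s := (Finset.range (F.numBorders e + 1)).filter (fun i => a < F.border e i) with hs
  have hne : s.Nonempty := by
    rw [Finset.nonempty_iff_ne_empty]
    intro h
    rw [h] at hd
    simp at hd
  obtain ⟨i, hi, hi'⟩ := Finset.exists_mem_eq_inf s hne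
    (fun i => ((F.border e i - a : ℝ) : WithTop ℝ))
  rw [hi'] at hd
  have hd' : d = F.border e i - a := by exact_mod_cast hd
  simp only [hs, Finset.mem_filter, Finset.mem_range] at hi
  unfold interval
  apply Finset.card_lt_card
  rw [Finset.ssubset_iff_of_subset]
  · refine ⟨i, ?_, ?_⟩
    · simp only [Finset.mem_filter, Finset.mem_Icc]
      refine ⟨⟨?_, by omega⟩, by linarith⟩
      rcases Nat.eq_zero_or_pos i with h | h
      · subst h; linarith
      · exact h
    · simp only [Finset.mem_filter, not_and, not_le]
      exact fun _ => hi.2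
  · intro k
    simp only [Finset.mem_filter]
    rintro ⟨h1, h2⟩
    exact ⟨h1, by linarith⟩

theorem toBorder_pos (F : Network V E) (e : E) (a : ℝ) : 0 < F.toBorder e a := by
  unfold toBorder
  rw [Finset.lt_inf_iff (by simp)]
  intro i hi
  simp only [Finset.mem_filter] at hi
  have : (0 : ℝ) < F.border e i - a := by linarith [hi.2]
  exact_mod_cast this

theorem toBorder_eq {F : Network V E} {e : E} {a : ℝ} (h0 : F.border e 0 = 0)
    (hb : ∀ i, i < F.numBorders e → F.border e i ≤ F.border e (i + 1)) (ha : 0 ≤ a) :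
    F.toBorder e a = if F.interval e a < F.numBorders e
      then ((F.border e (F.interval e a + 1) - a : ℝ) : WithTop ℝ) else ⊤ := by
  classical
  obtain ⟨h1, h2, h3⟩ := interval_spec h0 hb ha
  unfold toBorder
  split_ifs with h
  · apply le_antisymm
    · exact Finset.inf_le (by simp; exact ⟨by omega, h3 h⟩)
    · apply Finset.le_inf
      intro i hi
      simp only [Finset.mem_filter, Finset.mem_range] at hi
      have : F.interval e a + 1 ≤ i := by
        by_contra hc
        have := border_mono_of_step hb (show i ≤ F.interval e a by omega) h1
        linarith [hi.2]
      have := border_mono_of_step hb this (by omega)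
      have : F.border e (F.interval e a + 1) - a ≤ F.border e i - a := by linarith
      exact_mod_cast this
  · rw [Finset.filter_eq_empty_iff.2, Finset.inf_empty]
    intro i hi
    simp only [Finset.mem_range] at hi
    have := border_mono_of_step hb (show i ≤ F.interval e a by omega) h1
    linarith

/-! ### Lawful networks -/

/-- The laws of payments without default costs that the analysis of the two linear programs needs. -/
structure Lawful (G : Network V E) : Prop where
  no_loops : ∀ e, G.src e ≠ G.tgt e
  slope_nonneg : ∀ e a, 0 ≤ G.slopeAt e a
  pay_zero : ∀ e, G.pay e 0 = 0
  pay_le : ∀ e a, 0 ≤ a → G.pay e a ≤ G.liab e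
  pay_mono : ∀ e a a', 0 ≤ a → a ≤ a' → G.pay e a ≤ G.pay e a'
  pay_add : ∀ e (a d : ℝ), 0 ≤ a → 0 ≤ d → (d : WithTop ℝ) ≤ G.toBorder e a →
    G.pay e (a + d) = G.pay e a + G.slopeAt e a * d
  pay_add_of_active : ∀ e (a d : ℝ), 0 ≤ a → 0 ≤ d →
    (∀ e', G.src e' = G.src e → 0 < G.slopeAt e' a → (d : WithTop ℝ) ≤ G.toBorder e' a) →
    G.pay e (a + d) = G.pay e a + G.slopeAt e a * d
  pay_eq : ∀ e a, 0 ≤ a → G.pay e a = G.pay e (G.border e (G.interval e a)) +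
    G.slopeAt e a * (a - G.border e (G.interval e a))
  pay_border : ∀ e i, i < G.numBorders e → G.pay e (G.border e (i + 1)) =
    G.pay e (G.border e i) + G.slope e i * (G.border e (i + 1) - G.border e i)
  slope_sum_le : ∀ w a, 0 ≤ a → ∑ e ∈ G.outEdges w, G.slopeAt e a ≤ 1
  slope_sum_eq : ∀ e a, 0 ≤ a → 0 < G.slopeAt e a →
    ∑ e' ∈ G.outEdges (G.src e), G.slopeAt e' a = 1
  toBorder_ne_top : ∀ e a, 0 ≤ a → 0 < G.slopeAt e a → G.toBorder e a ≠ ⊤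

theorem Lawful.pay_nonneg {G : Network V E} (h : G.Lawful) (e : E) {a : ℝ} (ha : 0 ≤ a) :
    0 ≤ G.pay e a := by
  rw [← h.pay_zero e]; exact h.pay_mono e 0 a le_rfl ha

theorem Lawful.pay_sub_ge {G : Network V E} (h : G.Lawful) (e : E) {a a' d : ℝ} (ha : 0 ≤ a)
    (hd : 0 ≤ d) (hda : a + d ≤ a') (hdb : (d : WithTop ℝ) ≤ G.toBorder e a) :
    G.slopeAt e a * d ≤ G.pay e a' - G.pay e a := by
  have h1 := h.pay_add e a d ha hd hdb
  have h2 := h.pay_mono e (a + d) a' (by linarith) hda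
  linarith

/-! ### Payment functions of a well-formed network -/

theorem mem_outEdges (F : Network V E) {e : E} {w : V} : e ∈ F.outEdges w ↔ F.src e = w := by
  simp [outEdges]

theorem mem_inEdges (F : Network V E) {e : E} {w : V} : e ∈ F.inEdges w ↔ F.tgt e = w := by
  simp [inEdges]

/-- Let `ε` tend to `0`. This extends the affine formula for a payment function to an end point that
its half-open interval, or the restriction to positive assets, leaves out. -/
theorem eq_zero_of_abs_le_small {X c ε₀ : ℝ} (hε : 0 < ε₀)
    (h : ∀ ε, 0 < ε → ε < ε₀ → |X + c * ε| ≤ ε) : X = 0 := by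
  by_contra hX
  have hpos : 0 < |X| := abs_pos.2 hX
  set ε := min (ε₀ / 2) (|X| / (2 * (1 + |c|))) with hεd
  have hc : 0 < 1 + |c| := by positivity
  have h1 : 0 < ε := lt_min (by linarith) (by positivity)
  have h2 : ε < ε₀ := (min_le_left _ _).trans_lt (by linarith)
  have h3 : ε * (2 * (1 + |c|)) ≤ |X| := by
    rw [← le_div_iff₀ (by positivity)]; exact min_le_right _ _
  have h4 := h ε h1 h2
  have h5 : |X| ≤ |X + c * ε| + |c * ε| := by
    have := abs_sub (X + c * ε) (c * ε)
    simpa using this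
  rw [abs_mul, abs_of_pos h1] at h5
  nlinarith [abs_nonneg c]

namespace WellFormed
variable {F : Network V E} (hF : F.WellFormed)
include hF

theorem border_le (e : E) (i : ℕ) (hi : i < F.numBorders e) :
    F.border e i ≤ F.border e (i + 1) := (hF.border_lt e i hi).le

/-- All payments of the debtor are non-decreasing and their sum `min a L` grows with rate at most
`1`, so no single payment grows faster. -/
theorem pay_lipschitz (e : E) {a a' : ℝ} (ha : 0 < a) (h : a ≤ a') :
    F.pay e a ≤ F.pay e a' ∧ F.pay e a' - F.pay e a ≤ a' - a := by
  have hmono : ∀ e, F.pay e a ≤ F.pay e a' := by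
    intro e
    rcases h.eq_or_lt with h | h
    · rw [h]
    · have := hF.pay_mono e a (a' - a) ha (by linarith)
      simpa using this
  refine ⟨hmono e, ?_⟩
  have h1 := hF.no_fraud (F.src e) a ha
  have h2 := hF.no_fraud (F.src e) a' (by linarith)
  have h3 : F.pay e a' - F.pay e a ≤ ∑ e' ∈ F.outEdges (F.src e), (F.pay e' a' - F.pay e' a) :=
    Finset.single_le_sum (f := fun e' => F.pay e' a' - F.pay e' a)
      (fun e' _ => by linarith [hmono e']) ((mem_outEdges F).2 rfl)
  rw [Finset.sum_sub_distrib, h1, h2] at h3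
  have : min a' (F.outLiab (F.src e)) - min a (F.outLiab (F.src e)) ≤ a' - a := by
    rcases min_cases a (F.outLiab (F.src e)) with ⟨h4, h5⟩ | ⟨h4, h5⟩ <;> rw [h4]
    · linarith [min_le_left a' (F.outLiab (F.src e))]
    · linarith [min_le_right a' (F.outLiab (F.src e))]
  linarith

/-- The laws only speak of positive assets; the value at `0` is read off from `0 ≤ F.pay e ε ≤ ε` on
the first affine piece. -/
theorem pay_zero (e : E) : F.pay e 0 = 0 := by
  have hb := hF.border_lt e 0 (hF.one_le_numBorders e)
  rw [hF.border_zero] at hb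
  apply eq_zero_of_abs_le_small (c := F.slope e 0) hb
  intro ε h1 h2
  have h3 := hF.pay_piece e 0 ε (hF.one_le_numBorders e) (by rw [hF.border_zero]; exact h1.le) h2
  rw [hF.border_zero, sub_zero] at h3
  rw [add_comm, ← h3, abs_of_nonneg (hF.pay_mem e ε h1).1]
  calc F.pay e ε ≤ ∑ e' ∈ F.outEdges (F.src e), F.pay e' ε :=
        Finset.single_le_sum (f := fun e' => F.pay e' ε)
          (fun e' _ => (hF.pay_mem e' ε h1).1) ((mem_outEdges F).2 rfl)
    _ = min ε _ := hF.no_fraud _ _ h1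
    _ ≤ ε := min_le_left _ _

theorem border_nonneg (e : E) {i : ℕ} (hi : i ≤ F.numBorders e) : 0 ≤ F.border e i := by
  rw [← hF.border_zero e]
  exact border_mono_of_step (hF.border_le e) (Nat.zero_le _) hi

/-- The affine formula is given on a half-open interval; the Lipschitz bound carries it to the right
end point. -/
theorem pay_border (e : E) (i : ℕ) (hi : i < F.numBorders e) :
    F.pay e (F.border e (i + 1)) =
      F.pay e (F.border e i) + F.slope e i * (F.border e (i + 1) - F.border e i) := by
  have hlt := hF.border_lt e i hi
  have h0 := hF.border_nonneg e hi.le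
  rw [← sub_eq_zero]
  apply eq_zero_of_abs_le_small (c := F.slope e i)
    (show 0 < F.border e (i + 1) - F.border e i by linarith)
  intro ε h1 h2
  have h3 := hF.pay_piece e i (F.border e (i + 1) - ε) hi (by linarith) (by linarith)
  have h4 := hF.pay_lipschitz e (a := F.border e (i + 1) - ε) (a' := F.border e (i + 1))
    (by linarith) (by linarith)
  rw [h3] at h4
  rw [abs_of_nonneg] <;> nlinarith [h4.1, h4.2]

theorem pay_eq (e : E) {a : ℝ} (ha : 0 ≤ a) : F.pay e a = F.pay e (F.border e (F.interval e a)) +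
    F.slopeAt e a * (a - F.border e (F.interval e a)) := by
  obtain ⟨h1, h2, h3⟩ := interval_spec (hF.border_zero e) (hF.border_le e) ha
  unfold slopeAt
  rcases h1.eq_or_lt with h | h
  · have := hF.pay_last e a (by rw [← h]; exact h2)
    rw [h]; linarith
  · have := hF.pay_piece e _ a h h2 (h3 h)
    linarith

theorem pay_add (e : E) {a d : ℝ} (ha : 0 ≤ a) (hd : 0 ≤ d)
    (hdb : (d : WithTop ℝ) ≤ F.toBorder e a) :
    F.pay e (a + d) = F.pay e a + F.slopeAt e a * d := by
  obtain ⟨h1, h2, h3⟩ := interval_spec (hF.border_zero e) (hF.border_le e) ha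
  rw [hF.pay_eq e ha]
  rw [toBorder_eq (hF.border_zero e) (hF.border_le e) ha] at hdb
  unfold slopeAt
  split_ifs at hdb with h
  · have hdb' : d ≤ F.border e (F.interval e a + 1) - a := by exact_mod_cast hdb
    rcases hdb'.eq_or_lt with h4 | h4
    · have := hF.pay_border e _ h
      rw [show a + d = F.border e (F.interval e a + 1) by linarith, this, h4]
      ring
    · rw [hF.pay_piece e _ (a + d) h (by linarith) (by linarith)]
      ring
  · have h : F.interval e a = F.numBorders e := by omega
    rw [hF.pay_last e (a + d) (by rw [← h]; linarith), h]
    ring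

theorem no_fraud_nonneg (w : V) {a : ℝ} (ha : 0 ≤ a) (hw : 0 ≤ F.outLiab w) :
    ∑ e ∈ F.outEdges w, F.pay e a = min a (F.outLiab w) := by
  rcases ha.eq_or_lt with h | h
  · rw [← h, min_eq_left hw]
    exact Finset.sum_eq_zero (fun e _ => hF.pay_zero e)
  · exact hF.no_fraud w a h

theorem outLiab_nonneg (w : V) : 0 ≤ F.outLiab w :=
  Finset.sum_nonneg (fun e _ => hF.liab_nonneg e)

omit hF in
theorem exists_small_step (w : V) (a : ℝ) {r : ℝ} (hr : 0 < r) :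
    ∃ d, 0 < d ∧ d ≤ r ∧ ∀ e ∈ F.outEdges w, (d : WithTop ℝ) ≤ F.toBorder e a := by
  have h1 : ∀ᶠ d : ℝ in nhdsWithin 0 (Set.Ioi 0),
      ∀ e ∈ F.outEdges w, (d : WithTop ℝ) ≤ F.toBorder e a := by
    rw [Filter.eventually_all_finset]
    intro e _
    have hp := F.toBorder_pos e a
    induction h : F.toBorder e a using WithTop.recTopCoe with
    | top => simp
    | coe r =>
      rw [h] at hp
      have hp' : (0 : ℝ) < r := by exact_mod_cast hp
      filter_upwards [Ioc_mem_nhdsGT hp'] with x hx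
      exact_mod_cast hx.2
  obtain ⟨d, h2, h3⟩ := (h1.and (Ioc_mem_nhdsGT hr)).exists
  exact ⟨d, h3.1, h3.2, h2⟩

/-- The right derivative of `no_fraud`, taken over a step short enough to stay within the current
interval of every out-edge. -/
theorem slope_sum (w : V) {a : ℝ} (ha : 0 ≤ a) :
    ∑ e ∈ F.outEdges w, F.slopeAt e a = if a < F.outLiab w then 1 else 0 := by
  have hw := hF.outLiab_nonneg w
  have key : ∀ d : ℝ, 0 < d → (∀ e ∈ F.outEdges w, (d : WithTop ℝ) ≤ F.toBorder e a) →
      (∑ e ∈ F.outEdges w, F.slopeAt e a) * d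
        = min (a + d) (F.outLiab w) - min a (F.outLiab w) := by
    intro d hd hb
    rw [← hF.no_fraud_nonneg w ha hw, ← hF.no_fraud_nonneg w (by linarith : 0 ≤ a + d) hw,
      ← Finset.sum_sub_distrib, Finset.sum_mul]
    refine Finset.sum_congr rfl (fun e he => ?_)
    rw [hF.pay_add e ha hd.le (hb e he)]; ring
  split_ifs with h
  · obtain ⟨d, h1, h2, h3⟩ := exists_small_step (F := F) w a (sub_pos.2 h)
    have := key d h1 h3
    rw [min_eq_left (by linarith), min_eq_left h.le] at this
    have h4 : (∑ e ∈ F.outEdges w, F.slopeAt e a) * d = 1 * d := by linarith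
    exact mul_right_cancel₀ h1.ne' h4
  · obtain ⟨d, h1, h2, h3⟩ := exists_small_step (F := F) w a one_pos
    have := key d h1 h3
    rw [min_eq_right (by linarith), min_eq_right (not_lt.1 h)] at this
    have h4 : (∑ e ∈ F.outEdges w, F.slopeAt e a) * d = 0 * d := by linarith
    exact mul_right_cancel₀ h1.ne' h4

theorem slopeAt_nonneg (e : E) (a : ℝ) : 0 ≤ F.slopeAt e a :=
  hF.slope_nonneg e _ (F.interval_le_numBorders e a)

theorem pay_le_liab (e : E) {a : ℝ} (ha : 0 ≤ a) : F.pay e a ≤ F.liab e := by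
  rcases ha.eq_or_lt with h | h
  · rw [← h, hF.pay_zero]; exact hF.liab_nonneg e
  · exact (hF.pay_mem e a h).2

theorem pay_mono' (e : E) {a a' : ℝ} (ha : 0 ≤ a) (h : a ≤ a') : F.pay e a ≤ F.pay e a' := by
  rcases ha.eq_or_lt with h' | h'
  · rw [← h', hF.pay_zero]
    rcases (ha.trans h).eq_or_lt with h2 | h2
    · rw [← h2, hF.pay_zero]
    · exact (hF.pay_mem e a' h2).1
  · exact (hF.pay_lipschitz e h' h).1

/-- A bank whose assets cover its liabilities pays in full. -/
theorem pay_full (e : E) {a : ℝ} (ha : 0 ≤ a) (h : F.outLiab (F.src e) ≤ a) :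
    F.pay e a = F.liab e := by
  have h1 := hF.no_fraud_nonneg (F.src e) ha (hF.outLiab_nonneg _)
  rw [min_eq_right h, outLiab] at h1
  exact (Finset.sum_eq_sum_iff_of_le (fun e _ => hF.pay_le_liab e ha)).1 h1 e
    ((mem_outEdges F).2 rfl)

/-- An inactive edge may pass a border of its own during the step. It still receives nothing: the
active edges alone grow by the sum of the slopes times `d`, which is all that `no_fraud` allows, and
no payment decreases, so equality holds edge by edge. -/
theorem pay_add_of_active (e : E) {a d : ℝ} (ha : 0 ≤ a) (hd : 0 ≤ d)
    (h : ∀ e', F.src e' = F.src e → 0 < F.slopeAt e' a → (d : WithTop ℝ) ≤ F.toBorder e' a) :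
    F.pay e (a + d) = F.pay e a + F.slopeAt e a * d := by
  have hL := hF.outLiab_nonneg (F.src e)
  have hs := hF.slope_sum (F.src e) ha
  have hge : ∀ e' ∈ F.outEdges (F.src e), F.slopeAt e' a * d ≤ F.pay e' (a + d) - F.pay e' a := by
    intro e' he'
    rcases (hF.slopeAt_nonneg e' a).eq_or_lt with h0 | h0
    · rw [← h0, zero_mul]
      linarith [hF.pay_mono' e' ha (show a ≤ a + d by linarith)]
    · rw [hF.pay_add e' ha hd (h e' ((mem_outEdges F).1 he') h0)]
      linarith
  have hsum : ∑ e' ∈ F.outEdges (F.src e), (F.pay e' (a + d) - F.pay e' a)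
      ≤ ∑ e' ∈ F.outEdges (F.src e), F.slopeAt e' a * d := by
    rw [Finset.sum_sub_distrib, ← Finset.sum_mul, hs, hF.no_fraud_nonneg _ ha hL,
      hF.no_fraud_nonneg _ (by linarith : 0 ≤ a + d) hL]
    split_ifs with h'
    · rw [min_eq_left h'.le]
      linarith [min_le_left (a + d) (F.outLiab (F.src e))]
    · rw [min_eq_right (not_lt.1 h')]
      linarith [min_le_right (a + d) (F.outLiab (F.src e))]
  have := (Finset.sum_eq_sum_iff_of_le hge).1 (le_antisymm (Finset.sum_le_sum hge) hsum) e
    ((mem_outEdges F).2 rfl)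
  linarith

theorem lawful : F.Lawful where
  pay_add_of_active := fun e _ _ => hF.pay_add_of_active e
  no_loops := hF.no_loops
  slope_nonneg := hF.slopeAt_nonneg
  pay_zero := hF.pay_zero
  pay_le := fun e _ => hF.pay_le_liab e
  pay_mono := fun e _ _ => hF.pay_mono' e
  pay_add := fun e _ _ => hF.pay_add e
  pay_eq := fun e _ => hF.pay_eq e
  pay_border := hF.pay_border
  slope_sum_le := fun w a ha => by rw [hF.slope_sum w ha]; split_ifs <;> norm_num
  slope_sum_eq := fun e a ha hs => by
    have h := hF.slope_sum (F.src e) ha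
    split_ifs at h with h'
    · exact h
    · have := (Finset.sum_eq_zero_iff_of_nonneg (fun e' _ => hF.slopeAt_nonneg e' a)).1 h e
        ((mem_outEdges F).2 rfl)
      linarith
  toBorder_ne_top := fun e a ha hs => by
    have h := hF.slope_sum (F.src e) ha
    rw [toBorder_eq (hF.border_zero e) (hF.border_le e) ha]
    split_ifs at h with h'
    · rw [if_pos]
      · exact WithTop.coe_ne_top
      · by_contra hc
        obtain ⟨h1, h2, h3⟩ := interval_spec (hF.border_zero e) (hF.border_le e) ha
        rw [show F.interval e a = F.numBorders e by omega, hF.border_last] at h2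
        linarith
    · have := (Finset.sum_eq_zero_iff_of_nonneg (fun e' _ => hF.slopeAt_nonneg e' a)).1 h e
        ((mem_outEdges F).2 rfl)
      linarith

end WellFormed

/-! ### Laws of the adjusted network -/

section Adjust
variable [Fintype V] {F : Network V E}

open Classical in
theorem outEdges_adjust_inl (w : V) :
    F.adjust.outEdges (.inl w) = (F.outEdges w).map ⟨Sum.inl, Sum.inl_injective⟩ := by
  ext e
  rw [mem_outEdges]
  rcases e with e | e | e <;> simp [adjust, mem_outEdges]

open Classical in
theorem outEdges_adjust_collect (u : F.DefBank) :
    F.adjust.outEdges (.inr (.inl u)) = {.inr (.inl u), .inr (.inr u)} := by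
  ext e
  rw [mem_outEdges]
  rcases e with e | e | e <;> simp [adjust]

theorem outEdges_adjust_sink (u : F.DefBank) : F.adjust.outEdges (.inr (.inr u)) = ∅ := by
  ext e
  rw [mem_outEdges]
  rcases e with e | e | e <;> simp [adjust]

/-- the rate at which the collecting bank pays on its two edges -/
noncomputable def auxRate (F : Network V E) : F.DefBank ⊕ F.DefBank → ℝ
  | .inl u => 1 - F.beta u.1
  | .inr u => F.beta u.1

/-- the bank that an auxiliary edge belongs to -/
def auxBank (F : Network V E) : F.DefBank ⊕ F.DefBank → F.DefBank
  | .inl u => u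
  | .inr u => u

theorem adjust_src_aux (x : F.DefBank ⊕ F.DefBank) :
    F.adjust.src (.inr x) = .inr (.inl (F.auxBank x)) := by
  rcases x with u | u <;> rfl

theorem adjust_pay_aux (x : F.DefBank ⊕ F.DefBank) (a : ℝ) :
    F.adjust.pay (.inr x) a =
      min 1 (a / F.outLiab (F.auxBank x).1) * (F.auxRate x * F.outLiab (F.auxBank x).1) := by
  rcases x with u | u <;> rfl

theorem adjust_liab_aux (x : F.DefBank ⊕ F.DefBank) :
    F.adjust.liab (.inr x) = F.auxRate x * F.outLiab (F.auxBank x).1 := by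
  rcases x with u | u <;> rfl

theorem adjust_border_aux (x : F.DefBank ⊕ F.DefBank) (i : ℕ) :
    F.adjust.border (.inr x) i = if i = 0 then 0 else F.outLiab (F.auxBank x).1 := by
  rcases x with u | u <;> rfl

theorem adjust_slope_aux (x : F.DefBank ⊕ F.DefBank) (i : ℕ) :
    F.adjust.slope (.inr x) i = if i = 0 then F.auxRate x else 0 := by
  rcases x with u | u <;> rfl

theorem adjust_numBorders_aux (x : F.DefBank ⊕ F.DefBank) :
    F.adjust.numBorders (.inr x) = 1 := by
  rcases x with u | u <;> rfl

theorem adjust_interval_aux (x : F.DefBank ⊕ F.DefBank) (a : ℝ) :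
    F.adjust.interval (.inr x) a = if F.outLiab (F.auxBank x).1 ≤ a then 1 else 0 := by
  unfold interval
  rw [adjust_numBorders_aux]
  simp only [Finset.Icc_self, Finset.filter_singleton, adjust_border_aux]
  split_ifs <;> simp_all

theorem adjust_slopeAt_aux (x : F.DefBank ⊕ F.DefBank) (a : ℝ) :
    F.adjust.slopeAt (.inr x) a = if F.outLiab (F.auxBank x).1 ≤ a then 0 else F.auxRate x := by
  unfold slopeAt
  rw [adjust_slope_aux, adjust_interval_aux]
  split_ifs <;> simp_all

theorem sum_slopeAt_collect (u : F.DefBank) (a : ℝ) :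
    ∑ e ∈ F.adjust.outEdges (.inr (.inl u)), F.adjust.slopeAt e a =
      if F.outLiab u.1 ≤ a then 0 else 1 := by
  classical
  rw [outEdges_adjust_collect, Finset.sum_pair (by simp), adjust_slopeAt_aux,
    adjust_slopeAt_aux]
  change (if F.outLiab u.1 ≤ a then 0 else 1 - F.beta u.1) +
    (if F.outLiab u.1 ≤ a then 0 else F.beta u.1) = _
  split_ifs <;> ring

namespace WellFormed
variable (hF : F.WellFormed)
include hF

theorem auxRate_nonneg (x : F.DefBank ⊕ F.DefBank) : 0 ≤ F.auxRate x := by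
  rcases x with u | u
  · have := (hF.beta_mem u.1).2
    simp only [auxRate]; linarith
  · exact (hF.beta_mem u.1).1

/-- The inner distinction matters only for negative `a` and zero liabilities, where the payment is
`0` because the liability is a factor. -/
theorem adjust_pay_aux_eq (x : F.DefBank ⊕ F.DefBank) (a : ℝ) :
    F.adjust.pay (.inr x) a = if F.outLiab (F.auxBank x).1 ≤ a
      then F.auxRate x * F.outLiab (F.auxBank x).1
      else F.auxRate x * (if F.outLiab (F.auxBank x).1 = 0 then 0 else a) := by
  rw [adjust_pay_aux]
  have hL := hF.outLiab_nonneg (F.auxBank x).1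
  rcases hL.eq_or_lt with h | h
  · rw [← h]; simp
  · rw [if_neg h.ne']
    split_ifs with h1
    · rw [min_eq_left ((one_le_div h).2 h1), one_mul]
    · rw [min_eq_right ((div_le_one h).2 (not_le.1 h1).le)]
      field_simp

theorem adjust_border_zero (e : F.AdjEdge) : F.adjust.border e 0 = 0 := by
  rcases e with e | x
  · exact hF.border_zero e
  · rw [adjust_border_aux, if_pos rfl]

theorem adjust_border_le (e : F.AdjEdge) (i : ℕ) (hi : i < F.adjust.numBorders e) :
    F.adjust.border e i ≤ F.adjust.border e (i + 1) := by
  rcases e with e | x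
  · exact hF.border_le e i hi
  · rw [adjust_numBorders_aux] at hi
    have : i = 0 := by omega
    subst this
    simp [adjust_border_aux, hF.outLiab_nonneg]

/-- `WellFormed` can fail for the adjusted network, since a bank of `D` without liabilities yields
auxiliary edges whose two borders coincide. `Lawful` isolates the laws that survive. -/
theorem adjust_lawful : F.adjust.Lawful where
  no_loops := by
    rintro (e | u | u)
    · have := hF.no_loops e
      simp only [adjust]
      split_ifs <;> simp_all
    · simp [adjust]
    · simp [adjust]
  slope_nonneg := by
    rintro (e | x) a
    · exact hF.slopeAt_nonneg e a
    · rw [adjust_slopeAt_aux]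
      split_ifs
      · exact le_rfl
      · exact hF.auxRate_nonneg x
  pay_zero := by
    rintro (e | x)
    · exact hF.pay_zero e
    · rw [adjust_pay_aux]; simp
  pay_le := by
    rintro (e | x) a ha
    · exact hF.pay_le_liab e ha
    · rw [hF.adjust_pay_aux_eq, adjust_liab_aux]
      have := hF.auxRate_nonneg x
      have := hF.outLiab_nonneg (F.auxBank x).1
      split_ifs with h1 h2
      · exact le_rfl
      · simp [h2]
      · exact mul_le_mul_of_nonneg_left (not_le.1 h1).le (hF.auxRate_nonneg x)
  pay_mono := by
    rintro (e | x) a a' ha h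
    · exact hF.pay_mono' e ha h
    · rw [adjust_pay_aux, adjust_pay_aux]
      have h1 := hF.auxRate_nonneg x
      have h2 := hF.outLiab_nonneg (F.auxBank x).1
      gcongr
  pay_add_of_active := by
    rintro (e | x) a d ha hd hdb
    · exact hF.pay_add_of_active e ha hd fun e' he' => hdb (.inl e') (congrArg Sum.inl he')
    · have hL := hF.outLiab_nonneg (F.auxBank x).1
      rw [hF.adjust_pay_aux_eq, hF.adjust_pay_aux_eq, adjust_slopeAt_aux]
      by_cases h1 : F.outLiab (F.auxBank x).1 ≤ a
      · rw [if_pos (by linarith), if_pos h1, if_pos h1]; ring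
      · rw [if_neg h1, if_neg h1]
        -- An edge of rate `0` is never active, so the hypothesis gives no bound on `d` for it; but
        -- then it pays nothing anyway.
        rcases (hF.auxRate_nonneg x).eq_or_lt with h4 | h4
        · rw [← h4]; simp
        · have hdb := hdb (.inr x) rfl (by rw [adjust_slopeAt_aux, if_neg h1]; exact h4)
          rw [toBorder_eq (hF.adjust_border_zero _) (hF.adjust_border_le _) ha] at hdb
          rw [adjust_interval_aux, adjust_numBorders_aux] at hdb
          rw [if_neg h1, if_pos Nat.one_pos, adjust_border_aux, if_neg (by omega)] at hdb
          have hdb' : d ≤ F.outLiab (F.auxBank x).1 - a := by exact_mod_cast hdb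
          have h3 : F.outLiab (F.auxBank x).1 ≠ 0 := by intro h; linarith
          rw [if_neg h3]
          split_ifs with h2
          · rw [show F.outLiab (F.auxBank x).1 = a + d by linarith]; ring
          · ring
  pay_add := by
    rintro (e | x) a d ha hd hdb
    · exact hF.pay_add e ha hd hdb
    · rw [toBorder_eq (hF.adjust_border_zero _) (hF.adjust_border_le _) ha] at hdb
      rw [adjust_interval_aux, adjust_numBorders_aux] at hdb
      rw [hF.adjust_pay_aux_eq, hF.adjust_pay_aux_eq, adjust_slopeAt_aux]
      have hL := hF.outLiab_nonneg (F.auxBank x).1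
      by_cases h1 : F.outLiab (F.auxBank x).1 ≤ a
      · rw [if_pos (by linarith), if_pos h1, if_pos h1]; ring
      · rw [if_neg h1, if_pos Nat.one_pos, adjust_border_aux, if_neg (by omega)] at hdb
        have hdb' : d ≤ F.outLiab (F.auxBank x).1 - a := by exact_mod_cast hdb
        have h3 : F.outLiab (F.auxBank x).1 ≠ 0 := by intro h; linarith
        rw [if_neg h1, if_neg h1, if_neg h3, if_neg h3]
        split_ifs with h2
        · rw [show F.outLiab (F.auxBank x).1 = a + d by linarith]; ring
        · ring
  pay_eq := by
    rintro (e | x) a ha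
    · exact hF.pay_eq e ha
    · rw [adjust_interval_aux, adjust_slopeAt_aux]
      rw [hF.adjust_pay_aux_eq, hF.adjust_pay_aux_eq, adjust_border_aux]
      have hL := hF.outLiab_nonneg (F.auxBank x).1
      by_cases h1 : F.outLiab (F.auxBank x).1 ≤ a
      · simp [h1]
      · have h2 : F.outLiab (F.auxBank x).1 ≠ 0 := by intro h; linarith
        have h3 : ¬ F.outLiab (F.auxBank x).1 ≤ 0 := by
          intro h; exact h2 (le_antisymm h hL)
        simp [h1, h2, h3]
  pay_border := by
    rintro (e | x) i hi
    · exact hF.pay_border e i hi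
    · rw [adjust_numBorders_aux] at hi
      have : i = 0 := by omega
      subst this
      simp only [hF.adjust_pay_aux_eq, adjust_border_aux, adjust_slope_aux]
      by_cases h2 : F.outLiab (F.auxBank x).1 = 0
      · simp [h2]
      · have hL := hF.outLiab_nonneg (F.auxBank x).1
        have h3 : ¬ F.outLiab (F.auxBank x).1 ≤ 0 := by
          intro h; exact h2 (le_antisymm h hL)
        simp [h2, h3]
  slope_sum_le := by
    rintro (w | u | u) a ha
    · rw [outEdges_adjust_inl, Finset.sum_map]
      exact hF.lawful.slope_sum_le w a ha
    · rw [sum_slopeAt_collect]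
      split_ifs <;> norm_num
    · rw [outEdges_adjust_sink]; simp
  slope_sum_eq := by
    rintro (e | x) a ha h
    · have := hF.lawful.slope_sum_eq e a ha h
      rw [show F.adjust.src (.inl e) = .inl (F.src e) from rfl, outEdges_adjust_inl,
        Finset.sum_map]
      exact this
    · rw [adjust_slopeAt_aux] at h
      rw [adjust_src_aux, sum_slopeAt_collect]
      split_ifs at h with h1
      · exact absurd h (lt_irrefl _)
      · rw [if_neg h1]
  toBorder_ne_top := by
    rintro (e | x) a ha h
    · exact hF.lawful.toBorder_ne_top e a ha h
    · rw [adjust_slopeAt_aux] at h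
      split_ifs at h with h1
      · exact absurd h (lt_irrefl _)
      · rw [toBorder_eq (hF.adjust_border_zero _) (hF.adjust_border_le _) ha,
          adjust_interval_aux, adjust_numBorders_aux, if_neg h1, if_pos Nat.one_pos]
        exact WithTop.coe_ne_top

end WellFormed
end Adjust
end Network
end Clearing

/-! ### Non-negative matrices without sub-invariant vectors, and elimination of variables. -/

namespace Clearing

/-! ### Transient matrices -/

section Transient
variable {ι : Type*} [Fintype ι]

/-- A non-negative matrix without a non-zero sub-invariant vector. -/
def Transient (K : ι → ι → ℝ) : Prop :=
  (∀ i j, 0 ≤ K i j) ∧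
    ∀ z : ι → ℝ, (∀ i, 0 ≤ z i) → (∀ i, z i ≤ ∑ j, K i j * z j) → ∀ i, z i = 0

/-- Summing all rows gives `∑ z ≤ ∑ (column sum) * z ≤ ∑ z`, so every inequality used is an
equality. -/
theorem eq_of_le_of_colSum_le {K : ι → ι → ℝ} (hs : ∀ j, ∑ i, K i j ≤ 1)
    {z : ι → ℝ} (hz : ∀ i, 0 ≤ z i) (h : ∀ i, z i ≤ ∑ j, K i j * z j) :
    (∀ i, z i = ∑ j, K i j * z j) ∧ ∀ j, (∑ i, K i j) * z j = z j := by
  have h1 : ∑ i, ∑ j, K i j * z j = ∑ j, (∑ i, K i j) * z j := by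
    rw [Finset.sum_comm]
    exact Finset.sum_congr rfl fun j _ => (Finset.sum_mul _ _ _).symm
  have h2 : ∀ j ∈ Finset.univ, (∑ i, K i j) * z j ≤ z j := fun j _ =>
    mul_le_of_le_one_left (hz j) (hs j)
  have h3 := Finset.sum_le_sum h2
  have h4 := Finset.sum_le_sum fun i (_ : i ∈ Finset.univ) => h i
  rw [h1] at h4
  have h5 := (Finset.sum_eq_sum_iff_of_le h2).1 (le_antisymm h3 h4)
  have h6 := (Finset.sum_eq_sum_iff_of_le fun i (_ : i ∈ Finset.univ) => h i).1
    (by rw [h1]; exact le_antisymm h4 h3)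
  exact ⟨fun i => h6 i (Finset.mem_univ i), fun j => h5 j (Finset.mem_univ j)⟩

/-- The support of a non-zero sub-invariant vector is closed under the positive entries, and by the
equality case all of its columns sum to `1`. -/
theorem transient_of_colSum_le {K : ι → ι → ℝ} (hK : ∀ i j, 0 ≤ K i j)
    (hs : ∀ j, ∑ i, K i j ≤ 1)
    (h : ∀ S : Set ι, S.Nonempty → (∀ j ∈ S, ∀ i, 0 < K i j → i ∈ S) →
      (∀ j ∈ S, ∑ i, K i j = 1) → False) : Transient K := by
  refine ⟨hK, fun z hz hle => ?_⟩
  obtain ⟨h1, h2⟩ := eq_of_le_of_colSum_le hs hz hle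
  by_contra hne
  push Not at hne
  obtain ⟨i, hi⟩ := hne
  refine h {j | 0 < z j} ⟨i, (hz i).lt_of_ne' hi⟩ ?_ ?_
  · intro j hj k hk
    rw [Set.mem_ofPred_eq, h1 k]
    exact (mul_pos hk hj).trans_le (Finset.single_le_sum (f := fun j => K k j * z j)
      (fun l _ => mul_nonneg (hK k l) (hz l)) (Finset.mem_univ j))
  · intro j hj
    exact mul_right_cancel₀ (ne_of_gt hj) ((h2 j).trans (one_mul _).symm)

namespace Transient
variable {K : ι → ι → ℝ} (hK : Transient K)
include hK

/-- The vector `|z|` is sub-invariant. -/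
theorem eq_zero_of_fixed {z : ι → ℝ} (h : ∀ i, z i = ∑ j, K i j * z j) (i : ι) : z i = 0 := by
  have := hK.2 (fun i => |z i|) (fun i => abs_nonneg _) (fun i => by
    calc |z i| = |∑ j, K i j * z j| := by rw [← h i]
      _ ≤ ∑ j, |K i j * z j| := Finset.abs_sum_le_sum_abs _ _
      _ = _ := Finset.sum_congr rfl fun j _ => by rw [abs_mul, abs_of_nonneg (hK.1 i j)]) i
  exact abs_eq_zero.1 this

theorem solution_unique {q d d' : ι → ℝ} (h : ∀ i, d i = q i + ∑ j, K i j * d j)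
    (h' : ∀ i, d' i = q i + ∑ j, K i j * d' j) : d = d' := by
  funext i
  have := hK.eq_zero_of_fixed (z := fun i => d i - d' i) (fun i => by
    simp only [mul_sub, Finset.sum_sub_distrib]
    rw [h i, h' i]; ring_nf) i
  linarith

/-- The negative part of `d` is sub-invariant, hence zero. -/
theorem solution_nonneg {q d : ι → ℝ} (hq : ∀ i, 0 ≤ q i)
    (h : ∀ i, d i = q i + ∑ j, K i j * d j) (i : ι) : 0 ≤ d i := by
  have key : ∀ i, max (-d i) 0 ≤ ∑ j, K i j * max (-d j) 0 := by
    intro i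
    apply max_le
    · rw [h i]
      have : -∑ j, K i j * d j ≤ ∑ j, K i j * max (-d j) 0 := by
        rw [← Finset.sum_neg_distrib]
        refine Finset.sum_le_sum fun j _ => ?_
        rw [← mul_neg]
        exact mul_le_mul_of_nonneg_left (le_max_left _ _) (hK.1 i j)
      linarith [hq i]
    · exact Finset.sum_nonneg fun j _ => mul_nonneg (hK.1 i j) (le_max_right _ _)
  have := hK.2 _ (fun i => le_max_right (-d i) 0) key i
  have := le_max_left (-d i) 0
  linarith

/-- `1 - K` is injective by `eq_zero_of_fixed`, hence surjective in finite dimension. -/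
theorem exists_solution (q : ι → ℝ) : ∃ d : ι → ℝ, ∀ i, d i = q i + ∑ j, K i j * d j := by
  let L : (ι → ℝ) →ₗ[ℝ] (ι → ℝ) :=
    { toFun := fun d i => d i - ∑ j, K i j * d j
      map_add' := fun x y => by
        funext i; simp only [Pi.add_apply, mul_add, Finset.sum_add_distrib]; ring
      map_smul' := fun c x => by
        funext i
        simp only [Pi.smul_apply, smul_eq_mul, RingHom.id_apply, mul_sub, Finset.mul_sum]
        congr 1
        exact Finset.sum_congr rfl fun j _ => by ring }
  have hinj : Function.Injective L := by
    rw [← LinearMap.ker_eq_bot, LinearMap.ker_eq_bot']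
    intro m hm
    funext i
    refine hK.eq_zero_of_fixed (fun i => ?_) i
    have : m i - ∑ j, K i j * m j = 0 := congrFun hm i
    linarith
  obtain ⟨d, hd⟩ := LinearMap.injective_iff_surjective.1 hinj q
  refine ⟨d, fun i => ?_⟩
  have : d i - ∑ j, K i j * d j = q i := congrFun hd i
  linarith

/-- Otherwise the indicator of `k` would be sub-invariant. This is why no pivot of the elimination
vanishes. -/
theorem diag_lt_one [DecidableEq ι] (k : ι) : K k k < 1 := by
  by_contra hc
  have := hK.2 (fun i => if i = k then 1 else 0) (fun i => by split_ifs <;> norm_num) (fun i => by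
    simp only [mul_ite, mul_one, mul_zero, Finset.sum_ite_eq', Finset.mem_univ, if_true]
    split_ifs with h
    · subst h; linarith
    · exact hK.1 i k) k
  simp at this

end Transient

/-- row `k` of the matrix after the elimination of the variable `k` -/
noncomputable def pivotRow [DecidableEq ι] (K : ι → ι → ℝ) (k j : ι) : ℝ :=
  if j = k then 0 else K k j / (1 - K k k)

/-- the matrix after the elimination of the variable `k` from `d = q + K d` -/
noncomputable def eliminate [DecidableEq ι] (K : ι → ι → ℝ) (k i j : ι) : ℝ :=
  if i = k then pivotRow K k j else (if j = k then 0 else K i j) + K i k * pivotRow K k j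

/-- the right-hand side after the elimination of the variable `k` from `d = q + K d` -/
noncomputable def eliminateRhs [DecidableEq ι] (K : ι → ι → ℝ) (q : ι → ℝ) (k i : ι) : ℝ :=
  if i = k then q k / (1 - K k k) else q i + K i k * (q k / (1 - K k k))

section Eliminate
variable [DecidableEq ι] {K : ι → ι → ℝ}

omit [Fintype ι] in
theorem eliminate_self_column (k i : ι) : eliminate K k i k = 0 := by
  simp [eliminate, pivotRow]

omit [Fintype ι] in
-- Columns cleared in earlier rounds stay cleared. After all rounds the matrix is zero and the
-- right-hand side is the solution.
theorem eliminate_zero_column {k l : ι} (h : ∀ i, K i l = 0) (i : ι) : eliminate K k i l = 0 := by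
  simp [eliminate, pivotRow, h]

theorem sum_pivotRow (k : ι) (z : ι → ℝ) :
    (1 - K k k) * ∑ j, pivotRow K k j * z j = if 1 - K k k = 0 then 0
      else ∑ j, K k j * z j - K k k * z k := by
  split_ifs with h
  · rw [h, zero_mul]
  · rw [Finset.mul_sum, ← Finset.add_sum_erase _ _ (Finset.mem_univ k),
      ← Finset.add_sum_erase (a := k) _ (fun j => K k j * z j) (Finset.mem_univ k)]
    simp only [pivotRow, if_true, zero_mul, mul_zero, zero_add, add_sub_cancel_left]
    refine Finset.sum_congr rfl fun j hj => ?_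
    rw [if_neg (Finset.ne_of_mem_erase hj)]
    field_simp

theorem sum_eliminate (k i : ι) (hik : i ≠ k) (z : ι → ℝ) :
    ∑ j, eliminate K k i j * z j =
      ∑ j, K i j * z j - K i k * z k + K i k * ∑ j, pivotRow K k j * z j := by
  simp only [eliminate, if_neg hik, add_mul, Finset.sum_add_distrib]
  congr 1
  · rw [← Finset.add_sum_erase _ _ (Finset.mem_univ k),
      ← Finset.add_sum_erase (a := k) _ (fun j => K i j * z j) (Finset.mem_univ k)]
    simp only [if_true, zero_mul, zero_add, add_sub_cancel_left]
    refine Finset.sum_congr rfl fun j hj => ?_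
    rw [if_neg (Finset.ne_of_mem_erase hj)]
  · rw [Finset.mul_sum]
    exact Finset.sum_congr rfl fun j _ => by ring

theorem Transient.eliminate_solution (hK : Transient K) {q d : ι → ℝ} (k : ι)
    (h : ∀ i, d i = q i + ∑ j, K i j * d j) (i : ι) :
    d i = eliminateRhs K q k i + ∑ j, eliminate K k i j * d j := by
  have hk : 1 - K k k ≠ 0 := by linarith [hK.diag_lt_one k]
  have h1 := sum_pivotRow (K := K) k d
  rw [if_neg hk] at h1
  have hdk : d k = q k / (1 - K k k) + ∑ j, pivotRow K k j * d j := by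
    have : (1 - K k k) * d k = (1 - K k k) * (q k / (1 - K k k) + ∑ j, pivotRow K k j * d j) := by
      rw [mul_add, h1, mul_div_cancel₀ _ hk]
      linarith [h k]
    exact mul_left_cancel₀ hk this
  by_cases hik : i = k
  · subst hik
    simp only [eliminateRhs, eliminate, if_true]
    exact hdk
  · rw [sum_eliminate k i hik, eliminateRhs, if_neg hik]
    have h2 : K i k * d k = K i k * (q k / (1 - K k k)) + K i k * ∑ j, pivotRow K k j * d j := by
      rw [← mul_add, ← hdk]
    linarith [h i]

/-- A vector `z` that is sub-invariant after the elimination becomes sub-invariant for `K` itself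
when its entry at `k` is raised to the value `r` given by the pivot row. The raised vector is zero,
and it dominates `z`. -/
theorem Transient.eliminate (hK : Transient K) (k : ι) : Transient (eliminate K k) := by
  have hk := hK.diag_lt_one k
  have hk' : 1 - K k k ≠ 0 := by linarith
  have hrow : ∀ j, 0 ≤ pivotRow K k j := fun j => by
    unfold pivotRow
    split_ifs
    · exact le_rfl
    · exact div_nonneg (hK.1 k j) (by linarith)
  have hnn : ∀ i j, 0 ≤ Clearing.eliminate K k i j := fun i j => by
    unfold Clearing.eliminate
    have := mul_nonneg (hK.1 i k) (hrow j)
    split_ifs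
    · exact hrow j
    · linarith
    · linarith [hK.1 i j]
  refine ⟨hnn, fun z hz h => ?_⟩
  set r := ∑ j, pivotRow K k j * z j with hr
  have hzk : z k ≤ r := by simpa [Clearing.eliminate] using h k
  set z' : ι → ℝ := Function.update z k r with hz'
  have hle : ∀ i, z i ≤ z' i := fun i => by
    by_cases hi : i = k
    · subst hi; simpa [hz'] using hzk
    · simp [hz', hi]
  -- The pivot row has entry `0` at `k`, so raising the entry at `k` does not change `r`.
  have hr' : ∑ j, pivotRow K k j * z' j = r := by
    refine Finset.sum_congr rfl fun j _ => ?_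
    by_cases hj : j = k
    · subst hj; simp [pivotRow]
    · simp [hz', hj]
  have hsum : ∀ i, ∑ j, K i j * z' j - K i k * z' k = ∑ j, K i j * z j - K i k * z k := fun i => by
    rw [← Finset.add_sum_erase _ _ (Finset.mem_univ k),
      ← Finset.add_sum_erase (a := k) _ (fun j => K i j * z j) (Finset.mem_univ k),
      add_sub_cancel_left, add_sub_cancel_left]
    refine Finset.sum_congr rfl fun j hj => ?_
    simp [hz', Finset.ne_of_mem_erase hj]
  have hz'k : z' k = r := by simp [hz']
  have key := hK.2 z' (fun i => (hz i).trans (hle i)) (fun i => by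
    by_cases hi : i = k
    · subst hi
      have := sum_pivotRow (K := K) i z'
      rw [if_neg hk', hr'] at this
      rw [hz'k] at this ⊢
      linarith
    · have h1 := h i
      rw [sum_eliminate k i hi] at h1
      have h2 := hsum i
      rw [hz'k] at h2
      have h3 : z' i = z i := by simp [hz', hi]
      rw [h3]
      linarith)
  intro i
  exact le_antisymm ((hle i).trans (key i).le) (hz i)

end Eliminate
end Transient
end Clearing

/-! ### The flow matrix of the active graph, the two linear programs, and comparison with
supersolutions. -/

namespace Clearing
namespace Network
universe u v
set_option linter.unusedSectionVars false
variable {V : Type u} {E : Type v} [Fintype V] [Fintype E]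

/-! ### The flow matrix of the active graph -/

section Flow
variable {G : Network V E} {live : Finset E} {b : V → ℝ}

open Classical in
/-- the rate at which `i` receives payments of `j` on active edges -/
noncomputable def flow (G : Network V E) (live : Finset E) (b : V → ℝ) (i j : V) : ℝ :=
  ∑ e ∈ (G.activeEdges live b).filter (fun e => G.tgt e = i ∧ G.src e = j),
    G.slopeAt e (b (G.src e))

/-- All edges out of a bank are removed at the same time. -/
def OutClosed (G : Network V E) (live : Finset E) : Prop :=
  ∀ e e', G.src e = G.src e' → e ∈ live → e' ∈ live

theorem mem_activeEdges {e : E} :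
    e ∈ G.activeEdges live b ↔ e ∈ live ∧ 0 < G.slopeAt e (b (G.src e)) := by
  simp [activeEdges]

theorem adj_of_mem {e : E} (he : e ∈ G.activeEdges live b) :
    G.Adj live b (G.src e) (G.tgt e) := ⟨e, he, rfl, rfl⟩

open Classical in
theorem sum_flow (P : V → Prop) (d : V → ℝ) (w : V) :
    ∑ j, (if P j then G.flow live b w j else 0) * d j =
      ∑ e ∈ (G.activeEdges live b).filter (fun e => G.tgt e = w ∧ P (G.src e)),
        G.slopeAt e (b (G.src e)) * d (G.src e) := by
  rw [← Finset.sum_fiberwise (s := (G.activeEdges live b).filter _) (g := G.src)]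
  refine Finset.sum_congr rfl fun j _ => ?_
  rw [Finset.filter_filter]
  by_cases hj : P j
  · rw [if_pos hj, flow, Finset.sum_mul]
    refine Finset.sum_congr ?_ ?_
    · ext e
      simp only [Finset.mem_filter]
      constructor
      · rintro ⟨h1, h2, h3⟩; subst h3; exact ⟨h1, ⟨h2, hj⟩, rfl⟩
      · rintro ⟨h1, ⟨h2, _⟩, h3⟩; exact ⟨h1, h2, h3⟩
    · intro e he
      rw [(Finset.mem_filter.1 he).2.2]
  · rw [if_neg hj, zero_mul, Finset.sum_eq_zero]
    intro e he
    obtain ⟨_, ⟨_, h1⟩, h2⟩ := Finset.mem_filter.1 he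
    rw [h2] at h1
    exact absurd h1 hj

theorem flow_nonneg (hG : ∀ e a, 0 ≤ G.slopeAt e a) (i j : V) : 0 ≤ G.flow live b i j :=
  Finset.sum_nonneg fun e _ => hG e _

theorem flow_pos_iff {i j : V} : 0 < G.flow live b i j ↔ G.Adj live b j i := by
  classical
  unfold flow
  constructor
  · intro h
    by_contra hc
    rw [Finset.sum_eq_zero] at h
    · exact lt_irrefl _ h
    · intro e he
      obtain ⟨h1, h2, h3⟩ := Finset.mem_filter.1 he
      exact absurd ⟨e, h1, h3, h2⟩ hc
  · rintro ⟨e, he, h1, h2⟩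
    refine Finset.sum_pos (fun e he => ?_)
      (Finset.nonempty_of_ne_empty (Finset.ne_empty_of_mem (a := e) ?_))
    · exact (mem_activeEdges.1 (Finset.mem_filter.1 he).1).2
    · exact Finset.mem_filter.2 ⟨he, h2, h1⟩

open Classical in
theorem sum_flow_column (j : V) : ∑ i, G.flow live b i j =
    ∑ e ∈ (G.activeEdges live b).filter (fun e => G.src e = j), G.slopeAt e (b (G.src e)) := by
  rw [← Finset.sum_fiberwise (s := (G.activeEdges live b).filter _) (g := G.tgt)]
  refine Finset.sum_congr rfl fun i _ => ?_
  rw [Finset.filter_filter, flow]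
  refine Finset.sum_congr ?_ fun _ _ => rfl
  ext e
  simp only [Finset.mem_filter, and_comm]

namespace Lawful
variable (hG : G.Lawful) (hb : ∀ w, 0 ≤ b w)
include hG hb

theorem flow_column_le (j : V) : ∑ i, G.flow live b i j ≤ 1 := by
  classical
  rw [sum_flow_column]
  refine le_trans ?_ (hG.slope_sum_le j (b j) (hb j))
  calc _ = ∑ e ∈ (G.activeEdges live b).filter (fun e => G.src e = j), G.slopeAt e (b j) :=
        Finset.sum_congr rfl fun e he => by rw [(Finset.mem_filter.1 he).2]
    _ ≤ _ := Finset.sum_le_sum_of_subset_of_nonneg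
        (fun e he => (mem_outEdges G).2 (Finset.mem_filter.1 he).2)
        (fun e _ _ => hG.slope_nonneg e _)

/-- The slopes of all out-edges of `j` sum to `1`. As edges of a bank are removed only together, one
active out-edge of `j` shows that all its out-edges of positive slope remain. -/
theorem flow_column_eq (hl : G.OutClosed live) {i j : V} (h : G.Adj live b j i) :
    ∑ i, G.flow live b i j = 1 := by
  classical
  obtain ⟨e, he, rfl, rfl⟩ := h
  obtain ⟨h1, h2⟩ := mem_activeEdges.1 he
  rw [sum_flow_column, ← hG.slope_sum_eq e _ (hb _) h2]
  calc _ = ∑ e' ∈ (G.activeEdges live b).filter (fun e' => G.src e' = G.src e),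
          G.slopeAt e' (b (G.src e)) :=
        Finset.sum_congr rfl fun e he => by rw [(Finset.mem_filter.1 he).2]
    _ = _ := Finset.sum_subset
        (fun e he => (mem_outEdges G).2 (Finset.mem_filter.1 he).2)
        (fun e' he' hn => by
          have h3 := (mem_outEdges G).1 he'
          by_contra hne
          refine hn (Finset.mem_filter.2 ⟨mem_activeEdges.2 ⟨hl e e' h3.symm h1, ?_⟩, h3⟩)
          rw [h3]
          exact (hG.slope_nonneg e' _).lt_of_ne' hne)

end Lawful

/-- A closed set of banks all of which have active out-edges contains a non-singleton sink
component. -/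
theorem exists_sink_component (hn : ∀ e, G.src e ≠ G.tgt e) {S : Set V} (hS : S.Nonempty)
    (hc : ∀ j ∈ S, ∀ i, G.Adj live b j i → i ∈ S) (ho : ∀ j ∈ S, ∃ i, G.Adj live b j i) :
    ∃ c ∈ S, G.Floods live b c {w | G.Reach live b c w} := by
  classical
  have hreach : ∀ j ∈ S, ∀ i, G.Reach live b j i → i ∈ S := by
    intro j hj i h
    induction h with
    | refl => exact hj
    | tail _ h ih => exact hc _ ih _ h
  -- Among the banks of `S`, take one that reaches as few banks as possible. Each bank reachable
  -- from it then reaches the same set, in particular `c` itself.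
  obtain ⟨c, hcS, hmin⟩ := Set.exists_min_image S
    (fun c => (Finset.univ.filter fun w => G.Reach live b c w).card) S.toFinite hS
  have hback : ∀ w, G.Reach live b c w → G.Reach live b w c := by
    intro w hw
    have h1 := hmin w (hreach c hcS w hw)
    have h2 : (Finset.univ.filter fun x => G.Reach live b w x) ⊆
        Finset.univ.filter fun x => G.Reach live b c x := by
      intro x hx
      simp only [Finset.mem_filter, Finset.mem_univ, true_and] at hx ⊢
      exact hw.trans hx
    have h3 := Finset.eq_of_subset_of_card_le h2 h1
    have h4 : c ∈ Finset.univ.filter fun x => G.Reach live b w x := by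
      rw [h3]; simp only [Finset.mem_filter, Finset.mem_univ, true_and]; exact Relation.ReflTransGen.refl
    simpa using h4
  refine ⟨c, hcS, ⟨c, ?_⟩, ?_, ?_, c, Relation.ReflTransGen.refl, Relation.ReflTransGen.refl⟩
  · ext w
    exact ⟨fun h => ⟨h, hback w h⟩, fun h => h.1⟩
  · obtain ⟨i, hi⟩ := ho c hcS
    refine ⟨c, Relation.ReflTransGen.refl, i, Relation.ReflTransGen.single hi, ?_⟩
    obtain ⟨e, _, rfl, rfl⟩ := hi
    exact hn e
  · intro w hw w' h
    exact Relation.ReflTransGen.tail hw h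

theorem IsSCC.eq_of_mem {C : Set V} (hC : G.IsSCC live b C) {c : V} (hc : c ∈ C) :
    C = {w | G.Reach live b c w ∧ G.Reach live b w c} := by
  obtain ⟨c', rfl⟩ := hC
  ext w
  exact ⟨fun h => ⟨hc.2.trans h.1, h.2.trans hc.1⟩, fun h => ⟨hc.1.trans h.1, h.2.trans hc.2⟩⟩

theorem IsSCC.nonempty {C : Set V} (hC : G.IsSCC live b C) : C.Nonempty := by
  obtain ⟨c', rfl⟩ := hC
  exact ⟨c', Relation.ReflTransGen.refl, Relation.ReflTransGen.refl⟩

theorem Floods.exists_adj {v : V} {C : Set V} (hC : G.Floods live b v C) {c : V} (hc : c ∈ C) :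
    ∃ i, G.Adj live b c i := by
  obtain ⟨c', hc', hne⟩ := hC.2.1.exists_ne c
  have h1 := (hC.1.eq_of_mem hc).subset hc'
  rcases Relation.ReflTransGen.cases_head h1.1 with h | ⟨i, hi, _⟩
  · exact absurd h.symm hne
  · exact ⟨i, hi⟩

open Classical in
/-- the flow matrix with columns restricted to `P` and the rows in `Z` deleted -/
noncomputable def kernel (G : Network V E) (live : Finset E) (b : V → ℝ) (P Z : V → Prop)
    (i j : V) : ℝ := if P j ∧ ¬ Z i then G.flow live b i j else 0

theorem kernel_nonneg (hG : ∀ e a, 0 ≤ G.slopeAt e a) (P Z : V → Prop) (i j : V) :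
    0 ≤ G.kernel live b P Z i j := by
  unfold kernel
  split_ifs
  · exact flow_nonneg hG i j
  · exact le_rfl

theorem kernel_le_flow (hG : ∀ e a, 0 ≤ G.slopeAt e a) (P Z : V → Prop) (i j : V) :
    G.kernel live b P Z i j ≤ G.flow live b i j := by
  unfold kernel
  split_ifs
  · exact le_rfl
  · exact flow_nonneg hG i j

open Classical in
theorem sum_kernel {P Z : V → Prop} {i : V} (hi : ¬ Z i) (d : V → ℝ) :
    ∑ j, G.kernel live b P Z i j * d j =
      ∑ e ∈ (G.activeEdges live b).filter (fun e => G.tgt e = i ∧ P (G.src e)),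
        G.slopeAt e (b (G.src e)) * d (G.src e) := by
  rw [← sum_flow]
  refine Finset.sum_congr rfl fun j _ => ?_
  simp [kernel, hi]

namespace Lawful
variable (hG : G.Lawful) (hb : ∀ w, 0 ≤ b w)
include hG hb

theorem kernel_column_le (P Z : V → Prop) (j : V) : ∑ i, G.kernel live b P Z i j ≤ 1 :=
  (Finset.sum_le_sum fun i _ => kernel_le_flow hG.slope_nonneg P Z i j).trans
    (hG.flow_column_le hb j)

omit hG hb in
theorem adj_of_kernel_column_ne {P Z : V → Prop} {j : V} (h : ∑ i, G.kernel live b P Z i j ≠ 0)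
    (hs : ∀ e a, 0 ≤ G.slopeAt e a) : ∃ i, P j ∧ ¬ Z i ∧ G.Adj live b j i := by
  obtain ⟨i, _, hi⟩ := Finset.exists_ne_zero_of_sum_ne_zero h
  unfold kernel at hi
  split_ifs at hi with h1
  · exact ⟨i, h1.1, h1.2, flow_pos_iff.1 ((flow_nonneg hs i j).lt_of_ne' hi)⟩
  · exact absurd rfl hi

/-- Without a component to flood, the graph reachable from `v` is transient. -/
theorem transient_reach {v : V} (hv : ∀ C, ¬ G.Floods live b v C) :
    Transient (G.kernel live b (G.Reach live b v) (fun _ => False)) := by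
  refine transient_of_colSum_le (kernel_nonneg hG.slope_nonneg _ _)
    (hG.kernel_column_le hb _ _) fun S hS hcl h1 => ?_
  have key : ∀ j ∈ S, ∃ i, G.Reach live b v j ∧ G.Adj live b j i := fun j hj => by
    obtain ⟨i, h2, _, h3⟩ := adj_of_kernel_column_ne (by rw [h1 j hj]; norm_num) hG.slope_nonneg
    exact ⟨i, h2, h3⟩
  -- A closed set of full columns would contain a sink component, and all its banks are reachable
  -- from `v`, so this component could be flooded.
  obtain ⟨c, hc, hf⟩ := exists_sink_component hG.no_loops hS (fun j hj i hji => by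
    obtain ⟨_, h2, _⟩ := key j hj
    refine hcl j hj i ?_
    rw [kernel, if_pos ⟨h2, not_false⟩]
    exact flow_pos_iff.2 hji) (fun j hj => ⟨_, (key j hj).choose_spec.2⟩)
  exact hv _ ⟨hf.1, hf.2.1, hf.2.2.1, c, Relation.ReflTransGen.refl, (key c hc).choose_spec.1⟩

/-- A component that can be flooded becomes transient when the edges into one of its banks are
deleted. -/
theorem transient_component {v : V} {C : Set V} (hC : G.Floods live b v C) {c : V} (hc : c ∈ C) :
    Transient (G.kernel live b (· ∈ C) (· = c)) := by
  refine transient_of_colSum_le (kernel_nonneg hG.slope_nonneg _ _)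
    (hG.kernel_column_le hb _ _) fun S hS hcl h1 => ?_
  have hSC : ∀ j ∈ S, j ∈ C := fun j hj => by
    obtain ⟨i, h2, _⟩ := adj_of_kernel_column_ne (by rw [h1 j hj]; norm_num) hG.slope_nonneg
    exact h2
  -- An active edge into `c` lies in the deleted row, so the remaining column of its debtor would
  -- sum to less than `1`.
  have hnc : ∀ j ∈ S, ¬ G.Adj live b j c := fun j hj hadj => by
    have h2 := hG.flow_column_le (live := live) hb j
    have h3 : ∑ i, G.kernel live b (· ∈ C) (· = c) i j < ∑ i, G.flow live b i j :=
      Finset.sum_lt_sum (fun i _ => kernel_le_flow hG.slope_nonneg _ _ i j)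
        ⟨c, Finset.mem_univ c, by
          rw [kernel, if_neg (by simp)]
          exact flow_pos_iff.2 hadj⟩
    linarith [h1 j hj]
  obtain ⟨s, hs⟩ := hS
  -- Walking from `s` along active edges never enters `c`. But `C` is strongly connected, so `c` is
  -- reachable, which leaves only `s = c`; a cycle from `c` back to `c` then ends with a forbidden
  -- edge.
  have hreach : ∀ i, G.Reach live b s i → i ∈ S ∧ (i = c → i = s) := by
    intro i h
    induction h with
    | refl => exact ⟨hs, fun _ => rfl⟩
    | @tail j i _ h ih =>
      have hne : i ≠ c := fun hic => hnc j ih.1 (hic ▸ h)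
      refine ⟨hcl j ih.1 i ?_, fun hic => absurd hic hne⟩
      rw [kernel, if_pos ⟨hSC j ih.1, hne⟩]
      exact flow_pos_iff.2 h
  have hsc : G.Reach live b s c := ((hC.1.eq_of_mem hc).subset (hSC s hs)).2
  obtain ⟨h4, h5⟩ := hreach c hsc
  have h6 := h5 rfl
  subst h6
  obtain ⟨i, hi⟩ := hC.exists_adj hc
  have h7 : G.Reach live b i c := ((hC.1.eq_of_mem hc).subset (hC.2.2.1 c hc i hi)).2
  rcases Relation.ReflTransGen.cases_tail h7 with h | ⟨k, hk, hkc⟩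
  · subst h
    exact hnc c h4 hi
  · exact hnc k (hreach k (Relation.ReflTransGen.head hi hk)).1 hkc

end Lawful

/-! ### Solutions of the two linear programs -/

open Classical in
/-- `d` solves the equations of the kernel with one unit of inflow at `p`. -/
def IsBasic (G : Network V E) (live : Finset E) (b : V → ℝ) (P Z : V → Prop) (p : V)
    (d : V → ℝ) : Prop :=
  ∀ i, d i = (if i = p then 1 else 0) + ∑ j, G.kernel live b P Z i j * d j

/-- `T` is the largest multiple of `d`, up to `T₀`, that respects the borders. -/
def IsScale (G : Network V E) (live : Finset E) (b d : V → ℝ) (T₀ T : ℝ) : Prop :=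
  T ≤ T₀ ∧
  (∀ e ∈ G.activeEdges live b, ((T * d (G.src e) : ℝ) : WithTop ℝ) ≤ G.toBorder e (b (G.src e))) ∧
  (T = T₀ ∨ ∃ e ∈ G.activeEdges live b, 0 < d (G.src e) ∧
    ((T * d (G.src e) : ℝ) : WithTop ℝ) = G.toBorder e (b (G.src e)))

/-- The ratio test, by induction on the set of edges: an edge that is violated by the current
multiple lowers it to the quotient at which this edge is tight. -/
theorem exists_scale (d : V → ℝ) (hd : ∀ w, 0 ≤ d w) {T₀ : ℝ} (hT₀ : 0 < T₀) :
    ∃ T, 0 < T ∧ G.IsScale live b d T₀ T := by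
  classical
  have key : ∀ s : Finset E, ∃ T, 0 < T ∧ T ≤ T₀ ∧
      (∀ e ∈ s, ((T * d (G.src e) : ℝ) : WithTop ℝ) ≤ G.toBorder e (b (G.src e))) ∧
      (T = T₀ ∨ ∃ e ∈ s, 0 < d (G.src e) ∧
        ((T * d (G.src e) : ℝ) : WithTop ℝ) = G.toBorder e (b (G.src e))) := by
    intro s
    induction s using Finset.induction_on with
    | empty => exact ⟨T₀, hT₀, le_rfl, by simp, Or.inl rfl⟩
    | insert e s _ ih =>
      obtain ⟨T, h1, h2, h3, h4⟩ := ih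
      by_cases hle : ((T * d (G.src e) : ℝ) : WithTop ℝ) ≤ G.toBorder e (b (G.src e))
      · refine ⟨T, h1, h2, ?_, ?_⟩
        · intro e' he'
          rcases Finset.mem_insert.1 he' with rfl | h
          · exact hle
          · exact h3 e' h
        · rcases h4 with h | ⟨e', he', h⟩
          · exact Or.inl h
          · exact Or.inr ⟨e', Finset.mem_insert_of_mem he', h⟩
      · have hpos := G.toBorder_pos e (b (G.src e))
        obtain ⟨r, hr⟩ := WithTop.ne_top_iff_exists.1 (show G.toBorder e (b (G.src e)) ≠ ⊤ from fun h => hle (by rw [h]; exact le_top))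
        rw [← hr] at hle hpos
        have hle' : r < T * d (G.src e) := by exact_mod_cast not_le.1 hle
        have hpos' : 0 < r := by exact_mod_cast hpos
        have hde : 0 < d (G.src e) := by
          by_contra hc
          rw [le_antisymm (not_lt.1 hc) (hd _), mul_zero] at hle'
          linarith
        have hT : r / d (G.src e) < T := (div_lt_iff₀ hde).2 hle'
        have hmul : r / d (G.src e) * d (G.src e) = r := div_mul_cancel₀ _ hde.ne'
        refine ⟨r / d (G.src e), div_pos hpos' hde, by linarith, ?_,
          Or.inr ⟨e, Finset.mem_insert_self _ _, hde, by rw [hmul, hr]⟩⟩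
        intro e' he'
        rcases Finset.mem_insert.1 he' with rfl | h
        · rw [hmul, hr]
        · refine le_trans ?_ (h3 e' h)
          exact_mod_cast mul_le_mul_of_nonneg_right hT.le (hd _)
  exact key _

namespace Lawful
variable (hG : G.Lawful) (hb : ∀ w, 0 ≤ b w)
include hG hb

/-! #### The Increase-LP -/

omit hb in
open Classical in
-- The program states its equation for reachable banks only. It extends to all banks because the
-- reachable set is closed under active edges, so that both sides vanish outside.
theorem incFeasible_eq {v : V} {r δ : ℝ} {d : V → ℝ}
    (h : G.IncFeasible live b v r δ d) (i : V) :
    d i = (if i = v then δ else 0) +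
      ∑ j, G.kernel live b (G.Reach live b v) (fun _ => False) i j * d j := by
  classical
  by_cases hi : G.Reach live b v i
  · have h1 := h.1 i hi
    rw [sum_kernel not_false, h1]
    congr 1
    rw [← Finset.sum_subset
      (s₁ := (G.activeEdges live b).filter fun e => G.tgt e = i ∧ G.Reach live b v (G.src e))]
    · intro e he
      simp only [Finset.mem_filter] at he ⊢
      exact ⟨he.1, he.2.1⟩
    · intro e he hne
      simp only [Finset.mem_filter, not_and] at he hne
      rw [h.2.1 _ (hne he.1 he.2), mul_zero]
  · rw [h.2.1 i hi, if_neg (by rintro rfl; exact hi Relation.ReflTransGen.refl), Finset.sum_eq_zero,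
      zero_add]
    intro j _
    by_cases hj : G.Reach live b v j
    · have : G.kernel live b (G.Reach live b v) (fun _ => False) i j = 0 := by
        rw [kernel, if_pos ⟨hj, not_false⟩]
        refine le_antisymm (not_lt.1 fun hlt => hi ?_) (flow_nonneg hG.slope_nonneg i j)
        exact hj.tail (flow_pos_iff.1 hlt)
      rw [this, zero_mul]
    · rw [kernel, if_neg (fun h => hj h.1), zero_mul]

/-- By transience the direction is determined by `δ`: the feasible points lie on the ray of the
solution with unit inflow. -/
theorem incFeasible_eq_smul {v : V} {r δ : ℝ} {d d₁ : V → ℝ} (hv : ∀ C, ¬ G.Floods live b v C)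
    (hd₁ : G.IsBasic live b (G.Reach live b v) (fun _ => False) v d₁)
    (h : G.IncFeasible live b v r δ d) : d = δ • d₁ := by
  have hK := hG.transient_reach hb hv
  refine hK.solution_unique (hG.incFeasible_eq h) fun i => ?_
  rw [Pi.smul_apply, smul_eq_mul, hd₁ i, mul_add, Finset.mul_sum]
  congr 1
  · split_ifs <;> simp
  · exact Finset.sum_congr rfl fun j _ => by simp; ring

theorem basic_nonneg {P Z : V → Prop} {p : V} {d₁ : V → ℝ}
    (hK : Transient (G.kernel live b P Z)) (hd₁ : G.IsBasic live b P Z p d₁) (i : V) :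
    0 ≤ d₁ i := hK.solution_nonneg (fun i => by split_ifs <;> norm_num) hd₁ i

/-- Whatever stops the multiple at `T`, the bound `r` or a tight edge with positive direction, stops
every other feasible multiple of `d₁` as well. -/
theorem incOptimal_of_scale {v : V} {r T : ℝ} {d₁ : V → ℝ} (hv : ∀ C, ¬ G.Floods live b v C)
    (hd₁ : G.IsBasic live b (G.Reach live b v) (fun _ => False) v d₁) (hT0 : 0 ≤ T)
    (hT : G.IsScale live b d₁ r T) : G.IncOptimal live b v r T (T • d₁) := by
  classical
  have hK := hG.transient_reach hb hv
  have hnn := hG.basic_nonneg hb hK hd₁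
  have hout : ∀ w, ¬ G.Reach live b v w → d₁ w = 0 := by
    intro w hw
    rw [hd₁ w, if_neg (by rintro rfl; exact hw Relation.ReflTransGen.refl), zero_add]
    refine Finset.sum_eq_zero fun j _ => ?_
    have : G.kernel live b (G.Reach live b v) (fun _ => False) w j = 0 := by
      unfold kernel
      split_ifs with h
      · refine le_antisymm (not_lt.1 fun hlt => hw ?_) (flow_nonneg hG.slope_nonneg w j)
        exact h.1.tail (flow_pos_iff.1 hlt)
      · rfl
    rw [this, zero_mul]
  refine ⟨⟨fun w hw => ?_, fun w hw => by simp [hout w hw], ?_, hT.1,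
    fun w => mul_nonneg hT0 (hnn w)⟩, fun δ' d' h => ?_⟩
  · have h1 := hd₁ w
    rw [sum_kernel not_false] at h1
    rw [Pi.smul_apply, smul_eq_mul, h1, mul_add, Finset.mul_sum]
    congr 1
    · split_ifs <;> simp
    · have : ∑ e ∈ (G.activeEdges live b).filter
          (fun e => G.tgt e = w ∧ G.Reach live b v (G.src e)),
          T * (G.slopeAt e (b (G.src e)) * d₁ (G.src e)) =
        ∑ e ∈ (G.activeEdges live b).filter (fun e => G.tgt e = w),
          T * (G.slopeAt e (b (G.src e)) * d₁ (G.src e)) := by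
        apply Finset.sum_subset
        · intro e he
          simp only [Finset.mem_filter] at he ⊢
          exact ⟨he.1, he.2.1⟩
        · intro e he hne
          simp only [Finset.mem_filter, not_and] at he hne
          rw [hout _ (hne he.1 he.2)]; simp
      rw [this]
      exact Finset.sum_congr rfl fun e _ => by simp; ring
  · intro w e he hw
    subst hw
    exact hT.2.1 e he
  · have h1 := hG.incFeasible_eq_smul hb hv hd₁ h
    rcases hT.2.2 with h2 | ⟨e, he, h2, h3⟩
    · rw [h2]; exact h.2.2.2.1
    · have h4 := h.2.2.1 _ e he rfl
      rw [h1, ← h3] at h4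
      have h5 : δ' * d₁ (G.src e) ≤ T * d₁ (G.src e) := by exact_mod_cast h4
      exact le_of_mul_le_mul_right h5 h2

/-- An optimal solution of the Increase-LP exists. -/
theorem exists_incOptimal {v : V} {r : ℝ} (hr : 0 < r) (hv : ∀ C, ¬ G.Floods live b v C) :
    ∃ δ d, G.IncOptimal live b v r δ d := by
  classical
  have hK := hG.transient_reach hb hv
  obtain ⟨d₁, hd₁⟩ := hK.exists_solution (fun i => if i = v then 1 else 0)
  obtain ⟨T, h1, h2⟩ := exists_scale (G := G) (live := live) (b := b) d₁
    (hG.basic_nonneg hb hK hd₁) hr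
  exact ⟨T, _, hG.incOptimal_of_scale hb hv hd₁ h1.le h2⟩

/-- An optimal solution of the Increase-LP exhausts the external assets or reaches a border. -/
theorem incOptimal_hit {v : V} {r δ : ℝ} {d : V → ℝ} (hr : 0 < r)
    (hv : ∀ C, ¬ G.Floods live b v C) (h : G.IncOptimal live b v r δ d) :
    0 < δ ∧ (δ = r ∨ ∃ e ∈ G.activeEdges live b,
      ((d (G.src e) : ℝ) : WithTop ℝ) = G.toBorder e (b (G.src e))) := by
  classical
  have hK := hG.transient_reach hb hv
  obtain ⟨d₁, hd₁⟩ := hK.exists_solution (fun i => if i = v then 1 else 0)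
  obtain ⟨T, h1, h2⟩ := exists_scale (G := G) (live := live) (b := b) d₁
    (hG.basic_nonneg hb hK hd₁) hr
  have h3 := hG.incOptimal_of_scale hb hv hd₁ h1.le h2
  have h4 : δ = T := le_antisymm (h3.2 δ d h.1) (h.2 _ _ h3.1)
  rw [h4, hG.incFeasible_eq_smul hb hv hd₁ h.1, h4]
  refine ⟨h1, h2.2.2.imp_right ?_⟩
  rintro ⟨e, he, _, h5⟩
  exact ⟨e, he, h5⟩

/-! #### The Flood-LP -/

omit hG hb in
theorem floodFeasible_eq_kernel {C : Set V} {d : V → ℝ} (h : G.FloodFeasible live b C d)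
    (hcl : ∀ c ∈ C, ∀ c', G.Adj live b c c' → c' ∈ C) (hs : ∀ e a, 0 ≤ G.slopeAt e a)
    (i : V) : d i = ∑ j, G.kernel live b (· ∈ C) (fun _ => False) i j * d j := by
  classical
  by_cases hi : i ∈ C
  · rw [sum_kernel not_false, h.2.1 i hi]
  · rw [h.1 i hi, Finset.sum_eq_zero]
    intro j _
    have : G.kernel live b (· ∈ C) (fun _ => False) i j = 0 := by
      unfold kernel
      split_ifs with h1
      · refine le_antisymm (not_lt.1 fun hlt => hi ?_) (flow_nonneg hs i j)
        exact hcl j h1.1 i (flow_pos_iff.1 hlt)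
      · rfl
    rw [this, zero_mul]

/-- The flow inside `C` is singular, but when the equation of `c` is dropped and the value `d c`
prescribed, the rest is a transient system. So `d` is determined by `d c`. -/
theorem floodFeasible_eq_smul {v c : V} {C : Set V} {d d₁ : V → ℝ} (hC : G.Floods live b v C)
    (hc : c ∈ C) (hd₁ : G.IsBasic live b (· ∈ C) (· = c) c d₁)
    (h : G.FloodFeasible live b C d) : d = d c • d₁ := by
  classical
  have hK := hG.transient_component hb hC hc
  have hz : ∀ x : V → ℝ, ∑ j, G.kernel live b (· ∈ C) (· = c) c j * x j = 0 := fun x =>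
    Finset.sum_eq_zero fun j _ => by simp [kernel]
  refine hK.solution_unique (q := fun i => if i = c then d c else 0) (fun i => ?_) fun i => ?_
  · by_cases hi : i = c
    · subst hi
      rw [hz, if_pos rfl, add_zero]
    · rw [if_neg hi, zero_add, floodFeasible_eq_kernel h hC.2.2.1 hG.slope_nonneg i]
      exact Finset.sum_congr rfl fun j _ => by simp [kernel, hi]
  · rw [Pi.smul_apply, smul_eq_mul, hd₁ i, mul_add, Finset.mul_sum]
    congr 1
    · split_ifs <;> simp
    · exact Finset.sum_congr rfl fun j _ => by simp; ring

/-- The equation dropped at the pivot `c` is implied by the others: the columns of `C` sum to `1`,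
so the equations of all banks add up to an identity. -/
theorem basic_stationary {v c : V} {C : Set V} {d₁ : V → ℝ} (hl : G.OutClosed live)
    (hC : G.Floods live b v C) (hc : c ∈ C) (hd₁ : G.IsBasic live b (· ∈ C) (· = c) c d₁) :
    d₁ c = 1 ∧ (∀ w, w ∉ C → d₁ w = 0) ∧
      ∀ i, d₁ i = ∑ j, G.kernel live b (· ∈ C) (fun _ => False) i j * d₁ j := by
  classical
  have hc1 : d₁ c = 1 := by
    rw [hd₁ c, if_pos rfl, Finset.sum_eq_zero, add_zero]
    exact fun j _ => by simp [kernel]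
  have hne : ∀ i, i ≠ c → d₁ i = ∑ j, G.kernel live b (· ∈ C) (fun _ => False) i j * d₁ j := by
    intro i hi
    rw [hd₁ i, if_neg hi, zero_add]
    exact Finset.sum_congr rfl fun j _ => by simp [kernel, hi]
  have hout : ∀ w, w ∉ C → d₁ w = 0 := by
    intro w hw
    rw [hne w (fun h => hw (h ▸ hc))]
    refine Finset.sum_eq_zero fun j _ => ?_
    have : G.kernel live b (· ∈ C) (fun _ => False) w j = 0 := by
      unfold kernel
      split_ifs with h
      · refine le_antisymm (not_lt.1 fun hlt => hw ?_) (flow_nonneg hG.slope_nonneg w j)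
        exact hC.2.2.1 j h.1 w (flow_pos_iff.1 hlt)
      · rfl
    rw [this, zero_mul]
  refine ⟨hc1, hout, fun i => ?_⟩
  by_cases hi : i = c
  swap
  · exact hne i hi
  subst hi
  have hsum : ∑ k, ∑ j, G.kernel live b (· ∈ C) (fun _ => False) k j * d₁ j = ∑ j, d₁ j := by
    rw [Finset.sum_comm]
    refine Finset.sum_congr rfl fun j _ => ?_
    rw [← Finset.sum_mul]
    by_cases hj : j ∈ C
    · obtain ⟨k, hk⟩ := hC.exists_adj hj
      have := hG.flow_column_eq hb hl hk
      simp only [kernel, hj, not_false_eq_true, and_self, if_true]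
      rw [this, one_mul]
    · rw [hout j hj, mul_zero]
  rw [← Finset.add_sum_erase _ _ (Finset.mem_univ i),
    ← Finset.add_sum_erase _ d₁ (Finset.mem_univ i)] at hsum
  have : ∑ k ∈ Finset.univ.erase i, ∑ j, G.kernel live b (· ∈ C) (fun _ => False) k j * d₁ j =
      ∑ k ∈ Finset.univ.erase i, d₁ k :=
    Finset.sum_congr rfl fun k hk => (hne k (Finset.ne_of_mem_erase hk)).symm
  linarith

/-- The program has no explicit bound such as `r`. Since `d₁ c = 1`, the multiple of a feasible
point is its value at `c`, and any `T₀` above the border distance of one active edge out of `c`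
bounds it. -/
theorem floodOptimal_of_scale {v c : V} {C : Set V} {T₀ T : ℝ} {d₁ : V → ℝ}
    (hl : G.OutClosed live) (hC : G.Floods live b v C) (hc : c ∈ C)
    (hd₁ : G.IsBasic live b (· ∈ C) (· = c) c d₁)
    (hT₀ : ∃ e ∈ G.activeEdges live b, G.src e = c ∧ G.toBorder e (b c) ≤ (T₀ : WithTop ℝ))
    (hT0 : 0 ≤ T) (hT : G.IsScale live b d₁ T₀ T) : G.FloodOptimal live b C (T • d₁) := by
  classical
  have hK := hG.transient_component hb hC hc
  have hnn := hG.basic_nonneg hb hK hd₁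
  obtain ⟨hc1, hout, hst⟩ := hG.basic_stationary hb hl hC hc hd₁
  refine ⟨⟨fun w hw => by simp [hout w hw], fun w _ => ?_, ?_, fun w _ => mul_nonneg hT0 (hnn w)⟩,
    fun d' h => ?_⟩
  · have h1 := hst w
    rw [sum_kernel not_false] at h1
    rw [Pi.smul_apply, smul_eq_mul, h1, Finset.mul_sum]
    exact Finset.sum_congr rfl fun e _ => by simp; ring
  · intro w _ e he hw
    subst hw
    exact hT.2.1 e he
  · have h1 := hG.floodFeasible_eq_smul hb hC hc hd₁ h
    have h2 : d' c ≤ T := by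
      rcases hT.2.2 with h2 | ⟨e, he, h2, h3⟩
      · obtain ⟨e, he, hec, hle⟩ := hT₀
        have := h.2.2.1 c hc e he hec
        rw [h2]
        exact_mod_cast this.trans hle
      · have hmem : G.src e ∈ C := by
          by_contra hn
          rw [hout _ hn] at h2
          exact lt_irrefl _ h2
        have h4 := h.2.2.1 _ hmem e he rfl
        rw [h1, ← h3] at h4
        have h5 : d' c * d₁ (G.src e) ≤ T * d₁ (G.src e) := by exact_mod_cast h4
        exact le_of_mul_le_mul_right h5 h2
    rw [h1]
    exact Finset.sum_le_sum fun w _ => mul_le_mul_of_nonneg_right h2 (hnn w)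

/-- Feasible points are multiples of `d₁`, and `∑ d₁` is positive, so the objective fixes the
multiple. Every optimum is thus the one of the ratio test, which is tight at an active edge. This
makes each flooding pass a border, whichever optimum is chosen. -/
theorem exists_floodOptimal_hit {v : V} {C : Set V} (hl : G.OutClosed live)
    (hC : G.Floods live b v C) : ∃ d, G.FloodOptimal live b C d ∧
      ∀ d', G.FloodOptimal live b C d' → ∃ e ∈ G.activeEdges live b,
        ((d' (G.src e) : ℝ) : WithTop ℝ) = G.toBorder e (b (G.src e)) := by
  classical
  obtain ⟨c, hc⟩ := hC.1.nonempty
  have hK := hG.transient_component hb hC hc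
  obtain ⟨d₁, hd₁⟩ := hK.exists_solution (fun i => if i = c then 1 else 0)
  have hnn := hG.basic_nonneg hb hK hd₁
  obtain ⟨hc1, hout, hst⟩ := hG.basic_stationary hb hl hC hc hd₁
  obtain ⟨_, e₀, he₀, rfl, rfl⟩ := hC.exists_adj hc
  obtain ⟨r, hr⟩ := WithTop.ne_top_iff_exists.1
    (hG.toBorder_ne_top e₀ _ (hb (G.src e₀)) (mem_activeEdges.1 he₀).2)
  have hr0 : 0 < r := by
    have := G.toBorder_pos e₀ (b (G.src e₀))
    rw [← hr] at this
    exact_mod_cast this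
  obtain ⟨T, h1, h2⟩ := exists_scale (G := G) (live := live) (b := b) d₁ hnn hr0
  have hopt := hG.floodOptimal_of_scale hb hl hC hc hd₁ ⟨e₀, he₀, rfl, hr.ge⟩ h1.le h2
  refine ⟨_, hopt, fun d' h => ?_⟩
  have h3 := hG.floodFeasible_eq_smul hb hC hc hd₁ h.1
  set t := d' (G.src e₀) with ht
  have hS : 0 < ∑ w, d₁ w := Finset.sum_pos' (fun w _ => hnn w)
    ⟨_, Finset.mem_univ (G.src e₀), by rw [hc1]; exact one_pos⟩
  have h4 : T * ∑ w, d₁ w = t * ∑ w, d₁ w := by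
    have h5 := h.2 _ hopt.1
    have h6 := hopt.2 _ h.1
    rw [h3] at h5 h6
    simp only [Pi.smul_apply, smul_eq_mul, ← Finset.mul_sum] at h5 h6
    exact le_antisymm h5 h6
  have h5 : t = T := (mul_right_cancel₀ hS.ne' h4).symm
  rw [h3, h5]
  -- The initial bound `r` is the border distance of `e₀`, whose debtor is the pivot with `d₁ = 1`;
  -- if it was never lowered, `e₀` is tight.
  rcases h2.2.2 with h6 | ⟨e, he, _, h7⟩
  · refine ⟨e₀, he₀, ?_⟩
    rw [Pi.smul_apply, hc1, smul_eq_mul, mul_one, h6, hr]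
  · exact ⟨e, he, h7⟩

/-! ### Comparison with a supersolution -/

section Compare
variable {bx ax A : V → ℝ}

omit hb in
-- Subtract the balance equation of `b` from the inequality for `A`. A debtor pays at least its
-- slope times its additional assets in `A`, as long as no border is crossed, whence the truncation
-- by `d`; beyond that, monotonicity suffices. Inactive edges are discarded.
theorem surplus_ge [DecidableEq V] (hbA : ∀ w, b w ≤ A w) (hb : ∀ w, 0 ≤ b w)
    (heq : ∀ w, b w = bx w + ∑ e ∈ live.filter (fun e => G.tgt e = w), G.pay e (b (G.src e)))
    (hA : ∀ w, ax w + ∑ e ∈ live.filter (fun e => G.tgt e = w), G.pay e (A (G.src e)) ≤ A w)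
    {d : V → ℝ} (hd : ∀ w, 0 ≤ d w)
    (hdb : ∀ e ∈ G.activeEdges live b, ((d (G.src e) : ℝ) : WithTop ℝ) ≤ G.toBorder e (b (G.src e)))
    (w : V) :
    ax w - bx w + ∑ j, G.flow live b w j * min (A j - b j) (d j) ≤ A w - b w := by
  have h1 := sum_flow (G := G) (live := live) (b := b) (fun _ => True)
    (fun j => min (A j - b j) (d j)) w
  simp only [if_true, and_true] at h1
  have h1 : ∑ j, G.flow live b w j * min (A j - b j) (d j) =
      ∑ e ∈ (G.activeEdges live b).filter (fun e => G.tgt e = w),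
        G.slopeAt e (b (G.src e)) * min (A (G.src e) - b (G.src e)) (d (G.src e)) := by
    rw [h1]
  rw [h1]
  have h2 : ∑ e ∈ (G.activeEdges live b).filter (fun e => G.tgt e = w),
      G.slopeAt e (b (G.src e)) * min (A (G.src e) - b (G.src e)) (d (G.src e)) ≤
      ∑ e ∈ live.filter (fun e => G.tgt e = w),
        (G.pay e (A (G.src e)) - G.pay e (b (G.src e))) := by
    refine (Finset.sum_le_sum fun e he => ?_).trans
      (Finset.sum_le_sum_of_subset_of_nonneg (fun e he => ?_) fun e _ _ => ?_)
    · have he' := (Finset.mem_filter.1 he).1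
      refine hG.pay_sub_ge e (hb _) (le_min (by linarith [hbA (G.src e)]) (hd _)) ?_ ?_
      · linarith [min_le_left (A (G.src e) - b (G.src e)) (d (G.src e))]
      · refine le_trans ?_ (hdb e he')
        exact_mod_cast min_le_right _ _
    · have := Finset.mem_filter.1 he
      exact Finset.mem_filter.2 ⟨(mem_activeEdges.1 this.1).1, this.2⟩
    · have := hG.pay_mono e _ _ (hb _) (hbA (G.src e))
      linarith
  rw [Finset.sum_sub_distrib] at h2
  have := heq w
  have := hA w
  linarith

/-- The overshoot `d - min (A - b) d` is sub-invariant for a transient kernel. Where it is positive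
it equals `d - (A - b)`, and the inflow `δ` of `v` is covered by the gap `ax v - bx v`. -/
theorem increase_le [DecidableEq V] (hbA : ∀ w, b w ≤ A w) (hx : ∀ w, bx w ≤ ax w)
    (heq : ∀ w, b w = bx w + ∑ e ∈ live with G.tgt e = w, G.pay e (b (G.src e)))
    (hA : ∀ w, ax w + ∑ e ∈ live with G.tgt e = w, G.pay e (A (G.src e)) ≤ A w)
    {v : V} (hv : ∀ C, ¬ G.Floods live b v C) {δ : ℝ} {d : V → ℝ}
    (h : G.IncFeasible live b v (ax v - bx v) δ d) (w : V) : b w + d w ≤ A w := by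
  have hK := hG.transient_reach hb hv
  have hs := hG.surplus_ge hbA hb heq hA h.2.2.2.2 (fun e he => h.2.2.1 _ e he rfl)
  have hz : ∀ i, d i - min (A i - b i) (d i) = 0 := by
    refine hK.2 _ (fun i => by linarith [min_le_right (A i - b i) (d i)]) fun i => ?_
    rcases le_total (d i) (A i - b i) with h1 | h1
    · rw [min_eq_right h1, sub_self]
      exact Finset.sum_nonneg fun j _ => mul_nonneg (hK.1 i j)
        (by linarith [min_le_right (A j - b j) (d j)])
    · rw [min_eq_left h1]
      have h2 := hG.incFeasible_eq h i
      have h3 := hs i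
      have h4 : ∑ j, G.kernel live b (G.Reach live b v) (fun _ => False) i j *
          min (A j - b j) (d j) ≤ ∑ j, G.flow live b i j * min (A j - b j) (d j) :=
        Finset.sum_le_sum fun j _ => mul_le_mul_of_nonneg_right
          (kernel_le_flow hG.slope_nonneg _ _ i j)
          (le_min (by linarith [hbA j]) (h.2.2.2.2 j))
      have h5 : d i ≤ ax i - bx i +
          ∑ j, G.kernel live b (G.Reach live b v) (fun _ => False) i j * d j := by
        refine h2.le.trans (add_le_add ?_ le_rfl)
        split_ifs with hi
        · rw [hi]; exact h.2.2.2.1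
        · linarith [hx i]
      simp only [mul_sub, Finset.sum_sub_distrib]
      linarith
  have := hz w
  linarith [min_le_left (A w - b w) (d w)]

/-- The gap `ax v - bx v` is a surplus at `v`, and an active edge passes a positive share of a
surplus on to its creditor. -/
theorem surplus_pos_of_reach [DecidableEq V] (hbA : ∀ w, b w ≤ A w) (hx : ∀ w, bx w ≤ ax w)
    (heq : ∀ w, b w = bx w + ∑ e ∈ live with G.tgt e = w, G.pay e (b (G.src e)))
    (hA : ∀ w, ax w + ∑ e ∈ live with G.tgt e = w, G.pay e (A (G.src e)) ≤ A w)
    {v : V} (hv : bx v < ax v) {w : V} (h : G.Reach live b v w) : b w < A w := by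
  have hs := fun d hd hdb => hG.surplus_ge hbA hb heq hA (d := d) hd hdb
  induction h with
  | refl =>
    have h1 := hs (fun _ => 0) (fun _ => le_rfl) (fun e _ => (G.toBorder_pos e _).le) v
    have h2 : ∑ j, G.flow live b v j * min (A j - b j) 0 = 0 := Finset.sum_eq_zero fun j _ => by
      rw [min_eq_right (by linarith [hbA j]), mul_zero]
    rw [h2] at h1
    linarith
  | @tail u w _ huw ih =>
    obtain ⟨ε, h1, _, h3⟩ := WellFormed.exists_small_step (F := G) u (b u) one_pos
    have h4 := hs (fun j => if j = u then ε else 0)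
      (fun j => by split_ifs; exacts [h1.le, le_rfl]) (fun e _ => by
        split_ifs with he
        · rw [he]; exact h3 e ((mem_outEdges G).2 he)
        · exact (G.toBorder_pos e _).le) w
    have h5 : G.flow live b w u * min (A u - b u) ε ≤
        ∑ j, G.flow live b w j * min (A j - b j) (if j = u then ε else 0) := by
      refine le_trans ?_ (Finset.single_le_sum (a := u) (fun j _ => ?_) (Finset.mem_univ u))
      · rw [if_pos rfl]
      · refine mul_nonneg (flow_nonneg hG.slope_nonneg w j) (le_min (by linarith [hbA j]) ?_)
        split_ifs; exacts [h1.le, le_rfl]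
    have h6 : 0 < G.flow live b w u * min (A u - b u) ε :=
      mul_pos (flow_pos_iff.2 huw) (lt_min (by linarith) h1)
    linarith [hx w]

/-- Circulating payments need no outside money, so sub-invariance of the overshoot alone does not
exclude it. The gap at `v` decides: it gives a strict surplus `s` to some bank `w₀` of `C`, which
forces the overshoot to vanish at `w₀`, and then everywhere by transience without the row of `w₀`.
-/
theorem flood_le [DecidableEq V] (hbA : ∀ w, b w ≤ A w) (hx : ∀ w, bx w ≤ ax w)
    (heq : ∀ w, b w = bx w + ∑ e ∈ live with G.tgt e = w, G.pay e (b (G.src e)))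
    (hA : ∀ w, ax w + ∑ e ∈ live with G.tgt e = w, G.pay e (A (G.src e)) ≤ A w)
    {v : V} (hv : bx v < ax v) {C : Set V} (hC : G.Floods live b v C) {d : V → ℝ}
    (h : G.FloodFeasible live b C d) (w : V) : b w + d w ≤ A w := by
  have hd : ∀ i, 0 ≤ d i := fun i => by
    by_cases hi : i ∈ C
    · exact h.2.2.2 i hi
    · rw [h.1 i hi]
  have hdb : ∀ e ∈ G.activeEdges live b,
      ((d (G.src e) : ℝ) : WithTop ℝ) ≤ G.toBorder e (b (G.src e)) := fun e he => by
    by_cases hi : G.src e ∈ C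
    · exact h.2.2.1 _ hi e he rfl
    · rw [h.1 _ hi]
      exact (G.toBorder_pos e _).le
  have hs := hG.surplus_ge hbA hb heq hA hd hdb
  set y : V → ℝ := fun j => min (A j - b j) (d j) with hy
  have hy0 : ∀ j, 0 ≤ y j := fun j => le_min (by linarith [hbA j]) (hd j)
  have hyd : ∀ j, y j ≤ d j := fun j => min_le_right _ _
  set K := G.kernel live b (· ∈ C) (fun _ => False) with hKdef
  have hK0 : ∀ i j, 0 ≤ K i j := kernel_nonneg hG.slope_nonneg _ _
  have hKf : ∀ i, ∑ j, K i j * y j ≤ ∑ j, G.flow live b i j * y j := fun i =>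
    Finset.sum_le_sum fun j _ => mul_le_mul_of_nonneg_right
      (kernel_le_flow hG.slope_nonneg _ _ i j) (hy0 j)
  have hdK := floodFeasible_eq_kernel h hC.2.2.1 hG.slope_nonneg
  have hz0 : ∀ i, 0 ≤ d i - y i := fun i => by linarith [hyd i]
  -- a bank of the component that receives more in the supersolution
  obtain ⟨w₀, hw₀, s, hs0, hsw⟩ : ∃ w₀ ∈ C, ∃ s, 0 < s ∧
      s + ∑ j, K w₀ j * y j ≤ A w₀ - b w₀ := by
    by_cases hvC : v ∈ C
    · exact ⟨v, hvC, ax v - bx v, by linarith, by linarith [hs v, hKf v]⟩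
    · obtain ⟨c, hc, hreach⟩ := hC.2.2.2
      obtain ⟨u, w₀, hu, huC, hwC, huw⟩ : ∃ u w₀, G.Reach live b v u ∧ u ∉ C ∧ w₀ ∈ C ∧
          G.Adj live b u w₀ := by
        clear hs hdb hd
        by_contra hcon
        push Not at hcon
        have : ∀ x, G.Reach live b v x → x ∉ C := by
          intro x hx
          induction hx with
          | refl => exact hvC
          | tail hr ha ih => exact fun hx => hcon _ _ hr ih hx ha
        exact this c hreach hc
      have hAu := hG.surplus_pos_of_reach hb hbA hx heq hA hv hu
      obtain ⟨ε, h1, _, h3⟩ := WellFormed.exists_small_step (F := G) u (b u) one_pos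
      -- On `C` the direction is `d`; at the outside debtor `u` it is replaced by a small `ε`, so
      -- that the payment of `u` to `w₀` is counted in addition.
      have h4 := hG.surplus_ge hbA hb heq hA (d := fun j => if j = u then ε else d j)
        (fun j => by split_ifs; exacts [h1.le, hd j]) (fun e he => by
          split_ifs with heu
          · rw [heu]; exact h3 e ((mem_outEdges G).2 heu)
          · exact hdb e he) w₀
      refine ⟨w₀, hwC, G.flow live b w₀ u * min (A u - b u) ε,
        mul_pos (flow_pos_iff.2 huw) (lt_min (by linarith) h1), ?_⟩
      have h5 : G.flow live b w₀ u * min (A u - b u) ε + ∑ j, K w₀ j * y j ≤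
          ∑ j, G.flow live b w₀ j * min (A j - b j) (if j = u then ε else d j) := by
        rw [← Finset.add_sum_erase _ _ (Finset.mem_univ u),
          ← Finset.add_sum_erase (a := u) _
            (fun j => G.flow live b w₀ j * min (A j - b j) (if j = u then ε else d j))
            (Finset.mem_univ u)]
        have h6 : K w₀ u = 0 := by simp [hKdef, kernel, huC]
        rw [h6, zero_mul, zero_add, if_pos rfl]
        refine add_le_add_right (Finset.sum_le_sum fun j hj => ?_) _
        rw [if_neg (Finset.ne_of_mem_erase hj)]
        exact mul_le_mul_of_nonneg_right (kernel_le_flow hG.slope_nonneg _ _ _ j) (hy0 j)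
      linarith [hx w₀]
  have hzK : ∀ i, d i - y i ≤ ∑ j, K i j * (d j - y j) := by
    intro i
    rcases le_total (d i) (A i - b i) with h1 | h1
    · have : y i = d i := min_eq_right h1
      rw [this, sub_self]
      exact Finset.sum_nonneg fun j _ => mul_nonneg (hK0 i j) (hz0 j)
    · have : y i = A i - b i := min_eq_left h1
      rw [this]
      simp only [mul_sub, Finset.sum_sub_distrib]
      linarith [hdK i, hs i, hKf i, hx i]
  -- As the columns sum to at most `1`, the overshoot is exactly stationary. At `w₀` this would
  -- leave no room for the surplus `s` unless the overshoot is zero there.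
  have hzeq := (eq_of_le_of_colSum_le (hG.kernel_column_le hb _ _) hz0 hzK).1
  have hz₀ : d w₀ - y w₀ = 0 := by
    by_contra hne
    have h1 : A w₀ - b w₀ ≤ d w₀ := by
      by_contra hlt
      exact hne (by rw [hy]; dsimp only; rw [min_eq_right (not_le.1 hlt).le, sub_self])
    have h2 : y w₀ = A w₀ - b w₀ := min_eq_left h1
    have h3 := hzeq w₀
    simp only [mul_sub, Finset.sum_sub_distrib] at h3
    linarith [hdK w₀]
  have hT := hG.transient_component hb hC hw₀
  have hz := hT.2 _ hz0 (fun i => by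
    by_cases hi : i = w₀
    · rw [hi, hz₀]
      exact Finset.sum_nonneg fun j _ => mul_nonneg (hT.1 _ j) (hz0 j)
    · refine (hzK i).trans (le_of_eq (Finset.sum_congr rfl fun j _ => ?_))
      by_cases hj : j ∈ C <;> simp [hKdef, kernel, hi, hj]) w
  have : y w ≤ A w - b w := min_le_left _ _
  linarith

end Compare

/-- The payments on all remaining edges grow linearly along a feasible direction. -/
theorem pay_add_live {d : V → ℝ} (hl : G.OutClosed live) (hd : ∀ w, 0 ≤ d w)
    (hdb : ∀ e ∈ G.activeEdges live b, ((d (G.src e) : ℝ) : WithTop ℝ) ≤ G.toBorder e (b (G.src e)))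
    {e : E} (he : e ∈ live) :
    G.pay e (b (G.src e) + d (G.src e)) =
      G.pay e (b (G.src e)) + G.slopeAt e (b (G.src e)) * d (G.src e) := by
  refine hG.pay_add_of_active e _ _ (hb _) (hd _) fun e' he' hs => ?_
  have := hdb e' (mem_activeEdges.2 ⟨hl e e' he'.symm he, by rw [he']; exact hs⟩)
  rwa [he'] at this

theorem sum_pay_add [DecidableEq V] {d : V → ℝ} (hl : G.OutClosed live) (hd : ∀ w, 0 ≤ d w)
    (hdb : ∀ e ∈ G.activeEdges live b, ((d (G.src e) : ℝ) : WithTop ℝ) ≤ G.toBorder e (b (G.src e)))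
    (w : V) : ∑ e ∈ live with G.tgt e = w, G.pay e (b (G.src e) + d (G.src e)) =
      ∑ e ∈ live with G.tgt e = w, G.pay e (b (G.src e)) +
      ∑ e ∈ (G.activeEdges live b).filter (fun e => G.tgt e = w),
        G.slopeAt e (b (G.src e)) * d (G.src e) := by
  rw [Finset.sum_congr rfl fun e he => hG.pay_add_live hb hl hd hdb (Finset.mem_filter.1 he).1,
    Finset.sum_add_distrib]
  congr 1
  symm
  apply Finset.sum_subset
  · intro e he
    have := Finset.mem_filter.1 he
    exact Finset.mem_filter.2 ⟨(mem_activeEdges.1 this.1).1, this.2⟩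
  · intro e he hne
    have h1 := Finset.mem_filter.1 he
    have : G.slopeAt e (b (G.src e)) = 0 := by
      by_contra h0
      exact hne (Finset.mem_filter.2 ⟨mem_activeEdges.2
        ⟨h1.1, (hG.slope_nonneg e _).lt_of_ne' h0⟩, h1.2⟩)
    rw [this, zero_mul]

end Lawful
end Flow
end Network
end Clearing

/-! ### Invariants, termination and minimality for the algorithm, and the discontinuity of the
fixed-point map. -/

namespace Clearing
namespace Network
universe u v
set_option linter.unusedSectionVars false
variable {V : Type u} {E : Type v} [Fintype V] [Fintype E]

section LPFlow
variable {G : Network V E} {live : Finset E} {b : V → ℝ}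

theorem sum_kernel_eq_sum_active [DecidableEq V] {P : V → Prop} {d : V → ℝ} (hd : ∀ w, ¬ P w → d w = 0) (i : V) :
    ∑ j, G.kernel live b P (fun _ => False) i j * d j =
      ∑ e ∈ (G.activeEdges live b).filter (fun e => G.tgt e = i),
        G.slopeAt e (b (G.src e)) * d (G.src e) := by
  classical
  rw [sum_kernel not_false]
  apply Finset.sum_subset
  · intro e he
    simp only [Finset.mem_filter] at he ⊢
    exact ⟨he.1, he.2.1⟩
  · intro e he hne
    simp only [Finset.mem_filter, not_and] at he hne
    rw [hd _ (hne he.1 he.2), mul_zero]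

end LPFlow

variable {F : Network V E}

/-! ### Edges of the adjusted network by their creditor -/

open Classical in
theorem sum_adjust_tgt_inl (P : F.AdjEdge → ℝ) (w : V) (hw : ¬ (F.alpha w < 1 ∨ F.beta w < 1)) :
    ∑ e with F.adjust.tgt e = .inl w, P e = ∑ e ∈ F.inEdges w, P (.inl e) := by
  rw [Finset.sum_filter, Fintype.sum_sum_type, Fintype.sum_sum_type, inEdges, Finset.sum_filter]
  have h1 : ∀ e, F.adjust.tgt (.inl e) = .inl w ↔ F.tgt e = w := by
    intro e
    simp only [adjust]
    split_ifs with h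
    · simp only [false_iff]
      rintro rfl
      exact hw h
    · simp
  have h2 : ∀ u, F.adjust.tgt (.inr (.inl u)) ≠ .inl w := by intro u; simp [adjust]
  have h3 : ∀ u, F.adjust.tgt (.inr (.inr u)) ≠ .inl w := by
    intro u
    simp only [adjust, ne_eq, Sum.inl.injEq]
    intro h
    exact hw (h ▸ u.2)
  simp [h1, h2, h3]

open Classical in
theorem sum_adjust_tgt_inl_defBank (P : F.AdjEdge → ℝ) (u : F.DefBank) :
    ∑ e with F.adjust.tgt e = .inl u.1, P e = P (.inr (.inr u)) := by
  rw [Finset.sum_eq_single (.inr (.inr u))]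
  · intro e he hne
    have he := (Finset.mem_filter.1 he).2
    rcases e with e | x | x
    · simp only [adjust] at he
      split_ifs at he with h
      simp only [Sum.inl.injEq] at he
      exact absurd u.2 (he ▸ h)
    · simp [adjust] at he
    · simp only [adjust, Sum.inl.injEq] at he
      exact absurd (congrArg (fun x => Sum.inr (Sum.inr x)) (Subtype.ext he)) hne
  · refine fun h => absurd ?_ h
    exact Finset.mem_filter.2 ⟨Finset.mem_univ _, rfl⟩

open Classical in
theorem sum_adjust_tgt_collect (P : F.AdjEdge → ℝ) (u : F.DefBank) :
    ∑ e with F.adjust.tgt e = .inr (.inl u), P e = ∑ e ∈ F.inEdges u.1, P (.inl e) := by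
  rw [Finset.sum_filter, Fintype.sum_sum_type, Fintype.sum_sum_type, inEdges, Finset.sum_filter]
  have h1 : ∀ e, F.adjust.tgt (.inl e) = .inr (.inl u) ↔ F.tgt e = u.1 := by
    intro e
    simp only [adjust]
    split_ifs with h
    · exact ⟨fun h => congrArg Subtype.val (Sum.inl.inj (Sum.inr.inj h)),
        fun h => congrArg (fun x => Sum.inr (Sum.inl x)) (Subtype.ext h)⟩
    · simp only [false_iff]
      intro h'
      exact h (h' ▸ u.2)
  have h2 : ∀ x, F.adjust.tgt (.inr (.inl x)) ≠ .inr (.inl u) := by intro u; simp [adjust]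
  have h3 : ∀ x, F.adjust.tgt (.inr (.inr x)) ≠ .inr (.inl u) := by intro u; simp [adjust]
  simp [h1, h2, h3]

open Classical in
theorem sum_adjust_tgt_sink (P : F.AdjEdge → ℝ) (u : F.DefBank) :
    ∑ e with F.adjust.tgt e = .inr (.inr u), P e = P (.inr (.inl u)) := by
  rw [Finset.sum_eq_single (.inr (.inl u))]
  · intro e he hne
    have he := (Finset.mem_filter.1 he).2
    rcases e with e | x | x
    · simp only [adjust] at he
      split_ifs at he with h
      all_goals simp at he
    · simp only [adjust, Sum.inr.injEq] at he
      exact absurd (congrArg (fun x => Sum.inr (Sum.inl x)) he) hne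
    · simp [adjust] at he
  · refine fun h => absurd ?_ h
    exact Finset.mem_filter.2 ⟨Finset.mem_univ _, rfl⟩

/-! ### Clearing states seen from the adjusted network -/

open Classical in
/-- the assets in the adjusted network before settling, for assets `a` in `F` -/
noncomputable def lift (F : Network V E) (a : V → ℝ) : F.AdjBank → ℝ
  | .inl w => if h : F.alpha w < 1 ∨ F.beta w < 1
      then F.alpha w * F.ext w + F.adjust.pay (.inr (.inr ⟨w, h⟩)) (F.incoming a w)
      else a w
  | .inr (.inl u) => F.incoming a u.1
  | .inr (.inr u) => F.adjust.pay (.inr (.inl u)) (F.incoming a u.1)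

/-- the payments on the edges of the adjusted network for assets `a` in `F` -/
noncomputable def liftPay (F : Network V E) (a : V → ℝ) : F.AdjEdge → ℝ
  | .inl e => F.pay e (a (F.src e))
  | .inr x => F.adjust.pay (.inr x) (F.incoming a (F.auxBank x).1)

theorem assetMap_of_solvent {a : V → ℝ} {w : V} (h : F.outLiab w ≤ F.ext w + F.incoming a w) :
    F.assetMap a w = F.ext w + F.incoming a w := if_pos h

theorem assetMap_of_not_solvent {a : V → ℝ} {w : V}
    (h : ¬ F.outLiab w ≤ F.ext w + F.incoming a w) :
    F.assetMap a w = F.alpha w * F.ext w + F.beta w * F.incoming a w := if_neg h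

namespace WellFormed
variable (hF : F.WellFormed)
include hF

theorem incoming_nonneg {a : V → ℝ} (ha : ∀ w, 0 ≤ a w) (w : V) : 0 ≤ F.incoming a w :=
  Finset.sum_nonneg fun e _ => hF.lawful.pay_nonneg e (ha _)

theorem assetMap_of_not_defBank {a : V → ℝ} {w : V} (h : ¬ (F.alpha w < 1 ∨ F.beta w < 1)) :
    F.assetMap a w = F.ext w + F.incoming a w := by
  push Not at h
  have h1 : F.alpha w = 1 := le_antisymm (hF.alpha_mem w).2 h.1
  have h2 : F.beta w = 1 := le_antisymm (hF.beta_mem w).2 h.2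
  unfold assetMap
  rw [h1, h2, one_mul, one_mul, ite_self]

open Classical in
-- Edges of `F` pay according to `a`, not to `lift F a`: a solvent bank of `D` may hold more in `a`
-- than in the reduced vector.
theorem lift_eq {a : V → ℝ} (ha : F.IsClearing a) (w : F.AdjBank) :
    F.lift a w = F.adjust.ext w + ∑ e with F.adjust.tgt e = w, F.liftPay a e := by
  rcases w with w | u | u
  · by_cases h : F.alpha w < 1 ∨ F.beta w < 1
    · have := sum_adjust_tgt_inl_defBank (F.liftPay a) ⟨w, h⟩
      rw [this]
      simp only [lift, dif_pos h, adjust, if_pos h, liftPay, auxBank]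
    · rw [sum_adjust_tgt_inl _ _ h]
      have h1 := congrFun ha.2 w
      rw [hF.assetMap_of_not_defBank h] at h1
      simp only [lift, dif_neg h, adjust, if_neg h, liftPay]
      exact h1.symm
  · rw [sum_adjust_tgt_collect]
    simp [lift, adjust, liftPay, incoming]
  · rw [sum_adjust_tgt_sink]
    simp [lift, adjust, liftPay, auxBank]

theorem adjust_pay_aux_le (x : F.DefBank ⊕ F.DefBank) {a : ℝ} (ha : 0 ≤ a) :
    F.adjust.pay (.inr x) a ≤ F.auxRate x * a := by
  have h1 := hF.auxRate_nonneg x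
  rw [hF.adjust_pay_aux_eq]
  split_ifs with h2 h3
  · exact mul_le_mul_of_nonneg_left h2 h1
  · rw [mul_zero]; exact mul_nonneg h1 ha
  · exact le_rfl

/-- Reduction only loses money: both rates are at most `1`, and the proportional payment to `u`
never exceeds `beta u` times what `u_s` holds. -/
theorem lift_le {a : V → ℝ} (ha : F.IsClearing a) (w : V) : F.lift a (.inl w) ≤ a w := by
  have hinc := hF.incoming_nonneg (fun w => (ha.1 w).1) w
  have h1 := congrFun ha.2 w
  unfold lift
  dsimp only
  split_ifs with h
  · have h2 := hF.adjust_pay_aux_le (.inr ⟨w, h⟩) hinc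
    have h3 : F.auxRate (.inr ⟨w, h⟩) = F.beta w := rfl
    rw [h3] at h2
    have h4 := mul_le_of_le_one_left (hF.ext_nonneg w) (hF.alpha_mem w).2
    have h5 := mul_le_of_le_one_left hinc (hF.beta_mem w).2
    by_cases hs : F.outLiab w ≤ F.ext w + F.incoming a w
    · rw [assetMap_of_solvent hs] at h1; linarith
    · rw [assetMap_of_not_solvent hs] at h1; linarith
  · exact le_rfl

theorem lift_nonneg {a : V → ℝ} (ha : F.IsClearing a) (w : F.AdjBank) : 0 ≤ F.lift a w := by
  have hinc := hF.incoming_nonneg (fun w => (ha.1 w).1)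
  rcases w with w | u | u
  · unfold lift
    dsimp only
    split_ifs with h
    · have := hF.adjust_lawful.pay_nonneg (.inr (.inr ⟨w, h⟩)) (hinc w)
      have := mul_nonneg (hF.alpha_mem w).1 (hF.ext_nonneg w)
      linarith
    · exact (ha.1 w).1
  · exact hinc _
  · exact hF.adjust_lawful.pay_nonneg _ (hinc _)

end WellFormed

/-! ### Invariants of the algorithm -/

open Classical in
/-- The invariants of the algorithm that do not refer to the current bank. -/
structure Core (s : State F) : Prop where
  b_nonneg : ∀ w, 0 ≤ s.b w
  bx_le : ∀ w, s.bx w ≤ s.ax w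
  balance : ∀ w, s.b w = s.bx w +
    ∑ e ∈ s.live with F.adjust.tgt e = w, F.adjust.pay e (s.b (F.adjust.src e))
  ax_eq : ∀ w, s.ax w = F.adjust.ext w +
    ∑ e with F.adjust.tgt e = w, if e ∈ s.live then 0 else F.adjust.liab e
  outClosed : F.adjust.OutClosed s.live
  removed : ∀ e, e ∉ s.live → ∃ u : F.DefBank, F.adjust.src e = .inl u.1 ∧ F.Solvent s.b u
  le_lift : ∀ a, F.IsClearing a → ∀ w, s.b w ≤ F.lift a w

/-- The invariants of the algorithm. -/
structure Invariant (s : State F) : Prop extends Core s where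
  settled : s.cur = none → ∀ e ∈ s.live, ∀ u : F.DefBank, F.adjust.src e = .inl u.1 →
    ¬ F.Solvent s.b u
  cur_lt : ∀ w, s.cur = some w → s.bx w < s.ax w

theorem mem_settled {s : State F} {e : F.AdjEdge} : e ∈ F.settled s ↔
    e ∈ s.live ∧ ∃ u : F.DefBank, F.adjust.src e = .inl u.1 ∧ F.Solvent s.b u := by
  simp [settled]

theorem solvent_mono {b b' : F.AdjBank → ℝ} {u : F.DefBank} (h : ∀ w, b w ≤ b' w)
    (hs : F.Solvent b u) : F.Solvent b' u := by
  unfold Solvent at *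
  linarith [h (.inr (.inl u))]

namespace WellFormed
variable (hF : F.WellFormed)
include hF

open Classical in
-- Compare edge by edge with `lift_eq`. On a remaining edge of `F` the debtor has at most as much in
-- `lift F a` as in `a`. A removed edge has a debtor solvent at `s.b`, thus at `lift F a` and in
-- `a`, so it contributes its full liability in `a` too, which is exactly the amount that `ax` has
-- absorbed.
theorem lift_super {a : V → ℝ} (ha : F.IsClearing a) {s : State F} (hs : Core s)
    (w : F.AdjBank) : s.ax w + ∑ e ∈ s.live with F.adjust.tgt e = w,
      F.adjust.pay e (F.lift a (F.adjust.src e)) ≤ F.lift a w := by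
  rw [hF.lift_eq ha w, hs.ax_eq w, add_assoc]
  refine add_le_add_right ?_ _
  have h1 : ∑ e ∈ s.live with F.adjust.tgt e = w, F.adjust.pay e (F.lift a (F.adjust.src e)) =
      ∑ e with F.adjust.tgt e = w,
        if e ∈ s.live then F.adjust.pay e (F.lift a (F.adjust.src e)) else 0 := by
    rw [← Finset.sum_filter]
    refine Finset.sum_congr ?_ fun _ _ => rfl
    ext e; simp [and_comm]
  rw [h1, ← Finset.sum_add_distrib]
  refine Finset.sum_le_sum fun e _ => ?_
  by_cases he : e ∈ s.live
  · rw [if_pos he, if_pos he, zero_add]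
    rcases e with e | x
    · exact hF.pay_mono' e (hF.lift_nonneg ha _) (hF.lift_le ha (F.src e))
    · rw [adjust_src_aux]
      exact le_rfl
  · rw [if_neg he, if_neg he, add_zero]
    obtain ⟨u, hu, hsol⟩ := hs.removed e he
    rcases e with e | x
    · have hu' : F.src e = u.1 := by simpa [adjust] using hu
      have h2 : F.outLiab u.1 ≤ F.ext u.1 + F.incoming a u.1 := by
        have := hs.le_lift a ha (.inr (.inl u))
        unfold Solvent at hsol
        simp only [lift] at this
        linarith
      have h3 := congrFun ha.2 u.1
      rw [assetMap_of_solvent h2] at h3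
      have h4 : F.pay e (a (F.src e)) = F.liab e := hF.pay_full e (ha.1 _).1 (by rw [hu']; linarith)
      simp only [liftPay]
      rw [h4]
      exact le_rfl
    · rw [adjust_src_aux] at hu
      simp at hu

open Classical in
-- Settling moves the current payments from the edge sum into `bx`, which keeps the balance; the gap
-- `ax - bx` grows by liability minus payment, which is non-negative.
theorem core_settle {s : State F} (hs : Core s) : Core (F.settle s) ∧
    ∀ e ∈ (F.settle s).live, ∀ u : F.DefBank, F.adjust.src e = .inl u.1 →
      ¬ F.Solvent (F.settle s).b u := by
  have hsub : F.settled s ⊆ s.live := fun e he => (mem_settled.1 he).1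
  refine ⟨⟨hs.b_nonneg, fun w => ?_, fun w => ?_, fun w => ?_, ?_, ?_, hs.le_lift⟩, ?_⟩
  · exact add_le_add (hs.bx_le w) (Finset.sum_le_sum fun e _ =>
      hF.adjust_lawful.pay_le e _ (hs.b_nonneg _))
  · have h1 : ∑ e ∈ s.live with F.adjust.tgt e = w, F.adjust.pay e (s.b (F.adjust.src e)) =
        ∑ e ∈ F.settled s with F.adjust.tgt e = w, F.adjust.pay e (s.b (F.adjust.src e)) +
        ∑ e ∈ s.live \ F.settled s with F.adjust.tgt e = w,
          F.adjust.pay e (s.b (F.adjust.src e)) := by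
      rw [add_comm, Finset.sum_filter, Finset.sum_filter, Finset.sum_filter,
        Finset.sum_sdiff hsub]
    simp only [settle]
    rw [hs.balance w, h1]
    ring
  · simp only [settle]
    rw [hs.ax_eq w, add_assoc]
    congr 1
    have h1 : ∑ e ∈ F.settled s with F.adjust.tgt e = w, F.adjust.liab e =
        ∑ e with F.adjust.tgt e = w, if e ∈ F.settled s then F.adjust.liab e else 0 := by
      rw [← Finset.sum_filter]
      refine Finset.sum_congr ?_ fun _ _ => rfl
      ext e; simp [and_comm]
    rw [h1, ← Finset.sum_add_distrib]
    refine Finset.sum_congr rfl fun e _ => ?_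
    by_cases h2 : e ∈ F.settled s
    · simp [h2, hsub h2]
    · by_cases h3 : e ∈ s.live <;> simp [h2, h3]
  · intro e e' h he
    simp only [settle, Finset.mem_sdiff, mem_settled, not_and] at he ⊢
    refine ⟨hs.outClosed e e' h he.1, fun _ => ?_⟩
    rw [← h]
    exact he.2 he.1
  · intro e he
    simp only [settle, Finset.mem_sdiff, not_and, not_not] at he
    by_cases h : e ∈ s.live
    · exact (mem_settled.1 (he h)).2
    · exact hs.removed e h
  · intro e he u hu hsol
    simp only [settle, Finset.mem_sdiff, mem_settled, not_and] at he
    exact he.2 he.1 ⟨u, hu, hsol⟩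

open Classical in
theorem invariant_init : Invariant F.init := by
  have h0 : Core (F := F) { live := Finset.univ, ax := F.adjust.ext, bx := 0, b := 0, cur := none } := by
    refine ⟨fun _ => le_rfl, fun w => ?_, fun w => ?_, fun w => ?_, fun _ _ _ _ => Finset.mem_univ _,
      fun e he => absurd (Finset.mem_univ e) he, fun a ha w => hF.lift_nonneg ha w⟩
    · rcases w with w | w
      · simp only [adjust, Pi.zero_apply]
        have := hF.ext_nonneg w
        have := mul_nonneg (hF.alpha_mem w).1 (hF.ext_nonneg w)
        split_ifs <;> assumption
      · exact le_rfl
    · simp [hF.adjust_lawful.pay_zero]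
    · simp
  obtain ⟨h1, h2⟩ := hF.core_settle h0
  exact ⟨h1, fun _ => h2, fun w h => by simp [init, settle] at h⟩

open Classical in
-- The part common to floodings and increases: along a direction that respects the borders of active
-- edges all remaining payments are linear, so a solution of the linearized equation preserves the
-- balance.
theorem core_add {s : State F} (hs : Core s) {bx' : F.AdjBank → ℝ} (hx : ∀ w, bx' w ≤ s.ax w)
    {d : F.AdjBank → ℝ} (hd : ∀ w, 0 ≤ d w)
    (hdb : ∀ e ∈ F.adjust.activeEdges s.live s.b,
      ((d (F.adjust.src e) : ℝ) : WithTop ℝ) ≤ F.adjust.toBorder e (s.b (F.adjust.src e)))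
    (heq : ∀ w, d w = bx' w - s.bx w +
      ∑ e ∈ (F.adjust.activeEdges s.live s.b).filter (fun e => F.adjust.tgt e = w),
        F.adjust.slopeAt e (s.b (F.adjust.src e)) * d (F.adjust.src e))
    (hle : ∀ a, F.IsClearing a → ∀ w, s.b w + d w ≤ F.lift a w) (c : Option F.AdjBank) :
    Core { s with bx := bx', b := s.b + d, cur := c } where
  b_nonneg := fun w => add_nonneg (hs.b_nonneg w) (hd w)
  bx_le := hx
  balance := fun w => by
    have h1 := hF.adjust_lawful.sum_pay_add hs.b_nonneg hs.outClosed hd hdb w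
    simp only [Pi.add_apply]
    rw [h1, hs.balance w]
    linarith [heq w]
  ax_eq := hs.ax_eq
  outClosed := hs.outClosed
  removed := fun e he => by
    obtain ⟨u, h1, h2⟩ := hs.removed e he
    exact ⟨u, h1, solvent_mono (fun w => le_add_of_nonneg_right (hd w)) h2⟩
  le_lift := hle

theorem core_flood {s : State F} (hs : Core s) {v : F.AdjBank} (hv : s.bx v < s.ax v)
    {C : Set F.AdjBank} (hC : F.adjust.Floods s.live s.b v C) {d : F.AdjBank → ℝ}
    (hd : F.adjust.FloodFeasible s.live s.b C d) (c : Option F.AdjBank) :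
    Core { s with b := s.b + d, cur := c } := by
  classical
  have hG := hF.adjust_lawful
  refine hF.core_add hs hs.bx_le (fun i => ?_) (fun e he => ?_) (fun w => ?_) (fun a ha w => ?_) c
  · by_cases hi : i ∈ C
    · exact hd.2.2.2 i hi
    · rw [hd.1 i hi]
  · by_cases hi : F.adjust.src e ∈ C
    · exact hd.2.2.1 _ hi e he rfl
    · rw [hd.1 _ hi]
      exact (F.adjust.toBorder_pos e _).le
  · rw [sub_self, zero_add, ← sum_kernel_eq_sum_active (P := (· ∈ C)) hd.1]
    exact Lawful.floodFeasible_eq_kernel hd hC.2.2.1 hG.slope_nonneg w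
  · exact hG.flood_le hs.b_nonneg (hs.le_lift a ha) hs.bx_le hs.balance (hF.lift_super ha hs)
      hv hC hd w

open Classical in
theorem core_increase {s : State F} (hs : Core s) {v : F.AdjBank}
    (hC : ∀ C, ¬ F.adjust.Floods s.live s.b v C) {δ : ℝ} {d : F.AdjBank → ℝ}
    (hd : F.adjust.IncFeasible s.live s.b v (s.ax v - s.bx v) δ d)
    (c : Option F.AdjBank) :
    Core { s with bx := Function.update s.bx v (s.bx v + δ), b := s.b + d, cur := c } := by
  have hG := hF.adjust_lawful
  refine hF.core_add hs (fun w => ?_) hd.2.2.2.2 (fun e he => hd.2.2.1 _ e he rfl)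
    (fun w => ?_) (fun a ha w => ?_) c
  · by_cases hw : w = v
    · subst hw
      rw [Function.update_self]
      linarith [hd.2.2.2.1]
    · rw [Function.update_of_ne hw]
      exact hs.bx_le w
  · rw [← sum_kernel_eq_sum_active (P := F.adjust.Reach s.live s.b v) hd.2.1,
      hG.incFeasible_eq hd w]
    congr 1
    by_cases hw : w = v
    · subst hw; simp
    · simp [hw]
  · exact hG.increase_le hs.b_nonneg (hs.le_lift a ha) hs.bx_le hs.balance (hF.lift_super ha hs)
      hC hd w

theorem invariant_step {s s' : State F} (h : F.Step s s') (hs : Invariant s) : Invariant s' := by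
  classical
  cases h with
  | select w hcur hw =>
    refine ⟨⟨hs.b_nonneg, hs.bx_le, hs.balance, hs.ax_eq, hs.outClosed, hs.removed, hs.le_lift⟩,
      fun h => by simp at h, fun w' h => ?_⟩
    simp only [Option.some.injEq] at h
    exact h ▸ hw
  | flood w C d hcur hC hd =>
    refine ⟨hF.core_flood hs.toCore (hs.cur_lt w hcur) hC hd.1 s.cur, fun h => ?_, hs.cur_lt⟩
    rw [hcur] at h
    simp at h
  | increase w δ d hcur hC hd =>
    obtain ⟨h1, h2⟩ := hF.core_settle (hF.core_increase hs.toCore hC hd.1 none)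
    refine ⟨?_, fun _ => ?_, fun w h => by simp [settle] at h⟩
    · convert h1
    · convert h2

/-! ### Progress -/

/-- The algorithm is never stuck. -/
theorem exists_step {s : State F} (hs : Invariant s) (hf : ¬ Final s) : ∃ s', F.Step s s' := by
  cases hcur : s.cur with
  | none =>
    unfold Final at hf
    push Not at hf
    obtain ⟨w, hw⟩ := hf hcur
    exact ⟨_, .select s w hcur hw⟩
  | some w =>
    have hG := hF.adjust_lawful
    by_cases hC : ∃ C, F.adjust.Floods s.live s.b w C
    · obtain ⟨C, hC⟩ := hC
      obtain ⟨d, hd, _⟩ := hG.exists_floodOptimal_hit hs.b_nonneg hs.outClosed hC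
      exact ⟨_, .flood s w C d hcur hC hd⟩
    · push Not at hC
      obtain ⟨δ, d, hd⟩ := hG.exists_incOptimal hs.b_nonneg
        (sub_pos.2 (hs.cur_lt w hcur)) hC
      exact ⟨_, .increase s w δ d hcur hC hd⟩

end WellFormed

/-- the number of borders that have been passed -/
noncomputable def passed (b : F.AdjBank → ℝ) : ℕ :=
  ∑ e, F.adjust.interval e (b (F.adjust.src e))

open Classical in
/-- the number of pending banks and remaining edges -/
noncomputable def pending (s : State F) : ℕ :=
  (Finset.univ.filter fun w => s.bx w < s.ax w).card + s.live.card

open Classical in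
/-- a bound for the number of remaining steps -/
noncomputable def remaining (s : State F) : ℕ :=
  -- A selection is paid by the last summand. An increase gives that `1` back, which is why each
  -- unit of progress counts `2`.
  2 * (F.adjust.totalBorders - passed s.b + pending s) + if s.cur = none then 1 else 0

theorem passed_le (b : F.AdjBank → ℝ) : passed b ≤ F.adjust.totalBorders :=
  Finset.sum_le_sum fun e _ => F.adjust.interval_le_numBorders e _

theorem passed_mono {b b' : F.AdjBank → ℝ} (h : ∀ w, b w ≤ b' w) : passed b ≤ passed b' :=
  Finset.sum_le_sum fun e _ => F.adjust.interval_mono e (h _)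

open Classical in
-- A bank can become pending only as the creditor of a removed edge, so new pending banks are paid
-- for by removed edges.
theorem pending_settle (s : State F) : pending (F.settle s) ≤ pending s := by
  unfold pending
  have h1 : (Finset.univ.filter fun w => (F.settle s).bx w < (F.settle s).ax w) ⊆
      (Finset.univ.filter fun w => s.bx w < s.ax w) ∪ (F.settled s).image F.adjust.tgt := by
    intro w hw
    simp only [Finset.mem_union, Finset.mem_filter, Finset.mem_univ, true_and, Finset.mem_image]
    by_contra hc
    push Not at hc
    have hw := (Finset.mem_filter.1 hw).2
    simp only [settle] at hw
    have : (F.settled s).filter (fun e => F.adjust.tgt e = w) = ∅ :=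
      Finset.filter_eq_empty_iff.2 fun e he => hc.2 e he
    rw [this] at hw
    simp only [Finset.sum_empty, add_zero] at hw
    linarith [hc.1]
  have h2 := (Finset.card_le_card h1).trans (Finset.card_union_le _ _)
  have h3 : ((F.settled s).image F.adjust.tgt).card ≤ (F.settled s).card := Finset.card_image_le
  have hsub : F.settled s ⊆ s.live := fun e he => (mem_settled.1 he).1
  have h4 : (F.settle s).live.card = s.live.card - (F.settled s).card := by
    simp only [settle]
    rw [Finset.card_sdiff_of_subset hsub]
  have h5 := Finset.card_le_card hsub
  omega

theorem passed_lt {b d : F.AdjBank → ℝ} (hF : F.WellFormed) (hb : ∀ w, 0 ≤ b w) (hd : ∀ w, 0 ≤ d w)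
    {e : F.AdjEdge} (he : ((d (F.adjust.src e) : ℝ) : WithTop ℝ) =
      F.adjust.toBorder e (b (F.adjust.src e))) : passed b < passed (b + d) :=
  Finset.sum_lt_sum
    (fun e _ => F.adjust.interval_mono e (le_add_of_nonneg_right (hd _)))
    ⟨e, Finset.mem_univ e, interval_lt_of_toBorder_eq (hF.adjust_border_zero e) (hb _) he⟩

/-- Every step decreases the bound, and does so by the number of borders that it passes. -/
theorem WellFormed.remaining_step (hF : F.WellFormed) {s s' : State F} (h : F.Step s s')
    (hs : Invariant s) : passed s.b ≤ passed s'.b ∧ remaining s' + 1 ≤ remaining s ∧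
      remaining s' + (passed s'.b - passed s.b) ≤ remaining s := by
  classical
  have hG := hF.adjust_lawful
  cases h with
  | select w hcur hw =>
    have : pending { s with cur := some w } = pending s := rfl
    simp only [remaining, hcur, this, if_true, reduceCtorEq, if_false]
    omega
  | flood w C d hcur hC hd =>
    obtain ⟨_, _, h1⟩ := hG.exists_floodOptimal_hit hs.b_nonneg hs.outClosed hC
    obtain ⟨e, _, he⟩ := h1 d hd
    have hd0 : ∀ w, 0 ≤ d w := fun i => by
      by_cases hi : i ∈ C
      · exact hd.1.2.2.2 i hi
      · rw [hd.1.1 i hi]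
    have h2 := passed_lt hF hs.b_nonneg hd0 he
    have h3 := passed_le (F := F) (s.b + d)
    have hr : remaining { s with b := s.b + d } = 2 * (F.adjust.totalBorders - passed (s.b + d) +
      pending s) + if s.cur = none then 1 else 0 := rfl
    rw [hr, remaining, if_neg (by rw [hcur]; simp)]
    dsimp only
    omega
  | increase w δ d hcur hC hd =>
    obtain ⟨h0, h1⟩ := hG.incOptimal_hit hs.b_nonneg (sub_pos.2 (hs.cur_lt w hcur)) hC hd
    set s₁ : State F :=
      { s with bx := Function.update s.bx w (s.bx w + δ), b := s.b + d, cur := none } with hs₁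
    have h2 : pending (F.settle s₁) ≤ pending s₁ := pending_settle s₁
    have hsub : (Finset.univ.filter fun w => s₁.bx w < s₁.ax w) ⊆
        Finset.univ.filter fun w => s.bx w < s.ax w := by
      intro x hx
      simp only [Finset.mem_filter, Finset.mem_univ, true_and, hs₁] at hx ⊢
      by_cases hxw : x = w
      · subst hxw; exact hs.cur_lt x hcur
      · rwa [Function.update_of_ne hxw] at hx
    have h3 : pending s₁ ≤ pending s := Nat.add_le_add_right (Finset.card_le_card hsub) _
    have h4 := passed_mono (F := F) (b := s.b) (b' := s.b + d)
      fun x => le_add_of_nonneg_right (hd.1.2.2.2.2 x)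
    have h5 := passed_le (F := F) (s.b + d)
    -- If the increase exhausts the gap, its bank stops being pending; otherwise some active edge
    -- reaches its next border.
    have h6 : passed s.b < passed (s.b + d) ∨ pending s₁ < pending s := by
      rcases h1 with h1 | ⟨e, _, he⟩
      · right
        refine Nat.add_lt_add_right (Finset.card_lt_card ?_) _
        rw [Finset.ssubset_iff_of_subset hsub]
        refine ⟨w, by simpa using hs.cur_lt w hcur, ?_⟩
        simp [hs₁, h1]
      · left
        exact passed_lt hF hs.b_nonneg hd.1.2.2.2.2 he
    have h7 : (F.settle s₁).b = s.b + d := rfl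
    have h8 : (F.settle s₁).cur = none := rfl
    have h9 : s.cur ≠ none := by rw [hcur]; simp
    suffices passed s.b ≤ passed (F.settle s₁).b ∧ remaining (F.settle s₁) + 1 ≤ remaining s ∧
      remaining (F.settle s₁) + (passed (F.settle s₁).b - passed s.b) ≤ remaining s by
      convert this
    simp only [remaining, h7, h8, if_true, if_neg h9]
    omega

theorem card_defBank_le : Fintype.card F.DefBank ≤ Fintype.card V :=
  Fintype.card_le_of_injective (fun u => u.1) Subtype.val_injective

theorem adjust_totalBorders_le :
    F.adjust.totalBorders ≤ F.totalBorders + 2 * Fintype.card V := by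
  unfold totalBorders
  rw [Fintype.sum_sum_type]
  simp only [adjust_numBorders_aux, Finset.sum_const, Finset.card_univ, Fintype.card_sum, smul_eq_mul,
    mul_one]
  have := card_defBank_le (F := F)
  have h : ∑ e, F.adjust.numBorders (.inl e) = ∑ e, F.numBorders e := rfl
  rw [h]
  omega

/-- The `7` is `2 + 3 + 2`: at most two extra borders, three banks and two extra edges of the
adjusted network for each bank of `F`. -/
theorem remaining_le (s : State F) : remaining s ≤
    1 + 2 * (F.totalBorders + 7 * Fintype.card V + Fintype.card E) := by
  classical
  have h1 := adjust_totalBorders_le (F := F)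
  have h2 : (Finset.univ.filter fun w => s.bx w < s.ax w).card ≤ Fintype.card F.AdjBank :=
    Finset.card_le_univ _
  have h3 : s.live.card ≤ Fintype.card F.AdjEdge := Finset.card_le_univ _
  have h4 := card_defBank_le (F := F)
  simp only [Fintype.card_sum] at h2 h3
  have h5 : pending s ≤ 5 * Fintype.card V + Fintype.card E := by
    unfold pending
    calc _ ≤ _ := Nat.add_le_add (le_of_eq (by congr)) le_rfl
      _ ≤ _ := Nat.add_le_add h2 h3
      _ ≤ _ := by omega
  unfold remaining
  split_ifs <;> omega

theorem IsRun.invariant (hF : F.WellFormed) {N : ℕ} {s : ℕ → State F} (h : F.IsRun N s) :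
    ∀ i ≤ N, Invariant (s i) ∧ remaining (s i) + i ≤ remaining (s 0) := by
  intro i
  induction i with
  | zero => exact fun _ => ⟨h.1 ▸ hF.invariant_init, le_rfl⟩
  | succ i ih =>
    intro hi
    obtain ⟨h1, h2⟩ := ih (by omega)
    have hstep := h.2 i (by omega)
    have := (hF.remaining_step hstep h1).2.1
    exact ⟨hF.invariant_step hstep h1, by omega⟩

theorem IsRun.length_le (hF : F.WellFormed) {N : ℕ} {s : ℕ → State F} (h : F.IsRun N s) :
    N ≤ 16 * (F.totalBorders + Fintype.card V + Fintype.card E) := by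
  rcases Nat.eq_zero_or_pos N with h0 | h0
  · omega
  · have h1 := (h.invariant hF N le_rfl).2
    have h2 := remaining_le (s 0)
    -- A step involves a bank, so `V` is non-empty and the additive `1` in `remaining_le` is
    -- absorbed by the constant.
    have h3 : 1 ≤ Fintype.card V := by
      have : Nonempty F.AdjBank := by
        have hstep := h.2 0 h0
        generalize s 0 = t, s (0 + 1) = t' at hstep
        cases hstep with
        | select w => exact ⟨w⟩
        | flood w => exact ⟨w⟩
        | increase w => exact ⟨w⟩
      rw [Nat.succ_le_iff, Fintype.card_pos_iff]
      obtain ⟨w | u | u⟩ := this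
      exacts [⟨w⟩, ⟨u.1⟩, ⟨u.1⟩]
    omega

/-! ### Correctness of the output -/

namespace WellFormed
variable (hF : F.WellFormed) {s : State F} (hs : Invariant s) (hf : Final s)
include hF hs hf

theorem live_iff {e : E} : .inl e ∈ s.live ↔
    ¬ ∃ u : F.DefBank, F.src e = u.1 ∧ F.Solvent s.b u := by
  constructor
  · rintro h ⟨u, hu, hsol⟩
    exact hs.settled hf.1 _ h u (congrArg Sum.inl hu) hsol
  · intro h
    by_contra hn
    obtain ⟨u, hu, hsol⟩ := hs.removed _ hn
    exact h ⟨u, by simpa [adjust] using hu, hsol⟩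

open Classical in
-- In a final state the removed edges of `F` are those of solvent banks of `D`. These regain
-- unreduced assets in `result` and pay in full; all other banks keep their entry of `b`.
theorem result_pay (e : E) : F.pay e (F.result s (F.src e)) =
    if .inl e ∈ s.live then F.pay e (s.b (.inl (F.src e))) else F.liab e := by
  have h := hF.live_iff hs hf (e := e)
  unfold result
  split_ifs with h1 h2 h3 h3 h3
  · exact absurd ⟨_, rfl, h2⟩ (h.1 h3)
  · refine hF.pay_full e ?_ h2
    exact add_nonneg (hF.ext_nonneg _) (hs.b_nonneg _)
  · rfl
  · refine absurd (h.2 ?_) h3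
    rintro ⟨u, hu, hsol⟩
    have hu' : (⟨F.src e, h1⟩ : F.DefBank) = u := Subtype.ext hu
    exact h2 (hu' ▸ hsol)
  · rfl
  · refine absurd (h.2 ?_) h3
    rintro ⟨u, hu, hsol⟩
    exact h1 (hu ▸ u.2)

open Classical in
theorem final_b_eq (w : F.AdjBank) : s.b w = F.adjust.ext w + ∑ e with F.adjust.tgt e = w,
    if e ∈ s.live then F.adjust.pay e (s.b (F.adjust.src e)) else F.adjust.liab e := by
  have h1 : s.bx w = s.ax w :=
    le_antisymm (hs.bx_le w) (not_lt.1 fun h => hf.2 ⟨w, h⟩)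
  rw [hs.balance w, h1, hs.ax_eq w, add_assoc]
  congr 1
  have h1 : ∑ e ∈ s.live with F.adjust.tgt e = w, F.adjust.pay e (s.b (F.adjust.src e)) =
      ∑ e with F.adjust.tgt e = w,
        if e ∈ s.live then F.adjust.pay e (s.b (F.adjust.src e)) else 0 := by
    rw [← Finset.sum_filter]
    refine Finset.sum_congr ?_ fun _ _ => rfl
    ext e; simp [and_comm]
  rw [h1, ← Finset.sum_add_distrib]
  refine Finset.sum_congr rfl fun e _ => ?_
  split_ifs <;> simp

theorem final_b_collect (u : F.DefBank) :
    s.b (.inr (.inl u)) = F.incoming (F.result s) u.1 := by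
  classical
  rw [hF.final_b_eq hs hf, sum_adjust_tgt_collect]
  simp only [incoming, hF.result_pay hs hf]
  simp [adjust]

theorem final_b_inl (w : V) (hw : ¬ (F.alpha w < 1 ∨ F.beta w < 1)) :
    s.b (.inl w) = F.ext w + F.incoming (F.result s) w := by
  classical
  rw [hF.final_b_eq hs hf, sum_adjust_tgt_inl _ _ hw]
  simp only [incoming, hF.result_pay hs hf]
  simp only [adjust, if_neg hw]

theorem final_b_defBank (u : F.DefBank) (hsol : ¬ F.Solvent s.b u) : s.b (.inl u.1) =
    F.alpha u.1 * F.ext u.1 + F.beta u.1 * F.incoming (F.result s) u.1 := by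
  classical
  have hlive : (.inr (.inr u) : F.AdjEdge) ∈ s.live := by
    by_contra hn
    obtain ⟨u', hu', _⟩ := hs.removed _ hn
    simp [adjust] at hu'
  rw [hF.final_b_eq hs hf, sum_adjust_tgt_inl_defBank, if_pos hlive, hF.adjust_pay_aux_eq]
  have h1 : F.adjust.src (.inr (.inr u)) = .inr (.inl u) := rfl
  have h2 : F.adjust.ext (.inl u.1) = F.alpha u.1 * F.ext u.1 := if_pos u.2
  have hb := hs.b_nonneg (.inr (.inl u))
  have he := hF.ext_nonneg u.1
  unfold Solvent at hsol
  rw [h1, h2, ← hF.final_b_collect hs hf u]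
  -- External assets are non-negative, so insolvency leaves `u_s` with less than the liabilities of
  -- `u`. Its proportional payment is then not capped and equals `beta u` times its assets.
  have h3 : ¬ F.outLiab (F.auxBank (.inr u)).1 ≤ s.b (.inr (.inl u)) := by
    simp only [auxBank]; intro h; linarith
  have h4 : F.outLiab (F.auxBank (.inr u)).1 ≠ 0 := by
    simp only [auxBank]; intro h; linarith
  rw [if_neg h3, if_neg h4]
  rfl

/-- By `final_b_collect` each `u_s` holds precisely what `u` receives under `result`, so the
solvency test of the algorithm and that of `assetMap` agree. -/
theorem isClearing_result : F.IsClearing (F.result s) := by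
  have hres0 : ∀ w, 0 ≤ F.result s w := fun w => by
    unfold result
    split_ifs
    · exact add_nonneg (hF.ext_nonneg _) (hs.b_nonneg _)
    · exact hs.b_nonneg _
    · exact hs.b_nonneg _
  have heq : F.assetMap (F.result s) = F.result s := by
    funext w
    by_cases hw : F.alpha w < 1 ∨ F.beta w < 1
    · have hc := hF.final_b_collect hs hf ⟨w, hw⟩
      by_cases hsol : F.Solvent s.b ⟨w, hw⟩
      · rw [result, dif_pos hw, if_pos hsol, hc, assetMap_of_solvent]
        rw [← hc]
        exact hsol
      · rw [assetMap_of_not_solvent, ← hF.final_b_defBank hs hf ⟨w, hw⟩ hsol, result, dif_pos hw,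
          if_neg hsol]
        rw [← hc]
        exact hsol
    · rw [hF.assetMap_of_not_defBank hw, ← hF.final_b_inl hs hf w hw, result, dif_neg hw]
  refine ⟨fun w => ⟨hres0 w, ?_⟩, heq⟩
  rw [← heq]
  have h1 : F.incoming (F.result s) w ≤ F.inLiab w :=
    Finset.sum_le_sum fun e _ => hF.pay_le_liab e (hres0 _)
  have h2 := hF.incoming_nonneg hres0 w
  have h4 := mul_le_of_le_one_left (hF.ext_nonneg w) (hF.alpha_mem w).2
  have h5 := mul_le_of_le_one_left h2 (hF.beta_mem w).2
  unfold assetMap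
  split_ifs <;> linarith

/-- For an insolvent or undamaged bank combine `le_lift` with `lift_le`. A bank that the algorithm
finds solvent receives at least as much in any clearing state `a`, so it is solvent in `a` and not
reduced there either. -/
theorem isMinimalClearing_result : F.IsMinimalClearing (F.result s) := by
  refine ⟨hF.isClearing_result hs hf, fun a ha w => ?_⟩
  have hle := hs.le_lift a ha
  unfold result
  split_ifs with hw hsol
  · have h1 : s.b (.inr (.inl ⟨w, hw⟩)) ≤ F.incoming a w := hle (.inr (.inl ⟨w, hw⟩))
    have h2 := congrFun ha.2 w
    unfold Solvent at hsol
    dsimp only at hsol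
    rw [assetMap_of_solvent (by linarith)] at h2
    linarith
  · exact (hle _).trans (hF.lift_le ha w)
  · exact (hle _).trans (hF.lift_le ha w)

end WellFormed
end Network

theorem runs_correct : ∃ c : ℕ, ∀ (V : Type) (E : Type) [Fintype V] [Fintype E] (F : Network V E),
    F.WellFormed → ∀ (N : ℕ) (s : ℕ → Network.State F), F.IsRun N s →
      N ≤ c * (F.totalBorders + Fintype.card V + Fintype.card E) ∧
      (¬ Network.Final (s N) → ∃ s', F.Step (s N) s') ∧
      (Network.Final (s N) → F.IsMinimalClearing (F.result (s N))) :=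
  ⟨16, fun _ _ _ _ _ hF N _ h => ⟨h.length_le hF, hF.exists_step (h.invariant hF N le_rfl).1,
    hF.isMinimalClearing_result (h.invariant hF N le_rfl).1⟩⟩

/-! ### The fixed-point map is not continuous from below -/

open Classical in
/-- Bank `0` owes `1` to bank `1`, which owes `1` to bank `0` and loses everything in a default. -/
noncomputable def defaultExample : Network (Fin 2) (Fin 2) where
  src := id
  tgt := fun e => 1 - e
  liab := fun _ => 1
  ext := fun w => if w = 0 then 1 else 0
  alpha := fun _ => 0
  beta := fun _ => 0
  pay := fun _ a => min a 1
  numBorders := fun _ => 1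
  border := fun _ i => i
  slope := fun _ i => if i = 0 then 1 else 0

theorem outEdges_defaultExample (w : Fin 2) : defaultExample.outEdges w = {w} := by
  ext e; rw [Network.mem_outEdges]; simp [defaultExample]

theorem inEdges_defaultExample (w : Fin 2) : defaultExample.inEdges w = {1 - w} := by
  ext e
  rw [Network.mem_inEdges]
  simp only [defaultExample, Finset.mem_singleton]
  revert e w; decide

theorem outLiab_defaultExample (w : Fin 2) : defaultExample.outLiab w = 1 := by
  rw [Network.outLiab, outEdges_defaultExample]; simp [defaultExample]

theorem defaultExample_wellFormed : defaultExample.WellFormed where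
  no_loops := by simp only [defaultExample]; decide
  no_multi := fun e e' h _ => h
  liab_nonneg := by simp [defaultExample]
  ext_nonneg := by intro w; simp only [defaultExample]; split_ifs <;> norm_num
  alpha_mem := by simp [defaultExample]
  beta_mem := by simp [defaultExample]
  one_le_numBorders := by simp [defaultExample]
  border_zero := by simp [defaultExample]
  border_lt := by intro e i _; simp [defaultExample]
  border_last := by intro e; rw [outLiab_defaultExample]; simp [defaultExample]
  slope_nonneg := by intro e i _; simp only [defaultExample]; split_ifs <;> norm_num
  pay_piece := by
    intro e i a hi h1 h2
    have : i = 0 := by simpa [defaultExample] using hi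
    subst this
    simp only [defaultExample, Nat.cast_zero, zero_add, Nat.cast_one] at *
    rw [min_eq_left h2.le]; simp
  pay_last := by
    intro e a h
    simp only [defaultExample, Nat.cast_one] at *
    rw [min_eq_right h]; simp
  pay_mem := by intro e a h; simp only [defaultExample]; exact ⟨le_min h.le zero_le_one, min_le_right _ _⟩
  pay_mono := by intro e a ε _ h; simp only [defaultExample]; exact min_le_min_right _ (by linarith)
  no_fraud := by
    intro w a _
    rw [outLiab_defaultExample, outEdges_defaultExample]; simp [defaultExample]

/-- Let both banks have `1 - 1 / (i + 1)`. Bank `1` then receives less than its liability `1` and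
keeps nothing; in the limit it receives `1` and keeps all of it. -/
theorem defaultExample_not_continuousFromBelow : ¬ defaultExample.ContinuousFromBelow := by
  intro h
  have hin : ∀ a : Fin 2 → ℝ, defaultExample.incoming a 1 = min (a 0) 1 := by
    intro a
    rw [Network.incoming, inEdges_defaultExample]
    simp [defaultExample]
  have hL : ∀ w, defaultExample.inLiab w = 1 := by
    intro w
    rw [Network.inLiab, inEdges_defaultExample]; simp [defaultExample]
  have hext : ∀ w, 0 ≤ defaultExample.ext w := defaultExample_wellFormed.ext_nonneg
  have hspace : ∀ x : ℝ, 0 ≤ x → x ≤ 1 → (fun _ => x) ∈ defaultExample.assetSpace :=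
    fun x h0 h1 w => ⟨h0, by rw [hL]; linarith [hext w]⟩
  have hpos : ∀ i : ℕ, (0 : ℝ) < 1 / ((i : ℝ) + 1) := fun i => Nat.one_div_pos_of_nat
  have hle : ∀ i : ℕ, 1 / ((i : ℝ) + 1) ≤ 1 := fun i => by
    rw [div_le_one (by positivity)]; linarith [Nat.cast_nonneg (α := ℝ) i]
  have h1 := h (fun i _ => 1 - 1 / ((i : ℝ) + 1)) (fun _ => 1)
    (fun i j hij w => sub_le_sub_left (Nat.one_div_le_one_div hij) _)
    (fun i => hspace _ (by linarith [hle i]) (by linarith [hpos i]))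
    (hspace 1 zero_le_one le_rfl)
    (tendsto_pi_nhds.2 fun _ => by
      simpa using (tendsto_one_div_add_atTop_nhds_zero_nat (𝕜 := ℝ)).const_sub 1)
  have h2 := (tendsto_pi_nhds.1 h1) 1
  have h3 : ∀ i : ℕ, defaultExample.assetMap (fun _ => 1 - 1 / ((i : ℝ) + 1)) 1 = 0 := fun i => by
    rw [Network.assetMap_of_not_solvent]
    · simp [defaultExample]
    · rw [outLiab_defaultExample, hin, not_le]
      have : defaultExample.ext 1 = 0 := by simp [defaultExample]
      rw [this, zero_add]
      exact (min_le_left _ _).trans_lt (by linarith [hpos i])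
  have h4 : defaultExample.assetMap (fun _ => 1) 1 = 1 := by
    have : defaultExample.ext 1 = 0 := by simp [defaultExample]
    rw [Network.assetMap_of_solvent] <;> simp [hin, outLiab_defaultExample, this]
  simp only [h3, h4] at h2
  exact zero_ne_one (tendsto_nhds_unique tendsto_const_nhds h2)

end Clearing

/-! ### Big-step semantics and a calculus of running times for the machine. -/

namespace Clearing

/-! ### Verification of programs -/

@[simp] theorem Store.nat_writeNat (σ : Store) (a i j v a' i' j' : ℕ) :
    (σ.writeNat a i j v).nat a' i' j' = if a' = a ∧ i' = i ∧ j' = j then v else σ.nat a' i' j' := rfl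

@[simp] theorem Store.real_writeNat (σ : Store) (a i j v : ℕ) :
    (σ.writeNat a i j v).real = σ.real := rfl

@[simp] theorem Store.nat_writeReal (σ : Store) (a i j : ℕ) (v : ℝ) :
    (σ.writeReal a i j v).nat = σ.nat := rfl

@[simp] theorem Store.real_writeReal (σ : Store) (a i j : ℕ) (v : ℝ) (a' i' j' : ℕ) :
    (σ.writeReal a i j v).real a' i' j' =
      if a' = a ∧ i' = i ∧ j' = j then v else σ.real a' i' j' := rfl

attribute [simp] NExp.eval RExp.eval Test.Holds

namespace Program

/-- Does the program write the array of natural numbers? -/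
def writesNat : Program → ℕ → Bool
  | .setNat arr _ _ _, a => a == arr
  | .setReal _ _ _ _, _ => false
  | .seq p q, a => p.writesNat a || q.writesNat a
  | .ite _ p q, a => p.writesNat a || q.writesNat a
  | .while _ p, a => p.writesNat a

/-- Does the program write the array of reals? -/
def writesReal : Program → ℕ → Bool
  | .setNat _ _ _ _, _ => false
  | .setReal arr _ _ _, a => a == arr
  | .seq p q, a => p.writesReal a || q.writesReal a
  | .ite _ p q, a => p.writesReal a || q.writesReal a
  | .while _ p, a => p.writesReal a

/-- The program contains no loop. -/
def loopFree : Program → Bool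
  | .setNat _ _ _ _ => true
  | .setReal _ _ _ _ => true
  | .seq p q => p.loopFree && q.loopFree
  | .ite _ p q => p.loopFree && q.loopFree
  | .while _ _ => false

/-- a bound for the running time of a program without loops -/
def cost : Program → ℕ
  | .setNat _ _ _ _ => 1
  | .setReal _ _ _ _ => 1
  | .seq p q => p.cost + q.cost + 1
  | .ite _ p q => p.cost + q.cost + 1
  | .while _ _ => 0

open Classical in
/-- the effect of a program without loops -/
noncomputable def exec : Program → Store → Store
  | .setNat arr i j val, σ => σ.writeNat arr (i.eval σ) (j.eval σ) (val.eval σ)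
  | .setReal arr i j val, σ => σ.writeReal arr (i.eval σ) (j.eval σ) (val.eval σ)
  | .seq p q, σ => q.exec (p.exec σ)
  | .ite t p q, σ => if t.Holds σ then p.exec σ else q.exec σ
  | .while _ _, σ => σ

/-- `for c < N do body`, where the counter is the cell `(0, 0)` of the array `c` -/
def forN (c : ℕ) (N : NExp) (body : Program) : Program :=
  .seq (.setNat c (.const 0) (.const 0) (.const 0))
    (.while (.natLt (.cell c (.const 0) (.const 0)) N)
      (.seq body (.setNat c (.const 0) (.const 0)
        (.add (.cell c (.const 0) (.const 0)) (.const 1)))))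

end Program

open Program

/-- Big-step semantics with running times. -/
inductive Big : Program → Store → Store → ℕ → Prop
  | setNat (arr : ℕ) (i j val : NExp) (σ : Store) :
      Big (.setNat arr i j val) σ (σ.writeNat arr (i.eval σ) (j.eval σ) (val.eval σ)) 1
  | setReal (arr : ℕ) (i j : NExp) (val : RExp) (σ : Store) :
      Big (.setReal arr i j val) σ (σ.writeReal arr (i.eval σ) (j.eval σ) (val.eval σ)) 1
  | seq {p q : Program} {σ σ₁ σ₂ : Store} {t₁ t₂ : ℕ} (hp : Big p σ σ₁ t₁) (hq : Big q σ₁ σ₂ t₂) :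
      Big (.seq p q) σ σ₂ (t₁ + t₂ + 1)
  | iteTrue {t : Test} {p q : Program} {σ σ' : Store} {k : ℕ} (h : t.Holds σ) (hp : Big p σ σ' k) :
      Big (.ite t p q) σ σ' (k + 1)
  | iteFalse {t : Test} {p q : Program} {σ σ' : Store} {k : ℕ} (h : ¬ t.Holds σ)
      (hq : Big q σ σ' k) : Big (.ite t p q) σ σ' (k + 1)
  | whileFalse {t : Test} {p : Program} {σ : Store} (h : ¬ t.Holds σ) : Big (.while t p) σ σ 1
  | whileTrue {t : Test} {p : Program} {σ σ₁ σ₂ : Store} {k₁ k₂ : ℕ} (h : t.Holds σ)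
      (hp : Big p σ σ₁ k₁) (hw : Big (.while t p) σ₁ σ₂ k₂) :
      Big (.while t p) σ σ₂ (k₁ + k₂ + 1)

/-- The remaining program `K` is arbitrary: it is not inspected before `p` is finished. This
generality is what the induction needs and what later allows states in the middle of a run to be
located. -/
theorem Big.iterate_step {p : Program} {σ σ' : Store} {t : ℕ} (h : Big p σ σ' t) :
    ∀ K, step^[t] (p :: K, σ) = (K, σ') := by
  induction h with
  | setNat => intro K; rfl
  | setReal => intro K; rfl
  | seq _ _ ih₁ ih₂ =>
    intro K
    rw [Function.iterate_succ_apply, Nat.add_comm, Function.iterate_add_apply]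
    simp only [step, ih₁, ih₂]
  | iteTrue h _ ih =>
    intro K
    rw [Function.iterate_succ_apply]
    simp only [step, if_pos h, ih]
  | iteFalse h _ ih =>
    intro K
    rw [Function.iterate_succ_apply]
    simp only [step, if_neg h, ih]
  | whileFalse h => intro K; simp [step, h]
  | whileTrue h _ _ ih₁ ih₂ =>
    intro K
    rw [Function.iterate_succ_apply, Nat.add_comm, Function.iterate_add_apply]
    simp only [step, if_pos h, ih₁, ih₂]

/-- `σ'` differs from `σ` only in arrays that `p` writes. -/
def Frame (p : Program) (σ σ' : Store) : Prop :=
  (∀ a, p.writesNat a = false → σ'.nat a = σ.nat a) ∧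
    ∀ a, p.writesReal a = false → σ'.real a = σ.real a

theorem Frame.refl (p : Program) (σ : Store) : Frame p σ σ := ⟨fun _ _ => rfl, fun _ _ => rfl⟩

theorem Frame.trans {p : Program} {σ σ₁ σ₂ : Store} (h₁ : Frame p σ σ₁) (h₂ : Frame p σ₁ σ₂) :
    Frame p σ σ₂ :=
  ⟨fun a h => (h₂.1 a h).trans (h₁.1 a h), fun a h => (h₂.2 a h).trans (h₁.2 a h)⟩

theorem Frame.mono {p q : Program} {σ σ' : Store} (h : Frame p σ σ')
    (hn : ∀ a, q.writesNat a = false → p.writesNat a = false)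
    (hr : ∀ a, q.writesReal a = false → p.writesReal a = false) : Frame q σ σ' :=
  ⟨fun a ha => h.1 a (hn a ha), fun a ha => h.2 a (hr a ha)⟩

theorem or_eq_false_left {a b : Bool} (h : (a || b) = false) : a = false :=
  (Bool.or_eq_false_iff.1 h).1

theorem or_eq_false_right {a b : Bool} (h : (a || b) = false) : b = false :=
  (Bool.or_eq_false_iff.1 h).2

theorem Frame.seq_left {p : Program} (q : Program) {σ σ' : Store} (h : Frame p σ σ') :
    Frame (.seq p q) σ σ' := h.mono (fun _ => or_eq_false_left) (fun _ => or_eq_false_left)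

theorem Frame.seq_right (p : Program) {q : Program} {σ σ' : Store} (h : Frame q σ σ') :
    Frame (.seq p q) σ σ' := h.mono (fun _ => or_eq_false_right) (fun _ => or_eq_false_right)

theorem Big.frame {p : Program} {σ σ' : Store} {t : ℕ} (h : Big p σ σ' t) : Frame p σ σ' := by
  induction h with
  | setNat arr i j val σ =>
    refine ⟨fun a ha => ?_, fun _ _ => rfl⟩
    have : a ≠ arr := by simpa [writesNat] using ha
    funext x y
    simp [this]
  | setReal arr i j val σ =>
    refine ⟨fun _ _ => rfl, fun a ha => ?_⟩
    have : a ≠ arr := by simpa [writesReal] using ha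
    funext x y
    simp [this]
  | seq _ _ ih₁ ih₂ => exact (ih₁.seq_left _).trans (ih₂.seq_right _)
  | iteTrue _ _ ih => exact ih.mono (fun _ => or_eq_false_left) (fun _ => or_eq_false_left)
  | iteFalse _ _ ih => exact ih.mono (fun _ => or_eq_false_right) (fun _ => or_eq_false_right)
  | whileFalse => exact Frame.refl _ _
  | whileTrue _ _ _ ih₁ ih₂ => exact Frame.trans (ih₁.mono (fun _ h => h) (fun _ h => h)) ih₂

/-- `p` terminates from `σ` with a memory and a running time that satisfy `Q`. -/
def WP (p : Program) (σ : Store) (Q : Store → ℕ → Prop) : Prop := ∃ σ' t, Big p σ σ' t ∧ Q σ' t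

theorem WP.conseq {p : Program} {σ : Store} {Q Q' : Store → ℕ → Prop} (h : WP p σ Q)
    (hQ : ∀ σ' t, Frame p σ σ' → Q σ' t → Q' σ' t) : WP p σ Q' := by
  obtain ⟨σ', t, h1, h2⟩ := h
  exact ⟨σ', t, h1, hQ σ' t h1.frame h2⟩

theorem WP.seq {p q : Program} {σ : Store} {Q R : Store → ℕ → Prop} (hp : WP p σ R)
    (hq : ∀ σ₁ t₁, Frame p σ σ₁ → R σ₁ t₁ → WP q σ₁ fun σ₂ t₂ => Q σ₂ (t₁ + t₂ + 1)) :
    WP (.seq p q) σ Q := by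
  obtain ⟨σ₁, t₁, h1, h2⟩ := hp
  obtain ⟨σ₂, t₂, h3, h4⟩ := hq σ₁ t₁ h1.frame h2
  exact ⟨σ₂, _, .seq h1 h3, h4⟩

theorem WP.ite {t : Test} {p q : Program} {σ : Store} {Q : Store → ℕ → Prop}
    (hp : t.Holds σ → WP p σ fun σ' k => Q σ' (k + 1))
    (hq : ¬ t.Holds σ → WP q σ fun σ' k => Q σ' (k + 1)) : WP (.ite t p q) σ Q := by
  by_cases h : t.Holds σ
  · obtain ⟨σ', k, h1, h2⟩ := hp h
    exact ⟨σ', _, .iteTrue h h1, h2⟩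
  · obtain ⟨σ', k, h1, h2⟩ := hq h
    exact ⟨σ', _, .iteFalse h h1, h2⟩

/-- The exact time depends on the branches taken; `cost` adds up both branches and bounds it in any
case. -/
theorem big_exec (p : Program) (h : p.loopFree = true) (σ : Store) :
    ∃ t, t ≤ p.cost ∧ Big p σ (p.exec σ) t := by
  induction p generalizing σ with
  | setNat arr i j val => exact ⟨1, le_rfl, .setNat arr i j val σ⟩
  | setReal arr i j val => exact ⟨1, le_rfl, .setReal arr i j val σ⟩
  | seq p q ihp ihq =>
    simp only [loopFree, Bool.and_eq_true] at h
    obtain ⟨t₁, h1, h2⟩ := ihp h.1 σ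
    obtain ⟨t₂, h3, h4⟩ := ihq h.2 (p.exec σ)
    exact ⟨_, by simp only [cost]; omega, .seq h2 h4⟩
  | ite t p q ihp ihq =>
    simp only [loopFree, Bool.and_eq_true] at h
    unfold exec
    split_ifs with ht
    · obtain ⟨t₁, h1, h2⟩ := ihp h.1 σ
      exact ⟨_, by simp only [cost]; omega, .iteTrue ht h2⟩
    · obtain ⟨t₁, h1, h2⟩ := ihq h.2 σ
      exact ⟨_, by simp only [cost]; omega, .iteFalse ht h2⟩
  | _ => simp [loopFree] at h

theorem WP.exec {p : Program} {σ : Store} {Q : Store → ℕ → Prop} (h : p.loopFree = true)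
    (hQ : ∀ t ≤ p.cost, Q (p.exec σ) t) : WP p σ Q := by
  obtain ⟨t, h1, h2⟩ := big_exec p h σ
  exact ⟨_, t, h2, hQ t h1⟩

/-- The rule for loops with a variant. -/
theorem WP.while {t : Test} {p : Program} {σ₀ : Store} (n : ℕ) (T : ℕ → ℕ) (I : ℕ → Store → Prop)
    (h0 : I 0 σ₀)
    (hs : ∀ i < n, ∀ σ, Frame p σ₀ σ → I i σ →
      t.Holds σ ∧ WP p σ fun σ' k => k ≤ T i ∧ I (i + 1) σ')
    (hn : ∀ σ, Frame p σ₀ σ → I n σ → ¬ t.Holds σ) :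
    WP (.while t p) σ₀ fun σ' k => k ≤ ∑ i ∈ Finset.range n, (T i + 1) + 1 ∧ I n σ' := by
  -- Induction on the number `j` of iterations still to be made; accumulated framing is relative to
  -- the initial memory.
  have key : ∀ j, j ≤ n → ∀ σ, Frame p σ₀ σ → I (n - j) σ →
      WP (.while t p) σ fun σ' k => k ≤ ∑ i ∈ Finset.Ico (n - j) n, (T i + 1) + 1 ∧ I n σ' := by
    intro j
    induction j with
    | zero =>
      intro _ σ hf hI
      exact ⟨σ, 1, .whileFalse (hn σ hf hI), by simp, hI⟩
    | succ j ih =>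
      intro hj σ hf hI
      obtain ⟨h1, σ₁, k₁, h2, h3, h4⟩ := hs (n - (j + 1)) (by omega) σ hf hI
      rw [show n - (j + 1) + 1 = n - j by omega] at h4
      obtain ⟨σ₂, k₂, h5, h6, h7⟩ := ih (by omega) σ₁ (hf.trans h2.frame) h4
      refine ⟨σ₂, _, .whileTrue h1 h2 h5, ?_, h7⟩
      rw [Finset.sum_eq_sum_Ico_succ_bot (by omega), show n - (j + 1) + 1 = n - j by omega]
      omega
  have := key n le_rfl σ₀ (Frame.refl _ _) (by simpa using h0)
  simpa using this

/-- The rule for loops with a counter. -/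
theorem WP.forN {c : ℕ} {N : NExp} {body : Program} {σ₀ : Store} (n : ℕ) (T : ℕ → ℕ)
    (I : ℕ → Store → Prop)
    (hN : ∀ σ, Frame (Program.forN c N body) σ₀ σ → N.eval σ = n)
    (hc : body.writesNat c = false)
    (h0 : I 0 (σ₀.writeNat c 0 0 0))
    (hs : ∀ i < n, ∀ σ, Frame (Program.forN c N body) σ₀ σ → σ.nat c 0 0 = i → I i σ →
      WP body σ fun σ' k => k ≤ T i ∧ I (i + 1) (σ'.writeNat c 0 0 (i + 1))) :
    WP (Program.forN c N body) σ₀ fun σ' k => k ≤ ∑ i ∈ Finset.range n, (T i + 3) + 3 ∧ I n σ' := by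
  have hf0 : Frame (Program.forN c N body) σ₀ (σ₀.writeNat c 0 0 0) :=
    (Big.setNat c (.const 0) (.const 0) (.const 0) σ₀).frame.seq_left _
  refine WP.seq (R := fun σ₁ t => t = 1 ∧ σ₁ = σ₀.writeNat c 0 0 0)
    ⟨_, 1, .setNat _ _ _ _ _, rfl, rfl⟩ ?_
  rintro _ _ - ⟨rfl, rfl⟩
  -- The increment and its sequencing step add `2` to the body and the loop rule adds the test.
  -- Initialization, sequencing and the last, failing test account for the final `3`.
  refine (WP.while n (fun i => T i + 2) (fun i σ => σ.nat c 0 0 = i ∧ I i σ) ⟨by simp, h0⟩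
    (fun i hi σ hf hI => ?_) (fun σ hf hI => ?_)).conseq ?_
  · have hf' := hf0.trans (hf.mono (q := Program.forN c N body)
      (fun _ => or_eq_false_right) (fun _ => or_eq_false_right))
    refine ⟨by simp [hI.1, hN σ hf', hi], ?_⟩
    refine WP.seq (hs i hi σ hf' hI.1 hI.2) ?_
    rintro σ₁ t₁ hf₁ ⟨h1, h2⟩
    have hc' : σ₁.nat c 0 0 = i := by rw [hf₁.1 c hc]; exact hI.1
    refine ⟨_, 1, .setNat _ _ _ _ _, by omega, ?_⟩
    simp only [NExp.eval, hc']
    exact ⟨by simp, h2⟩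
  · have hf' := hf0.trans (hf.mono (q := Program.forN c N body)
      (fun _ => or_eq_false_right) (fun _ => or_eq_false_right))
    simp [hI.1, hN σ hf']
  · rintro σ' k _ ⟨h1, h2⟩
    refine ⟨?_, h2.2⟩
    simp only [add_assoc] at h1 ⊢
    norm_num at h1 ⊢
    omega

/-- The rule for loops with a counter and a uniform bound for the body. -/
theorem WP.forN_const {c : ℕ} {N : NExp} {body : Program} {σ₀ : Store} (n T : ℕ)
    (I : ℕ → Store → Prop)
    (hN : ∀ σ, Frame (Program.forN c N body) σ₀ σ → N.eval σ = n)
    (hc : body.writesNat c = false)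
    (h0 : I 0 (σ₀.writeNat c 0 0 0))
    (hs : ∀ i < n, ∀ σ, Frame (Program.forN c N body) σ₀ σ → σ.nat c 0 0 = i → I i σ →
      WP body σ fun σ' k => k ≤ T ∧ I (i + 1) (σ'.writeNat c 0 0 (i + 1))) :
    WP (Program.forN c N body) σ₀ fun σ' k => k ≤ n * (T + 3) + 3 ∧ I n σ' := by
  refine (WP.forN n (fun _ => T) I hN hc h0 hs).conseq ?_
  rintro σ' k _ ⟨h1, h2⟩
  rw [Finset.sum_const, Finset.card_range, smul_eq_mul] at h1
  exact ⟨h1, h2⟩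

end Clearing

/-! ### Specifications of the subprograms in terms of memory cells. -/

namespace Clearing
open Program

/-! ### Abbreviations for programs -/

infixr:60 " ;; " => Program.seq

/-- a natural-number variable, the cell `(0, 0)` of an array -/
abbrev nv (a : ℕ) : NExp := .cell a (.const 0) (.const 0)
/-- a cell in row `0` -/
abbrev na (a : ℕ) (i : NExp) : NExp := .cell a (.const 0) i
/-- a real variable, the cell `(0, 0)` of an array -/
abbrev rv (a : ℕ) : RExp := .cell a (.const 0) (.const 0)
/-- a cell in row `0` -/
abbrev ra (a : ℕ) (i : NExp) : RExp := .cell a (.const 0) i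
abbrev setNv (a : ℕ) (x : NExp) : Program := .setNat a (.const 0) (.const 0) x
abbrev setNa (a : ℕ) (i x : NExp) : Program := .setNat a (.const 0) i x
abbrev setRv (a : ℕ) (x : RExp) : Program := .setReal a (.const 0) (.const 0) x
abbrev setRa (a : ℕ) (i : NExp) (x : RExp) : Program := .setReal a (.const 0) i x
/-- a test for `0 < x` -/
abbrev isPos (x : NExp) : Test := .natLt (.const 0) x
/-- a program without a relevant effect -/
abbrev skip : Program := setNv 49 (.const 0)

/-! ### Transitive closure -/

/-- Array `24` becomes the reflexive relation and array `25` the zero matrix. -/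
def clearMatrix : Program :=
  forN 40 (nv 30)
    (forN 41 (nv 30)
      (.setReal 25 (nv 40) (nv 41) (.const 0) ;; .setNat 24 (nv 40) (nv 41) (.const 0)) ;;
    .setNat 24 (nv 40) (nv 40) (.const 1))

theorem clearMatrix_spec (σ : Store) (N : ℕ) (hN : σ.nat 30 0 0 = N) :
    WP clearMatrix σ fun σ' t => t ≤ N * (N * 6 + 8) + 3 ∧ ∀ i < N, ∀ j < N,
      σ'.real 25 i j = 0 ∧ σ'.nat 24 i j = if i = j then 1 else 0 := by
  refine (WP.forN_const N (N * 6 + 5) (fun k σ => ∀ i < k, ∀ j < N,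
    σ.real 25 i j = 0 ∧ σ.nat 24 i j = if i = j then 1 else 0) ?_ rfl ?_ ?_).conseq
    fun _ _ _ h => h
  · intro σ' hf; simp [hf.1 30 rfl, hN]
  · intro i hi; omega
  · intro k hk σ₁ hf₁ hc hI
    refine WP.seq (WP.forN_const N 3 (fun l σ => σ.nat 40 0 0 = k ∧ (∀ i < k, ∀ j < N,
      σ.real 25 i j = 0 ∧ σ.nat 24 i j = if i = j then 1 else 0) ∧
      ∀ j < l, σ.real 25 k j = 0 ∧ σ.nat 24 k j = 0) ?_ rfl ?_ ?_) ?_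
    · intro σ' hf; simp [hf.1 30 rfl, hf₁.1 30 rfl, hN]
    · simpa [hc] using hI
    · intro l hl σ₂ hf₂ hc₂ ⟨h1, h2, h3⟩
      refine WP.exec rfl fun t ht => ⟨ht, ?_⟩
      simp [exec, h1, hc₂]
      refine ⟨fun i hi j hj => ?_, fun j hj => ?_⟩
      · simp [hi.ne, h2 i hi j hj]
      · by_cases hjl : j = l
        · simp [hjl]
        · simp [hjl, h3 j (by omega)]
    · rintro σ₂ t₂ hf₂ ⟨ht, h1, h2, h3⟩
      refine WP.exec rfl fun t ht' => ⟨?_, ?_⟩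
      · simp only [cost] at ht'; omega
      · intro i hi j hj
        simp [exec, h1]
        by_cases hik : i = k
        · subst hik
          by_cases hij : i = j
          · subst hij
            simp [h3 i hj]
          · have : j ≠ i := fun h => hij h.symm
            simp [h3 j hj, hij, this]
        · have := h2 i (by omega) j hj
          simp [hik, this]

/-- Warshall's algorithm on array `24` -/
def warshall : Program :=
  forN 40 (nv 30) (forN 41 (nv 30) (forN 42 (nv 30)
    (.ite (.and (isPos (.cell 24 (nv 41) (nv 40))) (isPos (.cell 24 (nv 40) (nv 42))))
      (.setNat 24 (nv 41) (nv 42) (.const 1)) skip)))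

/-- Invariant of the outer loop: all entries are sound, the given entries are kept, and the relation
is closed under paths through an index below `k`. Reflexivity of the input supplies the diagonal. -/
theorem warshall_spec (σ : Store) (N : ℕ) (hN : σ.nat 30 0 0 = N)
    (hrefl : ∀ i < N, 0 < σ.nat 24 i i) :
    WP warshall σ fun σ' t => t ≤ N * (N * (N * 6 + 6) + 6) + 3 ∧ ∀ i < N, ∀ j < N,
      (0 < σ'.nat 24 i j ↔
        Relation.ReflTransGen (fun x y => x < N ∧ y < N ∧ 0 < σ.nat 24 x y) i j) := by
  set r : ℕ → ℕ → Prop := fun x y => x < N ∧ y < N ∧ 0 < σ.nat 24 x y with hr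
  refine (WP.forN_const N (N * (N * 6 + 6) + 3) (fun k σ' =>
    (∀ i < N, ∀ j < N, 0 < σ'.nat 24 i j → Relation.ReflTransGen r i j) ∧
    (∀ i < N, ∀ j < N, 0 < σ.nat 24 i j → 0 < σ'.nat 24 i j) ∧
    (∀ l < k, ∀ i < N, ∀ j < N, 0 < σ'.nat 24 i l → 0 < σ'.nat 24 l j → 0 < σ'.nat 24 i j))
    ?_ rfl ?_ ?_).conseq ?_
  · intro σ' hf; simp [hf.1 30 rfl, hN]
  · refine ⟨fun i hi j hj h => ?_, fun i _ j _ h => h, fun l hl => by omega⟩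
    exact .single ⟨hi, hj, h⟩
  · intro k hk σ₁ hf₁ hc₁ ⟨h1, h2, h3⟩
    -- Round `k` does not change which entries of row `k` and column `k` are positive, so the
    -- condition can refer to the memory at its beginning.
    refine (WP.forN_const N (N * 6 + 3) (fun i σ' => ∀ x < N, ∀ y < N, (0 < σ'.nat 24 x y ↔
      0 < σ₁.nat 24 x y ∨ (x < i ∧ 0 < σ₁.nat 24 x k ∧ 0 < σ₁.nat 24 k y))) ?_ rfl ?_ ?_).conseq ?_
    · intro σ' hf; simp [hf.1 30 rfl, hf₁.1 30 rfl, hN]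
    · intro x _ y _; simp
    · intro i hi σ₂ hf₂ hc₂ hI₂
      refine (WP.forN_const N 3 (fun j σ' => ∀ x < N, ∀ y < N, (0 < σ'.nat 24 x y ↔
        0 < σ₁.nat 24 x y ∨ ((x < i ∨ (x = i ∧ y < j)) ∧ 0 < σ₁.nat 24 x k ∧ 0 < σ₁.nat 24 k y)))
        ?_ rfl ?_ ?_).conseq ?_
      · intro σ' hf; simp [hf.1 30 rfl, hf₁.1 30 rfl, hf₂.1 30 rfl, hN]
      · intro x hx y hy; simpa using hI₂ x hx y hy
      · intro j hj σ₃ hf₃ hc₃ hI₃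
        refine WP.exec rfl fun t ht => ⟨ht, fun x hx y hy => ?_⟩
        have e1 : σ₃.nat 40 0 0 = k := by rw [hf₃.1 40 rfl, hf₂.1 40 rfl, hc₁]
        have e2 : σ₃.nat 41 0 0 = i := by rw [hf₃.1 41 rfl, hc₂]
        have g1 := hI₃ i hi k hk
        have g2 := hI₃ k hk j hj
        have g3 := hI₃ x hx y hy
        simp only [exec, Test.Holds, NExp.eval, e1, e2, hc₃]
        split_ifs with hcond
        · simp
          by_cases hxy : x = i ∧ y = j
          · grind
          · grind
        · simp
          by_cases hxy : x = i ∧ y = j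
          · grind
          · grind
      · rintro σ' t _ ⟨ht, h⟩
        refine ⟨by omega, fun x hx y hy => ?_⟩
        have := h x hx y hy
        simp
        grind
    · rintro σ' t _ ⟨ht, h⟩
      refine ⟨by omega, ?_, ?_, ?_⟩
      · intro i hi j hj h0
        simp at h0
        rcases (h i hi j hj).1 h0 with h4 | ⟨_, h4, h5⟩
        · exact h1 i hi j hj h4
        · exact (h1 i hi k hk h4).trans (h1 k hk j hj h5)
      · intro i hi j hj h0
        simp
        exact (h i hi j hj).2 (Or.inl (h2 i hi j hj h0))
      · intro l hl i hi j hj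
        have hlN : l < N := by omega
        have a1 := h i hi l hlN
        have a2 := h l hlN j hj
        have a3 := h i hi j hj
        simp
        rcases Nat.lt_succ_iff_lt_or_eq.1 hl with hl | hl
        · have b1 := h3 l hl i hi j hj
          have b2 := h3 l hl i hi k hk
          have b3 := h3 l hl k hk j hj
          grind
        · subst hl
          grind
  · rintro σ' t _ ⟨ht, h1, h2, h3⟩
    refine ⟨by omega, fun i hi j hj => ⟨h1 i hi j hj, fun h => ?_⟩⟩
    clear h1
    induction h with
    | refl => exact h2 i hi i hi (hrefl i hi)
    | tail _ h ih =>
      exact h3 _ h.1 i hi _ h.2.1 (ih h.1) (h2 _ h.1 _ h.2.1 h.2.2)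

end Clearing

namespace Clearing
open Program

/-! ### The flow matrix -/

/-- the debtor of the edge `e` -/
abbrev srcOf (e : NExp) : NExp := .cell 1 (.const 0) e
/-- the creditor of the edge `e` -/
abbrev tgtOf (e : NExp) : NExp := .cell 1 (.const 1) e
/-- the current slope of the edge `e` -/
abbrev slopeOf (e : NExp) : RExp := .cell 3 e (na 21 e)
/-- the next border of the edge `e` -/
abbrev nextBorder (e : NExp) : RExp := .cell 2 e (.add (na 21 e) (.const 1))
/-- a test for active edges -/
abbrev isActive (e : NExp) : Test := .and (isPos (na 20 e)) (.realLt (.const 0) (slopeOf e))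

/-- The edge with the index `x` is active. -/
def ActiveAt (σ : Store) (x : ℕ) : Prop := 0 < σ.nat 20 0 x ∧ 0 < σ.real 3 x (σ.nat 21 0 x)

/-- Adds the active edges to the flow matrix and to the relation. -/
def loadMatrix : Program :=
  forN 40 (nv 31)
    (.ite (isActive (nv 40))
      (.setReal 25 (tgtOf (nv 40)) (srcOf (nv 40))
        (.add (.cell 25 (tgtOf (nv 40)) (srcOf (nv 40))) (slopeOf (nv 40))) ;;
        .setNat 24 (srcOf (nv 40)) (tgtOf (nv 40)) (.const 1)) skip)

open Classical in
-- The orientations differ: array `25` has the creditor as row and the debtor as column, so that it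
-- maps growth of debtors to inflow of creditors, while array `24` points from debtor to creditor.
theorem loadMatrix_spec (σ : Store) (M : ℕ) (hM : σ.nat 31 0 0 = M) :
    WP loadMatrix σ fun σ' t => t ≤ M * 8 + 3 ∧
      (∀ i j, σ'.real 25 i j = σ.real 25 i j + ∑ x ∈ Finset.range M,
        if ActiveAt σ x ∧ σ.nat 1 1 x = i ∧ σ.nat 1 0 x = j
          then σ.real 3 x (σ.nat 21 0 x) else 0) ∧
      ∀ i j, 0 < σ'.nat 24 i j ↔ 0 < σ.nat 24 i j ∨
        ∃ x < M, ActiveAt σ x ∧ σ.nat 1 0 x = i ∧ σ.nat 1 1 x = j := by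
  refine (WP.forN_const M 5 (fun k σ' =>
      (∀ i j, σ'.real 25 i j = σ.real 25 i j + ∑ x ∈ Finset.range k,
        if ActiveAt σ x ∧ σ.nat 1 1 x = i ∧ σ.nat 1 0 x = j
          then σ.real 3 x (σ.nat 21 0 x) else 0) ∧
      ∀ i j, 0 < σ'.nat 24 i j ↔ 0 < σ.nat 24 i j ∨
        ∃ x < k, ActiveAt σ x ∧ σ.nat 1 0 x = i ∧ σ.nat 1 1 x = j) ?_ rfl ?_ ?_).conseq
    fun _ _ _ h => h
  · intro σ' hf; simp [hf.1 31 rfl, hM]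
  · simp
  · intro k hk σ₁ hf hc ⟨h1, h2⟩
    refine WP.exec rfl fun t ht => ⟨ht, ?_⟩
    have e1 := hf.1 1 rfl
    have e2 := hf.1 20 rfl
    have e3 := hf.1 21 rfl
    have e4 := hf.2 3 rfl
    simp only [exec, Test.Holds, NExp.eval, RExp.eval, e1, e2, e3, e4, hc, Nat.cast_zero]
    split_ifs with hact
    · have hact' : ActiveAt σ k := hact
      constructor
      · intro i j
        rw [Finset.sum_range_succ]
        simp [hact', h1, e1, hc]
        by_cases h3 : i = σ.nat 1 1 k ∧ j = σ.nat 1 0 k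
        · obtain ⟨rfl, rfl⟩ := h3
          simp [add_assoc]
        · rw [if_neg h3, if_neg (by rintro ⟨h4, h5⟩; exact h3 ⟨h4.symm, h5.symm⟩)]
          ring
      · intro i j
        have := h2 i j
        simp [e1, hc]
        by_cases h3 : i = σ.nat 1 0 k ∧ j = σ.nat 1 1 k
        · obtain ⟨rfl, rfl⟩ := h3
          simp
          exact Or.inr ⟨k, by omega, hact', rfl, rfl⟩
        · rw [if_neg h3, this]
          constructor
          · rintro (h | ⟨x, h4, h5⟩)
            · exact Or.inl h
            · exact Or.inr ⟨x, by omega, h5⟩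
          · rintro (h | ⟨x, h4, h5, h6, h7⟩)
            · exact Or.inl h
            · refine Or.inr ⟨x, ?_, h5, h6, h7⟩
              by_contra hx
              have : x = k := by omega
              subst this
              exact h3 ⟨h6.symm, h7.symm⟩
    · have hact' : ¬ ActiveAt σ k := hact
      constructor
      · intro i j
        rw [Finset.sum_range_succ, if_neg (fun h => hact' h.1)]
        simp [h1]
      · intro i j
        have := h2 i j
        simp
        rw [this]
        constructor
        · rintro (h | ⟨x, h4, h5⟩)
          · exact Or.inl h
          · exact Or.inr ⟨x, by omega, h5⟩
        · rintro (h | ⟨x, h4, h5, h6, h7⟩)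
          · exact Or.inl h
          · refine Or.inr ⟨x, ?_, h5, h6, h7⟩
            by_contra hx
            have : x = k := by omega
            subst this
            exact hact' h5

/-! ### Search for a component -/

/-- a test for equality -/
abbrev isEq (x y : NExp) : Test := .and (.not (.natLt x y)) (.not (.natLt y x))

/-- Searches a component that can be flooded; one of its banks, plus one, is stored in array `34`. -/
def findComponent : Program :=
  setNv 34 (.const 0) ;;
  forN 40 (nv 30)
    (.ite (isPos (.cell 24 (.sub (nv 32) (.const 1)) (nv 40))) (setNv 36 (.const 1))
      (setNv 36 (.const 0)) ;;
    setNv 37 (.const 0) ;;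
    forN 41 (nv 30)
      (.ite (isPos (.cell 24 (nv 40) (nv 41)))
        (.ite (isPos (.cell 24 (nv 41) (nv 40)))
          (.ite (isEq (nv 41) (nv 40)) skip (setNv 37 (.const 1)))
          (setNv 36 (.const 0)))
        skip) ;;
    .ite (.and (isPos (nv 36)) (isPos (nv 37))) (setNv 34 (.add (nv 40) (.const 1))) skip)

/-- The bank `c` is reachable from `p` and lies in a non-singleton sink component. -/
def SinkFrom (r : ℕ → ℕ → Prop) (N p c : ℕ) : Prop :=
  r p c ∧ (∀ j < N, r c j → r j c) ∧ ∃ j < N, j ≠ c ∧ r c j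

/-- For the candidate `k`, array `36` records that it is reachable from `p` and that every bank it
reaches leads back; array `37` records a second bank in its class. Together they characterize the
banks of a non-singleton sink component reachable from `p`. -/
theorem findComponent_spec (σ : Store) (N p : ℕ) (hN : σ.nat 30 0 0 = N)
    (hp : σ.nat 32 0 0 = p + 1) :
    WP findComponent σ fun σ' t => t ≤ N * (N * 10 + 17) + 10 ∧
      ((σ'.nat 34 0 0 = 0 ∧ ∀ c < N, ¬ SinkFrom (fun x y => 0 < σ.nat 24 x y) N p c) ∨
        ∃ c < N, σ'.nat 34 0 0 = c + 1 ∧ SinkFrom (fun x y => 0 < σ.nat 24 x y) N p c) := by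
  set r : ℕ → ℕ → Prop := fun x y => 0 < σ.nat 24 x y with hr
  refine WP.seq (R := fun σ' t => t ≤ 1 ∧ σ'.nat 34 0 0 = 0) (WP.exec rfl fun t ht => ⟨ht, ?_⟩) ?_
  · simp [exec]
  rintro σ₁ t₁ hf₁ ⟨ht₁, h0⟩
  refine (WP.forN_const N (N * 10 + 14) (fun k σ' =>
    (σ'.nat 34 0 0 = 0 ∧ ∀ c < k, ¬ SinkFrom r N p c) ∨
        ∃ c < N, σ'.nat 34 0 0 = c + 1 ∧ SinkFrom r N p c) ?_ rfl ?_ ?_).conseq ?_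
  · intro σ' hf; simp [hf.1 30 rfl, hf₁.1 30 rfl, hN]
  · left; simp [h0]
  · intro k hk σ₂ hf₂ hc hI
    have r24 : σ₂.nat 24 = σ.nat 24 := by rw [hf₂.1 24 rfl, hf₁.1 24 rfl]
    have r32 : σ₂.nat 32 0 0 = p + 1 := by rw [hf₂.1 32 rfl, hf₁.1 32 rfl, hp]
    refine WP.seq (R := fun σ' t => t ≤ 3 ∧ (0 < σ'.nat 36 0 0 ↔ r p k)) ?_ ?_
    · refine WP.exec rfl fun t ht => ⟨ht, ?_⟩
      simp only [exec, Test.Holds, NExp.eval, r24, r32, hc, Nat.add_sub_cancel]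
      have hr' : 0 < σ.nat 24 p k ↔ r p k := Iff.rfl
      simp only [hr']
      split_ifs with h <;> simp [h]
    rintro σ₃ t₃ hf₃ ⟨ht₃, h36⟩
    refine WP.seq (R := fun σ' t => t ≤ 1 ∧ σ'.nat 37 0 0 = 0) (WP.exec rfl fun t ht => ⟨ht, ?_⟩) ?_
    · simp [exec]
    rintro σ₄ t₄ hf₄ ⟨ht₄, h37⟩
    refine WP.seq (WP.forN_const N 7 (fun j σ' =>
      (0 < σ'.nat 36 0 0 ↔ r p k ∧ ∀ x < j, r k x → r x k) ∧
      (0 < σ'.nat 37 0 0 ↔ ∃ x < j, x ≠ k ∧ r k x ∧ r x k)) ?_ rfl ?_ ?_) ?_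
    · intro σ' hf; simp [hf.1 30 rfl, hf₄.1 30 rfl, hf₃.1 30 rfl, hf₂.1 30 rfl, hf₁.1 30 rfl, hN]
    · simp [h37, hf₄.1 36 rfl, h36]
    · intro j hj σ₅ hf₅ hc₅ ⟨h1, h2⟩
      have q24 : σ₅.nat 24 = σ.nat 24 := by rw [hf₅.1 24 rfl, hf₄.1 24 rfl, hf₃.1 24 rfl, r24]
      have q40 : σ₅.nat 40 0 0 = k := by rw [hf₅.1 40 rfl, hf₄.1 40 rfl, hf₃.1 40 rfl, hc]
      refine WP.exec rfl fun t ht => ⟨ht, ?_⟩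
      have hkj : 0 < σ.nat 24 k j ↔ r k j := Iff.rfl
      have hjk : 0 < σ.nat 24 j k ↔ r j k := Iff.rfl
      simp only [exec, Test.Holds, NExp.eval, q24, q40, hc₅, hkj, hjk]
      have s1 : (∀ x < j + 1, r k x → r x k) ↔ (∀ x < j, r k x → r x k) ∧ (r k j → r j k) :=
        Nat.forall_lt_succ_right
      have s2 : (∃ x < j + 1, x ≠ k ∧ r k x ∧ r x k) ↔
          (∃ x < j, x ≠ k ∧ r k x ∧ r x k) ∨ (j ≠ k ∧ r k j ∧ r j k) :=
        Nat.exists_lt_succ_right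
      rw [s1, s2]
      split_ifs with c1 c2 c3
      · have : j = k := by omega
        simp [h1, h2, this]
      · have : j ≠ k := by omega
        simp [h1, c1, c2, this]
      · simp [h2, c1, c2]
      · simp [h1, h2, c1]
    · rintro σ₅ t₅ hf₅ ⟨ht₅, h1, h2⟩
      have q40 : σ₅.nat 40 0 0 = k := by rw [hf₅.1 40 rfl, hf₄.1 40 rfl, hf₃.1 40 rfl, hc]
      have q34 : σ₅.nat 34 = σ₂.nat 34 := by rw [hf₅.1 34 rfl, hf₄.1 34 rfl, hf₃.1 34 rfl]
      have hgood : (0 < σ₅.nat 36 0 0 ∧ 0 < σ₅.nat 37 0 0) ↔ SinkFrom r N p k := by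
        rw [h1, h2]
        constructor
        · rintro ⟨⟨a1, a2⟩, x, hx, a3, a4, _⟩
          exact ⟨a1, a2, x, hx, a3, a4⟩
        · rintro ⟨a1, a2, x, hx, a3, a4⟩
          exact ⟨⟨a1, a2⟩, x, hx, a3, a4, a2 x hx a4⟩
      refine WP.ite (fun h => ?_) (fun h => ?_)
      · refine WP.exec rfl fun t ht => ⟨by simp only [cost] at ht; omega, ?_⟩
        exact Or.inr ⟨k, hk, by simp [exec, q40], hgood.1 h⟩
      · refine WP.exec rfl fun t ht => ⟨by simp only [cost] at ht; omega, ?_⟩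
        rcases hI with ⟨a1, a2⟩ | ⟨c, a1, a2, a3⟩
        · left
          refine ⟨by simp [exec, q34, a1], fun c hc => ?_⟩
          rcases Nat.lt_succ_iff_lt_or_eq.1 hc with hc | hc
          · exact a2 c hc
          · exact hc ▸ mt hgood.2 h
        · exact Or.inr ⟨c, a1, by simp [exec, q34, a2], a3⟩
  · rintro σ' t _ ⟨ht, h⟩
    have ht : t ≤ N * (N * 10 + 17) + 3 := ht
    exact ⟨by omega, h⟩

/-! ### The system of linear equations -/

/-- Selects the pivot bank and restricts the matrix to the system for this bank. -/
def restrictMatrix : Program :=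
  .ite (isPos (nv 34)) (setNv 35 (.sub (nv 34) (.const 1))) (setNv 35 (.sub (nv 32) (.const 1))) ;;
  forN 40 (nv 30)
    (forN 41 (nv 30)
      (.ite (.and (isPos (.cell 24 (nv 35) (nv 41)))
          (.not (.and (isPos (nv 34)) (isEq (nv 40) (nv 35)))))
        skip (.setReal 25 (nv 40) (nv 41) (.const 0))) ;;
    .ite (isEq (nv 40) (nv 35)) (setRa 26 (nv 40) (.const 1)) (setRa 26 (nv 40) (.const 0)))

/-- One rule serves both programs. The columns kept are those reachable from the pivot: for an
increase these are the banks reachable from the selected bank, for a flooding they form the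
component itself. Only for a flooding is the row of the pivot deleted. -/
theorem restrictMatrix_spec (σ : Store) (N p : ℕ) (hN : σ.nat 30 0 0 = N)
    (hp : p = if 0 < σ.nat 34 0 0 then σ.nat 34 0 0 - 1 else σ.nat 32 0 0 - 1) :
    WP restrictMatrix σ fun σ' t => t ≤ N * (N * 6 + 10) + 7 ∧ σ'.nat 35 0 0 = p ∧
      (∀ i < N, ∀ j < N, σ'.real 25 i j =
        if 0 < σ.nat 24 p j ∧ ¬ (0 < σ.nat 34 0 0 ∧ i = p) then σ.real 25 i j else 0) ∧
      ∀ i < N, σ'.real 26 0 i = if i = p then 1 else 0 := by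
  refine WP.seq (R := fun σ' t => t ≤ 3 ∧ σ'.nat 35 0 0 = p) ?_ ?_
  · refine WP.exec rfl fun t ht => ⟨ht, ?_⟩
    by_cases h : 0 < σ.nat 34 0 0 <;> simp [exec, hp, h]
  rintro σ₁ t₁ hf₁ ⟨ht₁, hp₁⟩
  refine (WP.forN_const N (N * 6 + 7) (fun k σ' =>
      (∀ i < N, ∀ j < N, σ'.real 25 i j =
        if i < k ∧ ¬ (0 < σ.nat 24 p j ∧ ¬ (0 < σ.nat 34 0 0 ∧ i = p)) then 0
        else σ.real 25 i j) ∧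
      ∀ i < k, σ'.real 26 0 i = if i = p then 1 else 0) ?_ rfl ?_ ?_).conseq ?_
  · intro σ' hf; simp [hf.1 30 rfl, hf₁.1 30 rfl, hN]
  · simp [hf₁.2 25 rfl]
  · intro k hk σ₂ hf₂ hc ⟨h1, h2⟩
    refine WP.seq (WP.forN_const N 3 (fun l σ' =>
      (∀ i < N, ∀ j < N, σ'.real 25 i j =
        if (i < k ∨ (i = k ∧ j < l)) ∧ ¬ (0 < σ.nat 24 p j ∧ ¬ (0 < σ.nat 34 0 0 ∧ i = p)) then 0
        else σ.real 25 i j)) ?_ rfl ?_ ?_) ?_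
    · intro σ' hf; simp [hf.1 30 rfl, hf₂.1 30 rfl, hf₁.1 30 rfl, hN]
    · simpa using h1
    · intro l hl σ₃ hf₃ hc₃ hI
      refine WP.exec rfl fun t ht => ⟨ht, fun i hi j hj => ?_⟩
      have r24 : σ₃.nat 24 = σ.nat 24 := by rw [hf₃.1 24 rfl, hf₂.1 24 rfl, hf₁.1 24 rfl]
      have r34 : σ₃.nat 34 = σ.nat 34 := by rw [hf₃.1 34 rfl, hf₂.1 34 rfl, hf₁.1 34 rfl]
      have r35 : σ₃.nat 35 0 0 = p := by rw [hf₃.1 35 rfl, hf₂.1 35 rfl, hp₁]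
      have r40 : σ₃.nat 40 0 0 = k := by rw [hf₃.1 40 rfl, hc]
      have hkp : (¬ k < p ∧ ¬ p < k) ↔ k = p := by omega
      have := hI i hi j hj
      simp only [exec, Test.Holds, NExp.eval, r24, r34, r35, r40, hc₃, hkp]
      split_ifs with hcond <;> simp <;> grind
    · rintro σ₃ t₃ hf₃ ⟨ht₃, hI⟩
      refine WP.exec rfl fun t ht => ⟨?_, ?_⟩
      · simp only [cost] at ht; omega
      have r35 : σ₃.nat 35 0 0 = p := by rw [hf₃.1 35 rfl, hf₂.1 35 rfl, hp₁]
      have r40 : σ₃.nat 40 0 0 = k := by rw [hf₃.1 40 rfl, hc]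
      have r26 : σ₃.real 26 = σ₂.real 26 := hf₃.2 26 rfl
      have hkp : (¬ k < p ∧ ¬ p < k) ↔ k = p := by omega
      refine ⟨fun i hi j hj => ?_, fun i hi => ?_⟩
      · have := hI i hi j hj
        simp only [exec, Test.Holds, NExp.eval, r35, r40, hkp]
        split_ifs with hcond <;> simp <;> grind
      · simp only [exec, Test.Holds, NExp.eval, r35, r40, hkp]
        by_cases hik : i = k
        · subst hik
          split_ifs with hcond <;> simp
        · have := h2 i (by omega)
          rw [← this, ← r26]
          split_ifs with hcond <;> simp [hik]
  · rintro σ' t hf ⟨ht, h1, h2⟩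
    have ht : t ≤ N * (N * 6 + 10) + 3 := ht
    refine ⟨by omega, by rw [hf.1 35 rfl, hp₁], fun i hi j hj => ?_, h2⟩
    rw [h1 i hi j hj]
    grind

end Clearing

namespace Clearing
open Program

/-- Eliminates the variables one by one. -/
def solveSystem : Program :=
  forN 40 (nv 30)
    (setRv 27 (.div (.const 1) (.sub (.const 1) (.cell 25 (nv 40) (nv 40)))) ;;
    .setReal 25 (nv 40) (nv 40) (.const 0) ;;
    forN 41 (nv 30)
      (.setReal 25 (nv 40) (nv 41) (.mul (.cell 25 (nv 40) (nv 41)) (rv 27))) ;;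
    setRa 26 (nv 40) (.mul (ra 26 (nv 40)) (rv 27)) ;;
    forN 41 (nv 30)
      (setRv 30 (.cell 25 (nv 41) (nv 40)) ;;
      .setReal 25 (nv 41) (nv 40) (.const 0) ;;
      forN 42 (nv 30)
        (.setReal 25 (nv 41) (nv 42) (.add (.cell 25 (nv 41) (nv 42))
          (.mul (rv 30) (.cell 25 (nv 40) (nv 42))))) ;;
      .ite (isEq (nv 41) (nv 40)) skip
        (setRa 26 (nv 41) (.add (ra 26 (nv 41)) (.mul (rv 30) (ra 26 (nv 40)))))))

/-- the matrix in array `25` -/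
def matrixOf (N : ℕ) (σ : Store) (i j : Fin N) : ℝ := σ.real 25 i j

/-- the vector in array `26` -/
def vectorOf (N : ℕ) (σ : Store) (i : Fin N) : ℝ := σ.real 26 0 i

/-- Invariant: the matrix is transient, `d` solves the current system, and the columns below `k` are
zero. Transience provides a positive pivot `1 - K k k` in each round without any search, and after
the last round the system reads `d = q`. -/
theorem solveSystem_spec (σ : Store) (N : ℕ) (hN : σ.nat 30 0 0 = N)
    (hK : Transient (matrixOf N σ)) (d : Fin N → ℝ)
    (hd : ∀ i, d i = vectorOf N σ i + ∑ j, matrixOf N σ i j * d j) :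
    WP solveSystem σ fun σ' t => t ≤ N * (N * (N * 4 + 16) + N * 4 + 20) + 3 ∧
      ∀ i, vectorOf N σ' i = d i := by
  refine (WP.forN_const N (N * (N * 4 + 16) + N * 4 + 17) (fun k σ' => Transient (matrixOf N σ') ∧
    (∀ i, d i = vectorOf N σ' i + ∑ j, matrixOf N σ' i j * d j) ∧
    ∀ l : Fin N, l.1 < k → ∀ i, matrixOf N σ' i l = 0) ?_ rfl ?_ ?_).conseq ?_
  · intro σ' hf; simp [hf.1 30 rfl, hN]
  · exact ⟨hK, hd, fun l hl => absurd hl (by omega)⟩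
  · intro k hk σ₁ hf₁ hc ⟨hK₁, hd₁, hz₁⟩
    suffices WP _ σ₁ fun σ' t => t ≤ N * (N * 4 + 16) + N * 4 + 17 ∧
        (∀ i j, matrixOf N σ' i j = eliminate (matrixOf N σ₁) ⟨k, hk⟩ i j) ∧
        ∀ i, vectorOf N σ' i = eliminateRhs (matrixOf N σ₁) (vectorOf N σ₁) ⟨k, hk⟩ i by
      refine this.conseq ?_
      rintro σ' t _ ⟨ht, h1, h2⟩
      have e1 : matrixOf N (σ'.writeNat 40 0 0 (k + 1)) = eliminate (matrixOf N σ₁) ⟨k, hk⟩ := by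
        funext i j; rw [← h1 i j]; rfl
      have e2 : vectorOf N (σ'.writeNat 40 0 0 (k + 1)) =
          eliminateRhs (matrixOf N σ₁) (vectorOf N σ₁) ⟨k, hk⟩ := by
        funext i; rw [← h2 i]; rfl
      rw [e1, e2]
      refine ⟨ht, hK₁.eliminate _, hK₁.eliminate_solution _ hd₁, fun l hl i => ?_⟩
      rcases Nat.lt_succ_iff_lt_or_eq.1 hl with hl | hl
      · exact eliminate_zero_column (hz₁ l hl) i
      · have : l = ⟨k, hk⟩ := Fin.ext hl
        rw [this]
        exact eliminate_self_column _ i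
    clear hK hd hK₁ hd₁ hz₁
    set a : ℕ → ℕ → ℝ := σ₁.real 25 with ha
    set q : ℕ → ℝ := σ₁.real 26 0 with hq
    set g : ℝ := 1 / (1 - a k k) with hg
    set pr : ℕ → ℝ := fun j => if j = k then 0 else a k j * g with hpr
    -- the pivot
    refine WP.seq (R := fun σ' t => t ≤ 1 ∧ σ'.real 27 0 0 = g) (WP.exec rfl fun t ht => ⟨ht, ?_⟩) ?_
    · simp [exec, hc, hg, ha]
    rintro σ₂ t₂ hf₂ ⟨ht₂, h27⟩
    have a₂ : σ₂.real 25 = a := hf₂.2 25 rfl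
    have c₂ : σ₂.nat 40 0 0 = k := by rw [hf₂.1 40 rfl, hc]
    have q₂ : σ₂.real 26 0 = q := by rw [hf₂.2 26 rfl]
    have n₂ : σ₂.nat 30 0 0 = N := by rw [hf₂.1 30 rfl, hf₁.1 30 rfl, hN]
    refine WP.seq (R := fun σ' t => t ≤ 1 ∧ ∀ x y, σ'.real 25 x y =
      if x = k ∧ y = k then 0 else a x y) (WP.exec rfl fun t ht => ⟨ht, fun x y => ?_⟩) ?_
    · simp [exec, c₂, a₂]
    rintro σ₃ t₃ hf₃ ⟨ht₃, a₃⟩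
    have c₃ : σ₃.nat 40 0 0 = k := by rw [hf₃.1 40 rfl, c₂]
    have q₃ : σ₃.real 26 0 = q := by rw [hf₃.2 26 rfl, q₂]
    have g₃ : σ₃.real 27 0 0 = g := by rw [hf₃.2 27 rfl, h27]
    have n₃ : σ₃.nat 30 0 0 = N := by rw [hf₃.1 30 rfl, n₂]
    -- the pivot row
    refine WP.seq (WP.forN_const N 1 (fun l σ' => ∀ x y, σ'.real 25 x y =
      if x = k ∧ y < l then pr y else if x = k ∧ y = k then 0 else a x y) ?_ rfl ?_ ?_) ?_
    · intro σ' hf; simp [hf.1 30 rfl, n₃]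
    · simpa using a₃
    · intro l hl σ₄ hf₄ hc₄ hI
      have c₄ : σ₄.nat 40 0 0 = k := by rw [hf₄.1 40 rfl, c₃]
      have g₄ : σ₄.real 27 0 0 = g := by rw [hf₄.2 27 rfl, g₃]
      refine WP.exec rfl fun t ht => ⟨ht, fun x y => ?_⟩
      have h1 := hI x y
      have h2 := hI k l
      simp [exec, c₄, g₄, hc₄]
      by_cases hxy : x = k ∧ y = l
      · obtain ⟨rfl, rfl⟩ := hxy
        simp at h2
        simp [h2, hpr]
      · rw [if_neg hxy, h1]
        by_cases hx : x = k
        · subst hx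
          have : y ≠ l := fun h => hxy ⟨rfl, h⟩
          have : y ≤ l ↔ y < l := by omega
          simp [this]
        · simp [hx]
    rintro σ₄ t₄ hf₄ ⟨ht₄, a₄⟩
    have c₄ : σ₄.nat 40 0 0 = k := by rw [hf₄.1 40 rfl, c₃]
    have q₄ : σ₄.real 26 0 = q := by rw [hf₄.2 26 rfl, q₃]
    have g₄ : σ₄.real 27 0 0 = g := by rw [hf₄.2 27 rfl, g₃]
    have n₄ : σ₄.nat 30 0 0 = N := by rw [hf₄.1 30 rfl, n₃]
    refine WP.seq (R := fun σ' t => t ≤ 1 ∧ ∀ x, σ'.real 26 0 x =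
      if x = k then q k * g else q x) (WP.exec rfl fun t ht => ⟨ht, fun x => ?_⟩) ?_
    · simp [exec, c₄, g₄, q₄]
    rintro σ₅ t₅ hf₅ ⟨ht₅, q₅⟩
    have c₅ : σ₅.nat 40 0 0 = k := by rw [hf₅.1 40 rfl, c₄]
    have a₅ : ∀ x < N, ∀ y < N, σ₅.real 25 x y = if x = k then pr y else a x y := by
      intro x hx y hy
      rw [hf₅.2 25 rfl, a₄]
      by_cases hxk : x = k <;> simp [hxk, hy]
    have n₅ : σ₅.nat 30 0 0 = N := by rw [hf₅.1 30 rfl, n₄]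
    -- the other rows
    set f : ℕ → ℝ := fun i => if i = k then 0 else a i k with hfdef
    set base : ℕ → ℕ → ℝ := fun i j => if i = k then pr j else if j = k then 0 else a i j with hbase
    have hprk : pr k = 0 := by simp [hpr]
    refine (WP.forN_const N (N * 4 + 13) (fun i σ' =>
      (∀ x < N, ∀ y < N, σ'.real 25 x y = if x < i then base x y + f x * pr y
        else if x = k then pr y else a x y) ∧
      ∀ x < N, σ'.real 26 0 x = if x < i then
        (if x = k then q k * g else q x + f x * (q k * g)) else if x = k then q k * g else q x)
      ?_ rfl ?_ ?_).conseq ?_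
    · intro σ' hf; simp [hf.1 30 rfl, n₅]
    · simp
      exact ⟨a₅, fun x _ => q₅ x⟩
    · intro i hi σ₆ hf₆ hc₆ ⟨a₆, q₆⟩
      have c₆ : σ₆.nat 40 0 0 = k := by rw [hf₆.1 40 rfl, c₅]
      have n₆ : σ₆.nat 30 0 0 = N := by rw [hf₆.1 30 rfl, n₅]
      refine WP.seq (R := fun σ' t => t ≤ 1 ∧ σ'.real 30 0 0 = f i)
        (WP.exec rfl fun t ht => ⟨ht, ?_⟩) ?_
      · have := a₆ i hi k hk
        simp [exec, c₆, hc₆, this, hfdef, hprk]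
      rintro σ₇ t₇ hf₇ ⟨ht₇, f₇⟩
      have c₇ : σ₇.nat 40 0 0 = k := by rw [hf₇.1 40 rfl, c₆]
      have i₇ : σ₇.nat 41 0 0 = i := by rw [hf₇.1 41 rfl, hc₆]
      have n₇ : σ₇.nat 30 0 0 = N := by rw [hf₇.1 30 rfl, n₆]
      refine WP.seq (R := fun σ' t => t ≤ 1 ∧ ∀ x < N, ∀ y < N, σ'.real 25 x y =
        if x < i then base x y + f x * pr y else if x = i then base x y
        else if x = k then pr y else a x y)
        (WP.exec rfl fun t ht => ⟨ht, fun x hx y hy => ?_⟩) ?_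
      · have := a₆ x hx y hy
        simp [exec, c₇, i₇, hf₇.2 25 rfl]
        rw [this]
        simp only [hbase]
        by_cases h1 : x = i
        · subst h1
          by_cases h2 : y = k
          · subst h2; simp [hprk]
          · simp [h2]
        · simp [h1]
      rintro σ₈ t₈ hf₈ ⟨ht₈, a₈⟩
      have c₈ : σ₈.nat 40 0 0 = k := by rw [hf₈.1 40 rfl, c₇]
      have i₈ : σ₈.nat 41 0 0 = i := by rw [hf₈.1 41 rfl, i₇]
      have n₈ : σ₈.nat 30 0 0 = N := by rw [hf₈.1 30 rfl, n₇]
      have f₈ : σ₈.real 30 0 0 = f i := by rw [hf₈.2 30 rfl, f₇]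
      refine WP.seq (WP.forN_const N 1 (fun l σ' => ∀ x < N, ∀ y < N, σ'.real 25 x y =
        if x < i ∨ (x = i ∧ y < l) then base x y + f x * pr y else if x = i then base x y
        else if x = k then pr y else a x y) ?_ rfl ?_ ?_) ?_
      · intro σ' hf; simp [hf.1 30 rfl, n₈]
      · simpa using a₈
      · intro l hl σ₉ hf₉ hc₉ hI
        have c₉ : σ₉.nat 40 0 0 = k := by rw [hf₉.1 40 rfl, c₈]
        have i₉ : σ₉.nat 41 0 0 = i := by rw [hf₉.1 41 rfl, i₈]
        have f₉ : σ₉.real 30 0 0 = f i := by rw [hf₉.2 30 rfl, f₈]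
        refine WP.exec rfl fun t ht => ⟨ht, fun x hx y hy => ?_⟩
        have h1 := hI x hx y hy
        have h2 := hI i hi l hl
        -- Whether or not row `k` has been processed already, it is still the pivot row, since its
        -- factor is `0`.
        have h3 : σ₉.real 25 k l = pr l := by
          rw [hI k hk l hl]
          simp only [hbase, hfdef, if_true]
          split_ifs <;> ring
        simp at h2
        simp [exec, c₉, i₉, f₉, hc₉, h2, h3]
        by_cases hxy : x = i ∧ y = l
        · obtain ⟨rfl, rfl⟩ := hxy
          simp
        · rw [if_neg hxy, h1]
          have : (x < i ∨ x = i ∧ y < l) ↔ (x < i ∨ x = i ∧ y < l + 1) := by omega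
          simp [this]
      · rintro σ₉ t₉ hf₉ ⟨ht₉, a₉⟩
        have c₉ : σ₉.nat 40 0 0 = k := by rw [hf₉.1 40 rfl, c₈]
        have i₉ : σ₉.nat 41 0 0 = i := by rw [hf₉.1 41 rfl, i₈]
        have f₉ : σ₉.real 30 0 0 = f i := by rw [hf₉.2 30 rfl, f₈]
        have q₉ : σ₉.real 26 = σ₆.real 26 := by rw [hf₉.2 26 rfl, hf₈.2 26 rfl, hf₇.2 26 rfl]
        have hik : (¬ i < k ∧ ¬ k < i) ↔ i = k := by omega
        have hqk : σ₆.real 26 0 k = q k * g := by rw [q₆ k hk]; simp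
        have hqi := q₆ i hi
        have h25 : ∀ x < N, ∀ y < N, σ₉.real 25 x y = if x < i + 1 then base x y + f x * pr y
            else if x = k then pr y else a x y := by
          intro x hx y hy
          rw [a₉ x hx y hy]
          have h2 : (x < i ∨ x = i ∧ y < N) ↔ x < i + 1 := by omega
          simp only [h2]
          split_ifs <;> first | rfl | omega
        refine WP.ite (fun h => ?_) (fun h => ?_)
        · have hi' : i = k := hik.1 (by simpa [c₉, i₉] using h)
          refine WP.exec rfl fun t ht => ⟨by simp only [cost] at ht; omega, ?_, fun x hx => ?_⟩
          · simpa [exec] using h25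
          · have e : ((skip.exec σ₉).writeNat 41 0 0 (i + 1)).real 26 0 x = σ₆.real 26 0 x := by
              simp [exec, q₉]
            rw [e, q₆ x hx]
            split_ifs <;> first | rfl | omega
        · have hi' : i ≠ k := fun h' => h (by simp [c₉, i₉, h'])
          refine WP.exec rfl fun t ht => ⟨by simp only [cost] at ht; omega, ?_, fun x hx => ?_⟩
          · simpa [exec] using h25
          · have h1 := q₆ x hx
            simp [exec, c₉, i₉, f₉, q₉, hqk, hqi, hi']
            by_cases hxi : x = i
            · subst hxi; simp [hi']
            · have : x ≤ i ↔ x < i := by omega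
              simp [hxi, h1, this]
    · rintro σ' t _ ⟨ht, h1, h2⟩
      refine ⟨?_, fun i j => ?_, fun i => ?_⟩
      · have ht : t ≤ N * (N * 4 + 16) + 3 := ht
        omega
      · unfold matrixOf
        rw [h1 i i.2 j j.2, if_pos i.2]
        simp only [eliminate, pivotRow, hbase, hfdef, hpr, Fin.ext_iff, hg, mul_one_div]
        by_cases hik : (i : ℕ) = k
        · simp [hik, ha]
        · simp [hik, ha]
      · unfold vectorOf
        rw [h2 i i.2, if_pos i.2]
        simp only [eliminateRhs, hfdef, Fin.ext_iff, hg, mul_one_div]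
        by_cases hik : (i : ℕ) = k
        · simp [hik, matrixOf, ha, hq]
        · simp [hik, matrixOf, ha, hq]
  · rintro σ' t _ ⟨ht, _, h2, h3⟩
    refine ⟨ht, fun i => ?_⟩
    rw [h2 i, Finset.sum_eq_zero, add_zero]
    intro j _
    rw [h3 j j.2 i, zero_mul]

end Clearing

namespace Clearing
open Program

/-! ### Step length -/

/-- the current assets of the debtor of `e` -/
abbrev assetsOf (e : NExp) : RExp := ra 20 (srcOf e)
/-- the direction for the debtor of `e` -/
abbrev dirOf (e : NExp) : RExp := ra 26 (srcOf e)

/-- Computes the largest feasible multiple of the direction in array `26`. -/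
def scale : Program :=
  .ite (isPos (nv 34)) (setRv 28 (rv 29)) (setRv 28 (.sub (ra 22 (nv 35)) (ra 21 (nv 35)))) ;;
  forN 40 (nv 31)
    (.ite (.and (isActive (nv 40)) (.and (.realLt (.const 0) (dirOf (nv 40)))
        (.realLt (.sub (nextBorder (nv 40)) (assetsOf (nv 40))) (.mul (rv 28) (dirOf (nv 40))))))
      (setRv 28 (.div (.sub (nextBorder (nv 40)) (assetsOf (nv 40))) (dirOf (nv 40)))) skip)

/-- the distance of the debtor of `x` to the next border -/
def gapAt (σ : Store) (x : ℕ) : ℝ := σ.real 2 x (σ.nat 21 0 x + 1) - σ.real 20 0 (σ.nat 1 0 x)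

/-- the direction for the debtor of `x` -/
def dirAt (σ : Store) (x : ℕ) : ℝ := σ.real 26 0 (σ.nat 1 0 x)

/-- The value only decreases, so the inequalities of edges already tested persist, and the edge that
lowered it last is tight. Edges with direction `0` impose no condition. -/
theorem scale_spec (σ : Store) (M : ℕ) (hM : σ.nat 31 0 0 = M) (T₀ : ℝ)
    (h₁ : 0 < σ.nat 34 0 0 → T₀ = σ.real 29 0 0)
    (h₂ : σ.nat 34 0 0 = 0 → T₀ = σ.real 22 0 (σ.nat 35 0 0) - σ.real 21 0 (σ.nat 35 0 0)) :
    WP scale σ fun σ' t => t ≤ M * 6 + 7 ∧ σ'.real 28 0 0 ≤ T₀ ∧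
      (∀ x < M, ActiveAt σ x → 0 < dirAt σ x → σ'.real 28 0 0 * dirAt σ x ≤ gapAt σ x) ∧
      (σ'.real 28 0 0 = T₀ ∨
        ∃ x < M, ActiveAt σ x ∧ 0 < dirAt σ x ∧ σ'.real 28 0 0 * dirAt σ x = gapAt σ x) := by
  refine WP.seq (R := fun σ' t => t ≤ 3 ∧ σ'.real 28 0 0 = T₀) ?_ ?_
  · refine WP.exec rfl fun t ht => ⟨ht, ?_⟩
    by_cases h : 0 < σ.nat 34 0 0
    · simp [exec, h, h₁ h]
    · simp [exec, h₂ (by omega), h]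
  rintro σ₁ t₁ hf₁ ⟨ht₁, hT₁⟩
  refine (WP.forN_const M 3 (fun k σ' => σ'.real 28 0 0 ≤ T₀ ∧
      (∀ x < k, ActiveAt σ x → 0 < dirAt σ x → σ'.real 28 0 0 * dirAt σ x ≤ gapAt σ x) ∧
      (σ'.real 28 0 0 = T₀ ∨
        ∃ x < M, ActiveAt σ x ∧ 0 < dirAt σ x ∧ σ'.real 28 0 0 * dirAt σ x = gapAt σ x))
      ?_ rfl ?_ ?_).conseq ?_
  · intro σ' hf; simp [hf.1 31 rfl, hf₁.1 31 rfl, hM]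
  · simp [hT₁]
  · intro k hk σ₂ hf₂ hc ⟨h1, h2, h3⟩
    have r1 : σ₂.nat 1 = σ.nat 1 := by rw [hf₂.1 1 rfl, hf₁.1 1 rfl]
    have r20 : σ₂.nat 20 = σ.nat 20 := by rw [hf₂.1 20 rfl, hf₁.1 20 rfl]
    have r21 : σ₂.nat 21 = σ.nat 21 := by rw [hf₂.1 21 rfl, hf₁.1 21 rfl]
    have r2 : σ₂.real 2 = σ.real 2 := by rw [hf₂.2 2 rfl, hf₁.2 2 rfl]
    have r3 : σ₂.real 3 = σ.real 3 := by rw [hf₂.2 3 rfl, hf₁.2 3 rfl]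
    have q20 : σ₂.real 20 = σ.real 20 := by rw [hf₂.2 20 rfl, hf₁.2 20 rfl]
    have q26 : σ₂.real 26 = σ.real 26 := by rw [hf₂.2 26 rfl, hf₁.2 26 rfl]
    refine WP.ite (fun h => ?_) (fun h => ?_)
    · simp only [Test.Holds, NExp.eval, RExp.eval, r1, r20, r21, r2, r3, q20, q26, hc,
        Nat.cast_zero] at h
      obtain ⟨h4, h5, h6⟩ := h
      have h5' : 0 < dirAt σ k := h5
      have h6' : gapAt σ k < σ₂.real 28 0 0 * dirAt σ k := h6
      refine WP.exec rfl fun t ht => ⟨by simp only [cost] at ht; omega, ?_⟩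
      have e : (((setRv 28 (.div (.sub (nextBorder (nv 40)) (assetsOf (nv 40)))
          (dirOf (nv 40)))).exec σ₂).writeNat 40 0 0 (k + 1)).real 28 0 0 =
          gapAt σ k / dirAt σ k := by
        simp [exec, r1, r21, r2, q20, q26, hc, gapAt, dirAt]
      have h7 : gapAt σ k / dirAt σ k < σ₂.real 28 0 0 := (div_lt_iff₀ h5').2 h6'
      rw [e]
      refine ⟨h7.le.trans h1, fun x hx ha hd => ?_, Or.inr ⟨k, hk, h4, h5', ?_⟩⟩
      · rcases Nat.lt_succ_iff_lt_or_eq.1 hx with hx | hx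
        · exact (mul_le_mul_of_nonneg_right h7.le hd.le).trans (h2 x hx ha hd)
        · subst hx
          exact (div_mul_cancel₀ _ hd.ne').le
      · exact div_mul_cancel₀ _ h5'.ne'
    · simp only [Test.Holds, NExp.eval, RExp.eval, r1, r20, r21, r2, r3, q20, q26, hc,
        Nat.cast_zero] at h
      refine WP.exec rfl fun t ht => ⟨by simp only [cost] at ht; omega, ?_⟩
      have e : ((skip.exec σ₂).writeNat 40 0 0 (k + 1)).real 28 0 0 = σ₂.real 28 0 0 := by
        simp [exec]
      rw [e]
      refine ⟨h1, fun x hx ha hd => ?_, h3⟩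
      rcases Nat.lt_succ_iff_lt_or_eq.1 hx with hx | hx
      · exact h2 x hx ha hd
      · subst hx
        by_contra hcon
        exact h ⟨ha, hd, not_le.1 hcon⟩
  · rintro σ' t _ ⟨ht, h⟩
    exact ⟨by omega, h⟩

/-- Moves along the direction in array `26`. -/
def update : Program :=
  forN 40 (nv 30) (setRa 20 (nv 40) (.add (ra 20 (nv 40)) (.mul (rv 28) (ra 26 (nv 40))))) ;;
  .ite (isPos (nv 34)) skip (setRa 21 (nv 35) (.add (ra 21 (nv 35)) (rv 28)))

theorem update_spec (σ : Store) (N : ℕ) (hN : σ.nat 30 0 0 = N) :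
    WP update σ fun σ' t => t ≤ N * 4 + 7 ∧
      (∀ i < N, σ'.real 20 0 i = σ.real 20 0 i + σ.real 28 0 0 * σ.real 26 0 i) ∧
      (0 < σ.nat 34 0 0 → σ'.real 21 = σ.real 21) ∧
      (σ.nat 34 0 0 = 0 → ∀ i, σ'.real 21 0 i =
        σ.real 21 0 i + if i = σ.nat 35 0 0 then σ.real 28 0 0 else 0) := by
  refine WP.seq (WP.forN_const N 1 (fun k σ' => ∀ i < N, σ'.real 20 0 i =
    σ.real 20 0 i + if i < k then σ.real 28 0 0 * σ.real 26 0 i else 0) ?_ rfl ?_ ?_) ?_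
  · intro σ' hf; simp [hf.1 30 rfl, hN]
  · simp
  · intro k hk σ₁ hf hc hI
    refine WP.exec rfl fun t ht => ⟨ht, fun i hi => ?_⟩
    have h1 := hI i hi
    simp [exec, hc, hf.2 28 rfl, hf.2 26 rfl]
    by_cases hik : i = k
    · subst hik; simp [h1]
    · have : i ≤ k ↔ i < k := by omega
      simp [hik, h1, this]
  · rintro σ₁ t₁ hf₁ ⟨ht₁, h⟩
    have h20 : ∀ i < N, σ₁.real 20 0 i = σ.real 20 0 i + σ.real 28 0 0 * σ.real 26 0 i := by
      intro i hi; rw [h i hi, if_pos hi]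
    refine WP.ite (fun h0 => ?_) (fun h0 => ?_)
    · have h0 : 0 < σ.nat 34 0 0 := by simpa [hf₁.1 34 rfl] using h0
      refine WP.exec rfl fun t ht => ⟨by simp only [cost] at ht; omega, ?_, fun _ => ?_, ?_⟩
      · simpa [exec] using h20
      · simp [exec, hf₁.2 21 rfl]
      · omega
    · have h0 : σ.nat 34 0 0 = 0 := by simpa [hf₁.1 34 rfl] using h0
      refine WP.exec rfl fun t ht => ⟨by simp only [cost] at ht; omega, ?_, ?_, fun _ i => ?_⟩
      · simpa [exec] using h20
      · omega
      · by_cases hi : i = σ.nat 35 0 0 <;>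
          simp [exec, hf₁.2 21 rfl, hf₁.2 28 rfl, hf₁.1 35 rfl, hi]

/-! ### Interval pointers -/

/-- Advances the pointers in array `21` to the intervals that contain the current assets. -/
def advance : Program :=
  forN 40 (nv 31)
    (.while (.and (.natLt (na 21 (nv 40)) (.cell 1 (.const 2) (nv 40)))
        (.not (.realLt (assetsOf (nv 40)) (nextBorder (nv 40)))))
      (setRa 24 (nv 40) (.add (ra 24 (nv 40)) (.mul (slopeOf (nv 40))
        (.sub (nextBorder (nv 40)) (.cell 2 (nv 40) (na 21 (nv 40)))))) ;;
      setNa 21 (nv 40) (.add (na 21 (nv 40)) (.const 1))))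

/-- Here `j` is the target of each pointer and `p` the payment at each border, updated by slope
times interval length. The bound charges `4` per pointer move and a constant per cell, which allows
amortization over the whole run. -/
theorem advance_spec (σ : Store) (M : ℕ) (hM : σ.nat 31 0 0 = M) (j : ℕ → ℕ) (p : ℕ → ℕ → ℝ)
    (hj : ∀ x < M, σ.nat 21 0 x ≤ j x) (hj' : ∀ x < M, j x ≤ σ.nat 1 2 x)
    (hle : ∀ x < M, ∀ i < j x, σ.real 2 x (i + 1) ≤ σ.real 20 0 (σ.nat 1 0 x))
    (hlt : ∀ x < M, j x < σ.nat 1 2 x → σ.real 20 0 (σ.nat 1 0 x) < σ.real 2 x (j x + 1))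
    (hp : ∀ x < M, ∀ i < j x, p x (i + 1) = p x i + σ.real 3 x i *
      (σ.real 2 x (i + 1) - σ.real 2 x i))
    (h0 : ∀ x < M, σ.real 24 0 x = p x (σ.nat 21 0 x)) :
    WP advance σ fun σ' t => t ≤ ∑ x ∈ Finset.range M, (j x - σ.nat 21 0 x) * 4 + M * 4 + 3 ∧
      ∀ x < M, σ'.nat 21 0 x = j x ∧ σ'.real 24 0 x = p x (j x) := by
  refine (WP.forN M (fun x => (j x - σ.nat 21 0 x) * 4 + 1) (fun k σ' => ∀ x < M,
    σ'.nat 21 0 x = (if x < k then j x else σ.nat 21 0 x) ∧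
    σ'.real 24 0 x = p x (σ'.nat 21 0 x)) ?_ rfl ?_ ?_).conseq ?_
  · intro σ' hf; simp [hf.1 31 rfl, hM]
  · intro x hx; simp [h0 x hx]
  · intro k hk σ₁ hf₁ hc hI
    have e0 : σ₁.nat 21 0 k = σ.nat 21 0 k := by rw [(hI k hk).1]; simp
    have hjk := hj k hk
    have r2 : σ₁.real 2 = σ.real 2 := hf₁.2 2 rfl
    have r3 : σ₁.real 3 = σ.real 3 := hf₁.2 3 rfl
    have r20 : σ₁.real 20 = σ.real 20 := hf₁.2 20 rfl
    have r1 : σ₁.nat 1 = σ.nat 1 := hf₁.1 1 rfl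
    refine (WP.while (j k - σ.nat 21 0 k) (fun _ => 3) (fun i σ' =>
      σ'.nat 21 0 k = σ.nat 21 0 k + i ∧ σ'.real 24 0 k = p k (σ.nat 21 0 k + i) ∧
      ∀ x < M, x ≠ k → σ'.nat 21 0 x = σ₁.nat 21 0 x ∧ σ'.real 24 0 x = σ₁.real 24 0 x)
      ?_ ?_ ?_).conseq ?_
    · exact ⟨e0, by rw [(hI k hk).2, e0]; rfl, fun _ _ _ => ⟨rfl, rfl⟩⟩
    · rintro i hi σ₂ hf₂ ⟨h1, h2, h3⟩
      have c2 : σ₂.nat 40 0 0 = k := by rw [hf₂.1 40 rfl, hc]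
      have hlt' : σ.nat 21 0 k + i < j k := by omega
      refine ⟨?_, WP.exec rfl fun t ht => ⟨ht, ?_⟩⟩
      · simp [c2, hf₂.1 1 rfl, r1, hf₂.2 2 rfl, r2, hf₂.2 20 rfl, r20, h1]
        exact ⟨lt_of_lt_of_le hlt' (hj' k hk), hle k hk _ hlt'⟩
      · simp [exec, c2, h1, h2, hf₂.2 2 rfl, r2, hf₂.2 3 rfl, r3]
        refine ⟨by omega, ?_, fun x hx hxk => ?_⟩
        · rw [← hp k hk _ hlt']; rfl
        · simp [hxk, h3 x hx hxk]
    · rintro σ₂ hf₂ ⟨h1, h2, h3⟩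
      have c2 : σ₂.nat 40 0 0 = k := by rw [hf₂.1 40 rfl, hc]
      have e1 : σ₂.nat 21 0 k = j k := by omega
      simp [c2, hf₂.1 1 rfl, r1, hf₂.2 2 rfl, r2, hf₂.2 20 rfl, r20, e1]
      exact hlt k hk
    · rintro σ₂ t hf₂ ⟨ht, h1, h2, h3⟩
      refine ⟨?_, fun x hx => ?_⟩
      · rw [Finset.sum_const, Finset.card_range, smul_eq_mul] at ht
        exact ht
      · simp
        by_cases hxk : x = k
        · subst hxk
          have e1 : σ.nat 21 0 x + (j x - σ.nat 21 0 x) = j x := by omega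
          simp [h1, h2, e1]
        · have : x ≤ k ↔ x < k := by omega
          simp [h3 x hx hxk, hI x hx, this]
  · rintro σ' t _ ⟨ht, h⟩
    refine ⟨?_, fun x hx => ?_⟩
    · simp only [add_assoc, Finset.sum_add_distrib, Finset.sum_const, Finset.card_range,
        smul_eq_mul] at ht ⊢
      omega
    · have := h x hx
      rw [if_pos hx] at this
      exact ⟨this.1, this.1 ▸ this.2⟩

end Clearing

namespace Clearing
open Program

/-! ### Settling -/

/-- the number of edges of the given network -/
abbrev edgeCount : NExp := na 0 (.const 1)

/-- a test for solvent banks with default costs -/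
abbrev isSolvent (u : NExp) : Test :=
  .and (isPos (na 22 u)) (.not (.realLt (.add (ra 0 u) (ra 20 (.add (nv 0) u))) (ra 23 u)))

/-- Removes the edges of the banks that became solvent. -/
def settleProgram : Program :=
  forN 40 (nv 0)
    (.ite (isSolvent (nv 40)) (setNa 23 (nv 40) (.const 1)) (setNa 23 (nv 40) (.const 0))) ;;
  forN 40 edgeCount
    (.ite (.and (isPos (na 20 (nv 40))) (isPos (na 23 (srcOf (nv 40)))))
      (setRa 21 (tgtOf (nv 40)) (.add (ra 21 (tgtOf (nv 40))) (.add (ra 24 (nv 40))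
        (.mul (slopeOf (nv 40)) (.sub (assetsOf (nv 40)) (.cell 2 (nv 40) (na 21 (nv 40))))))) ;;
      setRa 22 (tgtOf (nv 40)) (.add (ra 22 (tgtOf (nv 40))) (ra 1 (nv 40))) ;;
      setNa 20 (nv 40) (.const 0)) skip)

/-- The bank `u` has default costs and is solvent. -/
def SolventAt (σ : Store) (u : ℕ) : Prop :=
  0 < σ.nat 22 0 u ∧ ¬ σ.real 0 0 u + σ.real 20 0 (σ.nat 0 0 0 + u) < σ.real 23 0 u

/-- The edge `x` has to be removed. -/
def SettledAt (σ : Store) (x : ℕ) : Prop := 0 < σ.nat 20 0 x ∧ SolventAt σ (σ.nat 1 0 x)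

/-- the payment on the edge `x` -/
def payAt (σ : Store) (x : ℕ) : ℝ :=
  σ.real 24 0 x + σ.real 3 x (σ.nat 21 0 x) *
    (σ.real 20 0 (σ.nat 1 0 x) - σ.real 2 x (σ.nat 21 0 x))

open Classical in
-- Solvency of all banks is recorded before the first edge is removed, and the payments are computed
-- from cells that the second loop does not write. Hence both sums may refer to the initial memory.
theorem settleProgram_spec (σ : Store) (n m : ℕ) (hn : σ.nat 0 0 0 = n) (hm : σ.nat 0 0 1 = m)
    (hsrc : ∀ x < m, σ.nat 1 0 x < n) :
    WP settleProgram σ fun σ' t => t ≤ n * 6 + m * 10 + 7 ∧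
      (∀ i, σ'.real 21 0 i = σ.real 21 0 i + ∑ x ∈ Finset.range m,
        if SettledAt σ x ∧ σ.nat 1 1 x = i then payAt σ x else 0) ∧
      (∀ i, σ'.real 22 0 i = σ.real 22 0 i + ∑ x ∈ Finset.range m,
        if SettledAt σ x ∧ σ.nat 1 1 x = i then σ.real 1 0 x else 0) ∧
      ∀ x, 0 < σ'.nat 20 0 x ↔ 0 < σ.nat 20 0 x ∧ ¬ (x < m ∧ SettledAt σ x) := by
  refine WP.seq (WP.forN_const n 3 (fun k σ' => ∀ u < k,
    (0 < σ'.nat 23 0 u ↔ SolventAt σ u)) ?_ rfl ?_ ?_) ?_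
  · intro σ' hf; simp [hf.1 0 rfl, hn]
  · simp
  · intro k hk σ₁ hf hc hI
    have r0 : σ₁.nat 0 = σ.nat 0 := hf.1 0 rfl
    have r22 : σ₁.nat 22 = σ.nat 22 := hf.1 22 rfl
    have q0 : σ₁.real 0 = σ.real 0 := hf.2 0 rfl
    have q20 : σ₁.real 20 = σ.real 20 := hf.2 20 rfl
    have q23 : σ₁.real 23 = σ.real 23 := hf.2 23 rfl
    refine WP.ite (fun h => ?_) (fun h => ?_) <;>
      simp only [Test.Holds, NExp.eval, RExp.eval, r0, r22, q0, q20, q23, hc] at h <;>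
      refine WP.exec rfl fun t ht => ⟨by simp only [cost] at ht; omega, fun u hu => ?_⟩ <;>
      by_cases huk : u = k
    · subst huk
      simp [exec, hc]
      exact h
    · simp [exec, hc, huk, hI u (by omega)]
    · subst huk
      simp [exec, hc]
      exact h
    · simp [exec, hc, huk, hI u (by omega)]
  rintro σ₁ t₁ hf₁ ⟨ht₁, h23⟩
  refine (WP.forN_const m 7 (fun k σ' =>
      (∀ i, σ'.real 21 0 i = σ.real 21 0 i + ∑ x ∈ Finset.range k,
        if SettledAt σ x ∧ σ.nat 1 1 x = i then payAt σ x else 0) ∧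
      (∀ i, σ'.real 22 0 i = σ.real 22 0 i + ∑ x ∈ Finset.range k,
        if SettledAt σ x ∧ σ.nat 1 1 x = i then σ.real 1 0 x else 0) ∧
      ∀ x, 0 < σ'.nat 20 0 x ↔ 0 < σ.nat 20 0 x ∧ ¬ (x < k ∧ SettledAt σ x)) ?_ rfl ?_ ?_).conseq ?_
  · intro σ' hf; simp [hf.1 0 rfl, hf₁.1 0 rfl, hm]
  · simp [hf₁.2 21 rfl, hf₁.2 22 rfl, hf₁.1 20 rfl]
  · intro k hk σ₂ hf₂ hc ⟨h1, h2, h3⟩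
    have r1 : σ₂.nat 1 = σ.nat 1 := by rw [hf₂.1 1 rfl, hf₁.1 1 rfl]
    have r21 : σ₂.nat 21 = σ.nat 21 := by rw [hf₂.1 21 rfl, hf₁.1 21 rfl]
    have r23 : σ₂.nat 23 = σ₁.nat 23 := hf₂.1 23 rfl
    have q1 : σ₂.real 1 = σ.real 1 := by rw [hf₂.2 1 rfl, hf₁.2 1 rfl]
    have q2 : σ₂.real 2 = σ.real 2 := by rw [hf₂.2 2 rfl, hf₁.2 2 rfl]
    have q3 : σ₂.real 3 = σ.real 3 := by rw [hf₂.2 3 rfl, hf₁.2 3 rfl]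
    have q20 : σ₂.real 20 = σ.real 20 := by rw [hf₂.2 20 rfl, hf₁.2 20 rfl]
    have q24 : σ₂.real 24 = σ.real 24 := by rw [hf₂.2 24 rfl, hf₁.2 24 rfl]
    have hset : (0 < σ₂.nat 20 0 k ∧ 0 < σ₁.nat 23 0 (σ.nat 1 0 k)) ↔ SettledAt σ k := by
      rw [h23 _ (hsrc k hk), h3 k]
      simp [SettledAt]
    refine WP.ite (fun h => ?_) (fun h => ?_) <;>
      simp only [Test.Holds, NExp.eval, r1, r23, hc, hset] at h <;>
      refine WP.exec rfl fun t ht => ⟨by simp only [cost] at ht; omega, fun i => ?_, fun i => ?_,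
        fun x => ?_⟩
    · rw [Finset.sum_range_succ]
      by_cases hi : i = σ.nat 1 1 k
      · subst hi
        simp [exec, r1, r21, q1, q2, q3, q20, q24, hc, h1, h, payAt, add_assoc]
      · simp [exec, r1, r21, q1, q2, q3, q20, q24, hc, h1, hi, Ne.symm hi]
    · rw [Finset.sum_range_succ]
      by_cases hi : i = σ.nat 1 1 k
      · subst hi
        simp [exec, r1, q1, hc, h2, h, add_assoc]
      · simp [exec, r1, q1, hc, h2, hi, Ne.symm hi]
    · by_cases hx : x = k
      · subst hx
        simp [exec, hc, h]
      · have : x ≤ k ↔ x < k := by omega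
        simp [exec, hc, hx, h3, this]
    · rw [Finset.sum_range_succ, if_neg fun h' => h h'.1]
      simp [exec, h1]
    · rw [Finset.sum_range_succ, if_neg fun h' => h h'.1]
      simp [exec, h2]
    · have := h3 x
      by_cases hx : x = k
      · subst hx
        simp [exec, this, h]
      · have hx' : x ≤ k ↔ x < k := by omega
        simp [exec, this, hx']
  · rintro σ' t _ ⟨ht, h⟩
    exact ⟨by omega, h⟩

/-! ### Publication of the state -/

/-- Copies a vector over the banks into the three rows of another array. -/
def copyReal (a b : ℕ) : Program :=
  forN 40 (nv 0)
    (.setReal b (.const 0) (nv 40) (ra a (nv 40)) ;;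
    .setReal b (.const 1) (nv 40) (ra a (.add (nv 0) (nv 40))) ;;
    .setReal b (.const 2) (nv 40) (ra a (.add (nv 0) (.add (nv 0) (nv 40)))))

theorem copyReal_spec (a b : ℕ) (hab : (a == b) = false) (σ : Store)
    (n : ℕ) (hn : σ.nat 0 0 0 = n) :
    WP (copyReal a b) σ fun σ' t => t ≤ n * 8 + 3 ∧ ∀ i < n,
      σ'.real b 0 i = σ.real a 0 i ∧ σ'.real b 1 i = σ.real a 0 (n + i) ∧
      σ'.real b 2 i = σ.real a 0 (n + (n + i)) := by
  have hne : a ≠ b := by simpa using hab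
  refine (WP.forN_const n 5 (fun k σ' => ∀ i < k,
      σ'.real b 0 i = σ.real a 0 i ∧ σ'.real b 1 i = σ.real a 0 (n + i) ∧
      σ'.real b 2 i = σ.real a 0 (n + (n + i))) ?_ rfl ?_ ?_).conseq fun _ _ _ h => h
  · intro σ' hf; simp [hf.1 0 rfl, hn]
  · simp
  · intro k hk σ₁ hf hc hI
    have ra : σ₁.real a = σ.real a := hf.2 a (by simp [writesReal, forN, hab])
    have rn : σ₁.nat 0 0 0 = n := by rw [hf.1 0 rfl, hn]
    refine WP.exec rfl fun t ht => ⟨ht, fun i hi => ?_⟩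
    by_cases hik : i = k
    · subst hik
      simp [exec, hc, hne, ra, rn]
    · have := hI i (by omega)
      simp [exec, hc, hne, ra, rn, hik, this]

/-- Copies the indicator of the remaining edges. -/
def copyLive : Program :=
  forN 40 edgeCount (.setNat 10 (.const 0) (nv 40) (na 20 (nv 40))) ;;
  forN 40 (nv 0)
    (.setNat 10 (.const 1) (nv 40) (na 20 (.add edgeCount (nv 40))) ;;
    .setNat 10 (.const 2) (nv 40) (na 20 (.add edgeCount (.add (nv 0) (nv 40)))))

theorem copyLive_spec (σ : Store) (n m : ℕ) (hn : σ.nat 0 0 0 = n) (hm : σ.nat 0 0 1 = m) :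
    WP copyLive σ fun σ' t => t ≤ n * 6 + m * 4 + 7 ∧
      (∀ x < m, σ'.nat 10 0 x = σ.nat 20 0 x) ∧
      ∀ i < n, σ'.nat 10 1 i = σ.nat 20 0 (m + i) ∧ σ'.nat 10 2 i = σ.nat 20 0 (m + (n + i)) := by
  refine WP.seq (WP.forN_const m 1 (fun k σ' => ∀ x < k, σ'.nat 10 0 x = σ.nat 20 0 x)
    ?_ rfl ?_ ?_) ?_
  · intro σ' hf; simp [hf.1 0 rfl, hm]
  · simp
  · intro k hk σ₁ hf hc hI
    refine WP.exec rfl fun t ht => ⟨ht, fun x hx => ?_⟩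
    by_cases hxk : x = k
    · subst hxk
      simp [exec, hc, hf.1 20 rfl]
    · simp [exec, hc, hxk, hI x (by omega)]
  rintro σ₁ t₁ hf₁ ⟨ht₁, h1⟩
  refine (WP.forN_const n 3 (fun k σ' => (∀ x < m, σ'.nat 10 0 x = σ.nat 20 0 x) ∧ ∀ i < k,
    σ'.nat 10 1 i = σ.nat 20 0 (m + i) ∧ σ'.nat 10 2 i = σ.nat 20 0 (m + (n + i)))
    ?_ rfl ?_ ?_).conseq ?_
  · intro σ' hf; simp [hf.1 0 rfl, hf₁.1 0 rfl, hn]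
  · simpa using h1
  · intro k hk σ₂ hf hc ⟨h2, h3⟩
    have r0 : σ₂.nat 0 = σ.nat 0 := by rw [hf.1 0 rfl, hf₁.1 0 rfl]
    have r20 : σ₂.nat 20 = σ.nat 20 := by rw [hf.1 20 rfl, hf₁.1 20 rfl]
    refine WP.exec rfl fun t ht => ⟨ht, fun x hx => ?_, fun i hi => ?_⟩
    · simp [exec, h2 x hx]
    · by_cases hik : i = k
      · subst hik
        simp [exec, hc, r0, r20, hn, hm]
      · simp [exec, hc, hik, h3 i (by omega)]
  · rintro σ' t _ ⟨ht, h⟩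
    exact ⟨by omega, h⟩

/-! ### Selection of a bank and output -/

/-- Selects a bank whose external assets have to grow. -/
def selectBank : Program :=
  setNv 33 (.const 1) ;;
  forN 40 (nv 30)
    (.ite (.realLt (ra 21 (nv 40)) (ra 22 (nv 40)))
      (setNv 32 (.add (nv 40) (.const 1)) ;; setNv 33 (.const 0)) skip)

/-- Cell `33` is the stop flag. The index in cell `32` is shifted by one, so that `0` means that no
bank is selected. -/
theorem selectBank_spec (σ : Store) (N : ℕ) (hN : σ.nat 30 0 0 = N) (h32 : σ.nat 32 0 0 = 0) :
    WP selectBank σ fun σ' t => t ≤ N * 8 + 5 ∧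
      ((σ'.nat 33 0 0 = 1 ∧ σ'.nat 32 0 0 = 0 ∧ ∀ i < N, ¬ σ.real 21 0 i < σ.real 22 0 i) ∨
        (σ'.nat 33 0 0 = 0 ∧ ∃ i < N, σ'.nat 32 0 0 = i + 1 ∧ σ.real 21 0 i < σ.real 22 0 i)) := by
  refine WP.seq (R := fun σ' t => t ≤ 1 ∧ σ'.nat 33 0 0 = 1 ∧ σ'.nat 32 0 0 = 0)
    (WP.exec rfl fun t ht => ⟨ht, ?_⟩) ?_
  · simp [exec, h32]
  rintro σ₁ t₁ hf₁ ⟨ht₁, h1, h2⟩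
  refine (WP.forN_const N 5 (fun k σ' =>
      ((σ'.nat 33 0 0 = 1 ∧ σ'.nat 32 0 0 = 0 ∧ ∀ i < k, ¬ σ.real 21 0 i < σ.real 22 0 i) ∨
        (σ'.nat 33 0 0 = 0 ∧ ∃ i < N, σ'.nat 32 0 0 = i + 1 ∧ σ.real 21 0 i < σ.real 22 0 i)))
      ?_ rfl ?_ ?_).conseq ?_
  · intro σ' hf; simp [hf.1 30 rfl, hf₁.1 30 rfl, hN]
  · simp [h1, h2]
  · intro k hk σ₂ hf₂ hc hI
    have q21 : σ₂.real 21 = σ.real 21 := by rw [hf₂.2 21 rfl, hf₁.2 21 rfl]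
    have q22 : σ₂.real 22 = σ.real 22 := by rw [hf₂.2 22 rfl, hf₁.2 22 rfl]
    refine WP.ite (fun h => ?_) (fun h => ?_) <;>
      simp only [Test.Holds, NExp.eval, RExp.eval, q21, q22, hc] at h <;>
      refine WP.exec rfl fun t ht => ⟨by simp only [cost] at ht; omega, ?_⟩
    · exact Or.inr ⟨by simp [exec], k, hk, by simp [exec, hc], h⟩
    · rcases hI with ⟨h3, h4, h5⟩ | ⟨h3, i, h4, h5, h6⟩
      · refine Or.inl ⟨by simp [exec, h3], by simp [exec, h4], fun i hi => ?_⟩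
        rcases Nat.lt_succ_iff_lt_or_eq.1 hi with hi | hi
        · exact h5 i hi
        · exact hi ▸ h
      · exact Or.inr ⟨by simp [exec, h3], i, h4, by simp [exec, h5], h6⟩
  · rintro σ' t _ ⟨ht, h⟩
    exact ⟨by omega, h⟩

/-- Writes the output. -/
def writeOutput : Program :=
  forN 40 (nv 0)
    (.ite (isSolvent (nv 40)) (setRa 13 (nv 40) (.add (ra 0 (nv 40)) (ra 20 (.add (nv 0) (nv 40)))))
      (setRa 13 (nv 40) (ra 20 (nv 40))))

open Classical in
theorem writeOutput_spec (σ : Store) (n : ℕ) (hn : σ.nat 0 0 0 = n) :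
    WP writeOutput σ fun σ' t => t ≤ n * 6 + 3 ∧ ∀ u < n, σ'.real 13 0 u =
      if SolventAt σ u then σ.real 0 0 u + σ.real 20 0 (n + u) else σ.real 20 0 u := by
  refine (WP.forN_const n 3 (fun k σ' => ∀ u < k, σ'.real 13 0 u =
      if SolventAt σ u then σ.real 0 0 u + σ.real 20 0 (n + u) else σ.real 20 0 u)
      ?_ rfl ?_ ?_).conseq fun _ _ _ h => h
  · intro σ' hf; simp [hf.1 0 rfl, hn]
  · simp
  · intro k hk σ₁ hf hc hI
    have r0 : σ₁.nat 0 = σ.nat 0 := hf.1 0 rfl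
    have r22 : σ₁.nat 22 = σ.nat 22 := hf.1 22 rfl
    have q0 : σ₁.real 0 = σ.real 0 := hf.2 0 rfl
    have q20 : σ₁.real 20 = σ.real 20 := hf.2 20 rfl
    have q23 : σ₁.real 23 = σ.real 23 := hf.2 23 rfl
    refine WP.ite (fun h => ?_) (fun h => ?_) <;>
      simp only [Test.Holds, NExp.eval, RExp.eval, r0, r22, q0, q20, q23, hc] at h <;>
      refine WP.exec rfl fun t ht => ⟨by simp only [cost] at ht; omega, fun u hu => ?_⟩ <;>
      by_cases huk : u = k
    · subst huk
      have h : SolventAt σ u := h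
      simp [exec, hc, h, r0, q0, q20, hn]
    · simp [exec, hc, huk, hI u (by omega)]
    · subst huk
      have h : ¬ SolventAt σ u := h
      simp [exec, hc, h, q20]
    · simp [exec, hc, huk, hI u (by omega)]

end Clearing

namespace Clearing
open Program

/-! ### Construction of the adjusted network -/

/-- Stores the numbers of cells for banks and edges. -/
def initCounts : Program :=
  setNv 30 (.add (nv 0) (.add (nv 0) (nv 0))) ;;
  setNv 31 (.add edgeCount (.add (nv 0) (nv 0)))

theorem initCounts_spec (σ : Store) :
    WP initCounts σ fun σ' t => t ≤ 3 ∧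
      σ'.nat 30 0 0 = σ.nat 0 0 0 + (σ.nat 0 0 0 + σ.nat 0 0 0) ∧
      σ'.nat 31 0 0 = σ.nat 0 0 1 + (σ.nat 0 0 0 + σ.nat 0 0 0) := by
  refine WP.exec rfl fun t ht => ⟨ht, ?_⟩
  simp [initCounts, exec]

/-- Computes the total liabilities and marks the edges as remaining. -/
def initEdges : Program :=
  forN 40 edgeCount
    (setRa 23 (srcOf (nv 40)) (.add (ra 23 (srcOf (nv 40))) (ra 1 (nv 40))) ;;
    setNa 20 (nv 40) (.const 1))

theorem initEdges_spec (σ : Store) (m : ℕ) (hm : σ.nat 0 0 1 = m) :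
    WP initEdges σ fun σ' t => t ≤ m * 6 + 3 ∧
      (∀ i, σ'.real 23 0 i = σ.real 23 0 i +
        ∑ x ∈ Finset.range m, if σ.nat 1 0 x = i then σ.real 1 0 x else 0) ∧
      ∀ x, σ'.nat 20 0 x = if x < m then 1 else σ.nat 20 0 x := by
  refine (WP.forN_const m 3 (fun k σ' =>
      (∀ i, σ'.real 23 0 i = σ.real 23 0 i +
        ∑ x ∈ Finset.range k, if σ.nat 1 0 x = i then σ.real 1 0 x else 0) ∧
      ∀ x, σ'.nat 20 0 x = if x < k then 1 else σ.nat 20 0 x) ?_ rfl ?_ ?_).conseq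
      fun _ _ _ h => h
  · intro σ' hf; simp [hf.1 0 rfl, hm]
  · simp
  · intro k hk σ₁ hf hc ⟨h1, h2⟩
    refine WP.exec rfl fun t ht => ⟨ht, fun i => ?_, fun x => ?_⟩
    · rw [Finset.sum_range_succ]
      by_cases hi : i = σ.nat 1 0 k
      · subst hi
        simp [exec, hc, hf.1 1 rfl, hf.2 1 rfl, h1, add_assoc]
      · simp [exec, hc, hf.1 1 rfl, h1, hi, Ne.symm hi]
    · by_cases hx : x = k
      · simp [exec, hc, hx]
      · have : x ≤ k ↔ x < k := by omega
        simp [exec, hc, hx, h2, this]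

/-- Marks the banks with default costs and sets the external assets. -/
def initBanks : Program :=
  forN 40 (nv 0)
    (.ite (.not (.and (.not (.realLt (.cell 0 (.const 1) (nv 40)) (.const 1)))
        (.not (.realLt (.cell 0 (.const 2) (nv 40)) (.const 1)))))
      (setNa 22 (nv 40) (.const 1) ;;
        setRa 22 (nv 40) (.mul (.cell 0 (.const 1) (nv 40)) (ra 0 (nv 40))))
      (setRa 22 (nv 40) (ra 0 (nv 40))))

open Classical in
theorem initBanks_spec (σ : Store) (n : ℕ) (hn : σ.nat 0 0 0 = n) :
    WP initBanks σ fun σ' t => t ≤ n * 8 + 3 ∧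
      (∀ i, σ'.nat 22 0 i =
        if i < n ∧ (σ.real 0 1 i < 1 ∨ σ.real 0 2 i < 1) then 1 else σ.nat 22 0 i) ∧
      ∀ i, σ'.real 22 0 i = if i < n then
        (if σ.real 0 1 i < 1 ∨ σ.real 0 2 i < 1 then σ.real 0 1 i * σ.real 0 0 i
          else σ.real 0 0 i) else σ.real 22 0 i := by
  refine (WP.forN_const n 5 (fun k σ' =>
      (∀ i, σ'.nat 22 0 i =
        if i < k ∧ (σ.real 0 1 i < 1 ∨ σ.real 0 2 i < 1) then 1 else σ.nat 22 0 i) ∧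
      ∀ i, σ'.real 22 0 i = if i < k then
        (if σ.real 0 1 i < 1 ∨ σ.real 0 2 i < 1 then σ.real 0 1 i * σ.real 0 0 i
          else σ.real 0 0 i) else σ.real 22 0 i) ?_ rfl ?_ ?_).conseq fun _ _ _ h => h
  · intro σ' hf; simp [hf.1 0 rfl, hn]
  · simp
  · intro k hk σ₁ hf hc ⟨h1, h2⟩
    have q0 : σ₁.real 0 = σ.real 0 := hf.2 0 rfl
    refine WP.ite (fun h => ?_) (fun h => ?_) <;>
      simp only [Test.Holds, NExp.eval, RExp.eval, q0, hc, Nat.cast_one, not_and_or, not_not]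
        at h <;>
      refine WP.exec rfl fun t ht => ⟨by simp only [cost] at ht; omega, fun i => ?_, fun i => ?_⟩ <;>
      by_cases hi : i = k
    · subst hi; simp [exec, hc, h]
    · have : i ≤ k ↔ i < k := by omega
      simp [exec, hc, hi, h1, this]
    · subst hi; simp [exec, hc, h, q0]
    · have : i ≤ k ↔ i < k := by omega
      simp [exec, hc, hi, h2, this]
    · subst hi; simp [exec, h1, h]
    · have : i ≤ k ↔ i < k := by omega
      simp [exec, h1, this]
    · subst hi; simp [exec, hc, h, q0]
    · have : i ≤ k ↔ i < k := by omega
      simp [exec, hc, hi, h2, this]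

/-- Adds the edges with the indices `o + u`, creditors `q + u` and slopes `s` for all banks `u` with
default costs. -/
def auxEdges (o q : NExp) (s : RExp) : Program :=
  forN 40 (nv 0)
    (.ite (isPos (na 22 (nv 40)))
      (.setNat 1 (.const 0) (.add o (nv 40)) (.add (nv 0) (nv 40)) ;;
      .setNat 1 (.const 1) (.add o (nv 40)) (.add q (nv 40)) ;;
      .setNat 1 (.const 2) (.add o (nv 40)) (.const 1) ;;
      .setReal 2 (.add o (nv 40)) (.const 1) (ra 23 (nv 40)) ;;
      .setReal 3 (.add o (nv 40)) (.const 0) s ;;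
      setNa 20 (.add o (nv 40)) (.const 1)) skip)

/-- The cells of the edge `x` are those of a remaining edge with one border. -/
def IsAuxEdge (σ : Store) (x i j : ℕ) (L s : ℝ) : Prop :=
  σ.nat 1 0 x = i ∧ σ.nat 1 1 x = j ∧ σ.nat 1 2 x = 1 ∧ σ.real 2 x 1 = L ∧ σ.real 3 x 0 = s ∧
    σ.nat 20 0 x = 1

/-- Both memories agree in the cells of the edge `x`. -/
def SameEdge (σ σ' : Store) (x : ℕ) : Prop :=
  (∀ r, σ'.nat 1 r x = σ.nat 1 r x) ∧ σ'.real 2 x = σ.real 2 x ∧ σ'.real 3 x = σ.real 3 x ∧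
    σ'.nat 20 0 x = σ.nat 20 0 x

/-- The expressions are evaluated in changing memories; the hypotheses say that their values depend
on array `0`, and for the slope on the counter, only. The last two conjuncts keep border `0` and
slope `1` of the new edges at the `0` they have in the input. -/
theorem auxEdges_spec (o q : NExp) (s : RExp) (σ : Store) (n o' q' : ℕ) (s' : ℕ → ℝ)
    (hn : σ.nat 0 0 0 = n)
    (ho : ∀ σ', (∀ i j, σ'.nat 0 i j = σ.nat 0 i j) → o.eval σ' = o')
    (hq : ∀ σ', (∀ i j, σ'.nat 0 i j = σ.nat 0 i j) → q.eval σ' = q')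
    (hs : ∀ σ', (∀ i j, σ'.real 0 i j = σ.real 0 i j) → s.eval σ' = s' (σ'.nat 40 0 0)) :
    WP (auxEdges o q s) σ fun σ' t => t ≤ n * 16 + 3 ∧
      (∀ u < n, 0 < σ.nat 22 0 u → IsAuxEdge σ' (o' + u) (n + u) (q' + u) (σ.real 23 0 u) (s' u)) ∧
      (∀ x, (∀ u < n, 0 < σ.nat 22 0 u → o' + u ≠ x) → SameEdge σ σ' x) ∧
      (∀ x i, i ≠ 1 → σ'.real 2 x i = σ.real 2 x i) ∧
      ∀ x i, i ≠ 0 → σ'.real 3 x i = σ.real 3 x i := by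
  refine (WP.forN_const n 13 (fun k σ' =>
      (∀ u < k, 0 < σ.nat 22 0 u → IsAuxEdge σ' (o' + u) (n + u) (q' + u) (σ.real 23 0 u) (s' u)) ∧
      (∀ x, (∀ u < k, 0 < σ.nat 22 0 u → o' + u ≠ x) → SameEdge σ σ' x) ∧
      (∀ x i, i ≠ 1 → σ'.real 2 x i = σ.real 2 x i) ∧
      ∀ x i, i ≠ 0 → σ'.real 3 x i = σ.real 3 x i) ?_ rfl ?_ ?_).conseq fun _ _ _ h => h
  · intro σ' hf; simp [hf.1 0 rfl, hn]
  · simp [SameEdge]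
  · intro k hk σ₁ hf hc ⟨h1, h2, h3, h4⟩
    have r0 : σ₁.nat 0 = σ.nat 0 := hf.1 0 rfl
    have r22 : σ₁.nat 22 = σ.nat 22 := hf.1 22 rfl
    have q0 : σ₁.real 0 = σ.real 0 := hf.2 0 rfl
    have q23 : σ₁.real 23 = σ.real 23 := hf.2 23 rfl
    refine WP.ite (fun h => ?_) (fun h => ?_) <;>
      simp only [Test.Holds, NExp.eval, r22, hc] at h
    · refine WP.exec rfl fun t ht => ⟨by simp only [cost] at ht; omega, ?_⟩
      set σ₂ := ((((((σ₁.writeNat 1 0 (o' + k) (n + k)).writeNat 1 1 (o' + k) (q' + k)).writeNat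
        1 2 (o' + k) 1).writeReal 2 (o' + k) 1 (σ.real 23 0 k)).writeReal 3 (o' + k) 0
        (s' k)).writeNat 20 0 (o' + k) 1).writeNat 40 0 0 (k + 1) with hσ₂
      have e : (Program.exec (.setNat 1 (.const 0) (.add o (nv 40)) (.add (nv 0) (nv 40)) ;;
          .setNat 1 (.const 1) (.add o (nv 40)) (.add q (nv 40)) ;;
          .setNat 1 (.const 2) (.add o (nv 40)) (.const 1) ;;
          .setReal 2 (.add o (nv 40)) (.const 1) (ra 23 (nv 40)) ;;
          .setReal 3 (.add o (nv 40)) (.const 0) s ;;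
          setNa 20 (.add o (nv 40)) (.const 1)) σ₁).writeNat 40 0 0 (k + 1) = σ₂ := by
        have n0 : σ₁.nat 0 0 0 = n := by rw [r0, hn]
        simp only [exec, NExp.eval, RExp.eval]
        simp [ho, hq, hs, r0, q0, hc, n0, q23, hσ₂]
      rw [e]
      refine ⟨fun u hu hdu => ?_, fun x hx => ?_, fun x i hi => ?_, fun x i hi => ?_⟩
      · by_cases huk : u = k
        · subst huk
          simp [IsAuxEdge, hσ₂]
        · obtain ⟨g1, g2, g3, g4, g5, g6⟩ := h1 u (by omega) hdu
          simp [IsAuxEdge, hσ₂, huk, g1, g2, g3, g4, g5, g6]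
      · have hxk : x ≠ o' + k := fun h' => hx k (by omega) h h'.symm
        obtain ⟨g1, g2, g3, g4⟩ := h2 x fun u hu => hx u (by omega)
        refine ⟨fun r => ?_, ?_, ?_, ?_⟩
        · simp [hσ₂, hxk, g1]
        · funext i; simp [hσ₂, hxk, g2]
        · funext i; simp [hσ₂, hxk, g3]
        · simp [hσ₂, hxk, g4]
      · simp [hσ₂, hi, h3 x i hi]
      · simp [hσ₂, hi, h4 x i hi]
    · refine WP.exec rfl fun t ht => ⟨by simp only [cost] at ht; omega, fun u hu hdu => ?_,
        fun x hx => ?_, fun x i hi => ?_, fun x i hi => ?_⟩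
      · have huk : u ≠ k := by rintro rfl; exact h hdu
        simpa [exec, IsAuxEdge] using h1 u (by omega) hdu
      · simpa [exec, SameEdge] using h2 x fun u hu => hx u (by omega)
      · simp [exec, h3 x i hi]
      · simp [exec, h4 x i hi]

/-- Re-routes the edges to banks with default costs. -/
def redirect : Program :=
  forN 40 edgeCount
    (.ite (isPos (na 22 (tgtOf (nv 40))))
      (.setNat 1 (.const 1) (nv 40) (.add (nv 0) (tgtOf (nv 40)))) skip)

theorem redirect_spec (σ : Store) (n m : ℕ) (hn : σ.nat 0 0 0 = n) (hm : σ.nat 0 0 1 = m) :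
    WP redirect σ fun σ' t => t ≤ m * 6 + 3 ∧
      (∀ r x, r ≠ 1 → σ'.nat 1 r x = σ.nat 1 r x) ∧
      ∀ x, σ'.nat 1 1 x = if x < m ∧ 0 < σ.nat 22 0 (σ.nat 1 1 x) then n + σ.nat 1 1 x
        else σ.nat 1 1 x := by
  refine (WP.forN_const m 3 (fun k σ' =>
      (∀ r x, r ≠ 1 → σ'.nat 1 r x = σ.nat 1 r x) ∧
      ∀ x, σ'.nat 1 1 x = if x < k ∧ 0 < σ.nat 22 0 (σ.nat 1 1 x) then n + σ.nat 1 1 x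
        else σ.nat 1 1 x) ?_ rfl ?_ ?_).conseq fun _ _ _ h => h
  · intro σ' hf; simp [hf.1 0 rfl, hm]
  · simp
  · intro k hk σ₁ hf hc ⟨h1, h2⟩
    have r0 : σ₁.nat 0 0 0 = n := by rw [hf.1 0 rfl, hn]
    have r22 : σ₁.nat 22 = σ.nat 22 := hf.1 22 rfl
    have hk1 : σ₁.nat 1 1 k = σ.nat 1 1 k := by rw [h2]; simp
    refine WP.ite (fun h => ?_) (fun h => ?_) <;>
      simp only [Test.Holds, NExp.eval, r22, hc, hk1] at h <;>
      refine WP.exec rfl fun t ht => ⟨by simp only [cost] at ht; omega, fun r x hr => ?_,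
        fun x => ?_⟩
    · simp [exec, hr, h1 r x hr]
    · by_cases hx : x = k
      · subst hx; simp [exec, hc, r0, hk1, h]
      · have : x ≤ k ↔ x < k := by omega
        simp [exec, hc, hx, h2, this]
    · simp [exec, h1 r x hr]
    · by_cases hx : x = k
      · subst hx; simp [exec, hk1, h]
      · have : x ≤ k ↔ x < k := by omega
        simp [exec, h2, this]

/-- Computes a bound for all borders. -/
def initBound : Program :=
  forN 40 (nv 31) (setRv 29 (.add (rv 29) (.cell 2 (nv 40) (.cell 1 (.const 2) (nv 40)))))

/-- A sum of non-negative last borders dominates every border. It starts the ratio test of a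
flooding, for which the linear program gives no bound. -/
theorem initBound_spec (σ : Store) (M : ℕ) (hM : σ.nat 31 0 0 = M) :
    WP initBound σ fun σ' t => t ≤ M * 4 + 3 ∧
      σ'.real 29 0 0 = σ.real 29 0 0 + ∑ x ∈ Finset.range M, σ.real 2 x (σ.nat 1 2 x) := by
  refine (WP.forN_const M 1 (fun k σ' =>
      σ'.real 29 0 0 = σ.real 29 0 0 + ∑ x ∈ Finset.range k, σ.real 2 x (σ.nat 1 2 x))
      ?_ rfl ?_ ?_).conseq fun _ _ _ h => h
  · intro σ' hf; simp [hf.1 31 rfl, hM]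
  · simp
  · intro k hk σ₁ hf hc h1
    refine WP.exec rfl fun t ht => ⟨ht, ?_⟩
    rw [Finset.sum_range_succ]
    simp [exec, hc, hf.2 2 rfl, hf.1 1 rfl, h1, add_assoc]

end Clearing

/-! ### Correspondence between the memory and the states of the algorithm. -/

namespace Clearing
open Program Network

variable {n m : ℕ} {F : Network (Fin n) (Fin m)}

/-! ### Memory layout -/

/-- the cell of a bank of the adjusted network -/
def bankId : F.AdjBank → ℕ
  | .inl w => w
  | .inr (.inl u) => n + u.1
  | .inr (.inr u) => n + (n + u.1)

/-- the cell of an edge of the adjusted network -/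
def edgeId : F.AdjEdge → ℕ
  | .inl e => e
  | .inr (.inl u) => m + u.1
  | .inr (.inr u) => m + (n + u.1)

theorem bankId_lt (w : F.AdjBank) : bankId w < n + (n + n) := by
  rcases w with w | u | u
  · have := w.2; simp only [bankId]; omega
  · have := u.1.2; simp only [bankId]; omega
  · have := u.1.2; simp only [bankId]; omega

theorem edgeId_lt (e : F.AdjEdge) : edgeId e < m + (n + n) := by
  rcases e with e | u | u
  · have := e.2; simp only [edgeId]; omega
  · have := u.1.2; simp only [edgeId]; omega
  · have := u.1.2; simp only [edgeId]; omega

theorem bankId_injective : Function.Injective (bankId (F := F)) := by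
  rintro (w | u | u) (w' | u' | u') h <;> simp only [bankId] at h
  · exact congrArg Sum.inl (Fin.ext h)
  · have := w.2; omega
  · have := w.2; omega
  · have := w'.2; omega
  · exact congrArg (Sum.inr ∘ Sum.inl) (Subtype.ext (Fin.ext (by omega)))
  · have := u.1.2; omega
  · have := w'.2; omega
  · have := u'.1.2; omega
  · exact congrArg (Sum.inr ∘ Sum.inr) (Subtype.ext (Fin.ext (by omega)))

theorem edgeId_injective : Function.Injective (edgeId (F := F)) := by
  rintro (w | u | u) (w' | u' | u') h <;> simp only [edgeId] at h
  · exact congrArg Sum.inl (Fin.ext h)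
  · have := w.2; omega
  · have := w.2; omega
  · have := w'.2; omega
  · exact congrArg (Sum.inr ∘ Sum.inl) (Subtype.ext (Fin.ext (by omega)))
  · have := u.1.2; omega
  · have := w'.2; omega
  · have := u'.1.2; omega
  · exact congrArg (Sum.inr ∘ Sum.inr) (Subtype.ext (Fin.ext (by omega)))

/-- The layout reserves auxiliary cells for every bank, including those outside `D`. A loop runs
over all cells; the hypothesis `h0` says that unused ones contribute nothing. -/
theorem sum_range_eq_of_injective {ι M : Type*} [Fintype ι] [AddCommMonoid M] {g : ι → ℕ} {N : ℕ}
    (hg : Function.Injective g) (hN : ∀ i, g i < N) {f : ℕ → M}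
    (h0 : ∀ x < N, (∀ i, g i ≠ x) → f x = 0) : ∑ x ∈ Finset.range N, f x = ∑ i, f (g i) := by
  classical
  rw [← Finset.sum_image (s := Finset.univ) (g := g) (f := f) fun _ _ _ _ h => hg h]
  refine (Finset.sum_subset (fun x hx => ?_) fun x hx hx' => ?_).symm
  · obtain ⟨i, _, rfl⟩ := Finset.mem_image.1 hx
    exact Finset.mem_range.2 (hN i)
  · refine h0 x (Finset.mem_range.1 hx) fun i hi => hx' ?_
    exact Finset.mem_image.2 ⟨i, Finset.mem_univ _, hi⟩

variable (F) in
/-- The memory holds the adjusted network of `F`. -/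
structure Static (σ : Store) : Prop where
  bankCount : σ.nat 0 0 0 = n
  edgeCount : σ.nat 0 0 1 = m
  bankCells : σ.nat 30 0 0 = n + (n + n)
  edgeCells : σ.nat 31 0 0 = m + (n + n)
  src : ∀ e : F.AdjEdge, σ.nat 1 0 (edgeId e) = bankId (F.adjust.src e)
  tgt : ∀ e : F.AdjEdge, σ.nat 1 1 (edgeId e) = bankId (F.adjust.tgt e)
  numBorders : ∀ e : F.AdjEdge, σ.nat 1 2 (edgeId e) = F.adjust.numBorders e
  numBorders_unused : ∀ x, (∀ e : F.AdjEdge, edgeId e ≠ x) → σ.nat 1 2 x = 0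
  border : ∀ (e : F.AdjEdge) (i : ℕ), i ≤ F.adjust.numBorders e →
    σ.real 2 (edgeId e) i = F.adjust.border e i
  slope : ∀ (e : F.AdjEdge) (i : ℕ), i ≤ F.adjust.numBorders e →
    σ.real 3 (edgeId e) i = F.adjust.slope e i
  liab : ∀ e : Fin m, σ.real 1 0 e = F.liab e
  ext : ∀ w : Fin n, σ.real 0 0 w = F.ext w
  flag : ∀ w : Fin n, 0 < σ.nat 22 0 w ↔ F.alpha w < 1 ∨ F.beta w < 1
  outLiab : ∀ w : Fin n, σ.real 23 0 w = F.outLiab w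
  bound : ∀ e : F.AdjEdge, F.adjust.border e (F.adjust.numBorders e) ≤ σ.real 29 0 0

/-- The memory holds the variables of the algorithm. -/
structure Dynamic (s : State F) (σ : Store) : Prop where
  b : ∀ w, σ.real 20 0 (bankId w) = s.b w
  bx : ∀ w, σ.real 21 0 (bankId w) = s.bx w
  ax : ∀ w, σ.real 22 0 (bankId w) = s.ax w
  live : ∀ e, 0 < σ.nat 20 0 (edgeId e) ↔ e ∈ s.live
  bx_unused : ∀ i, (∀ w : F.AdjBank, bankId w ≠ i) → ¬ σ.real 21 0 i < σ.real 22 0 i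
  live_unused : ∀ x, (∀ e : F.AdjEdge, edgeId e ≠ x) → σ.nat 20 0 x = 0
  cur : σ.nat 32 0 0 = s.cur.elim 0 fun w => bankId w + 1

variable (F) in
/-- The memory holds the intervals of the edges for the assets `b`. -/
structure Pointers (b : F.AdjBank → ℝ) (σ : Store) : Prop where
  interval : ∀ e, σ.nat 21 0 (edgeId e) = F.adjust.interval e (b (F.adjust.src e))
  pay : ∀ e, σ.real 24 0 (edgeId e) =
    F.adjust.pay e (F.adjust.border e (F.adjust.interval e (b (F.adjust.src e))))
  unused : ∀ x < m + (n + n), (∀ e : F.AdjEdge, edgeId e ≠ x) →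
    σ.nat 21 0 x = 0 ∧ σ.real 24 0 x = 0

theorem Static.of_eq {σ σ' : Store} (h : Static F σ) (n0 : σ'.nat 0 = σ.nat 0)
    (n1 : σ'.nat 1 = σ.nat 1) (n22 : σ'.nat 22 = σ.nat 22) (n30 : σ'.nat 30 = σ.nat 30)
    (n31 : σ'.nat 31 = σ.nat 31) (r0 : σ'.real 0 = σ.real 0) (r1 : σ'.real 1 = σ.real 1)
    (r2 : σ'.real 2 = σ.real 2) (r3 : σ'.real 3 = σ.real 3) (r23 : σ'.real 23 = σ.real 23)
    (r29 : σ'.real 29 = σ.real 29) : Static F σ' := by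
  constructor
  · rw [n0]; exact h.bankCount
  · rw [n0]; exact h.edgeCount
  · rw [n30]; exact h.bankCells
  · rw [n31]; exact h.edgeCells
  · rw [n1]; exact h.src
  · rw [n1]; exact h.tgt
  · rw [n1]; exact h.numBorders
  · rw [n1]; exact h.numBorders_unused
  · rw [r2]; exact h.border
  · rw [r3]; exact h.slope
  · rw [r1]; exact h.liab
  · rw [r0]; exact h.ext
  · rw [n22]; exact h.flag
  · rw [r23]; exact h.outLiab
  · rw [r29]; exact h.bound

theorem Dynamic.of_eq {s : State F} {σ σ' : Store} (h : Dynamic s σ) (r20 : σ'.real 20 = σ.real 20)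
    (r21 : σ'.real 21 = σ.real 21) (r22 : σ'.real 22 = σ.real 22) (n20 : σ'.nat 20 = σ.nat 20)
    (n32 : σ'.nat 32 = σ.nat 32) : Dynamic s σ' := by
  constructor
  · rw [r20]; exact h.b
  · rw [r21]; exact h.bx
  · rw [r22]; exact h.ax
  · rw [n20]; exact h.live
  · rw [r21, r22]; exact h.bx_unused
  · rw [n20]; exact h.live_unused
  · rw [n32]; exact h.cur

theorem Pointers.of_eq {b : F.AdjBank → ℝ} {σ σ' : Store} (h : Pointers F b σ)
    (n21 : σ'.nat 21 = σ.nat 21) (r24 : σ'.real 24 = σ.real 24) : Pointers F b σ' := by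
  constructor
  · rw [n21]; exact h.interval
  · rw [r24]; exact h.pay
  · rw [n21, r24]; exact h.unused

/-! ### Setup -/

/-- Builds the adjusted network and the variables of the algorithm. -/
def setup : Program :=
  initCounts ;; initEdges ;; initBanks ;;
  auxEdges edgeCount (.add (nv 0) (nv 0)) (.sub (.const 1) (.cell 0 (.const 2) (nv 40))) ;;
  auxEdges (.add edgeCount (nv 0)) (.const 0) (.cell 0 (.const 2) (nv 40)) ;;
  redirect ;; initBound

/-- the state before the first settling -/
noncomputable def start (F : Network (Fin n) (Fin m)) : State F :=
  { live := Finset.univ, ax := F.adjust.ext, bx := 0, b := 0, cur := none }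

theorem edgeId_inl_ne {x : ℕ} {u : F.DefBank ⊕ F.DefBank} (h : x < m) :
    edgeId (F := F) (.inr u) ≠ x := by
  rcases u with u | u <;> simp only [edgeId] <;> omega

theorem setup_spec (hF : F.WellFormed) :
    WP setup (input F) fun σ' t => t ≤ n * 60 + m * 30 + 40 ∧ Static F σ' ∧ Dynamic (start F) σ' ∧
      ∀ x, σ'.nat 21 0 x = 0 ∧ σ'.real 24 0 x = 0 := by
  set σ := input F with hσ
  have in0 : σ.nat 0 0 0 = n := by simp [hσ, input]
  have in1 : σ.nat 0 0 1 = m := by simp [hσ, input]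
  have in_src : ∀ e : Fin m, σ.nat 1 0 e = F.src e := by intro e; simp [hσ, input]
  have in_tgt : ∀ e : Fin m, σ.nat 1 1 e = F.tgt e := by intro e; simp [hσ, input]
  have in_nb : ∀ e : Fin m, σ.nat 1 2 e = F.numBorders e := by intro e; simp [hσ, input]
  have in_nb' : ∀ x, m ≤ x → σ.nat 1 2 x = 0 := by
    intro x hx; simp [hσ, input, Nat.not_lt.2 hx]
  have in_ext : ∀ w : Fin n, σ.real 0 0 w = F.ext w := by intro w; simp [hσ, input]
  have in_alpha : ∀ w : Fin n, σ.real 0 1 w = F.alpha w := by intro w; simp [hσ, input]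
  have in_beta : ∀ w : Fin n, σ.real 0 2 w = F.beta w := by intro w; simp [hσ, input]
  have in_liab : ∀ e : Fin m, σ.real 1 0 e = F.liab e := by intro e; simp [hσ, input]
  have in_border : ∀ (e : Fin m) i, i ≤ F.numBorders e → σ.real 2 e i = F.border e i := by
    intro e i hi; simp [hσ, input, hi]
  have in_slope : ∀ (e : Fin m) i, i ≤ F.numBorders e → σ.real 3 e i = F.slope e i := by
    intro e i hi; simp [hσ, input, hi]
  have in_row : ∀ x i, m ≤ x → σ.real 2 x i = 0 ∧ σ.real 3 x i = 0 := by
    intro x i hx; simp [hσ, input, Nat.not_lt.2 hx]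
  have in_nat : ∀ a x, 2 ≤ a → σ.nat a 0 x = 0 := by
    intro a x ha
    have h0 : a ≠ 0 := by omega
    have h1 : a ≠ 1 := by omega
    simp [hσ, input, h0, h1]
  have in_real : ∀ a x, 4 ≤ a → σ.real a 0 x = 0 := by
    intro a x ha
    have h0 : a ≠ 0 := by omega
    have h1 : a ≠ 1 := by omega
    have h2 : a ≠ 2 := by omega
    have h3 : a ≠ 3 := by omega
    simp [hσ, input, h0, h1, h2, h3]
  refine WP.seq (initCounts_spec σ) ?_
  rintro σ₁ t₁ hf₁ ⟨ht₁, c30, c31⟩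
  rw [in0] at c30
  rw [in0, in1] at c31
  refine WP.seq (initEdges_spec σ₁ m (by rw [hf₁.1 0 rfl, in1])) ?_
  rintro σ₂ t₂ hf₂ ⟨ht₂, L₂, live₂⟩
  rw [hf₁.1 1 rfl, hf₁.2 1 rfl, hf₁.2 23 rfl] at L₂
  rw [hf₁.1 20 rfl] at live₂
  refine WP.seq (initBanks_spec σ₂ n (by rw [hf₂.1 0 rfl, hf₁.1 0 rfl, in0])) ?_
  rintro σ₃ t₃ hf₃ ⟨ht₃, flag₃, ax₃⟩
  rw [hf₂.1 22 rfl, hf₁.1 22 rfl, hf₂.2 0 rfl, hf₁.2 0 rfl] at flag₃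
  rw [hf₂.2 22 rfl, hf₁.2 22 rfl, hf₂.2 0 rfl, hf₁.2 0 rfl] at ax₃
  have n0₃ : σ₃.nat 0 = σ.nat 0 := by rw [hf₃.1 0 rfl, hf₂.1 0 rfl, hf₁.1 0 rfl]
  have r0₃ : σ₃.real 0 = σ.real 0 := by rw [hf₃.2 0 rfl, hf₂.2 0 rfl, hf₁.2 0 rfl]
  have L₃ : σ₃.real 23 = σ₂.real 23 := hf₃.2 23 rfl
  refine WP.seq (auxEdges_spec _ _ _ σ₃ n m (n + n) (fun u => 1 - σ.real 0 2 u) (by rw [n0₃, in0])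
    (fun σ' h => by simp [h, n0₃, in1]) (fun σ' h => by simp [h, n0₃, in0])
    (fun σ' h => by simp [h, r0₃])) ?_
  rintro σ₄ t₄ hf₄ ⟨ht₄, aux₄, same₄, bor₄, slo₄⟩
  have n0₄ : σ₄.nat 0 = σ.nat 0 := by rw [hf₄.1 0 rfl, n0₃]
  have r0₄ : σ₄.real 0 = σ.real 0 := by rw [hf₄.2 0 rfl, r0₃]
  refine WP.seq (auxEdges_spec _ _ _ σ₄ n (m + n) 0 (fun u => σ.real 0 2 u) (by rw [n0₄, in0])
    (fun σ' h => by simp [h, n0₄, in0, in1]) (fun σ' h => by simp)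
    (fun σ' h => by simp [h, r0₄])) ?_
  rintro σ₅ t₅ hf₅ ⟨ht₅, aux₅, same₅, bor₅, slo₅⟩
  have n0₅ : σ₅.nat 0 = σ.nat 0 := by rw [hf₅.1 0 rfl, n0₄]
  rw [hf₄.1 22 rfl] at aux₅ same₅
  rw [hf₄.2 23 rfl] at aux₅
  have f22 : ∀ w : Fin n, 0 < σ₃.nat 22 0 w ↔ F.alpha w < 1 ∨ F.beta w < 1 := by
    intro w
    rw [flag₃, in_alpha, in_beta, in_nat 22 _ (by omega)]
    by_cases h : F.alpha w < 1 ∨ F.beta w < 1 <;> simp [h]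
  refine WP.seq (redirect_spec σ₅ n m (by rw [n0₅, in0]) (by rw [n0₅, in1])) ?_
  rintro σ₆ t₆ hf₆ ⟨ht₆, row₆, tgt₆⟩
  rw [hf₅.1 22 rfl, hf₄.1 22 rfl] at tgt₆
  refine (initBound_spec σ₆ (m + (n + n)) (by rw [hf₆.1 31 rfl, hf₅.1 31 rfl, hf₄.1 31 rfl,
    hf₃.1 31 rfl, hf₂.1 31 rfl, c31])).conseq ?_
  rintro σ' t hf ⟨ht, big⟩
  have f22' : ∀ u : F.DefBank, 0 < σ₃.nat 22 0 u.1 := fun u => (f22 u.1).2 u.2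
  have k1 : σ'.nat 1 = σ₆.nat 1 := hf.1 1 rfl
  have k2 : σ'.real 2 = σ₅.real 2 := by rw [hf.2 2 rfl, hf₆.2 2 rfl]
  have k3 : σ'.real 3 = σ₅.real 3 := by rw [hf.2 3 rfl, hf₆.2 3 rfl]
  have k20 : σ'.nat 20 = σ₅.nat 20 := by rw [hf.1 20 rfl, hf₆.1 20 rfl]
  have m1 : σ₃.nat 1 = σ.nat 1 := by rw [hf₃.1 1 rfl, hf₂.1 1 rfl, hf₁.1 1 rfl]
  have m2 : σ₃.real 2 = σ.real 2 := by rw [hf₃.2 2 rfl, hf₂.2 2 rfl, hf₁.2 2 rfl]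
  have m3 : σ₃.real 3 = σ.real 3 := by rw [hf₃.2 3 rfl, hf₂.2 3 rfl, hf₁.2 3 rfl]
  have m20 : ∀ x, σ₃.nat 20 0 x = if x < m then 1 else 0 := by
    intro x; rw [hf₃.1 20 rfl, live₂, in_nat 20 x (by omega)]
  have hL : ∀ w : Fin n, σ₃.real 23 0 w = F.outLiab w := by
    intro w
    rw [L₃, L₂, in_real 23 _ (by omega), zero_add, outLiab, outEdges, Finset.sum_filter,
      Finset.sum_range]
    refine Finset.sum_congr rfl fun e _ => ?_
    rw [in_src, in_liab]
    simp only [Fin.ext_iff]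
  -- the edges that are not auxiliary
  have old : ∀ x, (∀ u : F.DefBank ⊕ F.DefBank, edgeId (F := F) (.inr u) ≠ x) →
      SameEdge σ₃ σ₅ x := by
    intro x hx
    obtain ⟨g1, g2, g3, g4⟩ := same₄ x fun u hu hd he =>
      hx (.inl ⟨⟨u, hu⟩, (f22 ⟨u, hu⟩).1 hd⟩) he
    obtain ⟨g5, g6, g7, g8⟩ := same₅ x fun u hu hd he =>
      hx (.inr ⟨⟨u, hu⟩, (f22 ⟨u, hu⟩).1 hd⟩) (by rw [← he]; exact (Nat.add_assoc _ _ _).symm)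
    exact ⟨fun r => (g5 r).trans (g1 r), g6.trans g2, g7.trans g3, g8.trans g4⟩
  have oldE : ∀ e : Fin m, SameEdge σ₃ σ₅ e := fun e => old _ fun u => edgeId_inl_ne e.2
  -- the auxiliary edges
  have aux : ∀ u : F.DefBank ⊕ F.DefBank, IsAuxEdge σ₅ (edgeId (F := F) (.inr u))
      (bankId (F.adjust.src (.inr u))) (bankId (F.adjust.tgt (.inr u)))
      (F.adjust.border (.inr u) 1) (F.adjust.slope (.inr u) 0) := by
    rintro (u | u)
    · have hne : ∀ v < n, 0 < σ₃.nat 22 0 v → m + n + v ≠ m + u.1 := by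
        intro v _ _; have := u.1.2; omega
      obtain ⟨g1, g2, g3, g4⟩ := same₅ _ hne
      obtain ⟨p1, p2, p3, p4, p5, p6⟩ := aux₄ u.1 u.1.2 (f22' u)
      refine ⟨?_, ?_, ?_, ?_, ?_, ?_⟩
      · exact (g1 0).trans p1
      · exact ((g1 1).trans p2).trans (Nat.add_assoc _ _ _)
      · exact (g1 2).trans p3
      · exact ((congrFun g2 1).trans p4).trans ((hL u.1).trans (by simp [adjust]))
      · exact ((congrFun g3 0).trans p5).trans (by simp [adjust, in_beta])
      · exact g4.trans p6
    · obtain ⟨p1, p2, p3, p4, p5, p6⟩ := aux₅ u.1 u.1.2 (f22' u)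
      rw [Nat.add_assoc] at p1 p2 p3 p4 p5 p6
      refine ⟨p1, p2.trans (Nat.zero_add _), p3, ?_, ?_, p6⟩
      · exact p4.trans ((hL u.1).trans (by simp [adjust]))
      · exact p5.trans (by simp [adjust, in_beta])
  have unused : ∀ x, (∀ e : F.AdjEdge, edgeId e ≠ x) → m ≤ x := by
    intro x hx
    by_contra hlt
    exact hx (.inl ⟨x, by omega⟩) rfl
  have hnb : ∀ e : F.AdjEdge, σ'.nat 1 2 (edgeId e) = F.adjust.numBorders e := by
    intro e
    rw [k1, row₆ 2 _ (by omega)]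
    rcases e with e | u
    · rw [show edgeId (F := F) (.inl e) = (e : ℕ) from rfl, (oldE e).1, m1, in_nb]; rfl
    · rw [(aux u).2.2.1, adjust_numBorders_aux]
  have hnb' : ∀ x, (∀ e : F.AdjEdge, edgeId e ≠ x) → σ'.nat 1 2 x = 0 := by
    intro x hx
    rw [k1, row₆ 2 _ (by omega), (old x fun u => hx (.inr u)).1, m1, in_nb' x (unused x hx)]
  have hborder : ∀ (e : F.AdjEdge) (i : ℕ), i ≤ F.adjust.numBorders e →
      σ'.real 2 (edgeId e) i = F.adjust.border e i := by
    intro e i hi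
    rw [k2]
    rcases e with e | u
    · rw [show edgeId (F := F) (.inl e) = (e : ℕ) from rfl, (oldE e).2.1, m2, in_border e i hi]; rfl
    · rw [adjust_numBorders_aux] at hi
      interval_cases i
      · rw [bor₅ _ _ (by omega), bor₄ _ _ (by omega), m2, (in_row _ _ ?_).1,
          hF.adjust_border_zero]
        rcases u with u | u <;> simp only [edgeId] <;> omega
      · exact (aux u).2.2.2.1
  refine ⟨by omega, ⟨?_, ?_, ?_, ?_, ?_, ?_, hnb, hnb', hborder, ?_, ?_, ?_, ?_, ?_, ?_⟩,
    ⟨?_, ?_, ?_, ?_, ?_, ?_, ?_⟩, ?_⟩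
  · rw [hf.1 0 rfl, hf₆.1 0 rfl, n0₅, in0]
  · rw [hf.1 0 rfl, hf₆.1 0 rfl, n0₅, in1]
  · rw [hf.1 30 rfl, hf₆.1 30 rfl, hf₅.1 30 rfl, hf₄.1 30 rfl, hf₃.1 30 rfl, hf₂.1 30 rfl, c30]
  · rw [hf.1 31 rfl, hf₆.1 31 rfl, hf₅.1 31 rfl, hf₄.1 31 rfl, hf₃.1 31 rfl, hf₂.1 31 rfl, c31]
  · intro e
    rw [k1, row₆ 0 _ (by omega)]
    rcases e with e | u
    · rw [show edgeId (F := F) (.inl e) = (e : ℕ) from rfl, (oldE e).1, m1, in_src]; rfl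
    · exact (aux u).1
  · intro e
    rw [k1, tgt₆]
    rcases e with e | u
    · rw [show edgeId (F := F) (.inl e) = (e : ℕ) from rfl, (oldE e).1, m1, in_tgt]
      simp only [e.2, true_and, f22, adjust]
      split_ifs <;> rfl
    · rw [if_neg, (aux u).2.1]
      rintro ⟨h, -⟩
      exact edgeId_inl_ne h rfl
  · intro e i hi
    rw [k3]
    rcases e with e | u
    · rw [show edgeId (F := F) (.inl e) = (e : ℕ) from rfl, (oldE e).2.2.1, m3, in_slope e i hi]; rfl
    · rw [adjust_numBorders_aux] at hi
      interval_cases i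
      · exact (aux u).2.2.2.2.1
      · rw [slo₅ _ _ (by omega), slo₄ _ _ (by omega), m3, (in_row _ _ ?_).2]
        · rcases u with u | u <;> simp [adjust]
        rcases u with u | u <;> simp only [edgeId] <;> omega
  · intro e
    rw [hf.2 1 rfl, hf₆.2 1 rfl, hf₅.2 1 rfl, hf₄.2 1 rfl, hf₃.2 1 rfl, hf₂.2 1 rfl, hf₁.2 1 rfl,
      in_liab]
  · intro w
    rw [hf.2 0 rfl, hf₆.2 0 rfl, hf₅.2 0 rfl, r0₄, in_ext]
  · intro w
    rw [hf.1 22 rfl, hf₆.1 22 rfl, hf₅.1 22 rfl, hf₄.1 22 rfl, f22]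
  · intro w
    rw [hf.2 23 rfl, hf₆.2 23 rfl, hf₅.2 23 rfl, hf₄.2 23 rfl, hL]
  · intro e
    rw [big, hf₆.2 29 rfl, hf₅.2 29 rfl, hf₄.2 29 rfl, hf₃.2 29 rfl, hf₂.2 29 rfl, hf₁.2 29 rfl,
      in_real 29 _ (by omega), zero_add, ← k1, ← hf.2 2 rfl,
      sum_range_eq_of_injective edgeId_injective (edgeId_lt (F := F))]
    · simp only [hnb, hborder _ _ le_rfl]
      refine Finset.single_le_sum (f := fun e => F.adjust.border e (F.adjust.numBorders e))
        (fun e _ => ?_) (Finset.mem_univ e)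
      rw [← hF.adjust_border_zero e]
      have key : ∀ i, i ≤ F.adjust.numBorders e → F.adjust.border e 0 ≤ F.adjust.border e i := by
        intro i
        induction i with
        | zero => exact fun _ => le_rfl
        | succ i ih => exact fun hi => (ih (by omega)).trans (hF.adjust_border_le e i (by omega))
      exact key _ le_rfl
    · intro x hx hx'
      rw [hnb' x hx', k2, bor₅ _ _ (by omega), bor₄ _ _ (by omega), m2,
        (in_row _ _ (unused x hx')).1]
  · intro w
    rw [hf.2 20 rfl, hf₆.2 20 rfl, hf₅.2 20 rfl, hf₄.2 20 rfl, hf₃.2 20 rfl, hf₂.2 20 rfl,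
      hf₁.2 20 rfl, in_real 20 _ (by omega)]
    rfl
  · intro w
    rw [hf.2 21 rfl, hf₆.2 21 rfl, hf₅.2 21 rfl, hf₄.2 21 rfl, hf₃.2 21 rfl, hf₂.2 21 rfl,
      hf₁.2 21 rfl, in_real 21 _ (by omega)]
    rfl
  · intro w
    rw [hf.2 22 rfl, hf₆.2 22 rfl, hf₅.2 22 rfl, hf₄.2 22 rfl, ax₃, in_real 22 _ (by omega)]
    rcases w with w | u | u
    · simp only [bankId, w.2, if_true, in_alpha, in_beta, in_ext, start, adjust]
    · simp [bankId, start, adjust]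
    · simp [bankId, start, adjust]
  · intro e
    rw [k20]
    simp only [start, Finset.mem_univ, iff_true]
    rcases e with e | u
    · rw [show edgeId (F := F) (.inl e) = (e : ℕ) from rfl, (oldE e).2.2.2, m20]
      simp
    · rw [(aux u).2.2.2.2.2]; exact one_pos
  · intro i hi
    have hni : ¬ i < n := fun h => hi (.inl ⟨i, h⟩) rfl
    rw [hf.2 21 rfl, hf₆.2 21 rfl, hf₅.2 21 rfl, hf₄.2 21 rfl, hf₃.2 21 rfl, hf₂.2 21 rfl,
      hf₁.2 21 rfl, in_real 21 _ (by omega), hf.2 22 rfl, hf₆.2 22 rfl, hf₅.2 22 rfl, hf₄.2 22 rfl,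
      ax₃, if_neg hni, in_real 22 _ (by omega)]
    exact lt_irrefl _
  · intro x hx
    rw [k20, (old x fun u => hx (.inr u)).2.2.2, m20, if_neg (Nat.not_lt.2 (unused x hx))]
  · rw [hf.1 32 rfl, hf₆.1 32 rfl, hf₅.1 32 rfl, hf₄.1 32 rfl, hf₃.1 32 rfl, hf₂.1 32 rfl,
      hf₁.1 32 rfl, in_nat 32 _ (by omega)]
    rfl
  · intro x
    rw [hf.1 21 rfl, hf₆.1 21 rfl, hf₅.1 21 rfl, hf₄.1 21 rfl, hf₃.1 21 rfl, hf₂.1 21 rfl,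
      hf₁.1 21 rfl, in_nat 21 _ (by omega), hf.2 24 rfl, hf₆.2 24 rfl, hf₅.2 24 rfl, hf₄.2 24 rfl,
      hf₃.2 24 rfl, hf₂.2 24 rfl, hf₁.2 24 rfl, in_real 24 _ (by omega)]
    exact ⟨rfl, rfl⟩

end Clearing

namespace Clearing
open Program Network

variable {n m : ℕ} {F : Network (Fin n) (Fin m)}

/-! ### Programs on the memory layout -/

/-- The number of pointer moves is the number of borders that `b` has passed beyond the old
pointers. This is the quantity that `remaining_step` charges to the potential. -/
theorem advance_holds (hF : F.WellFormed) {σ : Store} (hS : Static F σ) {b : F.AdjBank → ℝ}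
    (hb : ∀ w, σ.real 20 0 (bankId w) = b w) (hb0 : ∀ w, 0 ≤ b w) (ptr : F.AdjEdge → ℕ)
    (h21 : ∀ e, σ.nat 21 0 (edgeId e) = ptr e)
    (hptr : ∀ e, ptr e ≤ F.adjust.interval e (b (F.adjust.src e)))
    (hpay : ∀ e, σ.real 24 0 (edgeId e) = F.adjust.pay e (F.adjust.border e (ptr e)))
    (hun : ∀ x < m + (n + n), (∀ e : F.AdjEdge, edgeId e ≠ x) →
      σ.nat 21 0 x = 0 ∧ σ.real 24 0 x = 0) :
    WP advance σ fun σ' t =>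
      t ≤ 4 * (passed b - ∑ e, ptr e) + (m + (n + n)) * 4 + 3 ∧ Pointers F b σ' := by
  have hspec := fun e : F.AdjEdge =>
    interval_spec (hF.adjust_border_zero e) (hF.adjust_border_le e) (hb0 (F.adjust.src e))
  have hG := hF.adjust_lawful
  -- Cells without an edge get target `0` and payment `0`; their stored number of borders is `0`, so
  -- the loop leaves them alone.
  set j : ℕ → ℕ := Function.extend (edgeId (F := F))
    (fun e => F.adjust.interval e (b (F.adjust.src e))) 0 with hj
  set p : ℕ → ℕ → ℝ := Function.extend (edgeId (F := F))
    (fun e i => F.adjust.pay e (F.adjust.border e i)) 0 with hp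
  have je : ∀ e : F.AdjEdge, j (edgeId e) = F.adjust.interval e (b (F.adjust.src e)) :=
    fun e => edgeId_injective.extend_apply _ _ _
  have pe : ∀ e : F.AdjEdge, p (edgeId e) = fun i => F.adjust.pay e (F.adjust.border e i) :=
    fun e => edgeId_injective.extend_apply _ _ _
  have ju : ∀ x, (∀ e : F.AdjEdge, edgeId e ≠ x) → j x = 0 := fun x hx =>
    Function.extend_apply' _ _ _ fun ⟨e, he⟩ => hx e he
  have pu : ∀ x, (∀ e : F.AdjEdge, edgeId e ≠ x) → p x = 0 := fun x hx =>
    Function.extend_apply' _ _ _ fun ⟨e, he⟩ => hx e he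
  have cases : ∀ x, (∃ e : F.AdjEdge, edgeId e = x) ∨ ∀ e : F.AdjEdge, edgeId e ≠ x := fun x =>
    or_iff_not_imp_left.2 fun h e he => h ⟨e, he⟩
  refine (advance_spec σ (m + (n + n)) hS.edgeCells j p ?_ ?_ ?_ ?_ ?_ ?_).conseq ?_
  · intro x hx
    obtain ⟨e, rfl⟩ | hx' := cases x
    · rw [je, h21]; exact hptr e
    · rw [(hun x hx hx').1]; exact Nat.zero_le _
  · intro x hx
    obtain ⟨e, rfl⟩ | hx' := cases x
    · rw [je, hS.numBorders]; exact interval_le_numBorders _ _ _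
    · rw [ju x hx']; exact Nat.zero_le _
  · intro x hx i hi
    obtain ⟨e, rfl⟩ | hx' := cases x
    · rw [je] at hi
      have := F.adjust.interval_le_numBorders e (b (F.adjust.src e))
      rw [hS.border e _ (by omega), hS.src, hb]
      exact (border_mono_of_step (hF.adjust_border_le e) hi this).trans (hspec e).2.1
    · rw [ju x hx'] at hi; omega
  · intro x hx hi
    obtain ⟨e, rfl⟩ | hx' := cases x
    · rw [je, hS.numBorders] at hi
      rw [je, hS.border e _ (by omega), hS.src, hb]
      exact (hspec e).2.2 hi
    · rw [hS.numBorders_unused x hx'] at hi; omega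
  · intro x hx i hi
    obtain ⟨e, rfl⟩ | hx' := cases x
    · rw [je] at hi
      have := F.adjust.interval_le_numBorders e (b (F.adjust.src e))
      rw [pe, hS.border e _ (by omega), hS.border e _ (by omega), hS.slope e _ (by omega)]
      exact hG.pay_border e i (by omega)
    · rw [ju x hx'] at hi; omega
  · intro x hx
    obtain ⟨e, rfl⟩ | hx' := cases x
    · rw [pe, h21, hpay]
    · rw [pu x hx', (hun x hx hx').2]; rfl
  · rintro σ' t _ ⟨ht, h⟩
    have hsum : ∑ x ∈ Finset.range (m + (n + n)), (j x - σ.nat 21 0 x) * 4 =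
        4 * (passed b - ∑ e, ptr e) := by
      rw [sum_range_eq_of_injective edgeId_injective (edgeId_lt (F := F))
        (f := fun x => (j x - σ.nat 21 0 x) * 4) (fun x hx hx' => by simp [ju x hx'])]
      simp only [je, h21, passed]
      rw [← Finset.sum_mul, Finset.sum_tsub_distrib _ fun e _ => hptr e, mul_comm]
    rw [hsum] at ht
    refine ⟨ht, fun e => ?_, fun e => ?_, fun x hx hx' => ?_⟩
    · rw [(h _ (edgeId_lt e)).1, je]
    · rw [(h _ (edgeId_lt e)).2, je, pe]
    · rw [(h _ hx).1, (h _ hx).2, ju x hx', pu x hx']; exact ⟨rfl, rfl⟩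

/-- The stored payment at the left border plus the affine part is `Lawful.pay_eq`; no payment
function is ever evaluated by the machine. -/
theorem payAt_eq (hF : F.WellFormed) {s : State F} {σ : Store} (hS : Static F σ)
    (hD : Dynamic s σ) (hP : Pointers F s.b σ) (hb : ∀ w, 0 ≤ s.b w) (e : F.AdjEdge) :
    payAt σ (edgeId e) = F.adjust.pay e (s.b (F.adjust.src e)) := by
  have h := F.adjust.interval_le_numBorders e (s.b (F.adjust.src e))
  unfold payAt
  rw [hP.pay, hP.interval, hS.slope e _ h, hS.border e _ h, hS.src, hD.b,
    hF.adjust_lawful.pay_eq e _ (hb _)]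
  rfl

theorem solventAt_iff {s : State F} {σ : Store} (hS : Static F σ) (hD : Dynamic s σ) (w : Fin n) :
    SolventAt σ w ↔ ∃ h : F.alpha w < 1 ∨ F.beta w < 1, F.Solvent s.b ⟨w, h⟩ := by
  unfold SolventAt
  rw [hS.flag, hS.ext, hS.outLiab, hS.bankCount, not_lt, ← exists_prop]
  refine exists_congr fun h => ?_
  have := hD.b (.inr (.inl ⟨w, h⟩))
  simp only [bankId] at this
  rw [this]
  rfl

theorem settledAt_iff {s : State F} {σ : Store} (hS : Static F σ) (hD : Dynamic s σ) (e : Fin m) :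
    SettledAt σ e ↔ .inl e ∈ F.settled s := by
  have h1 := hS.src (.inl e)
  have h2 := hD.live (.inl e)
  simp only [edgeId, adjust, bankId] at h1 h2
  rw [SettledAt, h1, h2, solventAt_iff hS hD, mem_settled]
  refine and_congr_right fun _ => ?_
  constructor
  · rintro ⟨h, hs⟩
    exact ⟨⟨F.src e, h⟩, rfl, hs⟩
  · rintro ⟨⟨v, hv⟩, hu, hs⟩
    have hu : F.src e = v := Sum.inl_injective hu
    subst hu
    exact ⟨hv, hs⟩

/-- Auxiliary edges leave a collecting bank, which is never settled, so the program need only search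
the edges of `F`. -/
theorem exists_inl_of_mem_settled {s : State F} {e : F.AdjEdge} (he : e ∈ F.settled s) :
    ∃ e', e = .inl e' := by
  obtain ⟨-, u, hu, -⟩ := mem_settled.1 he
  rcases e with e | e | e
  · exact ⟨e, rfl⟩
  · simp [adjust] at hu
  · simp [adjust] at hu

open Classical in
theorem sum_settled {s : State F} {σ : Store} (hS : Static F σ) (hD : Dynamic s σ)
    (f : ℕ → ℝ) (w : F.AdjBank) :
    (∑ x ∈ Finset.range m, if SettledAt σ x ∧ σ.nat 1 1 x = bankId w then f x else 0) =
      ∑ e ∈ (F.settled s).filter (fun e => F.adjust.tgt e = w), f (edgeId e) := by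
  rw [Finset.sum_range, ← Finset.sum_filter]
  refine Finset.sum_bij (fun e _ => Sum.inl e) (fun e he => ?_) (fun _ _ _ _ h => Sum.inl_injective h)
    (fun e he => ?_) (fun e _ => rfl)
  · obtain ⟨h1, h2⟩ := (Finset.mem_filter.1 he).2
    exact Finset.mem_filter.2 ⟨(settledAt_iff hS hD e).1 h1,
      bankId_injective ((hS.tgt (.inl e)).symm.trans h2)⟩
  · obtain ⟨h1, h2⟩ := Finset.mem_filter.1 he
    obtain ⟨e', rfl⟩ := exists_inl_of_mem_settled h1
    exact ⟨e', Finset.mem_filter.2 ⟨Finset.mem_univ _, (settledAt_iff hS hD e').2 h1,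
      (hS.tgt (.inl e')).trans (congrArg _ h2)⟩, rfl⟩

theorem settleProgram_holds (hF : F.WellFormed) {s : State F} {σ : Store} (hS : Static F σ)
    (hD : Dynamic s σ) (hP : Pointers F s.b σ) (hb : ∀ w, 0 ≤ s.b w) :
    WP settleProgram σ fun σ' t => t ≤ n * 6 + m * 10 + 7 ∧ Dynamic (F.settle s) σ' := by
  classical
  have hsrc : ∀ x < m, σ.nat 1 0 x < n := by
    intro x hx
    have := hS.src (.inl ⟨x, hx⟩)
    simp only [edgeId, adjust, bankId] at this
    rw [this]; exact (F.src _).2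
  refine (settleProgram_spec σ n m hS.bankCount hS.edgeCount hsrc).conseq ?_
  rintro σ' t hf ⟨ht, h21, h22, h20⟩
  refine ⟨ht, ⟨fun w => ?_, fun w => ?_, fun w => ?_, fun e => ?_, fun i hi => ?_, fun x hx => ?_, ?_⟩⟩
  · rw [hf.2 20 rfl]; exact hD.b w
  · rw [h21, hD.bx]
    simp only [settle]
    have := (sum_settled hS hD (payAt σ) w).trans
      (Finset.sum_congr rfl fun e _ => payAt_eq hF hS hD hP hb e)
    convert congrArg (s.bx w + ·) this
  · rw [h22, hD.ax]
    simp only [settle]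
    have := (sum_settled hS hD (σ.real 1 0) w).trans (Finset.sum_congr rfl fun e he =>
      show _ = F.adjust.liab e by
        obtain ⟨e', rfl⟩ := exists_inl_of_mem_settled (Finset.mem_filter.1 he).1
        exact hS.liab e')
    convert congrArg (s.ax w + ·) this
  · rw [h20, hD.live]
    simp only [settle, Finset.mem_sdiff]
    refine and_congr_right fun _ => not_congr ?_
    constructor
    · rintro ⟨hx, h⟩
      rcases e with e | u
      · exact (settledAt_iff hS hD e).1 h
      · exact absurd rfl (edgeId_inl_ne hx)
    · intro h
      obtain ⟨e', rfl⟩ := exists_inl_of_mem_settled h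
      exact ⟨e'.2, (settledAt_iff hS hD e').2 h⟩
  · have hz : ∀ x ∈ Finset.range m, ¬ (SettledAt σ x ∧ σ.nat 1 1 x = i) := by
      rintro x hx ⟨-, h⟩
      exact hi _ ((hS.tgt (.inl ⟨x, Finset.mem_range.1 hx⟩)).symm.trans h)
    rw [h21, h22, Finset.sum_eq_zero fun x hx => if_neg (hz x hx),
      Finset.sum_eq_zero fun x hx => if_neg (hz x hx), add_zero, add_zero]
    exact hD.bx_unused i hi
  · have := h20 x
    rw [hD.live_unused x hx] at this
    simpa using this
  · rw [hf.1 32 rfl]; exact hD.cur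

/-- Publishes the variables of the algorithm. -/
def publish : Program := copyReal 20 10 ;; copyReal 21 11 ;; copyReal 22 12 ;; copyLive

theorem publish_holds {s : State F} {σ : Store} (hS : Static F σ) (hD : Dynamic s σ) :
    WP publish σ fun σ' t => t ≤ n * 30 + m * 4 + 19 ∧ StoreHolds s σ' := by
  refine WP.seq (copyReal_spec 20 10 rfl σ n hS.bankCount) ?_
  rintro σ₁ t₁ hf₁ ⟨ht₁, h₁⟩
  refine WP.seq (copyReal_spec 21 11 rfl σ₁ n (by rw [hf₁.1 0 rfl]; exact hS.bankCount)) ?_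
  rintro σ₂ t₂ hf₂ ⟨ht₂, h₂⟩
  refine WP.seq (copyReal_spec 22 12 rfl σ₂ n
    (by rw [hf₂.1 0 rfl, hf₁.1 0 rfl]; exact hS.bankCount)) ?_
  rintro σ₃ t₃ hf₃ ⟨ht₃, h₃⟩
  have n0 : σ₃.nat 0 = σ.nat 0 := by rw [hf₃.1 0 rfl, hf₂.1 0 rfl, hf₁.1 0 rfl]
  refine (copyLive_spec σ₃ n m (by rw [n0]; exact hS.bankCount)
    (by rw [n0]; exact hS.edgeCount)).conseq ?_
  rintro σ' t hf ⟨ht, h₄, h₅⟩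
  refine ⟨by omega, fun w => ?_, fun e => ?_⟩
  · rw [← hD.b, ← hD.bx, ← hD.ax, hf.2 10 rfl, hf₃.2 10 rfl, hf₂.2 10 rfl, hf.2 11 rfl, hf₃.2 11 rfl,
      hf.2 12 rfl, ← hf₁.2 21 rfl, ← hf₁.2 22 rfl, ← hf₂.2 22 rfl]
    rcases w with w | u | u
    · exact ⟨(h₁ w w.2).1, (h₂ w w.2).1, (h₃ w w.2).1⟩
    · exact ⟨(h₁ u.1 u.1.2).2.1, (h₂ u.1 u.1.2).2.1, (h₃ u.1 u.1.2).2.1⟩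
    · exact ⟨(h₁ u.1 u.1.2).2.2, (h₂ u.1 u.1.2).2.2, (h₃ u.1 u.1.2).2.2⟩
  · rw [← hD.live, ← Nat.pos_iff_ne_zero]
    rw [hf₃.1 20 rfl, hf₂.1 20 rfl, hf₁.1 20 rfl] at h₄ h₅
    rcases e with e | u | u
    · exact iff_of_eq (congrArg _ (h₄ e e.2))
    · exact iff_of_eq (congrArg _ (h₅ u.1 u.1.2).1)
    · exact iff_of_eq (congrArg _ (h₅ u.1 u.1.2).2)

theorem writeOutput_holds {s : State F} {σ : Store} (hS : Static F σ) (hD : Dynamic s σ) :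
    WP writeOutput σ fun σ' t => t ≤ n * 6 + 3 ∧ output σ' = F.result s := by
  refine (writeOutput_spec σ n hS.bankCount).conseq ?_
  rintro σ' t - ⟨ht, h⟩
  refine ⟨ht, funext fun w => ?_⟩
  unfold output result
  rw [h w w.2, hS.ext, show σ.real 20 0 w = s.b (.inl w) from hD.b (.inl w)]
  have hw := solventAt_iff hS hD w
  by_cases h1 : F.alpha w < 1 ∨ F.beta w < 1
  · rw [dif_pos h1, show σ.real 20 0 (n + w) = s.b (.inr (.inl ⟨w, h1⟩)) from
      hD.b (.inr (.inl ⟨w, h1⟩))]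
    by_cases h2 : F.Solvent s.b ⟨w, h1⟩
    · rw [if_pos (hw.2 ⟨h1, h2⟩), if_pos h2]
    · rw [if_neg fun h3 => h2 (hw.1 h3).2, if_neg h2]
  · rw [dif_neg h1, if_neg fun h3 => h1 (hw.1 h3).1]

end Clearing

namespace Clearing
open Program Network

/-- Zero rows and columns do not matter. -/
theorem Transient.of_injective {ι κ : Type*} [Fintype ι] [Fintype κ] {g : ι → κ}
    (hg : Function.Injective g) {K : κ → κ → ℝ} {K₀ : ι → ι → ℝ}
    (hrow : ∀ i, i ∉ Set.range g → ∀ j, K i j = 0) (hcol : ∀ j, j ∉ Set.range g → ∀ i, K i j = 0)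
    (h : ∀ i j, K (g i) (g j) = K₀ i j) (hK : Transient K₀) : Transient K := by
  refine ⟨fun i j => ?_, fun z hz0 hz => ?_⟩
  · by_cases hi : i ∈ Set.range g
    · by_cases hj : j ∈ Set.range g
      · obtain ⟨i, rfl⟩ := hi
        obtain ⟨j, rfl⟩ := hj
        rw [h]; exact hK.1 i j
      · rw [hcol j hj]
    · rw [hrow i hi]
  · have h1 : ∀ i, z (g i) = 0 := by
      refine hK.2 (fun i => z (g i)) (fun i => hz0 _) fun i => (hz (g i)).trans (le_of_eq ?_)
      refine (Fintype.sum_of_injective g hg _ _ (fun j hj => ?_) fun j => ?_).symm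
      · rw [hcol j hj, zero_mul]
      · rw [h]
    intro i
    by_cases hi : i ∈ Set.range g
    · obtain ⟨i, rfl⟩ := hi
      exact h1 i
    · refine le_antisymm ((hz i).trans (le_of_eq (Finset.sum_eq_zero fun j _ => ?_))) (hz0 i)
      rw [hrow i hi, zero_mul]

variable {n m : ℕ} {F : Network (Fin n) (Fin m)}

/-! ### Direction of a step -/

/-- The flow matrix, reachability, and a component that can be flooded. -/
def explore : Program := clearMatrix ;; loadMatrix ;; warshall ;; findComponent

/-- Computes the direction of the next step. -/
def direction : Program := explore ;; restrictMatrix ;; solveSystem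

theorem activeAt_iff {s : State F} {σ : Store} (hS : Static F σ) (hD : Dynamic s σ)
    (hP : Pointers F s.b σ) (e : F.AdjEdge) :
    ActiveAt σ (edgeId e) ↔ e ∈ F.adjust.activeEdges s.live s.b := by
  rw [mem_activeEdges, ActiveAt, hD.live, hP.interval, hS.slope e _ (interval_le_numBorders _ _ _)]
  rfl

theorem not_activeAt {s : State F} {σ : Store} (hD : Dynamic s σ) {x : ℕ}
    (hx : ∀ e : F.AdjEdge, edgeId e ≠ x) : ¬ ActiveAt σ x := by
  rintro ⟨h, -⟩
  rw [hD.live_unused x hx] at h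
  exact lt_irrefl _ h

theorem exists_activeAt_iff {s : State F} {σ : Store} (hS : Static F σ) (hD : Dynamic s σ)
    (hP : Pointers F s.b σ) (i j : ℕ) :
    (∃ x < m + (n + n), ActiveAt σ x ∧ σ.nat 1 0 x = i ∧ σ.nat 1 1 x = j) ↔
      ∃ w w', F.adjust.Adj s.live s.b w w' ∧ bankId w = i ∧ bankId w' = j := by
  constructor
  · rintro ⟨x, hx, ha, rfl, rfl⟩
    by_cases h : ∃ e : F.AdjEdge, edgeId e = x
    · obtain ⟨e, rfl⟩ := h
      exact ⟨_, _, adj_of_mem ((activeAt_iff hS hD hP e).1 ha), (hS.src e).symm, (hS.tgt e).symm⟩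
    · exact absurd ha (not_activeAt hD fun e he => h ⟨e, he⟩)
  · rintro ⟨w, w', ⟨e, he, rfl, rfl⟩, rfl, rfl⟩
    exact ⟨_, edgeId_lt e, (activeAt_iff hS hD hP e).2 he, hS.src e, hS.tgt e⟩

open Classical in
theorem sum_activeAt {s : State F} {σ : Store} (hS : Static F σ) (hD : Dynamic s σ)
    (hP : Pointers F s.b σ) (w w' : F.AdjBank) :
    (∑ x ∈ Finset.range (m + (n + n)), if ActiveAt σ x ∧ σ.nat 1 1 x = bankId w ∧
      σ.nat 1 0 x = bankId w' then σ.real 3 x (σ.nat 21 0 x) else 0) =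
      F.adjust.flow s.live s.b w w' := by
  rw [sum_range_eq_of_injective edgeId_injective (edgeId_lt (F := F)), ← Finset.sum_filter, flow]
  · refine Finset.sum_congr ?_ fun e _ => ?_
    · ext e
      simp only [Finset.mem_filter, Finset.mem_univ, true_and, activeAt_iff hS hD hP, hS.src, hS.tgt,
        bankId_injective.eq_iff]
    · rw [hP.interval, hS.slope e _ (interval_le_numBorders _ _ _)]; rfl
  · intro x _ hx
    rw [if_neg fun h => not_activeAt hD hx h.1]

variable (F) in
/-- Array `25` holds the flow matrix, array `24` reachability, and array `34` a component. -/
structure Explored (s : State F) (v : F.AdjBank) (σ : Store) : Prop where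
  flow : ∀ w w', σ.real 25 (bankId w) (bankId w') = F.adjust.flow s.live s.b w w'
  row : ∀ i < n + (n + n), (∀ w : F.AdjBank, bankId w ≠ i) → ∀ j < n + (n + n), σ.real 25 i j = 0
  column : ∀ j < n + (n + n), (∀ w : F.AdjBank, bankId w ≠ j) → ∀ i < n + (n + n), σ.real 25 i j = 0
  reach : ∀ w w' : F.AdjBank, 0 < σ.nat 24 (bankId w) (bankId w') ↔ F.adjust.Reach s.live s.b w w'
  component : (σ.nat 34 0 0 = 0 ∧ ∀ C, ¬ F.adjust.Floods s.live s.b v C) ∨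
    ∃ c, σ.nat 34 0 0 = bankId c + 1 ∧
      F.adjust.Floods s.live s.b v {w | F.adjust.Reach s.live s.b c w}

theorem floods_of_sink {V E : Type*} [Fintype V] [Fintype E] {G : Network V E} {live : Finset E}
    {b : V → ℝ} {v c : V} (h1 : G.Reach live b v c)
    (h2 : ∀ w, G.Reach live b c w → G.Reach live b w c) (h3 : ∃ w, w ≠ c ∧ G.Reach live b c w) :
    G.Floods live b v {w | G.Reach live b c w} := by
  refine ⟨⟨c, ?_⟩, ?_, fun w hw w' hw' => hw.tail hw', c, .refl, h1⟩
  · ext w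
    exact ⟨fun h => ⟨h, h2 w h⟩, fun h => h.1⟩
  · obtain ⟨w, hw, hcw⟩ := h3
    exact ⟨w, hcw, c, .refl, hw⟩

/-- Any bank of `C` reachable from `v` will do: as `C` is closed, all that it reaches lies in `C`
and leads back. -/
theorem Network.Floods.exists_sink {V E : Type*} [Fintype V] [Fintype E] {G : Network V E}
    {live : Finset E} {b : V → ℝ} {v : V} {C : Set V} (h : G.Floods live b v C) :
    ∃ c, G.Reach live b v c ∧ (∀ w, G.Reach live b c w → G.Reach live b w c) ∧
      ∃ w, w ≠ c ∧ G.Reach live b c w := by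
  obtain ⟨⟨c₀, rfl⟩, hn, hcl, c, hc, hv⟩ := h
  refine ⟨c, hv, fun w hw => ?_, ?_⟩
  · have : w ∈ {w | G.Reach live b c₀ w ∧ G.Reach live b w c₀} := by
      induction hw with
      | refl => exact hc
      | tail _ h ih => exact hcl _ ih _ h
    exact this.2.trans hc.1
  · obtain ⟨w, hw, hne⟩ := hn.exists_ne c
    exact ⟨w, hne, hc.2.trans hw.1⟩

theorem explore_holds {s : State F} {v : F.AdjBank} {σ : Store} (hS : Static F σ)
    (hD : Dynamic s σ) (hP : Pointers F s.b σ) (hv : s.cur = some v) {N M : ℕ}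
    (hN : N = n + (n + n)) (hM : M = m + (n + n)) :
    WP explore σ fun σ' t => t ≤ N * (N * 6 + 8) + M * 8 + N * (N * (N * 6 + 6) + 6) +
      N * (N * 10 + 17) + 22 ∧ Explored F s v σ' := by
  have hN' : σ.nat 30 0 0 = N := hN ▸ hS.bankCells
  have hM' : σ.nat 31 0 0 = M := hM ▸ hS.edgeCells
  have hlt : ∀ w : F.AdjBank, bankId w < N := fun w => hN ▸ bankId_lt w
  refine WP.seq (clearMatrix_spec σ N hN') ?_
  rintro σ₁ t₁ hf₁ ⟨ht₁, h₁⟩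
  have hS₁ : Static F σ₁ := hS.of_eq (hf₁.1 0 rfl) (hf₁.1 1 rfl) (hf₁.1 22 rfl) (hf₁.1 30 rfl)
    (hf₁.1 31 rfl) (hf₁.2 0 rfl) (hf₁.2 1 rfl) (hf₁.2 2 rfl) (hf₁.2 3 rfl) (hf₁.2 23 rfl)
    (hf₁.2 29 rfl)
  have hD₁ : Dynamic s σ₁ := hD.of_eq (hf₁.2 20 rfl) (hf₁.2 21 rfl) (hf₁.2 22 rfl) (hf₁.1 20 rfl)
    (hf₁.1 32 rfl)
  have hP₁ : Pointers F s.b σ₁ := hP.of_eq (hf₁.1 21 rfl) (hf₁.2 24 rfl)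
  refine WP.seq (loadMatrix_spec σ₁ M (by rw [hf₁.1 31 rfl, hM'])) ?_
  rintro σ₂ t₂ hf₂ ⟨ht₂, A₂, R₂⟩
  rw [hM] at A₂ R₂
  have R₂' : ∀ i < N, ∀ j < N, (0 < σ₂.nat 24 i j ↔ i = j ∨
      ∃ w w', F.adjust.Adj s.live s.b w w' ∧ bankId w = i ∧ bankId w' = j) := by
    intro i hi j hj
    rw [R₂, exists_activeAt_iff hS₁ hD₁ hP₁, (h₁ i hi j hj).2]
    refine or_congr_left ?_
    split_ifs with h <;> simp [h]
  refine WP.seq (warshall_spec σ₂ N (by rw [hf₂.1 30 rfl, hf₁.1 30 rfl, hN'])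
    fun i hi => (R₂' i hi i hi).2 (Or.inl rfl)) ?_
  rintro σ₃ t₃ hf₃ ⟨ht₃, R₃⟩
  -- From the cell of a bank the computed relation leads only to cells of banks, so unused cells
  -- cannot create spurious paths.
  have reach₁ : ∀ (w : F.AdjBank) (j : ℕ), j < N → 0 < σ₃.nat 24 (bankId w) j →
      ∃ w', bankId w' = j ∧ F.adjust.Reach s.live s.b w w' := by
    intro w j hj h
    rw [R₃ _ (hlt w) j hj] at h
    clear hj
    induction h with
    | refl => exact ⟨w, rfl, .refl⟩
    | tail _ h ih =>
      obtain ⟨w', rfl, hw'⟩ := ih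
      obtain ⟨hi, hj, h⟩ := h
      rcases (R₂' _ hi _ hj).1 h with rfl | ⟨w₁, w₂, hadj, h3, rfl⟩
      · exact ⟨w', rfl, hw'⟩
      · exact ⟨w₂, rfl, hw'.tail (bankId_injective h3 ▸ hadj)⟩
  have reach₂ : ∀ w w' : F.AdjBank, 0 < σ₃.nat 24 (bankId w) (bankId w') ↔
      F.adjust.Reach s.live s.b w w' := by
    intro w w'
    constructor
    · intro h
      obtain ⟨w'', h1, h2⟩ := reach₁ w _ (hlt w') h
      exact bankId_injective h1 ▸ h2
    · intro h
      rw [R₃ _ (hlt w) _ (hlt w')]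
      refine Relation.ReflTransGen.lift bankId (fun x y hxy => ?_) _ _ h
      exact ⟨hlt x, hlt y, (R₂' _ (hlt x) _ (hlt y)).2 (Or.inr ⟨x, y, hxy, rfl, rfl⟩)⟩
  have h32 : σ₃.nat 32 0 0 = bankId v + 1 := by
    rw [hf₃.1 32 rfl, hf₂.1 32 rfl, hf₁.1 32 rfl, hD.cur, hv]; rfl
  refine (findComponent_spec σ₃ N (bankId v) (by rw [hf₃.1 30 rfl, hf₂.1 30 rfl, hf₁.1 30 rfl, hN'])
    h32).conseq ?_
  rintro σ' t hf ⟨ht, hc⟩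
  have k25 : σ'.real 25 = σ₂.real 25 := by rw [hf.2 25 rfl, hf₃.2 25 rfl]
  have k24 : σ'.nat 24 = σ₃.nat 24 := hf.1 24 rfl
  refine ⟨by omega, ⟨fun w w' => ?_, fun i hi hu j hj => ?_, fun j hj hu i hi => ?_, ?_, ?_⟩⟩
  · rw [k25, A₂, (h₁ _ (hlt w) _ (hlt w')).1, zero_add, sum_activeAt hS₁ hD₁ hP₁]
  · rw [k25, A₂, (h₁ i (hN ▸ hi) j (hN ▸ hj)).1, zero_add]
    refine Finset.sum_eq_zero fun x hx => if_neg ?_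
    rintro ⟨h1, h2, h3⟩
    obtain ⟨w, w', -, h4, h5⟩ := (exists_activeAt_iff hS₁ hD₁ hP₁ j i).1
      ⟨x, Finset.mem_range.1 hx, h1, h3, h2⟩
    exact hu w' h5
  · rw [k25, A₂, (h₁ i (hN ▸ hi) j (hN ▸ hj)).1, zero_add]
    refine Finset.sum_eq_zero fun x hx => if_neg ?_
    rintro ⟨h1, h2, h3⟩
    obtain ⟨w, w', -, h4, h5⟩ := (exists_activeAt_iff hS₁ hD₁ hP₁ j i).1
      ⟨x, Finset.mem_range.1 hx, h1, h3, h2⟩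
    exact hu w h4
  · rw [k24]; exact reach₂
  · refine hc.imp ?_ ?_
    · rintro ⟨h1, h2⟩
      refine ⟨h1, fun C hC => ?_⟩
      obtain ⟨c, hc1, hc2, w, hw, hcw⟩ := hC.exists_sink
      refine h2 _ (hlt c) ⟨(reach₂ _ _).2 hc1, fun j hj h => ?_, _, hlt w,
        fun h => hw (bankId_injective h), (reach₂ _ _).2 hcw⟩
      obtain ⟨w', rfl, h'⟩ := reach₁ c j hj h
      exact (reach₂ _ _).2 (hc2 w' h')
    · rintro ⟨c, hcN, h1, h2, h3, j, hj, hjc, h4⟩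
      obtain ⟨c, rfl, h5⟩ := reach₁ v c hcN h2
      obtain ⟨w, rfl, h6⟩ := reach₁ c j hj h4
      refine ⟨c, h1, floods_of_sink h5 (fun w hw => ?_) ⟨w, fun h => hjc (congrArg _ h), h6⟩⟩
      exact (reach₂ _ _).1 (h3 _ (hlt w) ((reach₂ _ _).2 hw))

variable (F) in
/-- Array `26` holds the direction `d` of a flooding or an increase with pivot bank `p`. -/
structure Directed (s : State F) (v p : F.AdjBank) (d : F.AdjBank → ℝ) (σ : Store) : Prop where
  dir : ∀ w, σ.real 26 0 (bankId w) = d w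
  pivot : σ.nat 35 0 0 = bankId p
  nonneg : ∀ w, 0 ≤ d w
  spec : (σ.nat 34 0 0 = 0 ∧ p = v ∧ (∀ C, ¬ F.adjust.Floods s.live s.b v C) ∧
      F.adjust.IsBasic s.live s.b (F.adjust.Reach s.live s.b v) (fun _ => False) v d) ∨
    0 < σ.nat 34 0 0 ∧ ∃ C, F.adjust.Floods s.live s.b v C ∧ p ∈ C ∧
      F.adjust.IsBasic s.live s.b (· ∈ C) (· = p) p d

open Classical in
-- Unused cells give zero rows and columns, so the matrix on all cells is transient along with the
-- kernel, and the entries of its solution at the used cells solve the kernel system.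
theorem solve_holds {s : State F} {p : F.AdjBank} {P Z : F.AdjBank → Prop} {σ : Store}
    (hK : Transient (F.adjust.kernel s.live s.b P Z)) {N : ℕ} (hN : N = n + (n + n))
    (h30 : σ.nat 30 0 0 = N)
    (hA : ∀ w w', σ.real 25 (bankId w) (bankId w') = F.adjust.kernel s.live s.b P Z w w')
    (hrow : ∀ i < N, (∀ w : F.AdjBank, bankId w ≠ i) → ∀ j < N, σ.real 25 i j = 0)
    (hcol : ∀ j < N, (∀ w : F.AdjBank, bankId w ≠ j) → ∀ i < N, σ.real 25 i j = 0)
    (hq : ∀ i < N, σ.real 26 0 i = if i = bankId p then 1 else 0) :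
    ∃ d, F.adjust.IsBasic s.live s.b P Z p d ∧
      WP solveSystem σ fun σ' t => t ≤ N * (N * (N * 4 + 16) + N * 4 + 20) + 3 ∧
        ∀ w, σ'.real 26 0 (bankId w) = d w := by
  set g : F.AdjBank → Fin N := fun w => ⟨bankId w, hN ▸ bankId_lt w⟩ with hg
  have hgi : Function.Injective g := fun w w' h => bankId_injective (Fin.mk.inj h)
  have hr : ∀ i : Fin N, i ∉ Set.range g → ∀ w : F.AdjBank, bankId w ≠ i := fun i hi w h =>
    hi ⟨w, Fin.ext h⟩
  have hK' : Transient (matrixOf N σ) := hK.of_injective hgi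
    (fun i hi j => hrow i i.2 (hr i hi) j j.2) (fun j hj i => hcol j j.2 (hr j hj) i i.2) hA
  obtain ⟨d, hd⟩ := hK'.exists_solution (vectorOf N σ)
  refine ⟨fun w => d (g w), fun w => ?_, (solveSystem_spec σ N h30 hK' d hd).conseq ?_⟩
  · dsimp only
    rw [hd (g w), show vectorOf N σ (g w) = _ from hq _ (g w).2]
    congr 1
    · simp only [hg, bankId_injective.eq_iff]
      congr
    · refine (Fintype.sum_of_injective g hgi _ _ (fun j hj => ?_) fun j => ?_).symm
      · rw [show matrixOf N σ (g w) j = 0 from hcol j j.2 (hr j hj) _ (g w).2, zero_mul]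
      · rw [show matrixOf N σ (g w) (g j) = _ from hA w j]
  · rintro σ' t - ⟨ht, h⟩
    exact ⟨ht, fun w => h (g w)⟩

theorem direction_holds (hF : F.WellFormed) {s : State F} {v : F.AdjBank} {σ : Store}
    (hS : Static F σ) (hD : Dynamic s σ) (hP : Pointers F s.b σ) (hv : s.cur = some v)
    (hb : ∀ w, 0 ≤ s.b w) {N M : ℕ} (hN : N = n + (n + n)) (hM : M = m + (n + n)) :
    WP direction σ fun σ' t => t ≤ N * (N * 6 + 8) + M * 8 + N * (N * (N * 6 + 6) + 6) +
      N * (N * 10 + 17) + N * (N * 6 + 10) + N * (N * (N * 4 + 16) + N * 4 + 20) + 34 ∧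
      ∃ p d, Directed F s v p d σ' := by
  classical
  have hG := hF.adjust_lawful
  refine WP.seq (explore_holds hS hD hP hv hN hM) ?_
  rintro σ₁ t₁ hf₁ ⟨ht₁, h⟩
  have h32 : σ₁.nat 32 0 0 = bankId v + 1 := by rw [hf₁.1 32 rfl, hD.cur, hv]; rfl
  have h30 : σ₁.nat 30 0 0 = N := by rw [hf₁.1 30 rfl, hN, hS.bankCells]
  -- Both linear programs in one form: pivot `p`, columns `P` reachable from `p`, deleted rows `Z`,
  -- which are empty for an increase and `{p}` for a flooding.
  obtain ⟨p, P, Z, hK, hp, hPR, hZ, hspec⟩ : ∃ (p : F.AdjBank) (P Z : F.AdjBank → Prop),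
      Transient (F.adjust.kernel s.live s.b P Z) ∧
      (bankId p = if 0 < σ₁.nat 34 0 0 then σ₁.nat 34 0 0 - 1 else σ₁.nat 32 0 0 - 1) ∧
      (∀ w, P w ↔ F.adjust.Reach s.live s.b p w) ∧
      (∀ w, Z w ↔ 0 < σ₁.nat 34 0 0 ∧ w = p) ∧
      ∀ d, F.adjust.IsBasic s.live s.b P Z p d →
        ((σ₁.nat 34 0 0 = 0 ∧ p = v ∧ (∀ C, ¬ F.adjust.Floods s.live s.b v C) ∧
          F.adjust.IsBasic s.live s.b (F.adjust.Reach s.live s.b v) (fun _ => False) v d) ∨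
        0 < σ₁.nat 34 0 0 ∧ ∃ C, F.adjust.Floods s.live s.b v C ∧ p ∈ C ∧
          F.adjust.IsBasic s.live s.b (· ∈ C) (· = p) p d) := by
    rcases h.component with ⟨h1, h2⟩ | ⟨c, h1, h2⟩
    · refine ⟨v, _, _, hG.transient_reach hb h2, ?_, fun w => Iff.rfl, fun w => ?_,
        fun d hd => Or.inl ⟨h1, rfl, h2, hd⟩⟩
      · simp [h1, h32]
      · simp [h1]
    · have hc : c ∈ {w | F.adjust.Reach s.live s.b c w} := Relation.ReflTransGen.refl
      refine ⟨c, _, _, hG.transient_component hb h2 hc, ?_, fun w => Iff.rfl, fun w => ?_,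
        fun d hd => Or.inr ⟨by omega, _, h2, hc, hd⟩⟩
      · simp [h1]
      · simp [h1]
  refine WP.seq (restrictMatrix_spec σ₁ N (bankId p) h30 hp) ?_
  rintro σ₂ t₂ hf₂ ⟨ht₂, hpiv, hA, hq⟩
  have hlt : ∀ w : F.AdjBank, bankId w < N := fun w => hN ▸ bankId_lt w
  obtain ⟨d, hd, hwp⟩ := solve_holds (p := p) hK hN (by rw [hf₂.1 30 rfl, h30])
    (fun w w' => by
      simp only [hA _ (hlt w) _ (hlt w'), h.reach, h.flow, bankId_injective.eq_iff, ← hPR, ← hZ,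
        kernel])
    (fun i hi hu j hj => by rw [hA i hi j hj, h.row i (hN ▸ hi) hu j (hN ▸ hj), ite_self])
    (fun j hj hu i hi => by rw [hA i hi j hj, h.column j (hN ▸ hj) hu i (hN ▸ hi), ite_self]) hq
  refine hwp.conseq ?_
  rintro σ' t hf ⟨ht, h26⟩
  refine ⟨by omega, p, d, h26, by rw [hf.1 35 rfl, hpiv], hG.basic_nonneg hb hK hd, ?_⟩
  rw [hf.1 34 rfl, hf₂.1 34 rfl]
  exact hspec d hd

end Clearing

/-! ### Simulation of one flooding or increase. -/

namespace Clearing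
open Program Network

variable {n m : ℕ} {F : Network (Fin n) (Fin m)}

/-! ### Steps of the algorithm -/

/-- An active edge is never in its last, unbounded interval, so the cell read as its next border
exists and the border distance is finite. -/
theorem gapAt_eq (hF : F.WellFormed) {s : State F} {σ : Store} (hS : Static F σ)
    (hD : Dynamic s σ) (hP : Pointers F s.b σ) (hb : ∀ w, 0 ≤ s.b w) {e : F.AdjEdge}
    (he : e ∈ F.adjust.activeEdges s.live s.b) :
    F.adjust.interval e (s.b (F.adjust.src e)) < F.adjust.numBorders e ∧
      F.adjust.toBorder e (s.b (F.adjust.src e)) = (gapAt σ (edgeId e) : WithTop ℝ) := by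
  have h1 := hF.adjust_lawful.toBorder_ne_top e _ (hb _) (mem_activeEdges.1 he).2
  have h2 := toBorder_eq (hF.adjust_border_zero e) (hF.adjust_border_le e) (hb (F.adjust.src e))
  rw [h2] at h1 ⊢
  split_ifs at h1 ⊢ with h
  · refine ⟨h, ?_⟩
    rw [gapAt, hP.interval, hS.border e _ h, hS.src, hD.b]
  · exact absurd rfl h1

theorem scale_holds (hF : F.WellFormed) {s : State F} (hI : Invariant s) {v p : F.AdjBank}
    {d : F.AdjBank → ℝ} {σ : Store} (hS : Static F σ) (hD : Dynamic s σ) (hP : Pointers F s.b σ)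
    (hv : s.cur = some v) (hdir : Directed F s v p d σ) {M : ℕ} (hM : M = m + (n + n)) :
    WP scale σ fun σ' t => t ≤ M * 6 + 7 ∧ 0 ≤ σ'.real 28 0 0 ∧
      ((σ.nat 34 0 0 = 0 ∧ p = v ∧ (∀ C, ¬ F.adjust.Floods s.live s.b v C) ∧
        F.adjust.IncOptimal s.live s.b v (s.ax v - s.bx v) (σ'.real 28 0 0)
          (σ'.real 28 0 0 • d)) ∨
      (0 < σ.nat 34 0 0 ∧ ∃ C, F.adjust.Floods s.live s.b v C ∧
        F.adjust.FloodOptimal s.live s.b C (σ'.real 28 0 0 • d))) := by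
  have hG := hF.adjust_lawful
  have hb := hI.b_nonneg
  have hdirAt : ∀ e : F.AdjEdge, dirAt σ (edgeId e) = d (F.adjust.src e) := fun e => by
    rw [dirAt, hS.src, hdir.dir]
  set T₀ : ℝ := if 0 < σ.nat 34 0 0 then σ.real 29 0 0 else s.ax v - s.bx v with hT₀
  refine (scale_spec σ M (by rw [hM, hS.edgeCells]) T₀ (fun h => if_pos h) fun h => ?_).conseq ?_
  · rw [hdir.pivot, hD.ax, hD.bx, hT₀, if_neg (by omega)]
    rcases hdir.spec with ⟨-, rfl, -⟩ | ⟨h', -⟩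
    · rfl
    · omega
  rintro σ' t - ⟨ht, h1, h2, h3⟩
  set T := σ'.real 28 0 0
  have hscale : F.adjust.IsScale s.live s.b d T₀ T := by
    refine ⟨h1, fun e he => ?_, h3.imp_right ?_⟩
    · rcases (hdir.nonneg (F.adjust.src e)).eq_or_lt with h0 | h0
      · rw [← h0, mul_zero]
        exact (toBorder_pos _ _ _).le
      · rw [(gapAt_eq hF hS hD hP hb he).2, WithTop.coe_le_coe, ← hdirAt]
        exact h2 _ (hM ▸ edgeId_lt e) ((activeAt_iff hS hD hP e).2 he) ((hdirAt e).symm ▸ h0)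
    · rintro ⟨x, hx, ha, hd, he⟩
      by_cases hxe : ∃ e : F.AdjEdge, edgeId e = x
      · obtain ⟨e, rfl⟩ := hxe
        have ha := (activeAt_iff hS hD hP e).1 ha
        rw [hdirAt] at hd he
        exact ⟨e, ha, hd, by rw [(gapAt_eq hF hS hD hP hb ha).2, he]⟩
      · exact absurd ha (not_activeAt hD fun e he => hxe ⟨e, he⟩)
  have hpos : 0 ≤ T₀ → 0 ≤ T := by
    intro h0
    rcases hscale.2.2 with h | ⟨e, -, hd, he⟩
    · exact h ▸ h0
    · have h4 := toBorder_pos F.adjust e (s.b (F.adjust.src e))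
      rw [← he] at h4
      exact (pos_of_mul_pos_left (WithTop.coe_pos.1 h4) hd.le).le
  rcases hdir.spec with ⟨h34, hpv, hno, hd⟩ | ⟨h34, C, hC, hpC, hd⟩
  · rw [hT₀, if_neg (by omega)] at hscale hpos
    have hT := hpos (sub_nonneg.2 (hI.bx_le v))
    exact ⟨ht, hT, Or.inl ⟨h34, hpv, hno, hG.incOptimal_of_scale hb hno hd hT hscale⟩⟩
  · obtain ⟨i, e, he, hsrc, -⟩ := hC.exists_adj hpC
    obtain ⟨g1, g2⟩ := gapAt_eq hF hS hD hP hb he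
    -- The pivot of a flooding has an active out-edge. Its border distance is at most its last
    -- border, hence at most the stored bound, which therefore qualifies as `T₀`.
    have hle : F.adjust.toBorder e (s.b (F.adjust.src e)) ≤ (T₀ : WithTop ℝ) := by
      rw [g2, WithTop.coe_le_coe, gapAt, hP.interval, hS.border e _ g1, hS.src, hD.b, hT₀,
        if_pos h34]
      have := border_mono_of_step (hF.adjust_border_le e) (show _ + 1 ≤ F.adjust.numBorders e from g1)
        le_rfl
      linarith [hS.bound e, hb (F.adjust.src e)]
    have hT := hpos (WithTop.coe_nonneg.1 ((toBorder_pos _ _ _).le.trans hle))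
    exact ⟨ht, hT, Or.inr ⟨h34, C, hC, hG.floodOptimal_of_scale hb hI.outClosed hC hpC hd
      ⟨e, he, hsrc, hsrc ▸ hle⟩ hT hscale⟩⟩

/-- One flooding or increase. -/
def stepProgram : Program :=
  direction ;; scale ;; update ;; advance ;;
  .ite (isPos (nv 34)) skip (setNv 32 (.const 0) ;; settleProgram) ;; publish

/-- Everything but the pointers is bounded in terms of the network size. The moves of the pointers
are kept apart as `passed s'.b - passed s.b`, since a single step may pass many borders. -/
theorem stepProgram_holds (hF : F.WellFormed) {s : State F} (hI : Invariant s) {v : F.AdjBank}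
    {σ : Store} (hS : Static F σ) (hD : Dynamic s σ) (hP : Pointers F s.b σ)
    (hv : s.cur = some v) {N M : ℕ} (hN : N = n + (n + n)) (hM : M = m + (n + n)) :
    WP stepProgram σ fun σ' t => ∃ s', F.Step s s' ∧ Static F σ' ∧ Dynamic s' σ' ∧
      Pointers F s'.b σ' ∧ StoreHolds s' σ' ∧
      t ≤ N * (N * 6 + 8) + M * 8 + N * (N * (N * 6 + 6) + 6) + N * (N * 10 + 17) +
        N * (N * 6 + 10) + N * (N * (N * 4 + 16) + N * 4 + 20) + M * 10 + N * 4 + n * 36 + m * 14 +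
        100 + 4 * (passed s'.b - passed s.b) := by
  classical
  have hlt : ∀ w : F.AdjBank, bankId w < N := fun w => hN ▸ bankId_lt w
  refine WP.seq (direction_holds hF hS hD hP hv hI.b_nonneg hN hM) ?_
  rintro σ₁ t₁ hf₁ ⟨ht₁, p, d, hdir⟩
  have hS₁ : Static F σ₁ := hS.of_eq (hf₁.1 0 rfl) (hf₁.1 1 rfl) (hf₁.1 22 rfl) (hf₁.1 30 rfl)
    (hf₁.1 31 rfl) (hf₁.2 0 rfl) (hf₁.2 1 rfl) (hf₁.2 2 rfl) (hf₁.2 3 rfl) (hf₁.2 23 rfl)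
    (hf₁.2 29 rfl)
  have hD₁ : Dynamic s σ₁ := hD.of_eq (hf₁.2 20 rfl) (hf₁.2 21 rfl) (hf₁.2 22 rfl) (hf₁.1 20 rfl)
    (hf₁.1 32 rfl)
  have hP₁ : Pointers F s.b σ₁ := hP.of_eq (hf₁.1 21 rfl) (hf₁.2 24 rfl)
  refine WP.seq (scale_holds hF hI hS₁ hD₁ hP₁ hv hdir hM) ?_
  rintro σ₂ t₂ hf₂ ⟨ht₂, hT0, hopt⟩
  set T := σ₂.real 28 0 0 with hT
  have hS₂ : Static F σ₂ := hS₁.of_eq (hf₂.1 0 rfl) (hf₂.1 1 rfl) (hf₂.1 22 rfl) (hf₂.1 30 rfl)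
    (hf₂.1 31 rfl) (hf₂.2 0 rfl) (hf₂.2 1 rfl) (hf₂.2 2 rfl) (hf₂.2 3 rfl) (hf₂.2 23 rfl)
    (hf₂.2 29 rfl)
  have hD₂ : Dynamic s σ₂ := hD₁.of_eq (hf₂.2 20 rfl) (hf₂.2 21 rfl) (hf₂.2 22 rfl) (hf₂.1 20 rfl)
    (hf₂.1 32 rfl)
  have hP₂ : Pointers F s.b σ₂ := hP₁.of_eq (hf₂.1 21 rfl) (hf₂.2 24 rfl)
  refine WP.seq (update_spec σ₂ N (by rw [hN, hS₂.bankCells])) ?_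
  rintro σ₃ t₃ hf₃ ⟨ht₃, b₃, bx₃, bx₃'⟩
  rw [hf₂.1 34 rfl] at bx₃ bx₃'
  have hS₃ : Static F σ₃ := hS₂.of_eq (hf₃.1 0 rfl) (hf₃.1 1 rfl) (hf₃.1 22 rfl) (hf₃.1 30 rfl)
    (hf₃.1 31 rfl) (hf₃.2 0 rfl) (hf₃.2 1 rfl) (hf₃.2 2 rfl) (hf₃.2 3 rfl) (hf₃.2 23 rfl)
    (hf₃.2 29 rfl)
  have hb₃ : ∀ w, σ₃.real 20 0 (bankId w) = (s.b + T • d) w := by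
    intro w
    rw [b₃ _ (hlt w), hD₂.b, hf₂.2 26 rfl, hdir.dir]; rfl
  have hmono : ∀ w, s.b w ≤ (s.b + T • d) w := fun w =>
    le_add_of_nonneg_right (mul_nonneg hT0 (hdir.nonneg w))
  have hb0 : ∀ w, 0 ≤ (s.b + T • d) w := fun w => (hI.b_nonneg w).trans (hmono w)
  refine WP.seq (advance_holds hF hS₃ hb₃ hb0
    (fun e => F.adjust.interval e (s.b (F.adjust.src e)))
    (fun e => by rw [hf₃.1 21 rfl]; exact hP₂.interval e)
    (fun e => interval_mono _ _ (hmono _)) (fun e => by rw [hf₃.2 24 rfl]; exact hP₂.pay e)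
    (by rw [hf₃.1 21 rfl, hf₃.2 24 rfl]; exact hP₂.unused)) ?_
  rintro σ₄ t₄ hf₄ ⟨ht₄, hP₄⟩
  replace ht₄ : t₄ ≤ 4 * (passed (s.b + T • d) - passed s.b) + (m + (n + n)) * 4 + 3 := ht₄
  have hS₄ : Static F σ₄ := hS₃.of_eq (hf₄.1 0 rfl) (hf₄.1 1 rfl) (hf₄.1 22 rfl) (hf₄.1 30 rfl)
    (hf₄.1 31 rfl) (hf₄.2 0 rfl) (hf₄.2 1 rfl) (hf₄.2 2 rfl) (hf₄.2 3 rfl) (hf₄.2 23 rfl)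
    (hf₄.2 29 rfl)
  have k20 : σ₄.real 20 = σ₃.real 20 := hf₄.2 20 rfl
  have k21 : σ₄.real 21 = σ₃.real 21 := hf₄.2 21 rfl
  have k22 : σ₄.real 22 = σ₂.real 22 := by rw [hf₄.2 22 rfl, hf₃.2 22 rfl]
  have kl : σ₄.nat 20 = σ₂.nat 20 := by rw [hf₄.1 20 rfl, hf₃.1 20 rfl]
  have k32 : σ₄.nat 32 = σ₂.nat 32 := by rw [hf₄.1 32 rfl, hf₃.1 32 rfl]
  have k34 : σ₄.nat 34 = σ₁.nat 34 := by rw [hf₄.1 34 rfl, hf₃.1 34 rfl, hf₂.1 34 rfl]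
  -- A flooding leaves `bx` and the selected bank alone; an increase clears the selection and
  -- settles. Both branches end with assets `s.b + T • d`, which is all that the pointers depend on.
  suffices h : WP (.ite (isPos (nv 34)) skip (setNv 32 (.const 0) ;; settleProgram)) σ₄
      fun σ' t => t ≤ n * 6 + m * 10 + 10 ∧ ∃ s', F.Step s s' ∧ Dynamic s' σ' ∧
        s'.b = s.b + T • d by
    refine WP.seq h ?_
    rintro σ₅ t₅ hf₅ ⟨ht₅, s', hstep, hD₅, hbs⟩
    have hS₅ : Static F σ₅ := hS₄.of_eq (hf₅.1 0 rfl) (hf₅.1 1 rfl) (hf₅.1 22 rfl) (hf₅.1 30 rfl)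
      (hf₅.1 31 rfl) (hf₅.2 0 rfl) (hf₅.2 1 rfl) (hf₅.2 2 rfl) (hf₅.2 3 rfl) (hf₅.2 23 rfl)
      (hf₅.2 29 rfl)
    refine (publish_holds hS₅ hD₅).conseq ?_
    rintro σ' t hf ⟨ht, hH⟩
    refine ⟨s', hstep, ?_, ?_, ?_, hH, ?_⟩
    · exact hS₅.of_eq (hf.1 0 rfl) (hf.1 1 rfl) (hf.1 22 rfl) (hf.1 30 rfl)
        (hf.1 31 rfl) (hf.2 0 rfl) (hf.2 1 rfl) (hf.2 2 rfl) (hf.2 3 rfl) (hf.2 23 rfl)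
        (hf.2 29 rfl)
    · exact hD₅.of_eq (hf.2 20 rfl) (hf.2 21 rfl) (hf.2 22 rfl) (hf.1 20 rfl) (hf.1 32 rfl)
    · rw [hbs]
      exact hP₄.of_eq ((hf.1 21 rfl).trans (hf₅.1 21 rfl)) ((hf.2 24 rfl).trans (hf₅.2 24 rfl))
    · rw [hbs]
      rw [← hM] at ht₄
      omega
  refine WP.ite (fun h => ?_) (fun h => ?_) <;>
    simp only [Test.Holds, NExp.eval, k34] at h
  · rcases hopt with ⟨h', -⟩ | ⟨-, C, hC, hfl⟩
    · omega
    refine WP.exec rfl fun t ht => ⟨by simp only [cost] at ht; omega, _,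
      .flood s v C (T • d) hv hC hfl, ?_, rfl⟩
    refine Dynamic.of_eq (σ := σ₄) ⟨fun w => ?_, fun w => ?_, fun w => ?_, fun e => ?_, fun i hi => ?_,
      fun x hx => ?_, ?_⟩ rfl rfl rfl ?_ ?_
    · rw [k20, hb₃]
    · rw [k21, bx₃ h]; exact hD₂.bx w
    · rw [k22]; exact hD₂.ax w
    · rw [kl]; exact hD₂.live e
    · rw [k21, bx₃ h, k22]; exact hD₂.bx_unused i hi
    · rw [kl]; exact hD₂.live_unused x hx
    · rw [k32]; exact hD₂.cur
    · funext i j; simp [exec]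
    · funext i j; simp [exec]
  · rcases hopt with ⟨h', rfl, hno, hinc⟩ | ⟨h', -⟩
    swap
    · omega
    set s₁ : State F :=
      { s with bx := Function.update s.bx p (s.bx p + T), b := s.b + T • d, cur := none } with hs₁
    refine WP.seq (R := fun σ' t => t ≤ 1 ∧ σ' = σ₄.writeNat 32 0 0 0)
      (WP.exec rfl fun t ht => ⟨ht, rfl⟩) ?_
    rintro σ₅ t₅ hf₅ ⟨ht₅, rfl⟩
    have hS₅ := hS₄.of_eq (hf₅.1 0 rfl) (hf₅.1 1 rfl) (hf₅.1 22 rfl) (hf₅.1 30 rfl)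
      (hf₅.1 31 rfl) (hf₅.2 0 rfl) (hf₅.2 1 rfl) (hf₅.2 2 rfl) (hf₅.2 3 rfl) (hf₅.2 23 rfl)
      (hf₅.2 29 rfl)
    have hD₅ : Dynamic s₁ (σ₄.writeNat 32 0 0 0) := by
      rw [show σ₂.nat 35 0 0 = bankId p by rw [hf₂.1 35 rfl, hdir.pivot]] at bx₃'
      refine ⟨fun w => ?_, fun w => ?_, fun w => ?_, fun e => ?_, fun i hi => ?_, fun x hx => ?_, ?_⟩
      · exact (congrFun (congrFun k20 0) _).trans (hb₃ w)
      · rw [Store.real_writeNat, k21, bx₃' h', hD₂.bx, hs₁]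
        by_cases hw : w = p
        · subst hw; simp [hT]
        · simp [hw, bankId_injective.eq_iff]
      · rw [Store.real_writeNat, k22]; exact hD₂.ax w
      · rw [hf₅.1 20 rfl, kl]; exact hD₂.live e
      · rw [Store.real_writeNat, k21, bx₃' h', k22, if_neg (fun h => hi p h.symm), add_zero]
        exact hD₂.bx_unused i hi
      · rw [hf₅.1 20 rfl, kl]; exact hD₂.live_unused x hx
      · simp [hs₁]
    refine (settleProgram_holds hF hS₅ hD₅ (hP₄.of_eq (hf₅.1 21 rfl) (hf₅.2 24 rfl)) hb0).conseq ?_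
    rintro σ' t - ⟨ht, hD'⟩
    refine ⟨by omega, _, .increase s p T (T • d) hv hno hinc, ?_, rfl⟩
    convert hD'

end Clearing

/-! ### Simulation of a complete execution and the total running time. -/

namespace Clearing
open Program Network

variable {n m : ℕ} {F : Network (Fin n) (Fin m)}

/-! ### Initialization -/

/-- Everything before the main loop. -/
def initProgram : Program := setup ;; advance ;; settleProgram ;; publish

theorem StoreHolds.of_eq {s : State F} {σ σ' : Store} (h : StoreHolds s σ)
    (r10 : σ'.real 10 = σ.real 10) (r11 : σ'.real 11 = σ.real 11) (r12 : σ'.real 12 = σ.real 12)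
    (n10 : σ'.nat 10 = σ.nat 10) : StoreHolds s σ' := by
  unfold StoreHolds
  rw [r10, r11, r12, n10]
  exact h

/-- the memory at the head of the main loop -/
structure LoopState (s : State F) (σ : Store) : Prop where
  static : Static F σ
  dynamic : Dynamic s σ
  pointers : Pointers F s.b σ
  holds : StoreHolds s σ
  running : σ.nat 33 0 0 = 0

theorem initProgram_holds (hF : F.WellFormed) :
    WP initProgram (input F) fun σ' t =>
      t ≤ n * 120 + m * 60 + 120 + 4 * F.adjust.totalBorders ∧ LoopState F.init σ' := by
  have h33 : ∀ σ', Frame initProgram (input F) σ' → σ'.nat 33 0 0 = 0 := by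
    intro σ' hf
    rw [hf.1 33 rfl]
    simp [input]
  suffices h : WP initProgram (input F) fun σ' t =>
      t ≤ n * 120 + m * 60 + 120 + 4 * F.adjust.totalBorders ∧ Static F σ' ∧ Dynamic F.init σ' ∧
        Pointers F F.init.b σ' ∧ StoreHolds F.init σ' by
    refine h.conseq ?_
    rintro σ' t hf ⟨h1, h2, h3, h4, h5⟩
    exact ⟨h1, h2, h3, h4, h5, h33 σ' hf⟩
  refine WP.seq (setup_spec hF) ?_
  rintro σ₁ t₁ hf₁ ⟨ht₁, hS₁, hD₁, hz⟩
  refine WP.seq (advance_holds hF hS₁ hD₁.b (fun _ => le_rfl) 0 (fun e => (hz _).1)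
    (fun e => Nat.zero_le _) (fun e => ?_) fun x _ _ => hz x) ?_
  · rw [(hz _).2, Pi.zero_apply, hF.adjust_border_zero, hF.adjust_lawful.pay_zero]
  rintro σ₂ t₂ hf₂ ⟨ht₂, hP₂⟩
  have hpass := passed_le (F := F) (start F).b
  have hS₂ : Static F σ₂ := hS₁.of_eq (hf₂.1 0 rfl) (hf₂.1 1 rfl) (hf₂.1 22 rfl) (hf₂.1 30 rfl)
    (hf₂.1 31 rfl) (hf₂.2 0 rfl) (hf₂.2 1 rfl) (hf₂.2 2 rfl) (hf₂.2 3 rfl) (hf₂.2 23 rfl)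
    (hf₂.2 29 rfl)
  have hD₂ : Dynamic (start F) σ₂ := hD₁.of_eq (hf₂.2 20 rfl) (hf₂.2 21 rfl) (hf₂.2 22 rfl)
    (hf₂.1 20 rfl) (hf₂.1 32 rfl)
  refine WP.seq (settleProgram_holds hF hS₂ hD₂ hP₂ fun _ => le_rfl) ?_
  rintro σ₃ t₃ hf₃ ⟨ht₃, hD₃⟩
  have hS₃ : Static F σ₃ := hS₂.of_eq (hf₃.1 0 rfl) (hf₃.1 1 rfl) (hf₃.1 22 rfl) (hf₃.1 30 rfl)
    (hf₃.1 31 rfl) (hf₃.2 0 rfl) (hf₃.2 1 rfl) (hf₃.2 2 rfl) (hf₃.2 3 rfl) (hf₃.2 23 rfl)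
    (hf₃.2 29 rfl)
  refine (publish_holds hS₃ hD₃).conseq ?_
  rintro σ' t hf ⟨ht, hH⟩
  refine ⟨by omega, ?_, ?_, ?_, hH⟩
  · exact hS₃.of_eq (hf.1 0 rfl) (hf.1 1 rfl) (hf.1 22 rfl) (hf.1 30 rfl)
      (hf.1 31 rfl) (hf.2 0 rfl) (hf.2 1 rfl) (hf.2 2 rfl) (hf.2 3 rfl) (hf.2 23 rfl)
      (hf.2 29 rfl)
  · exact hD₃.of_eq (hf.2 20 rfl) (hf.2 21 rfl) (hf.2 22 rfl) (hf.1 20 rfl) (hf.1 32 rfl)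
  · exact hP₂.of_eq ((hf.1 21 rfl).trans (hf₃.1 21 rfl)) ((hf.2 24 rfl).trans (hf₃.2 24 rfl))

/-! ### Main loop -/

/-- From `κ` to `κ'` the machine passes in order through the states of an execution of the algorithm
from `s` to `s'`. -/
def Passes (s s' : State F) (κ κ' : Config) (t : ℕ) : Prop :=
  ∃ (N : ℕ) (f : ℕ → State F) (τ : ℕ → ℕ), f 0 = s ∧ f N = s' ∧ (∀ i < N, F.Step (f i) (f (i + 1))) ∧
    Monotone τ ∧ τ N ≤ t ∧ (∀ i ≤ N, StoreHolds (f i) (step^[τ i] κ).2) ∧ step^[t] κ = κ'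

theorem Passes.refl {s : State F} {κ κ' : Config} {t : ℕ} (hs : StoreHolds s κ.2)
    (h : step^[t] κ = κ') : Passes s s κ κ' t :=
  ⟨0, fun _ => s, fun _ => 0, rfl, rfl, fun _ h => absurd h (Nat.not_lt_zero _),
    fun _ _ _ => le_rfl, Nat.zero_le _, fun _ _ => hs, h⟩

theorem Passes.cons {s s₁ s' : State F} {κ κ₁ κ' : Config} {t₁ t : ℕ} (hs : StoreHolds s κ.2)
    (hstep : F.Step s s₁) (h₁ : step^[t₁] κ = κ₁) (h : Passes s₁ s' κ₁ κ' t) :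
    Passes s s' κ κ' (t₁ + t) := by
  obtain ⟨N, f, τ, h2, h3, h4, h5, h6, h7, h8⟩ := h
  refine ⟨N + 1, fun i => Nat.casesOn i s f, fun i => Nat.casesOn i 0 fun i => t₁ + τ i, rfl, h3,
    fun i hi => ?_, fun i j hij => ?_, Nat.add_le_add_left h6 _, fun i hi => ?_, ?_⟩
  · rcases i with _ | i
    · show F.Step s (f 0)
      exact h2.symm ▸ hstep
    · exact h4 i (by omega)
  · rcases i with _ | i
    · exact Nat.zero_le _
    · rcases j with _ | j
      · omega
      · exact Nat.add_le_add_left (h5 (by omega)) _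
  · rcases i with _ | i
    · exact hs
    · have := h7 i (by omega)
      rwa [← h₁, ← Function.iterate_add_apply, Nat.add_comm] at this
  · rw [Nat.add_comm, Function.iterate_add_apply, h₁, h8]

theorem Passes.prepend {s s' : State F} {κ₀ κ κ' : Config} {t₀ t : ℕ} (h₀ : step^[t₀] κ₀ = κ)
    (h : Passes s s' κ κ' t) : Passes s s' κ₀ κ' (t₀ + t) := by
  obtain ⟨N, f, τ, h2, h3, h4, h5, h6, h7, h8⟩ := h
  refine ⟨N, f, fun i => t₀ + τ i, h2, h3, h4, fun i j hij => Nat.add_le_add_left (h5 hij) _,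
    Nat.add_le_add_left h6 _, fun i hi => ?_, ?_⟩
  · have := h7 i hi
    rwa [← h₀, ← Function.iterate_add_apply, Nat.add_comm] at this
  · rw [Nat.add_comm, Function.iterate_add_apply, h₀, h8]

theorem Passes.append {s s' : State F} {κ κ' κ₂ : Config} {t t₂ : ℕ} (h : Passes s s' κ κ' t)
    (h₂ : step^[t₂] κ' = κ₂) : Passes s s' κ κ₂ (t + t₂) := by
  obtain ⟨N, f, τ, h3, h4, h5, h6, h7, h8, h9⟩ := h
  exact ⟨N, f, τ, h3, h4, h5, h6, h7.trans (Nat.le_add_right _ _), h8, by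
    rw [Nat.add_comm, Function.iterate_add_apply, h9, h₂]⟩

/-- One elementary step. -/
def loopBody : Program := .ite (.natLt (nv 32) (.const 1)) selectBank stepProgram

/-- The main loop. -/
def mainLoop : Program := .while (.natLt (nv 33) (.const 1)) loopBody

/-- a bound for the time of one iteration of the main loop, apart from the pointers -/
def stepTime (n m : ℕ) : ℕ := 1200 * (n ^ 3 + m)

/-- With `N = 3 n` and `M = m + 2 n` the coefficients of the powers of `n` and the constant add up
to `1079`, that of `m` is `32`; for `n ≥ 1` all powers are at most `n ^ 3`. -/
theorem stepTime_bound (hn : 0 < n) {N M : ℕ} (hN : N = n + (n + n)) (hM : M = m + (n + n)) :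
    N * (N * 6 + 8) + M * 8 + N * (N * (N * 6 + 6) + 6) + N * (N * 10 + 17) +
        N * (N * 6 + 10) + N * (N * (N * 4 + 16) + N * 4 + 20) + M * 10 + N * 4 + n * 36 + m * 14 +
        110 ≤ stepTime n m := by
  subst hN hM
  have h1 : 1 ≤ n ^ 3 := Nat.one_le_pow _ _ hn
  have h2 : n ≤ n ^ 3 := Nat.le_self_pow (by norm_num) n
  have h3 : n ^ 2 ≤ n ^ 3 := Nat.pow_le_pow_right hn (by norm_num)
  unfold stepTime
  nlinarith

theorem selectTime_bound (hn : 0 < n) : (n + (n + n)) * 8 + 10 ≤ stepTime n m := by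
  have h1 : 1 ≤ n ^ 3 := Nat.one_le_pow _ _ hn
  have h2 : n ≤ n ^ 3 := Nat.le_self_pow (by norm_num) n
  unfold stepTime
  omega

/-- One iteration of the machine loop is one elementary step: a selection if cell `32` is `0`, a
flooding or an increase otherwise. The main loop and the flooding loop of the algorithm are thus
merged into one. -/
theorem loopBody_holds (hF : F.WellFormed) (hn : 0 < n) {s : State F} (hI : Invariant s) {σ : Store}
    (hL : LoopState s σ) : WP loopBody σ fun σ' t =>
      (Final s ∧ Static F σ' ∧ Dynamic s σ' ∧ 0 < σ'.nat 33 0 0 ∧ t ≤ stepTime n m) ∨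
      ∃ s', F.Step s s' ∧ LoopState s' σ' ∧ t + 2 ≤ stepTime n m + 4 * (passed s'.b - passed s.b) := by
  obtain ⟨hS, hD, hP, hH, h33⟩ := hL
  have hB := stepTime_bound (m := m) hn rfl rfl
  have hB' := selectTime_bound (m := m) hn
  rcases hcur : s.cur with _ | v
  · have h32 : σ.nat 32 0 0 = 0 := by rw [hD.cur, hcur]; rfl
    refine WP.ite (fun _ => ?_) (fun h => absurd h32 (by simpa using h))
    refine (selectBank_spec σ (n + (n + n)) hS.bankCells h32).conseq ?_
    rintro σ' t hf ⟨ht, h⟩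
    have hS' : Static F σ' := hS.of_eq (hf.1 0 rfl) (hf.1 1 rfl) (hf.1 22 rfl) (hf.1 30 rfl)
      (hf.1 31 rfl) (hf.2 0 rfl) (hf.2 1 rfl) (hf.2 2 rfl) (hf.2 3 rfl) (hf.2 23 rfl)
      (hf.2 29 rfl)
    rcases h with ⟨h1, h2, h3⟩ | ⟨h1, i, hi, h2, h3⟩
    · refine Or.inl ⟨⟨hcur, ?_⟩, hS', ?_, by omega, by omega⟩
      · rintro ⟨w, hw⟩
        rw [← hD.bx, ← hD.ax] at hw
        exact h3 _ (bankId_lt w) hw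
      · refine ⟨?_, ?_, ?_, ?_, ?_, ?_, ?_⟩
        · rw [hf.2 20 rfl]; exact hD.b
        · rw [hf.2 21 rfl]; exact hD.bx
        · rw [hf.2 22 rfl]; exact hD.ax
        · rw [hf.1 20 rfl]; exact hD.live
        · rw [hf.2 21 rfl, hf.2 22 rfl]; exact hD.bx_unused
        · rw [hf.1 20 rfl]; exact hD.live_unused
        · rw [h2, hcur]; rfl
    · obtain ⟨w, rfl⟩ : ∃ w : F.AdjBank, bankId w = i := by
        by_contra hw
        exact hD.bx_unused i (fun w h => hw ⟨w, h⟩) h3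
      rw [hD.bx, hD.ax] at h3
      refine Or.inr ⟨_, .select s w hcur h3, ⟨hS', ⟨?_, ?_, ?_, ?_, ?_, ?_, h2⟩, ?_, ?_, h1⟩, ?_⟩
      · rw [hf.2 20 rfl]; exact hD.b
      · rw [hf.2 21 rfl]; exact hD.bx
      · rw [hf.2 22 rfl]; exact hD.ax
      · rw [hf.1 20 rfl]; exact hD.live
      · rw [hf.2 21 rfl, hf.2 22 rfl]; exact hD.bx_unused
      · rw [hf.1 20 rfl]; exact hD.live_unused
      · exact hP.of_eq (hf.1 21 rfl) (hf.2 24 rfl)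
      · exact StoreHolds.of_eq (s := s) hH (hf.2 10 rfl) (hf.2 11 rfl) (hf.2 12 rfl) (hf.1 10 rfl)
      · omega
  · have h32 : σ.nat 32 0 0 = bankId v + 1 := by rw [hD.cur, hcur]; rfl
    refine WP.ite (fun h => ?_) (fun _ => ?_)
    · simp [h32] at h
    refine (stepProgram_holds hF hI hS hD hP hcur rfl rfl).conseq ?_
    rintro σ' t hf ⟨s', h1, h2, h3, h4, h5, ht⟩
    exact Or.inr ⟨s', h1, ⟨h2, h3, h4, h5, by rw [hf.1 33 rfl, h33]⟩, by omega⟩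

theorem mainLoop_holds (hF : F.WellFormed) (hn : 0 < n) (K : List Program) (r : ℕ) :
    ∀ (s : State F) (σ : Store), remaining s < r → Invariant s → LoopState s σ →
      ∃ s' σ' t, Final s' ∧ Invariant s' ∧ Passes s s' (mainLoop :: K, σ) (K, σ') t ∧ Static F σ' ∧
        Dynamic s' σ' ∧ t ≤ (stepTime n m + 4) * remaining s + stepTime n m + 2 := by
  induction r with
  | zero => exact fun _ _ h => absurd h (Nat.not_lt_zero _)
  | succ r ih =>
    intro s σ hr hI hL
    have htest : (Test.natLt (nv 33) (.const 1)).Holds σ := by simp [hL.running]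
    have h1 : step^[1] (mainLoop :: K, σ) = (loopBody :: mainLoop :: K, σ) := if_pos htest
    obtain ⟨σ₁, t₁, hbig, h⟩ := loopBody_holds hF hn hI hL
    have h2 : step^[1 + t₁] (mainLoop :: K, σ) = (mainLoop :: K, σ₁) := by
      rw [Nat.add_comm, Function.iterate_add_apply, h1, hbig.iterate_step]
    rcases h with ⟨hf, hS, hD, h33, ht⟩ | ⟨s₁, hstep, hL₁, ht⟩
    · have htest' : ¬ (Test.natLt (nv 33) (.const 1)).Holds σ₁ := by
        simp only [Test.Holds, NExp.eval]; omega
      have h3 : step^[1] (mainLoop :: K, σ₁) = (K, σ₁) := if_neg htest'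
      refine ⟨s, σ₁, 1 + t₁ + 1, hf, hI, .refl hL.holds ?_, hS, hD, by omega⟩
      rw [Nat.add_comm, Function.iterate_add_apply, h2, h3]
    · obtain ⟨-, h4, h5⟩ := hF.remaining_step hstep hI
      obtain ⟨s', σ', t, g1, g2, g3, g4, g5, g6⟩ :=
        ih s₁ σ₁ (by omega) (hF.invariant_step hstep hI) hL₁
      refine ⟨s', σ', _, g1, g2, .cons hL.holds hstep h2 g3, g4, g5, ?_⟩
      -- The decrease `k` of the potential is at least `1` and at least the number of borders
      -- passed, so `k` times `stepTime n m + 4` pays for the iteration including its pointer moves.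
      obtain ⟨k, hk⟩ := Nat.exists_eq_add_of_le (show remaining s₁ ≤ remaining s by omega)
      have hk1 : 1 ≤ k := by omega
      have h6 : stepTime n m ≤ stepTime n m * k := Nat.le_mul_of_pos_right _ hk1
      rw [hk, Nat.mul_add, Nat.add_mul _ _ k]
      omega

/-! ### The program -/

/-- The program: initialization, main loop and output. -/
def clearingProgram : Program := initProgram ;; mainLoop ;; writeOutput

theorem clearingProgram_executes (hF : F.WellFormed) (hn : 0 < n) :
    ∃ T, T ≤ 30000 * ((F.totalBorders + n + m) * (n ^ 3 + m)) ∧ Executes clearingProgram F T ∧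
      F.IsMinimalClearing (output (runFor clearingProgram (input F) T).2) := by
  obtain ⟨σ₁, t₁, hbig₁, ht₁, hL⟩ := initProgram_holds hF
  obtain ⟨s', σ₂, t₂, hfin, hI, hpass, hS, hD, ht₂⟩ := mainLoop_holds hF hn [writeOutput] _ F.init σ₁
    (Nat.lt_succ_self _) hF.invariant_init hL
  obtain ⟨σ₃, t₃, hbig₃, ht₃, hout⟩ := writeOutput_holds hS hD
  have h1 : step^[1] ([clearingProgram], input F) =
    ([initProgram, mainLoop ;; writeOutput], input F) := rfl
  have h2 : step^[1] ([mainLoop ;; writeOutput], σ₁) = ([mainLoop, writeOutput], σ₁) := rfl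
  have h3 := ((hpass.append (hbig₃.iterate_step [])).prepend h2).prepend (hbig₁.iterate_step _)
    |>.prepend h1
  obtain ⟨N, f, τ, g1, g2, g3, g4, g5, g6, g7⟩ := h3
  have hend : runFor clearingProgram (input F) (1 + (t₁ + (1 + (t₂ + t₃)))) = ([], σ₃) := g7
  refine ⟨_, ?_, ⟨N, f, τ, ⟨g1, g3⟩, g2.symm ▸ hfin, g4, g5, g6, ?_, ?_⟩, ?_⟩
  · have h4 := remaining_le F.init
    have h5 := adjust_totalBorders_le (F := F)
    simp only [Fintype.card_fin] at h4 h5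
    -- Since `n` is positive, `1 + 14 n ≤ 15 n`. Multiplied by the `1204` of `stepTime n m + 4`,
    -- this gives `18060`; set-up, the last iteration and output fit into the rest of the constant.
    have h6 : remaining F.init ≤ 15 * (F.totalBorders + n + m) := by omega
    have h7 : 1 ≤ n ^ 3 + m := by have := Nat.one_le_pow 3 n hn; omega
    have h8 : F.totalBorders + n + m ≤ (F.totalBorders + n + m) * (n ^ 3 + m) :=
      Nat.le_mul_of_pos_right _ h7
    have h9 : n ^ 3 + m ≤ (F.totalBorders + n + m) * (n ^ 3 + m) :=
      Nat.le_mul_of_pos_left _ (by omega)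
    have h10 : (stepTime n m + 4) * remaining F.init ≤
        18060 * ((F.totalBorders + n + m) * (n ^ 3 + m)) := by
      calc _ ≤ (1204 * (n ^ 3 + m)) * (15 * (F.totalBorders + n + m)) :=
            Nat.mul_le_mul (by unfold stepTime; omega) h6
        _ = _ := by ring
    have h11 : stepTime n m ≤ 1200 * ((F.totalBorders + n + m) * (n ^ 3 + m)) :=
      Nat.mul_le_mul_left _ h9
    omega
  · unfold HaltsWithin
    rw [hend]
  · rw [hend, hout, g2]
  · rw [hend, hout]
    exact hF.isMinimalClearing_result hI hfin

theorem exists_clearingProgram : ∃ (P : Program) (c : ℕ),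
    ∀ (n m : ℕ) (F : Network (Fin n) (Fin m)), 0 < n → F.WellFormed →
      ∃ T : ℕ, T ≤ c * ((F.totalBorders + n + m) * (n ^ 3 + m)) ∧ Executes P F T ∧
        F.IsMinimalClearing (output (runFor P (input F) T).2) :=
  ⟨clearingProgram, 30000, fun _ _ _ hn hF => clearingProgram_executes hF hn⟩

end Clearing

theorem mainTheorem2 :
    -- correctness of every execution of the algorithm
    (∃ c : ℕ, ∀ (V : Type) (E : Type) [Fintype V] [Fintype E] (F : Clearing.Network V E),
      F.WellFormed →
      ∀ (N : ℕ) (s : ℕ → Clearing.Network.State F), F.IsRun N s →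
        N ≤ c * (F.totalBorders + Fintype.card V + Fintype.card E) ∧
        (¬ Clearing.Network.Final (s N) → ∃ s', F.Step (s N) s') ∧
        (Clearing.Network.Final (s N) → F.IsMinimalClearing (F.result (s N)))) ∧
    -- running time on a real random-access machine
    (∃ (P : Clearing.Program) (c : ℕ), ∀ (n m : ℕ) (F : Clearing.Network (Fin n) (Fin m)),
      0 < n → F.WellFormed →
      ∃ T : ℕ, T ≤ c * ((F.totalBorders + n + m) * (n ^ 3 + m)) ∧
        Clearing.Executes P F T ∧
        F.IsMinimalClearing (Clearing.output (Clearing.runFor P (Clearing.input F) T).2)) ∧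
    -- the fixed-point map need not be continuous from below
    (∃ (n m : ℕ) (F : Clearing.Network (Fin n) (Fin m)),
      F.WellFormed ∧ ¬ F.ContinuousFromBelow) := by
  exact ⟨Clearing.runs_correct, Clearing.exists_clearingProgram, 2, 2, Clearing.defaultExample,
    Clearing.defaultExample_wellFormed, Clearing.defaultExample_not_continuousFromBelow⟩
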